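/- Let $m\in\mathbb N$ and let $\phi:\mathbb R\to\mathbb C^{m\times m}$ have entries in $L^1_{\rm loc}(\mathbb R)$, with $\phi(x)=\phi(x)^*$ for a.e. $x\in\mathbb R$. *Operators.* In $L^2(\mathbb R)^m$ let $A u=u'+\phi u$ and $A^+u=-u'+\phi u$ be maximally defined, that is, on all $u\in L^2(\mathbb R)^m$ with $u\in AC_{\rm loc}(\mathbb R)^m$ and $u'+\phi u\in L^2(\mathbb R)^m$, respectively $-u'+\phi u\in L^2(\mathbb R)^m$ (then $A^+=A^*$), and put $H_1=A^+A$, $H_2=AA^+$ on their natural domains. For $j=1,2$, $H_j$ is self-adjoint; $E_{H_j}$ denotes its spectral measure and $F(H_j)=\int_{\mathbb R}F\,dE_{H_j}$, with domain $\{h:\int|F(\lambda)|^2\,d\|E_{H_j}(\lambda)h\|^2<\infty\}$. *Solutions.* Let $u^{[1,j]}=u'+(-1)^{j+1}\phi u$ and $\tau_ju=-(u^{[1,j]})'+(-1)^{j+1}\phi u^{[1,j]}$. For $z\in\mathbb C$ and $x_0\in\mathbb R$ let $c_j(z,\cdot,x_0)$, $s_j(z,\cdot,x_0)$ be the $m\times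 m$ matrix solutions of $\tau_ju=zu$ (with $u,u^{[1,j]}$ locally absolutely continuous) such that $c_j=I_m$, $c_j^{[1,j]}=0$, $s_j=0$, $s_j^{[1,j]}=I_m$ at $x=x_0$. *Weyl–Titchmarsh matrices.* For $\zeta\in\mathbb C\setminus\mathbb R$ let $M^D_\pm(\zeta,x_0)\in\mathbb C^{m\times m}$ be the matrix such that the columns of the solution $U=(u_1,u_2)^\top$ of $-u_2'+\phi u_2=\zeta u_1$, $u_1'+\phi u_1=\zeta u_2$ with $u_1(x_0)=I_m$, $u_2(x_0)=M^D_\pm(\zeta,x_0)$ span the space of solutions of this system that are square integrable over $[x_0,\infty)$ (for $+$), respectively $(-\infty,x_0]$ (for $-$). For $z=\zeta^2\in\mathbb C\setminus\mathbb R$ put $\widehat M_{\pm,0,1}(z,x_0)=\zeta M^D_\pm(\zeta,x_0)$, $\widehat M_{\pm,0,2}(z,x_0)=-\zeta M^D_\pm(\zeta,x_0)^{-1}$ (both independent of the choice of the root $\zeta$), and, abbreviating $M_\pm=\widehat M_{\pm,0,j}(z,x_0)$, $W=M_--M_+$, $$\widehat{\mathbf M}_j(z,x_0)=\begin{pmatrix}W^{-1}&\tfrac12W^{-1}(M_-+M_+)\\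 \tfrac12(M_-+M_+)W^{-1}&M_+W^{-1}M_-\end{pmatrix}.$$ This is a $2m\times2m$ matrix-valued Nevanlinna–Herglotz function, and $\widehat{\mathbf\Omega}_j(\cdot,x_0)$ denotes the nonnegative $2m\times 2m$ matrix-valued measure in its representation $$\widehat{\mathbf M}_j(z,x_0)=\mathbf C_j+\int_{\mathbb R}\Big[\frac1{\lambda-z}-\frac{\lambda}{1+\lambda^2}\Big]d\widehat{\mathbf\Omega}_j(\lambda,x_0),\quad \mathbf C_j=\mathbf C_j^*,\quad \int_{\mathbb R}\frac{\|d\widehat{\mathbf\Omega}_j(\lambda,x_0)\|}{1+\lambda^2}<\infty,\quad z\in\mathbb C\setminus\mathbb R.$$ The inner product of $L^2(\mathbb R;d\widehat{\mathbf\Omega}_j(\cdot,x_0))$ is $(\widehat h,\widehat k)=\int_{\mathbb R}(\widehat h(\lambda),d\widehat{\mathbf\Omega}_j(\lambda,x_0)\widehat k(\lambda))_{\mathbb C^{2m}}$ (inner products are linear in the second entry), and $M_G$ denotes the maximal operator of multiplication by $G$ in this space. **Theorem.** Let $j\in\{1,2\}$, $f,g\in C_0^\infty(\mathbb R)^m$,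 $F\in C(\mathbb R)$, $x_0\in\mathbb R$, and $\lambda_1<\lambda_2$ real. For $h\in C_0^\infty(\mathbb R)^m$ put $$\widehat h_j(\lambda,x_0)=\begin{pmatrix}\int_{\mathbb R}c_j(\lambda,x,x_0)^*h(x)\,dx\\ \int_{\mathbb R}s_j(\lambda,x,x_0)^*h(x)\,dx\end{pmatrix},\quad\lambda\in\mathbb R.$$ Then $\widehat f_j(\cdot,x_0)\in L^2(\mathbb R;d\widehat{\mathbf\Omega}_j(\cdot,x_0))$, $\widehat g_j(\cdot,x_0)\in\operatorname{dom}(M_FM_{\chi_{(\lambda_1,\lambda_2]}})$, $E_{H_j}((\lambda_1,\lambda_2])g\in\operatorname{dom}(F(H_j))$, and $$\big(f,F(H_j)E_{H_j}((\lambda_1,\lambda_2])g\big)_{L^2(\mathbb R)^m}=\big(\widehat f_j(\cdot,x_0),M_FM_{\chi_{(\lambda_1,\lambda_2]}}\widehat g_j(\cdot,x_0)\big)_{L^2(\mathbb R;d\widehat{\mathbf\Omega}_j(\cdot,x_0))}.$$ -/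

import Mathlib

open MeasureTheory
open scoped ContDiff ComplexOrder

noncomputable section

namespace SusySchrodinger

/-! ### Basic spaces and local absolute continuity -/

/-- `ℂ^m` with its Euclidean inner product. -/
abbrev Vec (m : ℕ) : Type := EuclideanSpace ℂ (Fin m)

/-- `ℂ^{m × m}`. -/
abbrev Mat (m : ℕ) : Type := Matrix (Fin m) (Fin m) ℂ

/-- The Hilbert space `L²(ℝ)^m`. -/
abbrev L2 (m : ℕ) : Type := Lp (Vec m) 2 (volume : Measure ℝ)

/-- The action of an `m × m` matrix on `ℂ^m`. -/
abbrev act {m : ℕ} (M : Mat m) (v : Vec m) : Vec m := Matrix.toEuclideanLin M v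

/-- Local absolute continuity on an interval `I`: absolute continuity on every compact
subinterval. -/
def LocAC {m : ℕ} (I : Set ℝ) (u : ℝ → Vec m) : Prop :=
  ∀ a ∈ I, ∀ b ∈ I, AbsolutelyContinuousOnInterval u a b

theorem LocAC.continuous {m : ℕ} {u : ℝ → Vec m} (hu : LocAC Set.univ u) : Continuous u := by
  rw [continuous_iff_continuousAt]
  intro x
  have h := (hu (x - 1) trivial (x + 1) trivial).continuousOn
  refine h.continuousAt ?_
  rw [Set.uIcc_of_le (by linarith)]
  exact Icc_mem_nhds (by linarith) (by linarith)

/-- The class in `L²(ℝ)^m` of a test function in `C_0^∞(ℝ)^m`. -/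
def testToL2 {m : ℕ} (f : ℝ → Vec m) (hf : ContDiff ℝ ∞ f) (hc : HasCompactSupport f) : L2 m :=
  (hf.continuous.memLp_of_hasCompactSupport hc).toLp f

/-! ### The operators `A`, `A⁺` and `H_j` -/

/-- The graph of the maximal operator generated by `σ d/dx + φ` in `L²(ℝ)^m`: all pairs
`(f, g) ∈ L² × L²` such that `f` has a locally absolutely continuous representative `u` with
`g = σ u' + φ u` almost everywhere. -/
def firstOrderGraph {m : ℕ} (φ : ℝ → Mat m) (σ : ℂ) : Submodule ℂ (L2 m × L2 m) where
  carrier := {p | ∃ u : ℝ → Vec m, LocAC Set.univ u ∧ p.1 =ᵐ[volume] u ∧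
    ∀ᵐ x : ℝ, ∃ u' : Vec m, HasDerivAt u u' x ∧ p.2 x = σ • u' + act (φ x) (u x)}
  zero_mem' := by
    refine ⟨fun _ => 0, fun a _ b _ => ?_, Lp.coeFn_zero _ _ _, ?_⟩
    · simpa [AbsolutelyContinuousOnInterval] using tendsto_const_nhds
    · filter_upwards [Lp.coeFn_zero (Vec m) 2 (volume : Measure ℝ)] with x hx
      exact ⟨0, hasDerivAt_const x 0, by simp⟩
  add_mem' := by
    rintro p q ⟨u, hu, hpu, hpd⟩ ⟨v, hv, hqv, hqd⟩
    refine ⟨u + v, fun a ha b hb => (hu a ha b hb).add (hv a ha b hb),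
      (Lp.coeFn_add _ _).trans (hpu.add hqv), ?_⟩
    filter_upwards [hpd, hqd, Lp.coeFn_add p.2 q.2] with x ⟨u', h1, h2⟩ ⟨v', h3, h4⟩ h5
    refine ⟨u' + v', h1.add h3, ?_⟩
    simp only [Prod.snd_add, h5, Pi.add_apply, h2, h4, act, map_add, smul_add]
    abel
  smul_mem' := by
    rintro c p ⟨u, hu, hpu, hpd⟩
    refine ⟨c • u, fun a ha b hb => (hu a ha b hb).const_smul c,
      (Lp.coeFn_smul _ _).trans (hpu.const_smul c), ?_⟩
    filter_upwards [hpd, Lp.coeFn_smul c p.2] with x ⟨u', h1, h2⟩ h5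
    refine ⟨c • u', h1.const_smul c, ?_⟩
    simp only [Prod.smul_snd, h5, Pi.smul_apply, h2, act, map_smul, smul_add, smul_comm c σ]

/-- The graph above is single-valued, so that it is the graph of an operator. -/
theorem firstOrderGraph_single {m : ℕ} (φ : ℝ → Mat m) (σ : ℂ) (p : L2 m × L2 m)
    (hp : p ∈ firstOrderGraph φ σ) (h0 : p.1 = 0) : p.2 = 0 := by
  obtain ⟨u, hu, hpu, hpd⟩ := hp
  have hu0 : u = 0 := by
    refine (hu.continuous.ae_eq_iff_eq volume continuous_zero).1 ?_
    rw [h0] at hpu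
    exact hpu.symm.trans (Lp.coeFn_zero _ _ _)
  subst hu0
  refine Lp.ext ?_
  filter_upwards [hpd, Lp.coeFn_zero (Vec m) 2 (volume : Measure ℝ)] with x ⟨u', h1, h2⟩ h3
  have : u' = 0 := h1.unique (hasDerivAt_const x 0)
  simp [h2, this, act]

/-- The maximally defined operator `A = d/dx + φ` in `L²(ℝ)^m`. -/
def opA {m : ℕ} (φ : ℝ → Mat m) : L2 m →ₗ.[ℂ] L2 m := (firstOrderGraph φ 1).toLinearPMap

/-- The maximally defined operator `A⁺ = - d/dx + φ` in `L²(ℝ)^m`. -/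
def opAPlus {m : ℕ} (φ : ℝ → Mat m) : L2 m →ₗ.[ℂ] L2 m := (firstOrderGraph φ (-1)).toLinearPMap

/-- The graph of the product `T S` of two operators on its natural domain
`{x ∈ dom S | S x ∈ dom T}`. -/
def prodGraph {H : Type*} [AddCommGroup H] [Module ℂ H] (T S : H →ₗ.[ℂ] H) :
    Submodule ℂ (H × H) where
  carrier := {p | ∃ y, (p.1, y) ∈ S.graph ∧ (y, p.2) ∈ T.graph}
  zero_mem' := ⟨0, S.graph.zero_mem, T.graph.zero_mem⟩
  add_mem' := by
    rintro p q ⟨y, h1, h2⟩ ⟨z, h3, h4⟩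
    exact ⟨y + z, S.graph.add_mem h1 h3, T.graph.add_mem h2 h4⟩
  smul_mem' := by
    rintro c p ⟨y, h1, h2⟩
    exact ⟨c • y, S.graph.smul_mem c h1, T.graph.smul_mem c h2⟩

theorem prodGraph_single {H : Type*} [AddCommGroup H] [Module ℂ H] (T S : H →ₗ.[ℂ] H) (p : H × H)
    (hp : p ∈ prodGraph T S) (h0 : p.1 = 0) : p.2 = 0 := by
  obtain ⟨y, h1, h2⟩ := hp
  rw [h0] at h1
  have hy : y = 0 := S.graph_fst_eq_zero_snd h1 rfl
  rw [hy] at h2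
  exact T.graph_fst_eq_zero_snd h2 rfl

/-- The product `T S` of two (unbounded) operators. -/
def opProd {H : Type*} [AddCommGroup H] [Module ℂ H] (T S : H →ₗ.[ℂ] H) : H →ₗ.[ℂ] H :=
  (prodGraph T S).toLinearPMap

/-- The generalized Schrödinger operators `H_1 = A⁺ A` and `H_2 = A A⁺` (`j = 1, 2`). -/
def opH {m : ℕ} (φ : ℝ → Mat m) (j : ℕ) : L2 m →ₗ.[ℂ] L2 m :=
  if j = 1 then opProd (opAPlus φ) (opA φ) else opProd (opA φ) (opAPlus φ)

/-! ### Spectral measures and functions of a self-adjoint operator -/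

section Spectral

variable {H : Type*} [NormedAddCommGroup H] [InnerProductSpace ℂ H] [CompleteSpace H]

/-- A projection-valued measure on the Borel sets of `ℝ` (a resolution of the identity). -/
structure ProjMeasure (H : Type*) [NormedAddCommGroup H] [InnerProductSpace ℂ H]
    [CompleteSpace H] where
  /-- the value on a Borel set; the values on other sets are irrelevant -/
  toFun : Set ℝ → H →L[ℂ] H
  proj : ∀ S, MeasurableSet S → IsStarProjection (toFun S)
  univ : toFun Set.univ = 1
  inter : ∀ S T, MeasurableSet S → MeasurableSet T → toFun (S ∩ T) = toFun S * toFun T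
  iUnion : ∀ S : ℕ → Set ℝ, (∀ n, MeasurableSet (S n)) → Pairwise (Function.onFun Disjoint S) →
    ∀ x, HasSum (fun n => toFun (S n) x) (toFun (⋃ n, S n) x)

namespace ProjMeasure

instance : CoeFun (ProjMeasure H) (fun _ => Set ℝ → H →L[ℂ] H) := ⟨toFun⟩

instance : Nonempty (ProjMeasure H) := by
  classical
  refine ⟨⟨fun S => if (0 : ℝ) ∈ S then 1 else 0, fun S _ => ?_, by simp, fun S T _ _ => ?_,
    fun S _ hd x => ?_⟩⟩
  · by_cases h : (0 : ℝ) ∈ S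
    · simp [h]
    · simp [h]
  · by_cases h : (0 : ℝ) ∈ S <;> by_cases h' : (0 : ℝ) ∈ T <;> simp [h, h']
  · by_cases h : ∃ n, (0 : ℝ) ∈ S n
    · obtain ⟨n, hn⟩ := h
      have hU : (0 : ℝ) ∈ ⋃ n, S n := Set.mem_iUnion.2 ⟨n, hn⟩
      have := hasSum_single (f := fun k => (if (0 : ℝ) ∈ S k then (1 : H →L[ℂ] H) else 0) x) n
        (fun k hk => by
          have : (0 : ℝ) ∉ S k := fun h' => Set.disjoint_left.1 (hd hk) h' hn
          simp [this])
      simpa [hn, hU] using this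
    · have hU : (0 : ℝ) ∉ ⋃ n, S n := fun h' => h (Set.mem_iUnion.1 h')
      have h' : ∀ n, (0 : ℝ) ∉ S n := fun n hn => h ⟨n, hn⟩
      simp [hU, h']

variable (E : ProjMeasure H)

theorem norm_sq_eq {S : Set ℝ} (hS : MeasurableSet S) (x : H) :
    ‖E S x‖ ^ 2 = (inner ℂ x (E S x)).re := by
  have h := E.proj S hS
  have h1 : E S (E S x) = E S x := by
    have := congrArg (fun T : H →L[ℂ] H => T x) h.isIdempotentElem
    simpa using this
  have h2 : inner ℂ (E S x) (E S x) = inner ℂ x (E S (E S x)) := by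
    have := h.isSelfAdjoint
    rw [ContinuousLinearMap.isSelfAdjoint_iff_isSymmetric] at this
    exact this x (E S x)
  rw [h1] at h2
  rw [← h2, inner_self_eq_norm_sq_to_K]
  norm_cast

/-- The finite Borel measure `S ↦ ‖E(S) x‖² = (x, E(S) x)`. -/
def diag (x : H) : Measure ℝ :=
  Measure.ofMeasurable (fun S _ => ENNReal.ofReal (‖E S x‖ ^ 2))
    (by
      have h := E.iUnion (fun _ => ∅) (fun _ => MeasurableSet.empty)
        (fun _ _ _ => by simp [Function.onFun]) x
      have h0 : E ∅ x = 0 := (summable_const_iff _).1 h.summable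
      simp [h0])
    (fun S hS hd => by
      have h := E.iUnion S hS hd x
      have h2 : HasSum (fun n => ‖E (S n) x‖ ^ 2) (‖E (⋃ n, S n) x‖ ^ 2) := by
        simp only [E.norm_sq_eq (hS _), E.norm_sq_eq (MeasurableSet.iUnion hS)]
        exact Complex.reCLM.hasSum ((innerSL ℂ x).hasSum h)
      rw [← h2.tsum_eq]
      exact ENNReal.ofReal_tsum_of_nonneg (fun n => by positivity) h2.summable)

/-- The domain of `∫ F dE`: all `x` with `∫ |F(λ)|² d‖E(λ) x‖² < ∞`. -/
def integralDomain (F : ℝ → ℂ) : Set H :=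
  {x | ∫⁻ t, ‖F t‖ₑ ^ 2 ∂(E.diag x) < ⊤}

/-- `∫ F(λ) d(x, E(λ) y)`, written through the polarization identity
`(x, E(S) y) = (1/4) ∑_{k=0}^{3} i^k ‖E(S) (y + i^k x)‖²`. -/
def form (F : ℝ → ℂ) (x y : H) : ℂ :=
  (1 / 4) * ∑ k ∈ Finset.range 4,
    Complex.I ^ k * ∫ t, F t ∂(E.diag (y + Complex.I ^ k • x))

/-- `y = (∫ F dE) x`: the vector `x` lies in the domain of `∫ F dE` and
`(w, y) = ∫ F(λ) d(w, E(λ) x)` for all `w` in that (dense) domain. -/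
def IsIntegral (F : ℝ → ℂ) (x y : H) : Prop :=
  x ∈ E.integralDomain F ∧ ∀ w ∈ E.integralDomain F, inner ℂ w y = E.form F w x

end ProjMeasure

/-- `E` is the spectral measure of the operator `T`, that is, `T = ∫ λ dE(λ)`, domains included. -/
def IsSpectralMeasure (T : H →ₗ.[ℂ] H) (E : ProjMeasure H) : Prop :=
  ∀ x y, (x, y) ∈ T.graph ↔ E.IsIntegral (fun t => (t : ℂ)) x y

/-- The spectral measure `E_T` of a self-adjoint operator `T`. -/
def spectralMeasure (T : H →ₗ.[ℂ] H) : ProjMeasure H :=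
  Classical.epsilon (IsSpectralMeasure T)

/-- `y = F(T) x`, with `F(T) = ∫ F dE_T`. -/
def IsFunctionOf (T : H →ₗ.[ℂ] H) (F : ℝ → ℂ) (x y : H) : Prop :=
  (spectralMeasure T).IsIntegral F x y

end Spectral

/-! ### The fundamental system `c_j`, `s_j` -/

/-- `u` solves `τ_j u = z u` on `ℝ`, where `τ_j u = -(u^{[1,j]})' + (-1)^{j+1} φ u^{[1,j]}`, and
`w` is the (locally absolutely continuous) quasi-derivative
`u^{[1,j]} = u' + (-1)^{j+1} φ u`. -/
def IsTauSolution {m : ℕ} (φ : ℝ → Mat m) (j : ℕ) (z : ℂ) (u w : ℝ → Vec m) : Prop :=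
  LocAC Set.univ u ∧ LocAC Set.univ w ∧
  ∀ᵐ x : ℝ, ∃ u' w' : Vec m, HasDerivAt u u' x ∧ HasDerivAt w w' x ∧
    w x = u' + (-1 : ℂ) ^ (j + 1) • act (φ x) (u x) ∧
    -w' + (-1 : ℂ) ^ (j + 1) • act (φ x) (w x) = z • u x

/-- `U` is the `m × m` matrix solution of `τ_j U = z U` with `U(x₀) = a`, `U^{[1,j]}(x₀) = b`. -/
def IsTauMatrixSolution {m : ℕ} (φ : ℝ → Mat m) (j : ℕ) (z : ℂ) (x₀ : ℝ) (a b : Mat m)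
    (U : ℝ → Mat m) : Prop :=
  ∃ W : ℝ → Mat m, U x₀ = a ∧ W x₀ = b ∧
    ∀ v : Vec m, IsTauSolution φ j z (fun x => act (U x) v) (fun x => act (W x) v)

/-- `c_j(z, x, x₀)`: `c_j(z, x₀, x₀) = I`, `c_j^{[1,j]}(z, x₀, x₀) = 0`. -/
def cSol {m : ℕ} (φ : ℝ → Mat m) (j : ℕ) (z : ℂ) (x x₀ : ℝ) : Mat m :=
  Classical.epsilon (IsTauMatrixSolution φ j z x₀ 1 0) x

/-- `s_j(z, x, x₀)`: `s_j(z, x₀, x₀) = 0`, `s_j^{[1,j]}(z, x₀, x₀) = I`. -/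
def sSol {m : ℕ} (φ : ℝ → Mat m) (j : ℕ) (z : ℂ) (x x₀ : ℝ) : Mat m :=
  Classical.epsilon (IsTauMatrixSolution φ j z x₀ 0 1) x

/-! ### Weyl–Titchmarsh matrices -/

/-- `V = (u, v)` is a locally absolutely continuous solution on the interval `I` of the Dirac
system `𝒟 V = ζ V`, i.e. `-v' + φ v = ζ u` and `u' + φ u = ζ v` a.e. on `I`. -/
def IsDiracSolution {m : ℕ} (φ : ℝ → Mat m) (ζ : ℂ) (I : Set ℝ) (u v : ℝ → Vec m) : Prop :=
  LocAC I u ∧ LocAC I v ∧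
  ∀ᵐ x ∂(volume.restrict I), ∃ u' v' : Vec m, HasDerivAt u u' x ∧ HasDerivAt v v' x ∧
    -v' + act (φ x) (v x) = ζ • u x ∧ u' + act (φ x) (u x) = ζ • v x

/-- `V = (u, v)` lies in the deficiency space of the half-line `I`: it is a solution of
`𝒟 V = ζ V` on `I` which is square integrable over `I`. -/
def InDeficiencySpace {m : ℕ} (φ : ℝ → Mat m) (ζ : ℂ) (I : Set ℝ) (u v : ℝ → Vec m) : Prop :=
  IsDiracSolution φ ζ I u v ∧ MemLp u 2 (volume.restrict I) ∧ MemLp v 2 (volume.restrict I)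

/-- `M` is the Weyl–Titchmarsh matrix of the Dirac system for the half-line `I` with end point
`x₀` (and boundary parameter `α₀ = (I 0)`): the solution `U = (u, v)` of `𝒟 U = ζ U` on `ℝ` with
`U(x₀) = (I, M)` has columns which span the deficiency space of `I`. -/
def IsDiracWeylMatrix {m : ℕ} (φ : ℝ → Mat m) (ζ : ℂ) (x₀ : ℝ) (I : Set ℝ) (M : Mat m) : Prop :=
  ∃ u v : ℝ → Mat m, u x₀ = 1 ∧ v x₀ = M ∧
    (∀ c : Vec m, IsDiracSolution φ ζ Set.univ (fun x => act (u x) c) (fun x => act (v x) c)) ∧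
    ∀ p q : ℝ → Vec m, InDeficiencySpace φ ζ I p q ↔
      ∃ c : Vec m, ∀ x ∈ I, p x = act (u x) c ∧ q x = act (v x) c

/-- `M^D_+(ζ, x₀, α₀)`. -/
def MDplus {m : ℕ} (φ : ℝ → Mat m) (ζ : ℂ) (x₀ : ℝ) : Mat m :=
  Classical.epsilon (IsDiracWeylMatrix φ ζ x₀ (Set.Ici x₀))

/-- `M^D_-(ζ, x₀, α₀)`. -/
def MDminus {m : ℕ} (φ : ℝ → Mat m) (ζ : ℂ) (x₀ : ℝ) : Mat m :=
  Classical.epsilon (IsDiracWeylMatrix φ ζ x₀ (Set.Iic x₀))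

/-- The square root `ζ` of `z`; it is not real if `z` is not real. -/
def zetaOf (z : ℂ) : ℂ := z ^ (1 / 2 : ℂ)

/-- The passage from `M^D_±(ζ, x₀, α₀)` to `M̂_{±,0,j}(z, x₀)`: `ζ M^D` for `j = 1`, and
`-ζ (M^D)⁻¹` for `j = 2`. -/
def hatOf {m : ℕ} (j : ℕ) (ζ : ℂ) (M : Mat m) : Mat m :=
  if j = 1 then ζ • M else -(ζ • M⁻¹)

/-- `M̂_{+,0,j}(z, x₀)`. -/
def Mhatplus {m : ℕ} (φ : ℝ → Mat m) (j : ℕ) (z : ℂ) (x₀ : ℝ) : Mat m :=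
  hatOf j (zetaOf z) (MDplus φ (zetaOf z) x₀)

/-- `M̂_{-,0,j}(z, x₀)`. -/
def Mhatminus {m : ℕ} (φ : ℝ → Mat m) (j : ℕ) (z : ℂ) (x₀ : ℝ) : Mat m :=
  hatOf j (zetaOf z) (MDminus φ (zetaOf z) x₀)

/-- `W(z) = M̂_{-,0,j}(z, x₀) - M̂_{+,0,j}(z, x₀)`. -/
def Wmat {m : ℕ} (φ : ℝ → Mat m) (j : ℕ) (z : ℂ) (x₀ : ℝ) : Mat m :=
  Mhatminus φ j z x₀ - Mhatplus φ j z x₀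

/-- The `2m × 2m` Weyl–Titchmarsh matrix `M̂_j(z, x₀)` of `H_j`. -/
def Mbold {m : ℕ} (φ : ℝ → Mat m) (j : ℕ) (z : ℂ) (x₀ : ℝ) :
    Matrix (Fin m ⊕ Fin m) (Fin m ⊕ Fin m) ℂ :=
  Matrix.fromBlocks
    (Wmat φ j z x₀)⁻¹
    ((1 / 2 : ℂ) • ((Wmat φ j z x₀)⁻¹ * (Mhatminus φ j z x₀ + Mhatplus φ j z x₀)))
    ((1 / 2 : ℂ) • ((Mhatminus φ j z x₀ + Mhatplus φ j z x₀) * (Wmat φ j z x₀)⁻¹))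
    (Mhatplus φ j z x₀ * (Wmat φ j z x₀)⁻¹ * Mhatminus φ j z x₀)

/-! ### Nonnegative matrix-valued measures and `L²(ℝ; dΩ)` -/

/-- A nonnegative, locally finite matrix-valued Borel measure `Ω` on `ℝ`, given by its trace
measure `base = tr Ω` and its (matrix) density with respect to the trace measure:
`Ω(S) = ∫_S density d base`. -/
structure MatrixMeasure (n : Type*) [Fintype n] where
  base : Measure ℝ
  locallyFinite : IsLocallyFiniteMeasure base
  density : ℝ → Matrix n n ℂ
  measurable : ∀ i k, Measurable fun t => density t i k
  posSemidef : ∀ᵐ t ∂base, (density t).PosSemidef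
  trace_eq_one : ∀ᵐ t ∂base, (density t).trace = 1

/-- The multiplication `(M_G ĥ)(λ) = G(λ) ĥ(λ)`. -/
def mulBy {n : Type*} (G : ℝ → ℂ) (h : ℝ → n → ℂ) : ℝ → n → ℂ := fun t => G t • h t

namespace MatrixMeasure

variable {n : Type*} [Fintype n]

instance : Nonempty (MatrixMeasure n) :=
  ⟨⟨0, inferInstance, fun _ => 0, fun _ _ => measurable_const, by simp, by simp⟩⟩

variable (Ω : MatrixMeasure n)

/-- `ĥ ∈ L²(ℝ; dΩ)`, i.e. `∫ (ĥ(λ), dΩ(λ) ĥ(λ)) < ∞`. -/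
def MemL2 (h : ℝ → n → ℂ) : Prop :=
  AEStronglyMeasurable h Ω.base ∧
    Integrable (fun t => star (h t) ⬝ᵥ (Ω.density t).mulVec (h t)) Ω.base

/-- The inner product `∫ (f̂(λ), dΩ(λ) ĝ(λ))` of `L²(ℝ; dΩ)`. -/
def innerL2 (f g : ℝ → n → ℂ) : ℂ :=
  ∫ t, star (f t) ⬝ᵥ (Ω.density t).mulVec (g t) ∂Ω.base

/-- `ĥ` belongs to the domain of the maximal operator `M_G` of multiplication by `G` in
`L²(ℝ; dΩ)`. -/
def InMulDomain (G : ℝ → ℂ) (h : ℝ → n → ℂ) : Prop :=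
  Ω.MemL2 h ∧ Ω.MemL2 (mulBy G h)

/-- `Ω` is the measure in the Nevanlinna–Herglotz representation
`M(z) = C + ∫ [(λ - z)⁻¹ - λ (1 + λ²)⁻¹] dΩ(λ)`, `z ∈ ℂ \ ℝ`, with `C = C*` and
`∫ (1 + λ²)⁻¹ ‖dΩ(λ)‖ < ∞`. -/
def IsHerglotzMeasure (M : ℂ → Matrix n n ℂ) : Prop :=
  Integrable (fun t : ℝ => (1 + t ^ 2)⁻¹) Ω.base ∧
  ∃ C : Matrix n n ℂ, C.IsHermitian ∧ ∀ z : ℂ, z.im ≠ 0 → ∀ i k,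
    M z i k = C i k +
      ∫ t : ℝ, (((t : ℂ) - z)⁻¹ - (t : ℂ) * (1 + (t : ℂ) ^ 2)⁻¹) * Ω.density t i k ∂Ω.base

end MatrixMeasure

/-- The `2m × 2m` matrix-valued spectral measure `Ω̂_j(·, x₀)` generated by `M̂_j(·, x₀)`. -/
def OmegaHat {m : ℕ} (φ : ℝ → Mat m) (j : ℕ) (x₀ : ℝ) : MatrixMeasure (Fin m ⊕ Fin m) :=
  Classical.epsilon fun Ω => Ω.IsHerglotzMeasure fun z => Mbold φ j z x₀

/-- The generalized Fourier transform `ĥ_j(λ, x₀) = (ĥ_{j,0}(λ, x₀), ĥ_{j,1}(λ, x₀))`, with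
`ĥ_{j,0} = ∫ c_j(λ, x, x₀)* h(x) dx` and `ĥ_{j,1} = ∫ s_j(λ, x, x₀)* h(x) dx`. -/
def hatTransform {m : ℕ} (φ : ℝ → Mat m) (j : ℕ) (x₀ : ℝ) (h : ℝ → Vec m) :
    ℝ → Fin m ⊕ Fin m → ℂ := fun t =>
  Sum.elim
    (fun i => (∫ x : ℝ, act (cSol φ j (t : ℂ) x x₀).conjTranspose (h x)) i)
    (fun i => (∫ x : ℝ, act (sSol φ j (t : ℂ) x x₀).conjTranspose (h x)) i)

/-- The characteristic function of `(a, b]`. -/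
def chi (a b : ℝ) : ℝ → ℂ := (Set.Ioc a b).indicator 1

end SusySchrodinger

end

open MeasureTheory
open scoped ContDiff ComplexOrder

noncomputable section

namespace SusySchrodinger

open Set Filter Topology

/-! ### Absolutely continuous functions -/

section AC

variable {X Y Z : Type*} [PseudoMetricSpace X] [PseudoMetricSpace Y] [PseudoMetricSpace Z]

/-! Why the theorem holds. Write `E` for the spectral measure of `H_j` and take a non-real `z`. For
`C = (a, b)` in `ℂ^{2m}` let `ψ_z(C)` be the square integrable function that solves `τ ψ = z ψ` off
`x₀` and jumps there by `(b, -a)`; it is glued from the two half-line Weyl solutions. Green's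
identity shows that `ψ_z(C)` represents point evaluation: its inner product with `(H - z̄) v` is the
pairing of `C` with `(v, v^{[1]})(x₀)` (`WeylPair.inner_psi`). Hence `ψ_z(C) = (H - w)(H - z)⁻¹
ψ_w(C)` (`WeylPair.psi_eq_fcalc`). The mean of the one-sided data of `ψ_z(C)` at `x₀` is the full
Weyl matrix applied to `C`, so Green's identity for `ψ_w(C)` and `ψ_z(C)` gives `(z - w̄) (ψ_w(C),
ψ_z(C))` as `(C, M(z) C)` minus the conjugate of `(C, M(w) C)` (`WeylPair.inner_psi_psi`). Putting
`w = i` yields the Herglotz representation of `M` with `(C, dΩ C) = (1 + λ²) d(ψ_i(C), E ψ_i(C))`,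
and uniqueness of that representation (Stieltjes inversion through Poisson kernels,
`measure_eq_of_herglotz`) forces this relation on `OmegaHat` (`represents_OmegaHat`).

The expansion of a test function `h` uses no eigenfunction limits. For real `t` let `q_t` solve `τ q
= t q + h` on each side of `x₀` and vanish far out; its jump at `x₀` encodes a vector `η(t)`, and
Green's identity against `c_j`, `s_j` identifies `η(t)` with the transform of `h`
(`hatTransform_eq_jump`). Pairing `q_t` with `(H - t) v` for `v` in the range of `E((s, t])` gives
`E((s, t]) h = ∫ (λ - i) dE ψ_i(η(t)) + ∫ (λ - t) dE q_t` over `(s, t]` (`expands_jump`). Since `η`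
is locally Lipschitz and `q_t` locally bounded, freezing `η` at the right end point costs a norm of
order `t - s`. The errors of `N` equal subintervals are mutually orthogonal, so their sum has
squared norm of order `1/N` (`ProjMeasure.apply_Ioc_eq_zero`), and `E(B) h` is the sum over `a` of
`∫_B (λ - i) η_a(λ) dE ψ_i(e_a)`. Inserting this for `f` and `g` and using `|λ - i|² = 1 + λ²` turns
the spectral side into the integral against `Ω` (`Expands.inner_fcalc`).

The spectral measure, the Weyl matrices and `OmegaHat` are chosen by `Classical.epsilon`, so
existence is needed for each. `A⁺` is minus the formal transpose found by
`exists_isD_of_orthogonal`; the graph of `A` is therefore closed, and compressing the projection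
onto it to the first factor gives `(1 + A⁺A)⁻¹` (`exists_isSpectralMeasure_of_graph`), to which the
bounded spectral theorem applies. The half-line Weyl spaces meet trivially and span all initial
data, so each has dimension `m` and is the graph of a matrix (`exists_weylMatrix`). For `OmegaHat`,
Radon–Nikodym densities assemble a matrix measure from `E` and `ψ_i` (`specMeasure`). -/

theorem ac_of_dist_le {f : ℝ → X} {g : ℝ → Y} {h : ℝ → Z} {a b C : ℝ}
    (hf : AbsolutelyContinuousOnInterval f a b) (hg : AbsolutelyContinuousOnInterval g a b)
    (hh : ∀ x ∈ uIcc a b, ∀ y ∈ uIcc a b,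
      dist (h x) (h y) ≤ C * (dist (f x) (f y) + dist (g x) (g y))) :
    AbsolutelyContinuousOnInterval h a b := by
  unfold AbsolutelyContinuousOnInterval at hf hg
  apply squeeze_zero' ?_ ?_ (by simpa using (hf.add hg).const_mul C)
  · exact Filter.Eventually.of_forall fun _ => Finset.sum_nonneg fun i hi => dist_nonneg
  rw [eventually_inf_principal]
  filter_upwards with (n, I) hnI
  simp only [Finset.mul_sum, ← Finset.sum_add_distrib]
  refine Finset.sum_le_sum fun i hi => ?_
  exact hh _ (hnI.1 i hi).1 _ (hnI.1 i hi).2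

theorem ac_congr {f g : ℝ → X} {a b : ℝ} (hf : AbsolutelyContinuousOnInterval f a b)
    (h : EqOn f g (uIcc a b)) : AbsolutelyContinuousOnInterval g a b :=
  ac_of_dist_le (C := 1) hf hf fun x hx y hy => by
    rw [← h hx, ← h hy]; linarith [dist_nonneg (x := f x) (y := f y)]

end AC

variable {E F G : Type*} [NormedAddCommGroup E] [NormedSpace ℝ E] [NormedAddCommGroup F]
  [NormedSpace ℝ F] [NormedAddCommGroup G] [NormedSpace ℝ G]

theorem ac_intervalIntegral {f : ℝ → E} {a b c : ℝ}
    (h : IntervalIntegrable f volume a b) (hc : c ∈ uIcc a b) :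
    AbsolutelyContinuousOnInterval (fun x => ∫ v in c..x, f v) a b := by
  have h1 := h.norm.absolutelyContinuousOnInterval_intervalIntegral hc
  refine ac_of_dist_le (C := 1) h1 h1 fun x hx y hy => ?_
  have hsub : ∀ u ∈ uIcc a b, ∀ v ∈ uIcc a b, IntervalIntegrable f volume u v :=
    fun u hu v hv => h.mono_set (uIcc_subset_uIcc hu hv)
  rw [dist_eq_norm, dist_eq_norm, intervalIntegral.integral_interval_sub_left (hsub _ hc _ hx)
    (hsub _ hc _ hy), intervalIntegral.integral_interval_sub_left (hsub _ hc _ hx).norm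
    (hsub _ hc _ hy).norm, Real.norm_eq_abs]
  have := intervalIntegral.norm_integral_le_abs_integral_norm (f := f) (a := y) (b := x)
    (μ := volume)
  linarith [abs_nonneg (∫ v in y..x, ‖f v‖)]

/-- Fundamental theorem of calculus for vector-valued absolutely continuous functions. -/
theorem ac_integral_eq_sub [CompleteSpace E] {f f' : ℝ → E} {a b : ℝ}
    (hf : AbsolutelyContinuousOnInterval f a b) (hf' : IntervalIntegrable f' volume a b)
    (hd : ∀ᵐ x, x ∈ uIcc a b → HasDerivAt f (f' x) x) :
    ∫ x in a..b, f' x = f b - f a := by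
  have h1 := hf.sub (ac_intervalIntegral hf' left_mem_uIcc)
  obtain ⟨C, hC⟩ := h1.const_of_ae_hasDerivAt_zero (by
    filter_upwards [hd, hf'.ae_hasDerivAt_integral] with x h2 h3 hx
    simpa using (h2 hx).sub (h3 hx a left_mem_uIcc))
  have ha := hC a left_mem_uIcc
  have hb := hC b right_mem_uIcc
  simp only [Pi.sub_apply, intervalIntegral.integral_same, sub_zero] at ha hb
  rw [ha, ← hb]; abel

theorem locallyIntegrable_intervalIntegrable {E : Type*} [NormedAddCommGroup E] {f : ℝ → E} (hf : LocallyIntegrable f volume)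
    (a b : ℝ) : IntervalIntegrable f volume a b :=
  intervalIntegrable_iff.mpr
    ((hf.integrableOn_isCompact isCompact_uIcc).mono_set uIoc_subset_uIcc)

theorem locallyIntegrable_norm {E : Type*} [NormedAddCommGroup E] {f : ℝ → E}
    (hf : LocallyIntegrable f volume) : LocallyIntegrable (fun x => ‖f x‖) volume :=
  fun x => (hf x).norm

theorem uIoc_subset_uIoc_of_mem {a b x : ℝ} (hx : x ∈ uIcc a b) : uIoc a x ⊆ uIoc a b :=
  Ioc_subset_Ioc (le_min (min_le_left _ _) hx.1) (max_le (le_max_left _ _) hx.2)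

theorem ac_bilinear (L : E →L[ℝ] F →L[ℝ] G) {f : ℝ → E} {g : ℝ → F} {a b : ℝ}
    (hf : AbsolutelyContinuousOnInterval f a b) (hg : AbsolutelyContinuousOnInterval g a b) :
    AbsolutelyContinuousOnInterval (fun x => L (f x) (g x)) a b := by
  obtain ⟨C, hC⟩ := hf.exists_bound
  obtain ⟨D, hD⟩ := hg.exists_bound
  have hC0 : 0 ≤ C := (norm_nonneg _).trans (hC a left_mem_uIcc)
  have hD0 : 0 ≤ D := (norm_nonneg _).trans (hD a left_mem_uIcc)
  refine ac_of_dist_le (C := ‖L‖ * (C + D)) hf hg fun x hx y hy => ?_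
  have e : L (f x) (g x) - L (f y) (g y) = L (f x - f y) (g x) + L (f y) (g x - g y) := by
    simp
  rw [dist_eq_norm, dist_eq_norm, dist_eq_norm, e]
  have h1 := L.le_opNorm₂ (f x - f y) (g x)
  have h2 := L.le_opNorm₂ (f y) (g x - g y)
  have h3 : ‖L‖ * ‖f x - f y‖ * ‖g x‖ ≤ ‖L‖ * ‖f x - f y‖ * D :=
    mul_le_mul_of_nonneg_left (hD x hx) (by positivity)
  have h4 : ‖L‖ * ‖f y‖ * ‖g x - g y‖ ≤ ‖L‖ * C * ‖g x - g y‖ := by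
    gcongr; exact hC y hy
  have h5 : 0 ≤ ‖L‖ * C * ‖f x - f y‖ := by positivity
  have h6 : 0 ≤ ‖L‖ * D * ‖g x - g y‖ := by positivity
  refine (norm_add_le _ _).trans ?_
  nlinarith

/-! ### A weighted Gronwall estimate for locally integrable coefficients -/

theorem ac_exp_mul {κ : ℝ → ℝ} {a b : ℝ} (c : ℝ) (h : AbsolutelyContinuousOnInterval κ a b) :
    AbsolutelyContinuousOnInterval (fun x => Real.exp (c * κ x)) a b := by
  obtain ⟨D, hD⟩ := h.exists_bound
  have hlip : ∀ u ∈ Icc (-(|c| * D)) (|c| * D), ∀ v ∈ Icc (-(|c| * D)) (|c| * D),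
      |Real.exp u - Real.exp v| ≤ Real.exp (|c| * D) * |u - v| := by
    intro u hu v hv
    refine (convex_Icc (-(|c| * D)) (|c| * D)).norm_image_sub_le_of_norm_deriv_le
      (f := Real.exp) (fun x _ => Real.differentiableAt_exp) (fun x hx => ?_) hv hu
    rw [Real.deriv_exp, Real.norm_eq_abs, abs_of_pos (Real.exp_pos _)]
    exact Real.exp_le_exp.2 hx.2
  have hm : ∀ x ∈ uIcc a b, c * κ x ∈ Icc (-(|c| * D)) (|c| * D) := by
    intro x hx
    rw [mem_Icc, ← abs_le, abs_mul]
    exact mul_le_mul_of_nonneg_left (hD x hx) (abs_nonneg c)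
  refine ac_of_dist_le (C := Real.exp (|c| * D) * |c|) h h fun x hx y hy => ?_
  rw [Real.dist_eq, Real.dist_eq]
  refine (hlip _ (hm x hx) _ (hm y hy)).trans ?_
  rw [← mul_sub, abs_mul, ← mul_assoc]
  have : 0 ≤ Real.exp (|c| * D) * |c| * |κ x - κ y| := by positivity
  nlinarith

variable {k : ℝ → ℝ}

/-- The exponential of an absolutely continuous primitive is again absolutely continuous, so the
a.e. chain rule integrates back. -/
theorem integral_mul_exp (hk : LocallyIntegrable k volume) (x₀ x c : ℝ) :
    c * ∫ t in x₀..x, k t * Real.exp (c * ∫ s in x₀..t, k s) =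
      Real.exp (c * ∫ s in x₀..x, k s) - 1 := by
  have hki := locallyIntegrable_intervalIntegrable hk
  have hac := ac_intervalIntegral (hki x₀ x) (left_mem_uIcc)
  have hcont : Continuous fun t => ∫ s in x₀..t, k s :=
    intervalIntegral.continuous_primitive hki x₀
  have h := ac_integral_eq_sub (f' := fun t => c * (k t * Real.exp (c * ∫ s in x₀..t, k s)))
    (ac_exp_mul c hac) ?_ ?_
  · rw [intervalIntegral.integral_const_mul] at h
    simpa using h
  · exact ((hki x₀ x).mul_continuousOn (by fun_prop)).const_mul c
  · filter_upwards [_root_.LocallyIntegrable.ae_hasDerivAt_integral hk] with t ht _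
    exact ((ht x₀).const_mul c).exp.congr_deriv (by ring)

/-- The `2` in the exponent is what produces the factor `1/2`; that factor closes both the Gronwall
estimate and the contraction argument. To the left of `x₀` the primitive is nonpositive, and the
exact formula is used with `-2`. -/
theorem abs_integral_mul_exp_le (hk : LocallyIntegrable k volume) (hk0 : ∀ t, 0 ≤ k t)
    (x₀ x : ℝ) :
    |∫ t in x₀..x, k t * Real.exp (2 * |∫ s in x₀..t, k s|)| ≤
      (Real.exp (2 * |∫ s in x₀..x, k s|) - 1) / 2 := by
  rcases le_total x₀ x with h | h
  · have e : ∫ t in x₀..x, k t * Real.exp (2 * |∫ s in x₀..t, k s|) =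
        ∫ t in x₀..x, k t * Real.exp (2 * ∫ s in x₀..t, k s) := by
      refine intervalIntegral.integral_congr fun t ht => ?_
      rw [uIcc_of_le h] at ht
      rw [abs_of_nonneg (intervalIntegral.integral_nonneg ht.1 fun s _ => hk0 s)]
    have h1 := integral_mul_exp hk x₀ x 2
    rw [e, abs_of_nonneg (intervalIntegral.integral_nonneg h fun s _ =>
      mul_nonneg (hk0 s) (Real.exp_pos _).le),
      abs_of_nonneg (intervalIntegral.integral_nonneg h fun s _ => hk0 s)]
    linarith
  · have hneg : ∀ t ≤ x₀, ∫ s in x₀..t, k s ≤ 0 := fun t ht => by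
      rw [intervalIntegral.integral_symm]
      exact neg_nonpos.2 (intervalIntegral.integral_nonneg ht fun s _ => hk0 s)
    have e : ∫ t in x₀..x, k t * Real.exp (2 * |∫ s in x₀..t, k s|) =
        ∫ t in x₀..x, k t * Real.exp (-2 * ∫ s in x₀..t, k s) := by
      refine intervalIntegral.integral_congr fun t ht => ?_
      rw [uIcc_of_ge h] at ht
      rw [abs_of_nonpos (hneg t ht.2)]
      ring_nf
    have h1 := integral_mul_exp hk x₀ x (-2)
    have h2 : ∫ t in x₀..x, k t * Real.exp (-2 * ∫ s in x₀..t, k s) ≤ 0 := by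
      rw [intervalIntegral.integral_symm]
      exact neg_nonpos.2 (intervalIntegral.integral_nonneg h fun s _ =>
        mul_nonneg (hk0 s) (Real.exp_pos _).le)
    rw [e, abs_of_nonpos h2, abs_of_nonpos (hneg x h)]
    rw [show (2 : ℝ) * -∫ s in x₀..x, k s = -2 * ∫ s in x₀..x, k s by ring]
    linarith

/-- Let `M` be the maximum of `f e^{-2κ}`, where `κ` is the modulus of the primitive of `k`. At the
maximizing point the hypothesis gives `M e^{2κ} ≤ c + M (e^{2κ} - 1)/2`, so half of the left side is
absorbed and `M ≤ 2c`. -/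
theorem gronwall_integral (hk : LocallyIntegrable k volume) (hk0 : ∀ t, 0 ≤ k t) {x₀ x₁ c : ℝ}
    {f : ℝ → ℝ} (hf : ContinuousOn f (uIcc x₀ x₁)) (hf0 : ∀ x, 0 ≤ f x) (hc : 0 ≤ c)
    (h : ∀ x ∈ uIcc x₀ x₁, f x ≤ c + |∫ t in x₀..x, k t * f t|) :
    f x₁ ≤ 2 * c * Real.exp (2 * |∫ t in x₀..x₁, k t|) := by
  have hki := locallyIntegrable_intervalIntegrable hk
  have hcont : Continuous fun t => ∫ s in x₀..t, k s :=
    intervalIntegral.continuous_primitive hki x₀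
  set κ : ℝ → ℝ := fun t => |∫ s in x₀..t, k s| with hκ
  have hκc : Continuous κ := hcont.abs
  obtain ⟨y, hy, hmax⟩ := isCompact_uIcc.exists_isMaxOn (s := uIcc x₀ x₁)
    ⟨x₀, left_mem_uIcc⟩ (f := fun t => f t * Real.exp (-(2 * κ t)))
    (hf.mul (by fun_prop))
  set M := f y * Real.exp (-(2 * κ y)) with hM
  have hM0 : 0 ≤ M := mul_nonneg (hf0 y) (Real.exp_pos _).le
  have hle : ∀ t ∈ uIcc x₀ x₁, f t ≤ M * Real.exp (2 * κ t) := by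
    intro t ht
    have h1 : f t * Real.exp (-(2 * κ t)) ≤ M := hmax ht
    have h2 := mul_le_mul_of_nonneg_right h1 (Real.exp_pos (2 * κ t)).le
    rwa [mul_assoc, ← Real.exp_add, neg_add_cancel, Real.exp_zero, mul_one] at h2
  have hsub : uIcc x₀ y ⊆ uIcc x₀ x₁ := uIcc_subset_uIcc left_mem_uIcc hy
  have h3 : |∫ t in x₀..y, k t * f t| ≤ M * ((Real.exp (2 * κ y) - 1) / 2) := by
    have h4 : |∫ t in x₀..y, k t * f t| ≤ |∫ t in x₀..y, M * (k t * Real.exp (2 * κ t))| := by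
      have := intervalIntegral.norm_integral_le_abs_of_norm_le (a := x₀) (b := y) (μ := volume)
        (f := fun t => k t * f t) (g := fun t => M * (k t * Real.exp (2 * κ t))) ?_ ?_
      · simpa [Real.norm_eq_abs] using this
      · refine ae_restrict_of_forall_mem measurableSet_uIoc fun t ht => ?_
        rw [Real.norm_eq_abs, abs_of_nonneg (mul_nonneg (hk0 t) (hf0 t))]
        have := mul_le_mul_of_nonneg_left (hle t (hsub (uIoc_subset_uIcc ht))) (hk0 t)
        linarith
      · exact ((hki x₀ y).mul_continuousOn (by fun_prop)).const_mul M
    refine h4.trans ?_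
    rw [intervalIntegral.integral_const_mul, abs_mul, abs_of_nonneg hM0]
    exact mul_le_mul_of_nonneg_left (abs_integral_mul_exp_le hk hk0 x₀ y) hM0
  have h5 := h y hy
  have h6 : f y = M * Real.exp (2 * κ y) := by
    rw [hM, mul_assoc, ← Real.exp_add, neg_add_cancel, Real.exp_zero, mul_one]
  have h7 : 1 ≤ Real.exp (2 * κ y) := Real.one_le_exp (by positivity)
  have h8 : M ≤ 2 * c := by
    have : M * Real.exp (2 * κ y) ≤ 2 * c := by nlinarith
    nlinarith
  exact (hle x₁ right_mem_uIcc).trans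
    (mul_le_mul_of_nonneg_right h8 (Real.exp_pos _).le)

/-! ### Linear systems with locally integrable coefficients -/

section ODE

variable {V : Type*} [NormedAddCommGroup V] [NormedSpace ℝ V]

theorem intervalIntegrable_clm_apply {A : ℝ → V →L[ℝ] V} (hA : LocallyIntegrable A volume)
    {y : ℝ → V} {a c : ℝ} (hy : ContinuousOn y (uIcc a c)) :
    IntervalIntegrable (fun t => A t (y t)) volume a c := by
  have h1 := locallyIntegrable_intervalIntegrable hA a c
  rw [intervalIntegrable_iff] at h1 ⊢
  obtain ⟨D, hD⟩ := isCompact_uIcc.exists_bound_of_continuousOn hy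
  refine Integrable.mono' (h1.norm.mul_const D) ?_ ?_
  · have hy' : AEStronglyMeasurable y (volume.restrict (uIoc a c)) :=
      (hy.mono uIoc_subset_uIcc).aestronglyMeasurable measurableSet_uIoc
    exact (isBoundedBilinearMap_apply (𝕜 := ℝ) (E := V) (F := V)).continuous
      |>.comp_aestronglyMeasurable (h1.aestronglyMeasurable.prodMk hy')
  · refine ae_restrict_of_forall_mem measurableSet_uIoc fun t ht => ?_
    exact (A t).le_opNorm_of_le (hD t (uIoc_subset_uIcc ht))

theorem norm_integral_clm_apply_le {A : ℝ → V →L[ℝ] V} {k : ℝ → ℝ}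
    (hk : LocallyIntegrable k volume) (hk0 : ∀ t, 0 ≤ k t) (hAk : ∀ t, ‖A t‖ ≤ k t)
    {y : ℝ → V} {M : ℝ} (hM : 0 ≤ M) {x₀ : ℝ}
    (hy : ∀ t, ‖y t‖ ≤ M * Real.exp (2 * |∫ s in x₀..t, k s|)) (x : ℝ) :
    ‖∫ t in x₀..x, A t (y t)‖ ≤ M * ((Real.exp (2 * |∫ s in x₀..x, k s|) - 1) / 2) := by
  have hki := locallyIntegrable_intervalIntegrable hk
  have hcont : Continuous fun t => ∫ s in x₀..t, k s :=
    intervalIntegral.continuous_primitive hki x₀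
  have h4 := intervalIntegral.norm_integral_le_abs_of_norm_le (a := x₀) (b := x) (μ := volume)
    (f := fun t => A t (y t)) (g := fun t => M * (k t * Real.exp (2 * |∫ s in x₀..t, k s|)))
    (Eventually.of_forall fun t => by
      refine ((A t).le_opNorm _).trans ?_
      refine (mul_le_mul (hAk t) (hy t) (norm_nonneg _) (hk0 t)).trans (le_of_eq (by ring)))
    (((hki x₀ x).mul_continuousOn (by fun_prop)).const_mul M)
  refine h4.trans ?_
  rw [intervalIntegral.integral_const_mul, abs_mul, abs_of_nonneg hM]
  exact mul_le_mul_of_nonneg_left (abs_integral_mul_exp_le hk hk0 x₀ x) hM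

/-- Picard iteration in a weighted sup norm: with weight `e^{2κ}` the integral operator is a
contraction with constant `1/2` on the whole line at once, so no continuation of local solutions is
needed. -/
theorem exists_linear_ode [CompleteSpace V] {A : ℝ → V →L[ℝ] V} {b : ℝ → V}
    (hA : LocallyIntegrable A volume) (hb : LocallyIntegrable b volume) (x₀ : ℝ) (y₀ : V) :
    ∃ y : ℝ → V, Continuous y ∧ ∀ x, y x = y₀ + ∫ t in x₀..x, (A t (y t) + b t) := by
  -- The forcing term is included in `k` so that the weight also dominates the primitive of `b`.
  set k : ℝ → ℝ := fun t => ‖A t‖ + ‖b t‖ with hk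
  have hkl : LocallyIntegrable k volume := (locallyIntegrable_norm hA).add (locallyIntegrable_norm hb)
  have hk0 : ∀ t, 0 ≤ k t := fun t => by positivity
  have hAk : ∀ t, ‖A t‖ ≤ k t := fun t => le_add_of_nonneg_right (norm_nonneg _)
  have hki := locallyIntegrable_intervalIntegrable hkl
  have hbi := locallyIntegrable_intervalIntegrable hb
  have hcont : Continuous fun t => ∫ s in x₀..t, k s :=
    intervalIntegral.continuous_primitive hki x₀
  set w : ℝ → ℝ := fun t => Real.exp (2 * |∫ s in x₀..t, k s|) with hw
  have hwc : Continuous w := by fun_prop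
  have hw0 : ∀ t, 0 < w t := fun t => Real.exp_pos _
  have hw1 : ∀ t, 1 ≤ w t := fun t => Real.one_le_exp (by positivity)
  have hAi : ∀ (z : BoundedContinuousFunction ℝ V) (x : ℝ),
      IntervalIntegrable (fun t => A t (w t • z t)) volume x₀ x := fun z x =>
    intervalIntegrable_clm_apply hA (hwc.smul z.continuous).continuousOn
  have hAc : ∀ z : BoundedContinuousFunction ℝ V,
      Continuous fun x => ∫ t in x₀..x, A t (w t • z t) := fun z =>
    intervalIntegral.continuous_primitive (fun a c =>
      intervalIntegrable_clm_apply hA (hwc.smul z.continuous).continuousOn) x₀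
  have hbound : ∀ (z : BoundedContinuousFunction ℝ V) x,
      ‖∫ t in x₀..x, A t (w t • z t)‖ ≤ ‖z‖ * ((w x - 1) / 2) := fun z x =>
    norm_integral_clm_apply_le hkl hk0 hAk (norm_nonneg z) (fun t => by
      rw [norm_smul, Real.norm_of_nonneg (hw0 t).le, mul_comm]
      exact mul_le_mul_of_nonneg_right (z.norm_coe_le_norm t) (hw0 t).le) x
  have hbb : ∀ x, ‖∫ t in x₀..x, b t‖ ≤ w x := fun x => by
    have h1 := intervalIntegral.norm_integral_le_abs_of_norm_le (a := x₀) (b := x) (μ := volume)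
      (f := b) (g := k) (Eventually.of_forall fun t => le_add_of_nonneg_left (norm_nonneg _))
      (hki x₀ x)
    refine h1.trans ?_
    have h2 := Real.add_one_le_exp (2 * |∫ s in x₀..x, k s|)
    have h3 := abs_nonneg (∫ s in x₀..x, k s)
    simp only [hw]
    linarith
  -- The unknown is the bounded function `z = y / w`, which makes the complete space of bounded
  -- continuous functions available.
  let S : BoundedContinuousFunction ℝ V → BoundedContinuousFunction ℝ V := fun z =>
    BoundedContinuousFunction.ofNormedAddCommGroup
      (fun x => (w x)⁻¹ • (y₀ + ((∫ t in x₀..x, A t (w t • z t)) + ∫ t in x₀..x, b t)))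
      ((hwc.inv₀ fun t => (hw0 t).ne').smul (continuous_const.add ((hAc z).add
        (intervalIntegral.continuous_primitive (fun a c => hbi a c) x₀))))
      (‖y₀‖ + (‖z‖ + 1)) (fun x => by
        rw [norm_smul, norm_inv, Real.norm_of_nonneg (hw0 x).le, inv_mul_le_iff₀ (hw0 x)]
        refine (norm_add_le _ _).trans ?_
        have h1 := norm_add_le (∫ t in x₀..x, A t (w t • z t)) (∫ t in x₀..x, b t)
        have h2 := hbound z x
        have h3 := hbb x
        have h4 := hw1 x
        have h5 := norm_nonneg z
        have h6 := norm_nonneg y₀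
        nlinarith)
  have hS : ContractingWith (1 / 2) S := by
    refine ⟨by norm_num [← NNReal.coe_lt_coe], LipschitzWith.of_dist_le_mul fun z z' => ?_⟩
    rw [BoundedContinuousFunction.dist_le (by positivity)]
    intro x
    have e : S z x - S z' x = (w x)⁻¹ • ∫ t in x₀..x, A t (w t • (z - z') t) := by
      simp only [S, BoundedContinuousFunction.coe_ofNormedAddCommGroup,
        BoundedContinuousFunction.sub_apply, smul_sub, map_sub]
      rw [← smul_sub, intervalIntegral.integral_sub (hAi z x) (hAi z' x)]
      congr 1
      abel
    rw [dist_eq_norm, e, norm_smul, norm_inv, Real.norm_of_nonneg (hw0 x).le,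
      inv_mul_le_iff₀ (hw0 x), dist_eq_norm]
    refine (hbound _ x).trans ?_
    have h5 := norm_nonneg (z - z')
    have h4 := hw1 x
    have : ((1 / 2 : NNReal) : ℝ) = 1 / 2 := by norm_num
    rw [this]
    nlinarith
  set z := ContractingWith.fixedPoint S hS
  have hz : S z = z := hS.fixedPoint_isFixedPt
  have hyz : ∀ x, w x • z x = y₀ + ∫ t in x₀..x, (A t (w t • z t) + b t) := fun x => by
    rw [intervalIntegral.integral_add (hAi z x) (hbi x₀ x)]
    conv_lhs => rw [← hz]
    simp only [S, BoundedContinuousFunction.coe_ofNormedAddCommGroup]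
    rw [smul_inv_smul₀ (hw0 x).ne']
  exact ⟨fun x => w x • z x, hwc.smul z.continuous, hyz⟩

/-- A priori bound for linear systems. -/
theorem linear_ode_bound {A : ℝ → V →L[ℝ] V} {b y : ℝ → V}
    (hA : LocallyIntegrable A volume) {x₀ x₁ : ℝ} (hy : ContinuousOn y (uIcc x₀ x₁))
    (hb : IntervalIntegrable b volume x₀ x₁)
    (h : ∀ x ∈ uIcc x₀ x₁, y x = y x₀ + ∫ t in x₀..x, (A t (y t) + b t)) :
    ‖y x₁‖ ≤ 2 * (‖y x₀‖ + |∫ t in x₀..x₁, ‖b t‖|) *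
      Real.exp (2 * |∫ t in x₀..x₁, ‖A t‖|) := by
  have hyn : ContinuousOn (fun x => ‖y (projIcc (min x₀ x₁) (max x₀ x₁) min_le_max x)‖)
      (uIcc x₀ x₁) := by
    have hc : Continuous fun x => (projIcc (min x₀ x₁) (max x₀ x₁) min_le_max x : ℝ) :=
      continuous_subtype_val.comp continuous_projIcc
    exact (hy.comp hc.continuousOn fun x _ => Subtype.coe_prop _).norm
  have hp : ∀ x ∈ uIcc x₀ x₁, (projIcc (min x₀ x₁) (max x₀ x₁) min_le_max x : ℝ) = x :=
    fun x hx => by rw [projIcc_of_mem _ hx]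
  have := gronwall_integral (k := fun t => ‖A t‖) (locallyIntegrable_norm hA) (fun t => norm_nonneg _)
    (c := ‖y x₀‖ + |∫ t in x₀..x₁, ‖b t‖|) hyn (fun x => norm_nonneg _) (by positivity) ?_
  · rwa [hp x₁ right_mem_uIcc] at this
  intro x hx
  have hsub : uIcc x₀ x ⊆ uIcc x₀ x₁ := uIcc_subset_uIcc left_mem_uIcc hx
  have hAi := intervalIntegrable_clm_apply hA (hy.mono hsub)
  have hbi := hb.mono_set hsub
  rw [hp x hx, h x hx, intervalIntegral.integral_add hAi hbi]
  have h1 : ‖∫ t in x₀..x, A t (y t)‖ ≤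
      |∫ t in x₀..x, ‖A t‖ * ‖y (projIcc (min x₀ x₁) (max x₀ x₁) min_le_max t)‖| := by
    refine intervalIntegral.norm_integral_le_abs_of_norm_le ?_ ?_
    · refine ae_restrict_of_forall_mem measurableSet_uIoc fun t ht => ?_
      rw [hp t (hsub (uIoc_subset_uIcc ht))]
      exact (A t).le_opNorm _
    · exact (locallyIntegrable_intervalIntegrable hA x₀ x).norm.mul_continuousOn (hyn.mono hsub)
  have h2 : ‖∫ t in x₀..x, b t‖ ≤ |∫ t in x₀..x₁, ‖b t‖| := by
    refine (intervalIntegral.norm_integral_le_abs_integral_norm).trans ?_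
    exact intervalIntegral.abs_integral_mono_interval (uIoc_subset_uIoc_of_mem hx)
      (Eventually.of_forall fun t => norm_nonneg _) hb.norm
  have h3 := norm_add_le (y x₀) ((∫ t in x₀..x, A t (y t)) + ∫ t in x₀..x, b t)
  have h4 := norm_add_le (∫ t in x₀..x, A t (y t)) (∫ t in x₀..x, b t)
  linarith

end ODE

/-! ### Bounded Borel functions -/

/-- Bounded Borel functions on the line. -/
def BddMeas (F : ℝ → ℂ) : Prop := Measurable F ∧ ∃ C : ℝ, ∀ t, ‖F t‖ ≤ C

namespace BddMeas

variable {F G : ℝ → ℂ}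

theorem indicator_one {S : Set ℝ} (hS : MeasurableSet S) : BddMeas (S.indicator 1) :=
  ⟨measurable_one.indicator hS, 1, fun t => (norm_indicator_le_norm_self _ _).trans (by simp)⟩

theorem const (c : ℂ) : BddMeas fun _ => c := ⟨measurable_const, ‖c‖, fun _ => le_rfl⟩

theorem add (hF : BddMeas F) (hG : BddMeas G) : BddMeas (F + G) := by
  obtain ⟨h1, C, hC⟩ := hF
  obtain ⟨h2, D, hD⟩ := hG
  exact ⟨h1.add h2, C + D, fun t => (norm_add_le _ _).trans (add_le_add (hC t) (hD t))⟩

theorem mul (hF : BddMeas F) (hG : BddMeas G) : BddMeas (F * G) := by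
  obtain ⟨h1, C, hC⟩ := hF
  obtain ⟨h2, D, hD⟩ := hG
  refine ⟨h1.mul h2, C * D, fun t => ?_⟩
  rw [Pi.mul_apply, norm_mul]
  exact mul_le_mul (hC t) (hD t) (norm_nonneg _) ((norm_nonneg _).trans (hC t))

theorem smul (c : ℂ) (hF : BddMeas F) : BddMeas (c • F) := (const c).mul hF

theorem neg (hF : BddMeas F) : BddMeas (-F) := by
  obtain ⟨h1, C, hC⟩ := hF
  exact ⟨h1.neg, C, fun t => by simpa using hC t⟩

theorem sub (hF : BddMeas F) (hG : BddMeas G) : BddMeas (F - G) := by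
  rw [sub_eq_add_neg]; exact hF.add hG.neg

theorem star (hF : BddMeas F) : BddMeas (star F) := by
  obtain ⟨h1, C, hC⟩ := hF
  exact ⟨Complex.continuous_conj.measurable.comp h1, C, fun t => by simpa using hC t⟩

theorem of_continuousOn_indicator (hF : Continuous F) {a b : ℝ} {S : Set ℝ} (hS : MeasurableSet S)
    (hSab : S ⊆ Icc a b) : BddMeas (F * S.indicator 1) := by
  obtain ⟨C, hC⟩ := isCompact_Icc.exists_bound_of_continuousOn (s := Icc a b) hF.continuousOn
  refine ⟨hF.measurable.mul (measurable_one.indicator hS), max C 0, fun t => ?_⟩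
  by_cases ht : t ∈ S
  · simpa [ht] using Or.inl (hC t (hSab ht))
  · simp [ht]

theorem integrable (hF : BddMeas F) (μ : Measure ℝ) [IsFiniteMeasure μ] : Integrable F μ := by
  obtain ⟨h1, C, hC⟩ := hF
  exact Integrable.of_bound h1.aestronglyMeasurable C (Eventually.of_forall hC)

/-- Simple functions reach every bounded Borel function by pointwise limits with a common bound,
which is the mode of convergence that dominated convergence respects. -/
theorem induction {P : (ℝ → ℂ) → Prop} (hind : ∀ S, MeasurableSet S → P (S.indicator 1))
    (hadd : ∀ F G, BddMeas F → BddMeas G → P F → P G → P (F + G))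
    (hsmul : ∀ (c : ℂ) F, BddMeas F → P F → P (c • F))
    (hlim : ∀ (Fn : ℕ → ℝ → ℂ) (F : ℝ → ℂ) (C : ℝ), (∀ n, BddMeas (Fn n)) →
      (∀ n t, ‖Fn n t‖ ≤ C) → (∀ t, Tendsto (fun n => Fn n t) atTop (𝓝 (F t))) →
      (∀ n, P (Fn n)) → P F) (hF : BddMeas F) : P F := by
  obtain ⟨h1, C, hC⟩ := hF
  have hs : ∀ f : SimpleFunc ℝ ℂ, BddMeas f ∧ P f := by
    intro f
    induction f using SimpleFunc.induction with
    | const c hs =>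
      rename_i s
      have e : (⇑(SimpleFunc.piecewise s hs (SimpleFunc.const ℝ c) (SimpleFunc.const ℝ 0)) :
          ℝ → ℂ) = c • s.indicator 1 := by
        ext t
        by_cases ht : t ∈ s <;> simp [ht]
      rw [e]
      exact ⟨(indicator_one hs).smul c, hsmul c _ (indicator_one hs) (hind s hs)⟩
    | add _ hf hg =>
      rw [SimpleFunc.coe_add]
      exact ⟨hf.1.add hg.1, hadd _ _ hf.1 hg.1 hf.2 hg.2⟩
  have hsm := h1.stronglyMeasurable
  have hC0 : 0 ≤ C := (norm_nonneg _).trans (hC 0)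
  exact hlim (fun n => hsm.approxBounded C n) F C (fun n => (hs _).1)
    (fun n t => hsm.norm_approxBounded_le hC0 n t)
    (fun t => hsm.tendsto_approxBounded_of_norm_le (hC t)) (fun n => (hs _).2)

end BddMeas

/-! ### Scalar measures and sesquilinear forms of a resolution of the identity. -/

namespace ProjMeasure

variable {H : Type*} [NormedAddCommGroup H] [InnerProductSpace ℂ H] [CompleteSpace H]
  (E : ProjMeasure H)

theorem diag_apply {S : Set ℝ} (hS : MeasurableSet S) (x : H) :
    E.diag x S = ENNReal.ofReal (‖E S x‖ ^ 2) :=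
  Measure.ofMeasurable_apply S hS

instance diag_finite (x : H) : IsFiniteMeasure (E.diag x) :=
  ⟨by rw [E.diag_apply MeasurableSet.univ]; exact ENNReal.ofReal_lt_top⟩

theorem diag_real {S : Set ℝ} (hS : MeasurableSet S) (x : H) :
    (E.diag x).real S = ‖E S x‖ ^ 2 := by
  rw [Measure.real, E.diag_apply hS, ENNReal.toReal_ofReal (by positivity)]

theorem diag_smul (c : ℂ) (x : H) : E.diag (c • x) = ENNReal.ofReal (‖c‖ ^ 2) • E.diag x := by
  ext S hS
  rw [Measure.smul_apply, E.diag_apply hS, E.diag_apply hS, map_smul, norm_smul, mul_pow,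
    ENNReal.ofReal_mul (by positivity), smul_eq_mul]

/-- Domination of the measure of a sum; it keeps integrability stable under the combinations that
occur in polarization. -/
theorem diag_add_le (x y : H) : E.diag (x + y) ≤ (2 : ENNReal) • (E.diag x + E.diag y) := by
  refine Measure.le_iff.2 fun S hS => ?_
  rw [Measure.smul_apply, Measure.add_apply, E.diag_apply hS, E.diag_apply hS, E.diag_apply hS,
    ← ENNReal.ofReal_add (by positivity) (by positivity), smul_eq_mul,
    ← ENNReal.ofReal_ofNat 2, ← ENNReal.ofReal_mul (by norm_num), map_add]
  refine ENNReal.ofReal_le_ofReal ?_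
  have h := norm_add_le (E S x) (E S y)
  have h2 : ‖E S x + E S y‖ ^ 2 ≤ (‖E S x‖ + ‖E S y‖) ^ 2 := by gcongr
  nlinarith [sq_nonneg (‖E S x‖ - ‖E S y‖)]

theorem inner_apply_left {S : Set ℝ} (hS : MeasurableSet S) (x y : H) :
    inner ℂ (E S x) y = inner ℂ x (E S y) := by
  have := (E.proj S hS).isSelfAdjoint
  rw [ContinuousLinearMap.isSelfAdjoint_iff_isSymmetric] at this
  exact this x y

theorem apply_apply {S T : Set ℝ} (hS : MeasurableSet S) (hT : MeasurableSet T) (x : H) :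
    E S (E T x) = E (S ∩ T) x := by
  rw [E.inter S T hS hT]; rfl

theorem inner_eq_sum_norm_sq {H : Type*} [NormedAddCommGroup H] [InnerProductSpace ℂ H] (x y : H) :
    inner ℂ x y = (1 / 4) * ∑ k ∈ Finset.range 4,
      Complex.I ^ k * ((‖y + Complex.I ^ k • x‖ ^ 2 : ℝ) : ℂ) := by
  have h : ∀ v : H, ((‖v‖ ^ 2 : ℝ) : ℂ) = inner ℂ v v := fun v => by
    rw [inner_self_eq_norm_sq_to_K]; norm_cast
  simp only [h, Finset.sum_range_succ, Finset.sum_range_zero, inner_add_left, inner_add_right,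
    inner_smul_left, inner_smul_right, map_pow, Complex.conj_I]
  have h3 : Complex.I ^ 3 = -Complex.I := Complex.I_pow_three
  have h3' : (-Complex.I) ^ 3 = Complex.I := by rw [neg_pow, h3]; ring
  have h2' : (-Complex.I) ^ 2 = -1 := by rw [neg_pow, Complex.I_sq]; ring
  simp only [h3, h3', h2', Complex.I_sq, pow_zero, pow_one]
  linear_combination (-(1 / 2) * inner ℂ y x + (1/2) * inner ℂ x y) * Complex.I_sq

theorem form_indicator {S : Set ℝ} (hS : MeasurableSet S) (x y : H) :
    E.form (S.indicator 1) x y = inner ℂ x (E S y) := by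
  have h1 : inner ℂ x (E S y) = inner ℂ (E S x) (E S y) := by
    rw [E.inner_apply_left hS, E.apply_apply hS hS, inter_self]
  rw [h1, inner_eq_sum_norm_sq, form]
  congr 1
  refine Finset.sum_congr rfl fun k _ => ?_
  congr 1
  have e : ∫ t, S.indicator (1 : ℝ → ℂ) t ∂(E.diag (y + Complex.I ^ k • x)) =
      ((E.diag (y + Complex.I ^ k • x)).real S : ℂ) := by
    rw [integral_indicator hS]; simp
  rw [e, E.diag_real hS, map_add, map_smul]

theorem form_add {F G : ℝ → ℂ} (hF : BddMeas F) (hG : BddMeas G) (x y : H) :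
    E.form (F + G) x y = E.form F x y + E.form G x y := by
  simp only [form, ← mul_add, ← Finset.sum_add_distrib]
  congr 1
  refine Finset.sum_congr rfl fun k _ => ?_
  rw [← integral_add (hF.integrable _) (hG.integrable _)]
  rfl

theorem form_smul (c : ℂ) (F : ℝ → ℂ) (x y : H) : E.form (c • F) x y = c * E.form F x y := by
  simp only [form, Pi.smul_apply, smul_eq_mul, integral_const_mul, Finset.mul_sum]
  refine Finset.sum_congr rfl fun k _ => by ring

theorem form_tendsto {Fn : ℕ → ℝ → ℂ} {F : ℝ → ℂ} {C : ℝ} (hFn : ∀ n, BddMeas (Fn n))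
    (hC : ∀ n t, ‖Fn n t‖ ≤ C) (h : ∀ t, Tendsto (fun n => Fn n t) atTop (𝓝 (F t))) (x y : H) :
    Tendsto (fun n => E.form (Fn n) x y) atTop (𝓝 (E.form F x y)) := by
  refine Tendsto.const_mul _ (tendsto_finsetSum _ fun k _ => Tendsto.const_mul _ ?_)
  exact tendsto_integral_of_dominated_convergence (fun _ => C)
    (fun n => (hFn n).1.aestronglyMeasurable) (integrable_const _)
    (fun n => Eventually.of_forall (hC n)) (Eventually.of_forall h)

/-- With equal arguments the four polarization weights `|1 + i^k|²` are `4, 2, 0, 2`, and the two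
middle contributions `±2i` cancel. -/
theorem form_self (F : ℝ → ℂ) (x : H) : E.form F x x = ∫ t, F t ∂(E.diag x) := by
  have h : ∀ c : ℂ, ∫ t, F t ∂(E.diag (x + c • x)) = (‖1 + c‖ ^ 2 : ℝ) * ∫ t, F t ∂(E.diag x) := by
    intro c
    have e : x + c • x = (1 + c) • x := by rw [add_smul, one_smul]
    rw [e, diag_smul, integral_smul_measure, ENNReal.toReal_ofReal (by positivity)]
    exact Complex.real_smul
  have n1 : ‖(1 : ℂ) + Complex.I‖ ^ 2 = 2 := by
    rw [← Complex.normSq_eq_norm_sq, Complex.normSq_apply]; simp; norm_num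
  have n2 : ‖(1 : ℂ) + -Complex.I‖ ^ 2 = 2 := by
    rw [← Complex.normSq_eq_norm_sq, Complex.normSq_apply]; simp; norm_num
  simp only [form, h, Finset.sum_range_succ, Finset.sum_range_zero, pow_zero, pow_one,
    Complex.I_sq, Complex.I_pow_three, n1, n2]
  norm_num
  ring

/-- The measure of a vector does not change under a unimodular factor, so exchanging the two
arguments only permutes the four polarization terms. -/
theorem form_conj (F : ℝ → ℂ) (x y : H) :
    E.form (star F) x y = star (E.form F y x) := by
  have hd : ∀ (c d : ℂ) (v w : H), ‖c‖ = 1 → c * d = 1 →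
      E.diag (v + c • w) = E.diag (w + d • v) := by
    intro c d v w hc hcd
    have e : v + c • w = c • (w + d • v) := by
      rw [smul_add, smul_smul, hcd, one_smul, add_comm]
    rw [e, diag_smul, hc]
    simp
  have hi : ∀ μ : Measure ℝ, ∫ t, (star F) t ∂μ = star (∫ t, F t ∂μ) := fun μ => integral_conj
  have hI : Complex.I * Complex.I = -1 := Complex.I_mul_I
  simp only [form, hi, Finset.sum_range_succ, Finset.sum_range_zero, pow_zero, pow_one,
    Complex.I_sq, Complex.I_pow_three]
  rw [hd 1 1 y x (by simp) (by simp), hd Complex.I (-Complex.I) y x (by simp) (by simp),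
    hd (-1) (-1) y x (by simp) (by simp), hd (-Complex.I) Complex.I y x (by simp) (by simp)]
  simp
  ring

/-! ### The bounded Borel functional calculus -/

/-- The polarization formula is not visibly sesquilinear. For indicators it is the form of a bounded
operator, and the property passes to linear combinations and bounded limits. -/
theorem form_sesq {F : ℝ → ℂ} (hF : BddMeas F) :
    (∀ x x' y, E.form F (x + x') y = E.form F x y + E.form F x' y) ∧
    (∀ (c : ℂ) x y, E.form F (c • x) y = star c * E.form F x y) ∧
    (∀ x y y', E.form F x (y + y') = E.form F x y + E.form F x y') ∧
    (∀ (c : ℂ) x y, E.form F x (c • y) = c * E.form F x y) := by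
  refine BddMeas.induction (P := fun F =>
    (∀ x x' y, E.form F (x + x') y = E.form F x y + E.form F x' y) ∧
    (∀ (c : ℂ) x y, E.form F (c • x) y = star c * E.form F x y) ∧
    (∀ x y y', E.form F x (y + y') = E.form F x y + E.form F x y') ∧
    (∀ (c : ℂ) x y, E.form F x (c • y) = c * E.form F x y))
    (fun S hS => ?_) (fun F G hF hG h1 h2 => ?_) (fun c F hF h1 => ?_)
    (fun Fn F C hFn hC hlim h => ?_) hF
  · simp only [E.form_indicator hS, inner_add_left, inner_smul_left, map_add, map_smul,
      inner_add_right, inner_smul_right]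
    exact ⟨fun _ _ _ => trivial, fun _ _ _ => rfl, fun _ _ _ => trivial, fun _ _ _ => trivial⟩
  · obtain ⟨a1, a2, a3, a4⟩ := h1
    obtain ⟨b1, b2, b3, b4⟩ := h2
    simp only [E.form_add hF hG]
    refine ⟨fun x x' y => ?_, fun c x y => ?_, fun x y y' => ?_, fun c x y => ?_⟩
    · rw [a1, b1]; ring
    · rw [a2, b2]; ring
    · rw [a3, b3]; ring
    · rw [a4, b4]; ring
  · obtain ⟨a1, a2, a3, a4⟩ := h1
    simp only [E.form_smul]
    refine ⟨fun x x' y => ?_, fun c x y => ?_, fun x y y' => ?_, fun c x y => ?_⟩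
    · rw [a1]; ring
    · rw [a2]; ring
    · rw [a3]; ring
    · rw [a4]; ring
  · have ht := E.form_tendsto hFn hC hlim
    refine ⟨fun x x' y => ?_, fun c x y => ?_, fun x y y' => ?_, fun c x y => ?_⟩
    · refine tendsto_nhds_unique (ht (x + x') y) ?_
      simp only [(h _).1]
      exact (ht x y).add (ht x' y)
    · refine tendsto_nhds_unique (ht (c • x) y) ?_
      simp only [(h _).2.1]
      exact (ht x y).const_mul _
    · refine tendsto_nhds_unique (ht x (y + y')) ?_
      simp only [(h _).2.2.1]
      exact (ht x y).add (ht x y')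
    · refine tendsto_nhds_unique (ht x (c • y)) ?_
      simp only [(h _).2.2.2]
      exact (ht x y).const_mul _

/-- On unit vectors each of the four measures has mass at most `4`, which gives the constant `4C`;
sesquilinearity rescales to arbitrary vectors. -/
theorem form_bound {F : ℝ → ℂ} (hF : BddMeas F) :
    ∃ C : ℝ, ∀ x y, ‖E.form F x y‖ ≤ C * ‖x‖ * ‖y‖ := by
  obtain ⟨C, hC⟩ := hF.2
  have hC0 : 0 ≤ C := (norm_nonneg _).trans (hC 0)
  obtain ⟨-, a2, -, a4⟩ := E.form_sesq hF
  have h1 : ∀ v : H, ‖∫ t, F t ∂(E.diag v)‖ ≤ C * ‖v‖ ^ 2 := fun v => by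
    have := norm_integral_le_of_norm_le_const (μ := E.diag v) (Eventually.of_forall hC)
    rwa [E.diag_real MeasurableSet.univ, E.univ, one_apply_eq_self] at this
  have h2 : ∀ x y : H, ‖x‖ = 1 → ‖y‖ = 1 → ‖E.form F x y‖ ≤ 4 * C := by
    intro x y hx hy
    rw [form, norm_mul]
    have h3 : ‖∑ k ∈ Finset.range 4,
        Complex.I ^ k * ∫ t, F t ∂(E.diag (y + Complex.I ^ k • x))‖ ≤
        ∑ k ∈ Finset.range 4, (4 * C) := by
      refine norm_sum_le_of_le _ fun k _ => ?_
      rw [norm_mul, norm_pow, Complex.norm_I, one_pow, one_mul]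
      refine (h1 _).trans ?_
      have h4 : ‖y + Complex.I ^ k • x‖ ≤ 2 := by
        refine (norm_add_le _ _).trans ?_
        rw [norm_smul, norm_pow, Complex.norm_I, one_pow, one_mul, hx, hy]
        norm_num
      have h5 : ‖y + Complex.I ^ k • x‖ ^ 2 ≤ 2 ^ 2 := by gcongr
      nlinarith
    simp only [Finset.sum_const, Finset.card_range, nsmul_eq_mul] at h3
    have h6 : ‖(1 / 4 : ℂ)‖ = 1 / 4 := by norm_num
    rw [h6]
    push_cast at h3
    linarith
  refine ⟨4 * C, fun x y => ?_⟩
  by_cases hx : x = 0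
  · have : E.form F x y = 0 := by simpa [hx] using a2 0 0 y
    rw [this]; simp [hx]
  by_cases hy : y = 0
  · have : E.form F x y = 0 := by simpa [hy] using a4 0 x 0
    rw [this]; simp [hy]
  have hx' : ‖x‖ ≠ 0 := norm_ne_zero_iff.2 hx
  have hy' : ‖y‖ ≠ 0 := norm_ne_zero_iff.2 hy
  have h7 := h2 (((‖x‖ : ℂ)⁻¹) • x) (((‖y‖ : ℂ)⁻¹) • y)
    (by rw [norm_smul, norm_inv, Complex.norm_real, norm_norm, inv_mul_cancel₀ hx'])
    (by rw [norm_smul, norm_inv, Complex.norm_real, norm_norm, inv_mul_cancel₀ hy'])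
  rw [a2, a4, norm_mul, norm_mul, norm_star, norm_inv, norm_inv, Complex.norm_real, norm_norm,
    Complex.norm_real, norm_norm] at h7
  have h8 : ‖E.form F x y‖ = ‖x‖ * ‖y‖ * (‖x‖⁻¹ * (‖y‖⁻¹ * ‖E.form F x y‖)) := by
    field_simp
  rw [h8]
  calc _ ≤ ‖x‖ * ‖y‖ * (4 * C) := mul_le_mul_of_nonneg_left h7 (by positivity)
    _ = _ := by ring

/-- A bounded sesquilinear form is represented by a bounded operator; the adjoint appears because
the operator has to stand in the second slot. -/
theorem exists_fcalc {F : ℝ → ℂ} (hF : BddMeas F) :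
    ∃ T : H →L[ℂ] H, ∀ x y, inner ℂ x (T y) = E.form F x y := by
  obtain ⟨a1, a2, a3, a4⟩ := E.form_sesq hF
  obtain ⟨C, hC⟩ := E.form_bound hF
  let B : H →L⋆[ℂ] H →L[ℂ] ℂ :=
    (LinearMap.mk₂'ₛₗ (starRingEnd ℂ) (RingHom.id ℂ) (E.form F) a1 a2 a3 a4).mkContinuous₂ C hC
  refine ⟨ContinuousLinearMap.adjoint (InnerProductSpace.continuousLinearMapOfBilin B),
    fun x y => ?_⟩
  rw [ContinuousLinearMap.adjoint_inner_right,
    InnerProductSpace.continuousLinearMapOfBilin_apply]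
  rfl

open Classical in
/-- `∫ F dE` for a bounded Borel function `F`. -/
def fcalc (F : ℝ → ℂ) : H →L[ℂ] H :=
  if h : ∃ T : H →L[ℂ] H, ∀ x y, inner ℂ x (T y) = E.form F x y then h.choose else 0

theorem inner_fcalc {F : ℝ → ℂ} (hF : BddMeas F) (x y : H) :
    inner ℂ x (E.fcalc F y) = E.form F x y := by
  have h := E.exists_fcalc hF
  rw [fcalc, dif_pos h]
  exact h.choose_spec x y

theorem fcalc_indicator {S : Set ℝ} (hS : MeasurableSet S) : E.fcalc (S.indicator 1) = E S := by
  refine ContinuousLinearMap.ext fun y => ext_inner_left ℂ fun x => ?_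
  rw [E.inner_fcalc (BddMeas.indicator_one hS), E.form_indicator hS]

theorem fcalc_add {F G : ℝ → ℂ} (hF : BddMeas F) (hG : BddMeas G) :
    E.fcalc (F + G) = E.fcalc F + E.fcalc G := by
  refine ContinuousLinearMap.ext fun y => ext_inner_left ℂ fun x => ?_
  rw [E.inner_fcalc (hF.add hG), E.form_add hF hG, _root_.add_apply, inner_add_right,
    E.inner_fcalc hF, E.inner_fcalc hG]

theorem fcalc_smul (c : ℂ) {F : ℝ → ℂ} (hF : BddMeas F) : E.fcalc (c • F) = c • E.fcalc F := by
  refine ContinuousLinearMap.ext fun y => ext_inner_left ℂ fun x => ?_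
  rw [E.inner_fcalc (hF.smul c), E.form_smul, _root_.smul_apply, inner_smul_right,
    E.inner_fcalc hF]

theorem fcalc_sub {F G : ℝ → ℂ} (hF : BddMeas F) (hG : BddMeas G) :
    E.fcalc (F - G) = E.fcalc F - E.fcalc G := by
  have e : F - G = F + (-1 : ℂ) • G := by ext t; simp [sub_eq_add_neg]
  rw [e, E.fcalc_add hF (hG.smul _), E.fcalc_smul _ hG, neg_one_smul, sub_eq_add_neg]

theorem fcalc_one : E.fcalc 1 = 1 := by
  rw [← indicator_univ (1 : ℝ → ℂ), E.fcalc_indicator MeasurableSet.univ, E.univ]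

theorem inner_fcalc_left {F : ℝ → ℂ} (hF : BddMeas F) (x y : H) :
    inner ℂ (E.fcalc F x) y = inner ℂ x (E.fcalc (star F) y) := by
  rw [E.inner_fcalc hF.star, form_conj, ← E.inner_fcalc hF]
  exact (inner_conj_symm _ _).symm

theorem form_indicator_mul {G : ℝ → ℂ} (hG : BddMeas G) {S : Set ℝ} (hS : MeasurableSet S) :
    ∀ x y, E.form G (E S x) y = E.form (S.indicator 1 * G) x y := by
  refine BddMeas.induction (P := fun G =>
    ∀ x y, E.form G (E S x) y = E.form (S.indicator 1 * G) x y)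
    (fun T hT => ?_) (fun F G hF hG h1 h2 => ?_) (fun c F hF h1 => ?_)
    (fun Fn F C hFn hC hlim h => ?_) hG
  · intro x y
    have e : (S.indicator 1 * T.indicator 1 : ℝ → ℂ) = (S ∩ T).indicator 1 := by
      rw [inter_indicator_one]
    rw [e, E.form_indicator hT, E.form_indicator (hS.inter hT), E.inner_apply_left hS,
      E.apply_apply hS hT]
  · intro x y
    rw [mul_add, E.form_add hF hG, E.form_add ((BddMeas.indicator_one hS).mul hF)
      ((BddMeas.indicator_one hS).mul hG), h1, h2]
  · intro x y
    rw [mul_smul_comm, E.form_smul, E.form_smul, h1]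
  · intro x y
    refine tendsto_nhds_unique (E.form_tendsto hFn hC hlim (E S x) y) ?_
    simp only [h]
    refine E.form_tendsto (C := C) (fun n => (BddMeas.indicator_one hS).mul (hFn n))
      (fun n t => ?_) (fun t => (hlim t).const_mul _) x y
    by_cases ht : t ∈ S
    · simpa [ht] using hC n t
    · simpa [ht] using (norm_nonneg _).trans (hC n t)

/-- Induction on `F` with `G` fixed: for an indicator the projection moves to the left argument,
where `form_indicator_mul` absorbs it. -/
theorem fcalc_mul {F G : ℝ → ℂ} (hF : BddMeas F) (hG : BddMeas G) :
    E.fcalc (F * G) = E.fcalc F * E.fcalc G := by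
  refine ContinuousLinearMap.ext fun y => ext_inner_left ℂ fun x => ?_
  rw [E.inner_fcalc (hF.mul hG), mul_apply_eq_comp, E.inner_fcalc hF]
  revert x y
  refine BddMeas.induction (P := fun F =>
    ∀ y x, E.form (F * G) x y = E.form F x (E.fcalc G y))
    (fun S hS => ?_) (fun F F' hF hF' h1 h2 => ?_) (fun c F hF h1 => ?_)
    (fun Fn F C hFn hC hlim h => ?_) hF
  · intro y x
    rw [E.form_indicator hS, ← E.inner_apply_left hS, E.inner_fcalc hG, E.form_indicator_mul hG hS]
  · intro y x
    rw [add_mul, E.form_add hF hF', E.form_add (hF.mul hG) (hF'.mul hG), h1, h2]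
  · intro y x
    rw [smul_mul_assoc, E.form_smul, E.form_smul, h1]
  · intro y x
    obtain ⟨D, hD⟩ := hG.2
    refine tendsto_nhds_unique (E.form_tendsto (C := C * D) (fun n => (hFn n).mul hG)
      (fun n t => ?_) (fun t => (hlim t).mul_const _) x y) ?_
    · rw [Pi.mul_apply, norm_mul]
      exact mul_le_mul (hC n t) (hD t) (norm_nonneg _) ((norm_nonneg _).trans (hC n t))
    · simp only [h]
      exact E.form_tendsto hFn hC hlim _ _

theorem fcalc_fcalc {F G : ℝ → ℂ} (hF : BddMeas F) (hG : BddMeas G) (x : H) :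
    E.fcalc F (E.fcalc G x) = E.fcalc (F * G) x := by
  rw [E.fcalc_mul hF hG]; rfl

theorem norm_fcalc_sq {F : ℝ → ℂ} (hF : BddMeas F) (x : H) :
    ‖E.fcalc F x‖ ^ 2 = ∫ t, ‖F t‖ ^ 2 ∂(E.diag x) := by
  have h : inner ℂ (E.fcalc F x) (E.fcalc F x) = ∫ t, ((‖F t‖ ^ 2 : ℝ) : ℂ) ∂(E.diag x) := by
    rw [E.inner_fcalc_left hF, E.fcalc_fcalc hF.star hF, E.inner_fcalc (hF.star.mul hF), form_self]
    refine integral_congr_ae (Eventually.of_forall fun t => ?_)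
    simp [← Complex.normSq_eq_norm_sq, Complex.normSq_eq_conj_mul_self]
  rw [integral_complex_ofReal, inner_self_eq_norm_sq_to_K] at h
  apply Complex.ofReal_injective
  rw [← h, Complex.ofReal_pow]
  rfl

theorem norm_fcalc_le {F : ℝ → ℂ} (hF : BddMeas F) {C : ℝ} (hC : ∀ t, ‖F t‖ ≤ C) (x : H) :
    ‖E.fcalc F x‖ ≤ C * ‖x‖ := by
  have hC0 : 0 ≤ C := (norm_nonneg _).trans (hC 0)
  refine le_of_sq_le_sq ?_ (by positivity)
  rw [E.norm_fcalc_sq hF, mul_pow]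
  have h2 : ‖x‖ ^ 2 = (E.diag x).real Set.univ := by
    rw [E.diag_real MeasurableSet.univ, E.univ, one_apply_eq_self]
  rw [h2, mul_comm, ← smul_eq_mul, ← integral_const]
  refine integral_mono_of_nonneg (Eventually.of_forall fun t => by positivity)
    (integrable_const _) (Eventually.of_forall fun t => ?_)
  have := hC t
  simp only
  gcongr

/-- Both sides of a Borel set `S` are `∫ |1_S G|²` against the measure of `x`, by multiplicativity
and the norm formula. -/
theorem diag_fcalc {G : ℝ → ℂ} (hG : BddMeas G) (x : H) :
    E.diag (E.fcalc G x) = (E.diag x).withDensity fun t => ‖G t‖ₑ ^ 2 := by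
  ext S hS
  rw [E.diag_apply hS, withDensity_apply _ hS, ← E.fcalc_indicator hS,
    E.fcalc_fcalc (BddMeas.indicator_one hS) hG,
    E.norm_fcalc_sq ((BddMeas.indicator_one hS).mul hG), ← lintegral_indicator hS,
    ofReal_integral_eq_lintegral_ofReal]
  · refine lintegral_congr fun t => ?_
    by_cases ht : t ∈ S
    · simp only [Pi.mul_apply, ht, indicator_of_mem, Pi.one_apply, one_mul]
      rw [ENNReal.ofReal_pow (norm_nonneg _), ofReal_norm]
    · simp [ht]
  · obtain ⟨h1, C, hC⟩ := (BddMeas.indicator_one hS).mul hG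
    refine Integrable.of_bound (h1.norm.pow_const 2).aestronglyMeasurable (C ^ 2)
      (Eventually.of_forall fun t => ?_)
    rw [norm_pow, norm_norm]
    have := hC t
    gcongr
  · exact Eventually.of_forall fun t => by positivity

theorem integrable_of_mem_integralDomain {F : ℝ → ℂ} (hF : Measurable F) {x : H}
    (hx : x ∈ E.integralDomain F) : Integrable F (E.diag x) := by
  have : MemLp F 2 (E.diag x) := by
    refine ⟨hF.aestronglyMeasurable, ?_⟩
    rw [eLpNorm_lt_top_iff_lintegral_rpow_enorm_lt_top (by norm_num) (by norm_num)]
    simpa [integralDomain] using hx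
  exact this.integrable (by norm_num)

theorem integrable_diag_add {F : ℝ → ℂ} {x y : H} (hx : Integrable F (E.diag x))
    (hy : Integrable F (E.diag y)) (c : ℂ) : Integrable F (E.diag (x + c • y)) := by
  refine Integrable.mono_measure ?_ (E.diag_add_le x (c • y))
  refine Integrable.smul_measure (hx.add_measure ?_) (by norm_num)
  rw [diag_smul]
  exact hy.smul_measure ENNReal.ofReal_ne_top

theorem form_tendsto_of_integrable {Fn : ℕ → ℝ → ℂ} {F : ℝ → ℂ} {x y : H}
    (hFm : ∀ n, Measurable (Fn n)) (hF : ∀ n t, ‖Fn n t‖ ≤ ‖F t‖)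
    (h : ∀ t, Tendsto (fun n => Fn n t) atTop (𝓝 (F t)))
    (hx : Integrable F (E.diag x)) (hy : Integrable F (E.diag y)) :
    Tendsto (fun n => E.form (Fn n) x y) atTop (𝓝 (E.form F x y)) := by
  refine Tendsto.const_mul _ (tendsto_finsetSum _ fun k _ => Tendsto.const_mul _ ?_)
  exact tendsto_integral_of_dominated_convergence (fun t => ‖F t‖)
    (fun n => (hFm n).aestronglyMeasurable) (E.integrable_diag_add hy hx _).norm
    (fun n => Eventually.of_forall (hF n)) (Eventually.of_forall h)

/-- `(∫ F dE) (∫ G dE) x = (∫ F G dE) x` if `G` and `F G` are bounded. -/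
theorem isIntegral_fcalc {F G : ℝ → ℂ} (hF : Measurable F) (hG : BddMeas G)
    (hFG : BddMeas (F * G)) (x : H) : E.IsIntegral F (E.fcalc G x) (E.fcalc (F * G) x) := by
  have hdom : E.fcalc G x ∈ E.integralDomain F := by
    rw [integralDomain, mem_ofPred_eq, diag_fcalc E hG,
      lintegral_withDensity_eq_lintegral_mul _ (hG.1.enorm.pow_const 2) (hF.enorm.pow_const 2)]
    obtain ⟨C, hC⟩ := hFG.2
    refine (lintegral_mono (g := fun _ => ENNReal.ofReal C ^ 2) fun t => ?_).trans_lt ?_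
    · rw [Pi.mul_apply, ← mul_pow, ← enorm_mul, mul_comm (G t), ← ofReal_norm]
      exact pow_le_pow_left' (ENNReal.ofReal_le_ofReal (hC t)) 2
    · rw [lintegral_const]
      exact ENNReal.mul_lt_top (by simp) (measure_lt_top _ _)
  refine ⟨hdom, fun w hw => ?_⟩
  -- `F` may be unbounded, so it is truncated to `|F| ≤ n`. The product rule holds for the
  -- truncations; one limit uses the bound on `F G`, the other the domain condition on `w`.
  let S : ℕ → Set ℝ := fun n => {t | ‖F t‖ ≤ n}
  have hS : ∀ n, MeasurableSet (S n) := fun n => measurableSet_le hF.norm measurable_const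
  have hFn : ∀ n, BddMeas ((S n).indicator F) := fun n =>
    ⟨hF.indicator (hS n), n, fun t => by
      by_cases ht : t ∈ S n
      · rw [indicator_of_mem ht]; exact ht
      · simp [ht]⟩
  have hev : ∀ t, ∀ᶠ n : ℕ in atTop, (S n).indicator F t = F t := fun t => by
    obtain ⟨N, hN⟩ := exists_nat_ge ‖F t‖
    filter_upwards [eventually_ge_atTop N] with n hn
    have ht : t ∈ S n := hN.trans (by exact_mod_cast hn)
    exact indicator_of_mem ht F
  have hle : ∀ n t, ‖(S n).indicator F t‖ ≤ ‖F t‖ := fun n t => norm_indicator_le_norm_self _ _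
  refine tendsto_nhds_unique ?_ (E.form_tendsto_of_integrable (fun n => (hFn n).1) hle
    (fun t => tendsto_const_nhds.congr' ((hev t).mono fun n hn => hn.symm))
    (E.integrable_of_mem_integralDomain hF hw) (E.integrable_of_mem_integralDomain hF hdom))
  rw [E.inner_fcalc hFG]
  obtain ⟨C, hC⟩ := hFG.2
  refine Tendsto.congr (fun n => ?_) (E.form_tendsto (C := C) (fun n => (hFn n).mul hG)
    (fun n t => ?_) (fun t => ?_) w x)
  · rw [← E.inner_fcalc ((hFn n).mul hG), ← E.fcalc_fcalc (hFn n) hG, E.inner_fcalc (hFn n)]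
  · refine le_trans ?_ (hC t)
    rw [Pi.mul_apply, Pi.mul_apply, norm_mul, norm_mul]
    exact mul_le_mul_of_nonneg_right (hle n t) (norm_nonneg _)
  · exact tendsto_const_nhds.congr' ((hev t).mono fun n hn => by
      simp only [Pi.mul_apply, hn])

end ProjMeasure

/-! ### Projections representing a quadratic family of measures -/

section HasProj

variable {H : Type*} [NormedAddCommGroup H] [InnerProductSpace ℂ H] {X : Type*} [MeasurableSpace X]

/-- The orthogonal projection `P` satisfies `(x, P x) = μ_x(S)` for all `x`. -/
structure HasProj (μ : H → Measure X) (S : Set X) (P : H →L[ℂ] H) : Prop where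
  symm : ∀ x y, inner ℂ (P x) y = inner ℂ x (P y)
  idem : ∀ x, P (P x) = P x
  meas : ∀ x, (μ x).real S = ‖P x‖ ^ 2

theorem clm_ext_of_inner {P Q : H →L[ℂ] H} (h : ∀ x, inner ℂ (P x) x = inner ℂ (Q x) x) : P = Q := by
  have := (ext_inner_map (P : H →ₗ[ℂ] H) (Q : H →ₗ[ℂ] H)).1 h
  exact ContinuousLinearMap.coe_injective this

namespace HasProj

variable {μ : H → Measure X} {S T : Set X} {P Q : H →L[ℂ] H}

theorem inner_self (h : HasProj μ S P) (x : H) : inner ℂ (P x) x = ((‖P x‖ ^ 2 : ℝ) : ℂ) := by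
  rw [← h.idem x, h.symm, h.idem x, inner_self_eq_norm_sq_to_K]
  norm_cast

theorem unique (h : HasProj μ S P) (h' : HasProj μ S Q) : P = Q :=
  clm_ext_of_inner fun x => by rw [h.inner_self, h'.inner_self, ← h.meas, h'.meas]

theorem norm_sq_compl (h : HasProj μ S P) (x : H) : ‖x - P x‖ ^ 2 = ‖x‖ ^ 2 - ‖P x‖ ^ 2 := by
  rw [@norm_sub_sq ℂ, ← inner_conj_symm, h.inner_self]
  simp only [RCLike.conj_re]
  have : RCLike.re ((‖P x‖ ^ 2 : ℝ) : ℂ) = ‖P x‖ ^ 2 := Complex.ofReal_re _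
  rw [this]; ring

variable [∀ x, IsFiniteMeasure (μ x)] (hμ : ∀ x, (μ x).real univ = ‖x‖ ^ 2)

include hμ

theorem compl (h : HasProj μ S P) (hS : MeasurableSet S) : HasProj μ Sᶜ (1 - P) where
  symm x y := by
    simp only [_root_.sub_apply, one_apply_eq_self, inner_sub_left, inner_sub_right, h.symm]
  idem x := by simp [h.idem]
  meas x := by
    rw [measureReal_compl hS, hμ, h.meas, _root_.sub_apply, one_apply_eq_self, h.norm_sq_compl]

/-- The vector `Q x` already spends its whole mass `‖Q x‖²` on `T`, so nothing remains for a
disjoint `S`. -/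
theorem mul_eq_zero (h : HasProj μ S P) (h' : HasProj μ T Q) (hT : MeasurableSet T)
    (hd : Disjoint S T) (x : H) : P (Q x) = 0 := by
  have h1 : (μ (Q x)).real S + (μ (Q x)).real T ≤ ‖Q x‖ ^ 2 := by
    rw [← measureReal_union hd hT, ← hμ]
    exact measureReal_mono (subset_univ _)
  rw [h.meas, h'.meas, h'.idem] at h1
  have h2 : ‖P (Q x)‖ ^ 2 = 0 := le_antisymm (by linarith) (by positivity)
  simpa using h2

theorem union (h : HasProj μ S P) (h' : HasProj μ T Q) (hS : MeasurableSet S)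
    (hT : MeasurableSet T) (hd : Disjoint S T) : HasProj μ (S ∪ T) (P + Q) where
  symm x y := by
    simp only [_root_.add_apply, inner_add_left, inner_add_right, h.symm, h'.symm]
  idem x := by
    simp only [_root_.add_apply, map_add, h.idem, h'.idem, h.mul_eq_zero hμ h' hT hd,
      h'.mul_eq_zero hμ h hS hd.symm, add_zero, zero_add]
  meas x := by
    rw [measureReal_union hd hT, h.meas, h'.meas, _root_.add_apply, @norm_add_sq ℂ, h.symm,
      h.mul_eq_zero hμ h' hT hd]
    simp

theorem diff (h : HasProj μ S P) (h' : HasProj μ T Q) (hS : MeasurableSet S)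
    (hT : MeasurableSet T) (hST : S ⊆ T) : HasProj μ (T \ S) (Q - P) := by
  have h1 := ((h'.compl hμ hT).union hμ h hT.compl hS
    (disjoint_compl_left_iff_subset.2 hST)).compl hμ (hT.compl.union hS)
  have e : (Tᶜ ∪ S)ᶜ = T \ S := by rw [compl_union, compl_compl]; rfl
  rw [e] at h1
  convert h1 using 1
  abel

omit hμ [∀ x, IsFiniteMeasure (μ x)] in
-- The strong limit `P` is symmetric with `(P x, x) = ‖P x‖²` for every `x`, since both are the same
-- limit. Then `P²` and `P` have equal quadratic forms, so `P` is idempotent although the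
-- approximants need not be.
theorem of_tendsto [CompleteSpace H] {Tn : ℕ → H →L[ℂ] H}
    (hsymm : ∀ n x y, inner ℂ (Tn n x) y = inner ℂ x (Tn n y))
    (hc : ∀ x, CauchySeq fun n => Tn n x)
    (h1 : ∀ x, Tendsto (fun n => (inner ℂ (Tn n x) x).re) atTop (𝓝 ((μ x).real S)))
    (h2 : ∀ x, Tendsto (fun n => ‖Tn n x‖ ^ 2) atTop (𝓝 ((μ x).real S))) :
    ∃ P, HasProj μ S P := by
  choose f hf using fun x => cauchySeq_tendsto_of_complete (hc x)
  let P : H →L[ℂ] H := continuousLinearMapOfTendsto Tn (f := f) (tendsto_pi_nhds.2 hf)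
  have hP : ∀ x, Tendsto (fun n => Tn n x) atTop (𝓝 (P x)) := hf
  have hs : ∀ x y, inner ℂ (P x) y = inner ℂ x (P y) := fun x y =>
    tendsto_nhds_unique ((hP x).inner tendsto_const_nhds)
      (by simpa only [hsymm] using (tendsto_const_nhds (x := x)).inner (𝕜 := ℂ) (hP y))
  have hm : ∀ x, (μ x).real S = ‖P x‖ ^ 2 := fun x =>
    tendsto_nhds_unique (h2 x) ((hP x).norm.pow 2)
  have hr : ∀ x, (inner ℂ (P x) x).re = ‖P x‖ ^ 2 := fun x => by
    rw [← hm]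
    exact tendsto_nhds_unique ((Complex.continuous_re.tendsto _).comp
      ((hP x).inner tendsto_const_nhds)) (h1 x)
  have hi : ∀ x, (inner ℂ (P x) x).im = 0 := fun x => by
    have h3 := inner_conj_symm (𝕜 := ℂ) (P x) x
    rw [← hs] at h3
    exact Complex.conj_eq_iff_im.1 h3
  refine ⟨P, hs, fun x => ?_, hm⟩
  have h4 : P * P = P := clm_ext_of_inner fun x => by
    have h5 : inner ℂ ((P * P) x) x = inner ℂ (P x) (P x) := by
      rw [mul_apply_eq_comp, hs]
    rw [h5, inner_self_eq_norm_sq_to_K]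
    refine Complex.ext ?_ ?_
    · rw [hr]; norm_cast
    · rw [hi]; norm_cast
  exact congrArg (fun T : H →L[ℂ] H => T x) h4

/-- Partial sums of the projections converge strongly: the squared norm of a difference is the mass
of a difference of finite unions, which is Cauchy. -/
theorem iUnion [CompleteSpace H] {Sn : ℕ → Set X} (hd : Pairwise (Function.onFun Disjoint Sn))
    (hS : ∀ n, MeasurableSet (Sn n)) (h : ∀ n, ∃ P, HasProj μ (Sn n) P) :
    ∃ P, HasProj μ (⋃ n, Sn n) P := by
  choose P hP using h
  let U : ℕ → Set X := fun N => ⋃ n ∈ Finset.range N, Sn n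
  have hU : ∀ N, MeasurableSet (U N) := fun N => Finset.measurableSet_biUnion _ fun n _ => hS n
  have hUmono : Monotone U := fun N M hNM => by
    exact biUnion_subset_biUnion_left fun n hn => Finset.range_mono hNM hn
  have hUU : ⋃ n, Sn n = ⋃ N, U N := by
    ext x
    simp only [U, mem_iUnion, Finset.mem_range]
    exact ⟨fun ⟨n, hn⟩ => ⟨n + 1, n, Nat.lt_succ_self n, hn⟩, fun ⟨_, n, _, hn⟩ => ⟨n, hn⟩⟩
  let Q : ℕ → H →L[ℂ] H := fun N => ∑ n ∈ Finset.range N, P n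
  have hQ : ∀ N, HasProj μ (U N) (Q N) := by
    intro N
    induction N with
    | zero => exact ⟨by simp [Q], by simp [Q], by simp [U, Q]⟩
    | succ N ih =>
      have e : U (N + 1) = U N ∪ Sn N := by
        simp only [U, Finset.range_add_one, Finset.set_biUnion_insert, union_comm]
      have e' : Q (N + 1) = Q N + P N := Finset.sum_range_succ _ _
      rw [e, e']
      refine ih.union hμ (hP N) (hU N) (hS N) ?_
      simp only [U, disjoint_iUnion_left]
      exact fun n hn => hd (Finset.mem_range.1 hn).ne
  have hlim : ∀ x, Tendsto (fun N => ‖Q N x‖ ^ 2) atTop (𝓝 ((μ x).real (⋃ n, Sn n))) := by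
    intro x
    simp only [← (hQ _).meas]
    rw [hUU]
    exact (ENNReal.tendsto_toReal (measure_ne_top _ _)).comp
      (tendsto_measure_iUnion_atTop hUmono)
  refine of_tendsto (Tn := Q) (fun n => (hQ n).symm) (fun x => ?_) (fun x => ?_) hlim
  · rw [Metric.cauchySeq_iff']
    intro ε hε
    obtain ⟨N, hN⟩ := Metric.cauchySeq_iff'.1 (hlim x).cauchySeq (ε ^ 2) (by positivity)
    refine ⟨N, fun n hn => ?_⟩
    have h1 := ((hQ N).diff hμ (hQ n) (hU N) (hU n) (hUmono hn)).meas x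
    rw [measureReal_sdiff (hUmono hn) (hU N) (measure_ne_top _ _), (hQ N).meas, (hQ n).meas, _root_.sub_apply] at h1
    have h2 := hN n hn
    rw [Real.dist_eq] at h2
    rw [dist_eq_norm]
    refine lt_of_pow_lt_pow_left₀ 2 hε.le ?_
    rw [← h1]
    exact (le_abs_self _).trans_lt h2
  · refine (hlim x).congr fun N => ?_
    rw [(hQ N).inner_self]
    exact (Complex.ofReal_re _).symm

/-- A quadratic family of measures that is represented by projections on all measurable sets
gives rise to a resolution of the identity. -/
theorem exists_projMeasure [CompleteSpace H] (h : ∀ S, MeasurableSet S → ∃ P, HasProj μ S P)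
    {κ : X → ℝ} (hκ : Measurable κ) : ∃ E : ProjMeasure H, ∀ x, E.diag x = (μ x).map κ := by
  classical
  let P : Set X → H →L[ℂ] H := fun S => if hS : MeasurableSet S then (h S hS).choose else 0
  have hP : ∀ S, MeasurableSet S → HasProj μ S (P S) := fun S hS => by
    simp only [P, dif_pos hS]; exact (h S hS).choose_spec
  have huniv : P univ = 1 := (hP univ .univ).unique ⟨by simp, by simp, by simp [hμ]⟩
  -- Split each set along the intersection; all products of projections belonging to disjoint pieces
  -- vanish.
  have hinter : ∀ S T, MeasurableSet S → MeasurableSet T → P (S ∩ T) = P S * P T := by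
    intro S T hS hT
    have e1 : P S = P (S ∩ T) + P (S \ T) := by
      refine (hP S hS).unique ?_
      have := (hP _ (hS.inter hT)).union hμ (hP _ (hS.diff hT)) (hS.inter hT) (hS.diff hT)
        (disjoint_sdiff_inter.symm)
      rwa [inter_union_sdiff] at this
    have e2 : P T = P (S ∩ T) + P (T \ S) := by
      refine (hP T hT).unique ?_
      have := (hP _ (hS.inter hT)).union hμ (hP _ (hT.diff hS)) (hS.inter hT) (hT.diff hS)
        (by rw [inter_comm]; exact disjoint_sdiff_inter.symm)
      rwa [inter_comm S T, inter_union_sdiff, inter_comm T S] at this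
    ext x
    rw [e1, e2]
    simp only [mul_apply_eq_comp, _root_.add_apply, map_add]
    rw [(hP _ (hS.inter hT)).idem, (hP _ (hS.inter hT)).mul_eq_zero hμ (hP _ (hT.diff hS))
      (hT.diff hS) (disjoint_left.2 fun x h1 h2 => h2.2 h1.1),
      (hP _ (hS.diff hT)).mul_eq_zero hμ (hP _ (hS.inter hT)) (hS.inter hT)
      (disjoint_left.2 fun x h1 h2 => h1.2 h2.2),
      (hP _ (hS.diff hT)).mul_eq_zero hμ (hP _ (hT.diff hS)) (hT.diff hS)
      (disjoint_left.2 fun x h1 h2 => h1.2 h2.1)]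
    simp
  let E : ProjMeasure H :=
    { toFun := fun S => P (κ ⁻¹' S)
      proj := fun S hS => by
        have h1 := hP _ (hκ hS)
        refine ⟨ContinuousLinearMap.ext h1.idem, ?_⟩
        rw [ContinuousLinearMap.isSelfAdjoint_iff_isSymmetric]
        exact h1.symm
      univ := huniv
      inter := fun S T hS hT => hinter _ _ (hκ hS) (hκ hT)
      iUnion := by
        intro S hS hd x
        have hS' : ∀ n, MeasurableSet (κ ⁻¹' S n) := fun n => hκ (hS n)
        have hd' : Pairwise (Function.onFun Disjoint fun n => κ ⁻¹' S n) :=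
          fun i k hik => (hd hik).preimage κ
        rw [preimage_iUnion]
        set V : ℕ → Set X := fun n => κ ⁻¹' S n
        have hfin : ∀ F : Finset ℕ, HasProj μ (⋃ n ∈ F, V n) (∑ n ∈ F, P (V n)) := by
          intro F
          induction F using Finset.induction with
          | empty => exact ⟨by simp, by simp, by simp⟩
          | insert a F ha ih =>
            rw [Finset.set_biUnion_insert, Finset.sum_insert ha]
            refine (hP _ (hS' a)).union hμ ih (hS' a)
              (Finset.measurableSet_biUnion _ fun n _ => hS' n) ?_
            rw [disjoint_iUnion₂_right]
            exact fun n hn => hd' fun e => ha (e ▸ hn)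
        have hsum : HasSum (fun n => (μ x).real (V n)) ((μ x).real (⋃ n, V n)) := by
          rw [measureReal_def, measure_iUnion hd' hS']
          have := ENNReal.hasSum_toReal (f := fun n => μ x (V n)) (by
            rw [← measure_iUnion hd' hS']; exact measure_ne_top _ _)
          rw [ENNReal.tsum_toReal_eq (fun n => measure_ne_top _ _)]
          exact this
        rw [HasSum, SummationFilter.unconditional_filter, tendsto_iff_norm_sub_tendsto_zero]
        -- The distance from a finite partial sum to the limit is the square root of the mass of the
        -- remaining tail.
        have h0 : Tendsto (fun F : Finset ℕ => Real.sqrt ((μ x).real (⋃ n, V n) -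
            ∑ n ∈ F, (μ x).real (V n))) atTop (𝓝 0) := by
          have := (tendsto_const_nhds (x := (μ x).real (⋃ n, V n))).sub hsum
          rw [sub_self] at this
          simpa using this.sqrt
        refine h0.congr fun F => ?_
        have hsub : ⋃ n ∈ F, V n ⊆ ⋃ n, V n := iUnion₂_subset fun n _ => subset_iUnion V n
        have hFm : MeasurableSet (⋃ n ∈ F, V n) := Finset.measurableSet_biUnion _ fun n _ => hS' n
        have h1 := ((hfin F).diff hμ (hP _ (MeasurableSet.iUnion hS')) hFm
          (MeasurableSet.iUnion hS') hsub).meas x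
        rw [measureReal_sdiff hsub hFm, measureReal_biUnion_finset
          (fun i _ k _ hik => hd' hik) (fun n _ => hS' n)] at h1
        rw [h1, Real.sqrt_sq (norm_nonneg _), norm_sub_rev]
        rw [_root_.sub_apply, _root_.sum_apply] }
  refine ⟨E, fun x => ?_⟩
  ext S hS
  rw [E.diag_apply hS, Measure.map_apply hκ hS]
  have := (hP _ (hκ hS)).meas x
  change ENNReal.ofReal (‖P (κ ⁻¹' S) x‖ ^ 2) = _
  rw [← this, ofReal_measureReal]

end HasProj

end HasProj

/-! ### The spectral theorem -/

section SpectralTheorem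

variable {H : Type*} [NormedAddCommGroup H] [InnerProductSpace ℂ H] [CompleteSpace H]

/-- Riesz–Markov for the positive functional `f ↦ (f(R) x, x)`. The spectrum is compact, so all
continuous functions are admissible and the measure is finite. -/
theorem exists_scalar_spectral_measure {R : H →L[ℂ] H} (hR : IsSelfAdjoint R) (x : H) :
    ∃ μ : Measure (spectrum ℝ R), IsFiniteMeasure μ ∧
      ∀ f : C(spectrum ℝ R, ℝ), ∫ t, f t ∂μ = (inner ℂ (cfcHom hR f x) x).re := by
  let L : CompactlySupportedContinuousMap (spectrum ℝ R) ℝ →ₗ[ℝ] ℝ :=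
    { toFun := fun f => (inner ℂ (cfcHom hR f.toContinuousMap x) x).re
      map_add' := fun f g => by
        have e : (f + g).toContinuousMap = f.toContinuousMap + g.toContinuousMap := rfl
        rw [e, map_add, _root_.add_apply, inner_add_left, Complex.add_re]
      map_smul' := fun c f => by
        have e : (c • f).toContinuousMap = c • f.toContinuousMap := rfl
        rw [e, map_smul, _root_.smul_apply, RingHom.id_apply, ← Complex.coe_smul,
          inner_smul_left]
        simp }
  let Λ : CompactlySupportedContinuousMap (spectrum ℝ R) ℝ →ₚ[ℝ] ℝ :=
    PositiveLinearMap.mk₀ L fun f hf => by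
      have h1 : 0 ≤ cfcHom hR f.toContinuousMap := (cfcHom_nonneg_iff hR).2 hf
      rw [ContinuousLinearMap.nonneg_iff_isPositive] at h1
      exact h1.re_inner_nonneg_left x
  refine ⟨RealRMK.rieszMeasure Λ, ?_, fun f => ?_⟩
  · have : (RealRMK.rieszMeasure Λ).Regular := inferInstance
    exact ⟨isCompact_univ.measure_lt_top⟩
  · exact RealRMK.integral_rieszMeasure Λ (CompactlySupportedContinuousMap.continuousMapEquiv f)

/-- The indicator of a closed set is a limit of continuous functions with values in `[0, 1]`. Since
`‖f(R) x‖² = ∫ f² dμ_x`, their convergence in `L²(μ_x)` is strong convergence of the operators. -/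
theorem exists_hasProj_of_isClosed {R : H →L[ℂ] H} (hR : IsSelfAdjoint R)
    {μ : H → Measure (spectrum ℝ R)} [∀ x, IsFiniteMeasure (μ x)]
    (hμ : ∀ x (f : C(spectrum ℝ R, ℝ)), ∫ t, f t ∂(μ x) = (inner ℂ (cfcHom hR f x) x).re)
    {K : Set (spectrum ℝ R)} (hK : IsClosed K) : ∃ P, HasProj μ K P := by
  let f : ℕ → C(spectrum ℝ R, ℝ) := fun n =>
    ⟨fun t => (hK.apprSeq n t : ℝ), NNReal.continuous_coe.comp (hK.apprSeq n).continuous⟩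
  have hf0 : ∀ n t, 0 ≤ f n t := fun n t => NNReal.coe_nonneg _
  have hf1 : ∀ n t, f n t ≤ 1 := fun n t => by
    exact_mod_cast HasOuterApproxClosed.apprSeq_apply_le_one hK n t
  have hft : ∀ t, Tendsto (fun n => f n t) atTop (𝓝 (K.indicator 1 t)) := fun t => by
    have h1 := tendsto_pi_nhds.1 (HasOuterApproxClosed.tendsto_apprSeq hK) t
    have h2 := (NNReal.continuous_coe.tendsto _).comp h1
    have e : ((K.indicator (fun _ => (1 : NNReal)) t : NNReal) : ℝ) = K.indicator 1 t := by
      by_cases ht : t ∈ K <;> simp [ht]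
    rw [← e]
    exact h2
  have hs : ∀ (g : C(spectrum ℝ R, ℝ)) x y, inner ℂ (cfcHom hR g x) y =
      inner ℂ x (cfcHom hR g y) := fun g x y => by
    have h1 : IsSelfAdjoint (cfcHom hR g) := by
      rw [IsSelfAdjoint, ← map_star]
      rfl
    rw [ContinuousLinearMap.isSelfAdjoint_iff_isSymmetric] at h1
    exact h1 x y
  have hn : ∀ (g : C(spectrum ℝ R, ℝ)) x, ‖cfcHom hR g x‖ ^ 2 = ∫ t, g t ^ 2 ∂(μ x) := by
    intro g x
    have h1 := hμ x (g * g)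
    rw [map_mul, mul_apply_eq_comp, hs, inner_self_eq_norm_sq_to_K] at h1
    have h2 : ((((‖cfcHom hR g x‖ : ℝ) : ℂ)) ^ 2).re = ‖cfcHom hR g x‖ ^ 2 := by norm_cast
    rw [← h2]
    refine h1.symm.trans (integral_congr_ae (Eventually.of_forall fun t => ?_))
    simp [sq]
  have hind : Measurable (K.indicator (1 : spectrum ℝ R → ℝ)) :=
    measurable_one.indicator hK.measurableSet
  have hmeas : ∀ x, ∫ t, K.indicator 1 t ∂(μ x) = (μ x).real K := fun x =>
    integral_indicator_one hK.measurableSet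
  have hd0 : ∀ x, Tendsto (fun n => ∫ t, (f n t - K.indicator 1 t) ^ 2 ∂(μ x)) atTop (𝓝 0) := by
    intro x
    have := tendsto_integral_of_dominated_convergence (μ := μ x) (fun _ => (1 : ℝ))
      (F := fun n t => (f n t - K.indicator 1 t) ^ 2) (f := fun _ => 0)
      (fun n => (((f n).continuous.measurable.sub hind).pow_const 2).aestronglyMeasurable)
      (integrable_const _) (fun n => Eventually.of_forall fun t => ?_)
      (Eventually.of_forall fun t => ?_)
    · simpa using this
    · have h1 := hf0 n t
      have h2 := hf1 n t
      by_cases ht : t ∈ K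
      · simp only [ht, indicator_of_mem, Pi.one_apply, norm_pow, Real.norm_eq_abs, sq_abs]
        nlinarith
      · simp only [ht, not_false_eq_true, indicator_of_notMem, sub_zero, norm_pow,
          Real.norm_eq_abs, sq_abs]
        nlinarith
    · have h1 := ((hft t).sub_const (K.indicator 1 t)).pow 2
      simpa using h1
  refine HasProj.of_tendsto (Tn := fun n => cfcHom hR (f n)) (fun n => hs (f n)) (fun x => ?_)
    (fun x => ?_) (fun x => ?_)
  · rw [Metric.cauchySeq_iff]
    intro ε hε
    obtain ⟨N, hN⟩ := Metric.tendsto_atTop.1 (hd0 x) (ε ^ 2 / 4) (by positivity)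
    refine ⟨N, fun n hnN k hkN => ?_⟩
    have h1 := hN n hnN
    have h2 := hN k hkN
    rw [Real.dist_eq, sub_zero] at h1 h2
    have h1' := (le_abs_self _).trans_lt h1
    have h2' := (le_abs_self _).trans_lt h2
    rw [dist_eq_norm]
    refine lt_of_pow_lt_pow_left₀ 2 hε.le ?_
    have h3 : cfcHom hR (f n) x - cfcHom hR (f k) x = cfcHom hR (f n - f k) x := by
      rw [map_sub, _root_.sub_apply]
    rw [h3, hn]
    have hint : ∀ n, Integrable (fun t => (f n t - K.indicator 1 t) ^ 2) (μ x) := fun n => by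
      refine Integrable.of_bound
        (((f n).continuous.measurable.sub hind).pow_const 2).aestronglyMeasurable 1
        (Eventually.of_forall fun t => ?_)
      have h1 := hf0 n t
      have h2 := hf1 n t
      by_cases ht : t ∈ K
      · simp only [ht, indicator_of_mem, Pi.one_apply, norm_pow, Real.norm_eq_abs, sq_abs]
        nlinarith
      · simp only [ht, not_false_eq_true, indicator_of_notMem, sub_zero, norm_pow,
          Real.norm_eq_abs, sq_abs]
        nlinarith
    have h4 : ∫ t, (f n - f k) t ^ 2 ∂(μ x) ≤ ∫ t, (2 * (f n t - K.indicator 1 t) ^ 2 +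
        2 * (f k t - K.indicator 1 t) ^ 2) ∂(μ x) := by
      refine integral_mono_of_nonneg (Eventually.of_forall fun t => by positivity)
        (((hint n).const_mul 2).add ((hint k).const_mul 2)) (Eventually.of_forall fun t => ?_)
      simp only [ContinuousMap.sub_apply]
      nlinarith [sq_nonneg ((f n t - K.indicator 1 t) + (f k t - K.indicator 1 t))]
    rw [integral_add ((hint n).const_mul 2) ((hint k).const_mul 2), integral_const_mul,
      integral_const_mul] at h4
    nlinarith
  · rw [← hmeas]
    simp only [← hμ]
    refine tendsto_integral_of_dominated_convergence (fun _ => (1 : ℝ))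
      (fun n => (f n).continuous.aestronglyMeasurable)
      (integrable_const _) (fun n => Eventually.of_forall fun t => ?_)
      (Eventually.of_forall hft)
    rw [Real.norm_of_nonneg (hf0 n t)]
    exact hf1 n t
  · rw [← hmeas]
    simp only [hn]
    refine tendsto_integral_of_dominated_convergence (fun _ => (1 : ℝ))
      (fun n => ((f n).continuous.pow 2).aestronglyMeasurable)
      (integrable_const _) (fun n => Eventually.of_forall fun t => ?_)
      (Eventually.of_forall fun t => ?_)
    · rw [norm_pow, Real.norm_of_nonneg (hf0 n t)]
      exact pow_le_one₀ (hf0 n t) (hf1 n t)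
    · convert (hft t).pow 2 using 2
      by_cases ht : t ∈ K <;> simp [ht]

/-- The resolution of the identity of a bounded self-adjoint operator, transported by a Borel
function. -/
theorem exists_projMeasure_of_isSelfAdjoint {R : H →L[ℂ] H} (hR : IsSelfAdjoint R)
    {κ : ℝ → ℝ} (hκ : Measurable κ) {G : ℝ → ℂ} (hG : BddMeas G)
    (hGκ : ∀ t ∈ spectrum ℝ R, G (κ t) = t) : ∃ E : ProjMeasure H, E.fcalc G = R := by
  choose μ hfin hμ using exists_scalar_spectral_measure hR
  have hμ1 : ∀ x, (μ x).real univ = ‖x‖ ^ 2 := fun x => by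
    have h1 := hμ x 1
    rw [map_one, one_apply_eq_self, inner_self_eq_norm_sq_to_K] at h1
    have h2 : ((((‖x‖ : ℝ) : ℂ)) ^ 2).re = ‖x‖ ^ 2 := by norm_cast
    rw [← h2]
    refine Eq.trans ?_ h1
    simp
  have hall : ∀ S, MeasurableSet S → ∃ P, HasProj μ S P := by
    intro S hS
    -- Closed sets form a π-system generating the Borel sets; complements and disjoint unions are
    -- supplied by `HasProj.compl` and `HasProj.iUnion`.
    refine MeasurableSpace.induction_on_inter (C := fun S _ => ∃ P, HasProj μ S P)
      (BorelSpace.measurable_eq.trans borel_eq_generateFrom_isClosed) isPiSystem_isClosed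
      ⟨0, by simp, by simp, by simp⟩ (fun S hS => exists_hasProj_of_isClosed hR hμ hS)
      (fun S hS h => ?_) (fun S hd hS h => HasProj.iUnion hμ1 hd hS h) S hS
    obtain ⟨P, hP⟩ := h
    exact ⟨_, hP.compl hμ1 hS⟩
  obtain ⟨E, hE⟩ := HasProj.exists_projMeasure hμ1 hall (hκ.comp measurable_subtype_coe)
  refine ⟨E, clm_ext_of_inner fun x => ?_⟩
  have h1 : inner ℂ x (E.fcalc G x) = (inner ℂ (R x) x).re := by
    rw [E.inner_fcalc hG, E.form_self, hE, integral_map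
      (hκ.comp measurable_subtype_coe).aemeasurable hG.1.aestronglyMeasurable]
    have h2 := hμ x (ContinuousMap.restrict (spectrum ℝ R) (ContinuousMap.id ℝ))
    rw [cfcHom_id hR] at h2
    rw [← h2, ← integral_complex_ofReal]
    exact integral_congr_ae (Eventually.of_forall fun t => hGκ t t.2)
  have h3 : (inner ℂ (R x) x).im = 0 := by
    have h4 := inner_conj_symm (𝕜 := ℂ) (R x) x
    rw [ContinuousLinearMap.isSelfAdjoint_iff_isSymmetric] at hR
    rw [← show inner ℂ (R x) x = inner ℂ x (R x) from hR x x] at h4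
    exact Complex.conj_eq_iff_im.1 h4
  rw [← inner_conj_symm, h1, Complex.conj_ofReal]
  exact Complex.ext (Complex.ofReal_re _) (by rw [Complex.ofReal_im, h3])

/-- The spectral theorem for an operator `T` such that `(1 + T)⁻¹` is a bounded self-adjoint
operator. -/
theorem exists_isSpectralMeasure {T : H →ₗ.[ℂ] H} {R : H →L[ℂ] H} (hR : IsSelfAdjoint R)
    (hinj : ∀ x, R x = 0 → x = 0) (hT : ∀ v r, (v, r) ∈ T.graph ↔ v = R (v + r)) :
    ∃ E : ProjMeasure H, IsSpectralMeasure T E := by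
  obtain ⟨C, hC⟩ := (spectrum.isCompact (𝕜 := ℝ) R).exists_bound_of_continuousOn
    continuous_id.continuousOn
  -- `(1 + t)⁻¹` is cut off where it exceeds the bound `C` of the spectrum of `R`, so that the
  -- symbol of `R` is bounded on the whole line.
  let D : Set ℝ := {t | |(1 + t)⁻¹| ≤ C}
  have hm1 : Measurable fun t : ℝ => (1 + t)⁻¹ := (measurable_const.add measurable_id).inv
  have hD : MeasurableSet D := measurableSet_le hm1.norm measurable_const
  let G : ℝ → ℂ := D.indicator fun t => (((1 + t)⁻¹ : ℝ) : ℂ)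
  have hG : BddMeas G := by
    refine ⟨(Complex.measurable_ofReal.comp hm1).indicator hD, max C 0, fun t => ?_⟩
    by_cases ht : t ∈ D
    · simp only [G, indicator_of_mem ht, Complex.norm_real]
      exact le_max_of_le_left ht
    · simp [G, ht]
  -- The map `t ↦ t⁻¹ - 1` inverts the symbol. The convention `0⁻¹ = 0` sends the spectral value `0`
  -- of `R` to `-1`, where the symbol is again `0`.
  obtain ⟨E, hE⟩ := exists_projMeasure_of_isSelfAdjoint hR (κ := fun t => t⁻¹ - 1)
    (measurable_inv.sub_const 1) hG (fun t ht => by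
      have e : (1 + (t⁻¹ - 1))⁻¹ = t := by rw [add_sub_cancel, inv_inv]
      have hm : t⁻¹ - 1 ∈ D := by
        change |(1 + (t⁻¹ - 1))⁻¹| ≤ C
        rw [e]; exact hC t ht
      simp only [G, indicator_of_mem hm, e])
  have hRx : ∀ x, R x = E.fcalc G x := fun x => by rw [hE]
  -- Removing `-1` leaves the set where `t (1 + t)⁻¹ = 1 - (1 + t)⁻¹` holds; injectivity of `R`
  -- shows that its complement carries no spectral mass.
  let D' : Set ℝ := D \ {-1}
  have hD' : MeasurableSet D' := hD.diff (measurableSet_singleton _)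
  have hGD : G * D'ᶜ.indicator 1 = 0 := by
    ext t
    by_cases ht : t ∈ D
    · by_cases h1 : t = -1
      · subst h1; simp [G]
      · have : t ∈ D' := ⟨ht, h1⟩
        simp [this]
    · simp [G, ht]
  have hE0 : ∀ x, E.fcalc (D'ᶜ.indicator 1) x = 0 := fun x => by
    refine hinj _ ?_
    rw [hRx, E.fcalc_fcalc hG (BddMeas.indicator_one hD'.compl), hGD]
    have h0 := E.fcalc_smul 0 (BddMeas.const 1)
    rw [zero_smul, zero_smul] at h0
    rw [h0]
    rfl
  have hE1 : ∀ x, E.fcalc (D'.indicator 1) x = x := fun x => by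
    have e : (1 : ℝ → ℂ) = D'.indicator 1 + D'ᶜ.indicator 1 := (indicator_self_add_compl _ _).symm
    have h1 := congrArg (fun A : H →L[ℂ] H => A x) E.fcalc_one
    simp only [one_apply_eq_self] at h1
    rw [e, E.fcalc_add (BddMeas.indicator_one hD') (BddMeas.indicator_one hD'.compl),
      _root_.add_apply, hE0, add_zero] at h1
    exact h1
  have hlG : (fun t : ℝ => (t : ℂ)) * G = D'.indicator 1 - G := by
    ext t
    by_cases ht : t ∈ D
    · by_cases h1 : t = -1
      · subst h1; simp [G, D']
      · have h2 : t ∈ D' := ⟨ht, h1⟩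
        have h3 : (1 + (t : ℂ)) ≠ 0 := by
          intro h4
          apply h1
          have : ((1 + t : ℝ) : ℂ) = 0 := by push_cast; exact h4
          have := Complex.ofReal_eq_zero.1 this
          linarith
        simp only [Pi.mul_apply, Pi.sub_apply, G, indicator_of_mem ht, indicator_of_mem h2,
          Pi.one_apply]
        push_cast
        field_simp
        ring
    · have h2 : t ∉ D' := fun h => ht h.1
      simp [G, ht, h2]
  have hlGb : BddMeas ((fun t : ℝ => (t : ℂ)) * G) := by
    rw [hlG]; exact (BddMeas.indicator_one hD').sub hG
  have hlGx : ∀ x, E.fcalc ((fun t : ℝ => (t : ℂ)) * G) x = x - R x := fun x => by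
    rw [hlG, E.fcalc_sub (BddMeas.indicator_one hD') hG, _root_.sub_apply, hE1, hRx]
  have hint : ∀ h, E.IsIntegral (fun t => (t : ℂ)) (R h) (h - R h) := fun h => by
    rw [← hlGx, hRx]
    exact E.isIntegral_fcalc Complex.measurable_ofReal hG hlGb h
  refine ⟨E, fun x y => ?_⟩
  rw [hT]
  constructor
  · intro h
    have h1 := hint (x + y)
    rw [← h] at h1
    simpa using h1
  · rintro ⟨hx, hy⟩
    refine ext_inner_left ℂ fun w => ?_
    have hs : ∀ u, inner ℂ w (R u) = inner ℂ (R w) u := fun u => by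
      have h2 := hR
      rw [ContinuousLinearMap.isSelfAdjoint_iff_isSymmetric] at h2
      exact (h2 w u).symm
    -- To recover `x = R (x + y)`, test against the vectors `R w`, which lie in the domain, and move
    -- `R` across the inner product.
    have h1 := (hint w).2 x hx
    have h2 := E.form_conj (fun t => (t : ℂ)) (R w) x
    have h3 : star (fun t : ℝ => (t : ℂ)) = fun t : ℝ => (t : ℂ) := by
      ext t; simp
    rw [h3, ← h1, ← hy _ (hint w).1, inner_sub_right] at h2
    rw [hs, inner_add_right, h2, star_sub]
    have h4 : ∀ u v : H, star (inner ℂ u v) = inner ℂ v u := fun u v => inner_conj_symm _ _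
    rw [h4, h4]
    ring

end SpectralTheorem

/-! ### Uniqueness in the Nevanlinna–Herglotz representation -/

/-- The Poisson kernel of the upper half-plane, up to a factor `π`. -/
def poisson (x y t : ℝ) : ℝ := y / ((t - x) ^ 2 + y ^ 2)

theorem poisson_nonneg {y : ℝ} (hy : 0 < y) (x t : ℝ) : 0 ≤ poisson x y t := by
  unfold poisson; positivity

theorem continuous_poisson {y : ℝ} (hy : 0 < y) :
    Continuous fun p : ℝ × ℝ => poisson p.1 y p.2 := by
  unfold poisson
  refine Continuous.div continuous_const (by fun_prop) fun p => by positivity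

/-- The substitution `x = t + y s` turns the Poisson kernel into the Cauchy density, which no longer
depends on `y`. -/
theorem integral_comp_poisson (f : ℝ → ℝ) {y : ℝ} (hy : 0 < y) (t : ℝ) :
    ∫ x, f x * poisson x y t = ∫ s, f (t + y * s) * (1 + s ^ 2)⁻¹ := by
  have h1 : ∫ x, f x * poisson x y t = ∫ x, f (t + x) * poisson (t + x) y t :=
    (integral_add_left_eq_self (fun x => f x * poisson x y t) t).symm
  have h2 := Measure.integral_comp_mul_left (fun x => f (t + x) * poisson (t + x) y t) y
  rw [abs_inv, abs_of_pos hy, smul_eq_mul] at h2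
  rw [h1, ← mul_inv_cancel_left₀ hy.ne' (∫ x, f (t + x) * poisson (t + x) y t), ← h2,
    ← integral_const_mul]
  refine integral_congr_ae (Eventually.of_forall fun s => ?_)
  simp only [poisson]
  field_simp
  ring_nf

theorem integrable_poisson {y : ℝ} (hy : 0 < y) (t : ℝ) :
    Integrable (fun x => poisson x y t) ∧ ∫ x, poisson x y t = Real.pi := by
  have h := integral_comp_poisson (fun _ => 1) hy t
  simp only [one_mul, integral_univ_inv_one_add_sq] at h
  refine ⟨?_, h⟩
  -- Integrability comes for free: a non-integrable function would have integral `0`, not `π`.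
  by_contra hc
  rw [integral_undef hc] at h
  exact Real.pi_pos.ne h

/-- Growth in `t` is paid for by `(t - x)² poisson ≤ y ≤ 1`, uniformly for `x` in a bounded set. -/
theorem poisson_mul_le {y : ℝ} (hy : 0 < y) (hy1 : y ≤ 1) {r x : ℝ} (hx : |x| ≤ r) (t : ℝ) :
    (1 + t ^ 2) * poisson x y t ≤ 2 * (1 + r ^ 2) * (1 + poisson x y t) := by
  have hx2 : x ^ 2 ≤ r ^ 2 := sq_le_sq' (abs_le.1 hx).1 (abs_le.1 hx).2
  have h1 : 1 + t ^ 2 ≤ 2 * (1 + r ^ 2) * (1 + (t - x) ^ 2) := by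
    nlinarith [sq_nonneg (t - 2 * x), sq_nonneg (r * (t - x)), sq_nonneg (t - x)]
  have h2 : (1 + (t - x) ^ 2) * poisson x y t ≤ 1 + poisson x y t := by
    have : (t - x) ^ 2 * poisson x y t ≤ 1 := by
      unfold poisson
      rw [mul_div_assoc', div_le_one (by positivity)]
      nlinarith [sq_nonneg (t - x)]
    linarith
  calc (1 + t ^ 2) * poisson x y t ≤ 2 * (1 + r ^ 2) * (1 + (t - x) ^ 2) * poisson x y t :=
        mul_le_mul_of_nonneg_right h1 (poisson_nonneg hy x t)
    _ = 2 * (1 + r ^ 2) * ((1 + (t - x) ^ 2) * poisson x y t) := by ring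
    _ ≤ _ := mul_le_mul_of_nonneg_left h2 (by positivity)

/-! ### Stieltjes inversion against compactly supported test functions. -/

section Stieltjes

variable {f : ℝ → ℝ} (hf : Continuous f) (hfc : HasCompactSupport f)

include hf hfc

/-- A majorant that does not depend on `y ≤ 1`; it serves both Fubini and dominated convergence for
measures that integrate `(1 + t²)⁻¹`. -/
theorem exists_poisson_bound : ∃ C : ℝ, ∀ y : ℝ, 0 < y → y ≤ 1 → ∀ t,
    ∫ x, |f x| * poisson x y t ≤ C * (1 + t ^ 2)⁻¹ := by
  obtain ⟨D, hD⟩ := hfc.exists_bound_of_continuous hf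
  obtain ⟨r, hr⟩ := hfc.isBounded.subset_closedBall 0
  have hfi : Integrable fun x => |f x| := (hf.integrable_of_hasCompactSupport hfc).norm
  have hD0 : 0 ≤ D := (norm_nonneg _).trans (hD 0)
  refine ⟨2 * (1 + r ^ 2) * ((∫ x, |f x|) + D * Real.pi), fun y hy hy1 t => ?_⟩
  have hpos : 0 < 1 + t ^ 2 := by positivity
  rw [← div_eq_mul_inv, le_div_iff₀ hpos, mul_comm, ← integral_const_mul]
  have hb : ∀ x, (1 + t ^ 2) * (|f x| * poisson x y t) ≤
      2 * (1 + r ^ 2) * (|f x| + D * poisson x y t) := by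
    intro x
    by_cases hx : f x = 0
    · have := poisson_nonneg hy x t
      rw [hx, abs_zero, zero_mul, mul_zero, zero_add]
      positivity
    · have hx' : |x| ≤ r := by
        have := hr (subset_tsupport f hx)
        simpa [Real.norm_eq_abs] using this
      have h1 := mul_le_mul_of_nonneg_left (poisson_mul_le hy hy1 hx' t) (abs_nonneg (f x))
      have h2 : |f x| * poisson x y t ≤ D * poisson x y t :=
        mul_le_mul_of_nonneg_right (hD x) (poisson_nonneg hy x t)
      have h3 : 0 ≤ 2 * (1 + r ^ 2) := by positivity
      nlinarith
  have hpi := integrable_poisson hy t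
  refine (integral_mono_of_nonneg (Eventually.of_forall fun x => ?_)
    ((hfi.add (hpi.1.const_mul D)).const_mul _) (Eventually.of_forall hb)).trans ?_
  · have := poisson_nonneg hy x t
    simp only [Pi.zero_apply]
    positivity
  · rw [integral_const_mul]
    simp only [Pi.add_apply]
    rw [integral_add hfi (hpi.1.const_mul D), integral_const_mul, hpi.2]

theorem integrable_mul_poisson {y : ℝ} (hy : 0 < y) (t : ℝ) :
    Integrable fun x => f x * poisson x y t := by
  obtain ⟨D, hD⟩ := hfc.exists_bound_of_continuous hf
  exact (integrable_poisson hy t).1.bdd_mul hf.aestronglyMeasurable (Eventually.of_forall hD)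

/-- Fubini moves the Poisson kernel onto `f`. The smoothed function is an average of `f (t + y s)`
against the Cauchy density of total mass `π`, and converges to `π f(t)` as `y → 0`. -/
theorem tendsto_integral_poisson {μ : Measure ℝ} [IsLocallyFiniteMeasure μ]
    (hμ : Integrable (fun t : ℝ => (1 + t ^ 2)⁻¹) μ) :
    Tendsto (fun n : ℕ => ∫ x, f x * ∫ t, poisson x (1 / (n + 1)) t ∂μ) atTop
      (𝓝 (Real.pi * ∫ t, f t ∂μ)) := by
  obtain ⟨C, hC⟩ := exists_poisson_bound hf hfc
  obtain ⟨D, hD⟩ := hfc.exists_bound_of_continuous hf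
  have hy0 : ∀ n : ℕ, (0 : ℝ) < 1 / (n + 1) := fun n => by positivity
  have hy1 : ∀ n : ℕ, (1 : ℝ) / (n + 1) ≤ 1 := fun n => by
    rw [div_le_one (by positivity)]; linarith [n.cast_nonneg (α := ℝ)]
  have hswap : ∀ n : ℕ, ∫ x, f x * ∫ t, poisson x (1 / (n + 1)) t ∂μ =
      ∫ t, (∫ x, f x * poisson x (1 / (n + 1)) t) ∂μ := by
    intro n
    simp only [← integral_const_mul]
    symm
    refine integral_integral_swap (f := fun t x => f x * poisson x (1 / (n + 1)) t) ?_
    have hc : Continuous (Function.uncurry fun t x => f x * poisson x (1 / (n + 1)) t) :=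
      (hf.comp continuous_snd).mul ((continuous_poisson (hy0 n)).comp continuous_swap)
    rw [integrable_prod_iff hc.aestronglyMeasurable]
    refine ⟨Eventually.of_forall fun t => integrable_mul_poisson hf hfc (hy0 n) t, ?_⟩
    refine Integrable.mono' (hμ.const_mul C)
      (hc.norm.aestronglyMeasurable.integral_prod_right' ) (Eventually.of_forall fun t => ?_)
    rw [Real.norm_of_nonneg (integral_nonneg fun x => norm_nonneg _)]
    refine le_trans (le_of_eq ?_) (hC _ (hy0 n) (hy1 n) t)
    refine integral_congr_ae (Eventually.of_forall fun x => ?_)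
    simp only [Function.uncurry_apply_pair, norm_mul, Real.norm_eq_abs,
      abs_of_nonneg (poisson_nonneg (hy0 n) x t)]
  simp only [hswap]
  rw [← integral_const_mul]
  refine tendsto_integral_of_dominated_convergence (fun t => C * (1 + t ^ 2)⁻¹) (fun n => ?_)
    (hμ.const_mul C) (fun n => Eventually.of_forall fun t => ?_) (Eventually.of_forall fun t => ?_)
  · have hc : Continuous (Function.uncurry fun t x => f x * poisson x (1 / (n + 1)) t) :=
      (hf.comp continuous_snd).mul ((continuous_poisson (hy0 n)).comp continuous_swap)
    exact hc.aestronglyMeasurable.integral_prod_right'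
  · refine (norm_integral_le_integral_norm _).trans ?_
    refine le_trans (le_of_eq ?_) (hC _ (hy0 n) (hy1 n) t)
    refine integral_congr_ae (Eventually.of_forall fun x => ?_)
    simp only [norm_mul, Real.norm_eq_abs, abs_of_nonneg (poisson_nonneg (hy0 n) x t)]
  · simp only [integral_comp_poisson f (hy0 _) t]
    have e : Real.pi * f t = ∫ s : ℝ, f t * (1 + s ^ 2)⁻¹ := by
      rw [integral_const_mul, integral_univ_inv_one_add_sq, mul_comm]
    rw [e]
    refine tendsto_integral_of_dominated_convergence (fun s : ℝ => D * (1 + s ^ 2)⁻¹)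
      (fun n => ?_) (integrable_inv_one_add_sq.const_mul D)
      (fun n => Eventually.of_forall fun s => ?_) (Eventually.of_forall fun s => ?_)
    · refine Continuous.aestronglyMeasurable ?_
      refine (hf.comp (by fun_prop)).mul (Continuous.inv₀ (by fun_prop) fun s => by positivity)
    · rw [norm_mul, norm_inv, Real.norm_of_nonneg (by positivity : (0 : ℝ) ≤ 1 + s ^ 2)]
      exact mul_le_mul_of_nonneg_right (hD _) (by positivity)
    · refine Tendsto.mul_const _ ?_
      have h0 : Tendsto (fun n : ℕ => t + 1 / ((n : ℝ) + 1) * s) atTop (𝓝 (t + 0 * s)) :=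
        (tendsto_one_div_add_atTop_nhds_zero_nat.mul_const s).const_add t
      rw [zero_mul, add_zero] at h0
      exact (hf.tendsto t).comp h0

end Stieltjes

theorem measure_eq_of_integral_poisson {μ ν : Measure ℝ} [IsLocallyFiniteMeasure μ]
    [IsLocallyFiniteMeasure ν] (hμ : Integrable (fun t : ℝ => (1 + t ^ 2)⁻¹) μ)
    (hν : Integrable (fun t : ℝ => (1 + t ^ 2)⁻¹) ν)
    (h : ∀ x y, 0 < y → ∫ t, poisson x y t ∂μ = ∫ t, poisson x y t ∂ν) : μ = ν := by
  refine Measure.ext_of_integral_eq_on_compactlySupported fun f => ?_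
  have h1 := tendsto_integral_poisson f.continuous f.hasCompactSupport hμ
  have h2 := tendsto_integral_poisson f.continuous f.hasCompactSupport hν
  have h3 : ∀ (x : ℝ) (n : ℕ), ∫ t, poisson x (1 / (n + 1)) t ∂μ =
      ∫ t, poisson x (1 / (n + 1)) t ∂ν := fun x n => h x _ (by positivity)
  simp only [h3] at h1
  exact mul_left_cancel₀ Real.pi_pos.ne' (tendsto_nhds_unique h1 h2)

/-- The kernel of the Nevanlinna–Herglotz representation. -/
def herglotzKernel (z : ℂ) (t : ℝ) : ℂ := ((t : ℂ) - z)⁻¹ - (t : ℂ) * (1 + (t : ℂ) ^ 2)⁻¹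

theorem ofReal_sub_ne_zero {z : ℂ} (hz : z.im ≠ 0) (t : ℝ) : (t : ℂ) - z ≠ 0 := by
  intro h
  apply hz
  have := congrArg Complex.im h
  simpa using this

theorem one_add_sq_ne_zero (t : ℝ) : (1 + (t : ℂ) ^ 2) ≠ 0 := by
  have : (1 + t ^ 2 : ℝ) ≠ 0 := by positivity
  exact_mod_cast this

/-- This form displays the decay `(1 + t²)⁻¹` times a bounded factor. -/
theorem herglotzKernel_eq {z : ℂ} (hz : z.im ≠ 0) (t : ℝ) :
    herglotzKernel z t = (z + (1 + z ^ 2) * ((t : ℂ) - z)⁻¹) * (((1 + t ^ 2)⁻¹ : ℝ) : ℂ) := by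
  have h1 := ofReal_sub_ne_zero hz t
  have h2 := one_add_sq_ne_zero t
  unfold herglotzKernel
  push_cast
  field_simp
  ring

theorem norm_inv_sub_le {z : ℂ} (hz : z.im ≠ 0) (t : ℝ) : ‖((t : ℂ) - z)⁻¹‖ ≤ |z.im|⁻¹ := by
  rw [norm_inv]
  refine inv_anti₀ (abs_pos.2 hz) ?_
  have := Complex.abs_im_le_norm ((t : ℂ) - z)
  simpa using this

theorem measurable_inv_sub (z : ℂ) : Measurable fun t : ℝ => ((t : ℂ) - z)⁻¹ :=
  (Complex.measurable_ofReal.sub_const z).inv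

theorem measurable_herglotzKernel (z : ℂ) : Measurable (herglotzKernel z) :=
  (measurable_inv_sub z).sub (Complex.measurable_ofReal.mul
    ((Complex.measurable_ofReal.pow_const 2).const_add 1).inv)

theorem norm_herglotzKernel_le {z : ℂ} (hz : z.im ≠ 0) (t : ℝ) :
    ‖herglotzKernel z t‖ ≤ (‖z‖ + ‖1 + z ^ 2‖ * |z.im|⁻¹) * (1 + t ^ 2)⁻¹ := by
  rw [herglotzKernel_eq hz, norm_mul, Complex.norm_real,
    Real.norm_of_nonneg (by positivity : (0 : ℝ) ≤ (1 + t ^ 2)⁻¹)]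
  refine mul_le_mul_of_nonneg_right ?_ (by positivity)
  refine (norm_add_le _ _).trans (add_le_add_right ?_ _)
  rw [norm_mul]
  exact mul_le_mul_of_nonneg_left (norm_inv_sub_le hz t) (norm_nonneg _)

theorem integrable_herglotzKernel {μ : Measure ℝ}
    (hμ : Integrable (fun t : ℝ => (1 + t ^ 2)⁻¹) μ) {z : ℂ} (hz : z.im ≠ 0) :
    Integrable (herglotzKernel z) μ :=
  Integrable.mono' (hμ.const_mul _) (measurable_herglotzKernel z).aestronglyMeasurable
    (Eventually.of_forall (norm_herglotzKernel_le hz))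

theorem herglotzKernel_im (x y t : ℝ) :
    (herglotzKernel ⟨x, y⟩ t).im = poisson x y t := by
  have h1 : ((t : ℂ) * (1 + (t : ℂ) ^ 2)⁻¹).im = 0 := by
    have : (t : ℂ) * (1 + (t : ℂ) ^ 2)⁻¹ = ((t * (1 + t ^ 2)⁻¹ : ℝ) : ℂ) := by push_cast; rfl
    rw [this, Complex.ofReal_im]
  unfold herglotzKernel poisson
  rw [Complex.sub_im, h1, Complex.inv_im, Complex.normSq_apply]
  simp
  ring_nf

/-- The imaginary part of the kernel at `x + i y` is the Poisson kernel, and taking imaginary parts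
removes the real constants. -/
theorem measure_eq_of_herglotz {μ ν : Measure ℝ} [IsLocallyFiniteMeasure μ]
    [IsLocallyFiniteMeasure ν] (hμ : Integrable (fun t : ℝ => (1 + t ^ 2)⁻¹) μ)
    (hν : Integrable (fun t : ℝ => (1 + t ^ 2)⁻¹) ν) (c d : ℝ)
    (h : ∀ z : ℂ, z.im ≠ 0 → c + ∫ t, herglotzKernel z t ∂μ = d + ∫ t, herglotzKernel z t ∂ν) :
    μ = ν := by
  refine measure_eq_of_integral_poisson hμ hν fun x y hy => ?_
  have hz : (⟨x, y⟩ : ℂ).im ≠ 0 := hy.ne'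
  have h1 := congrArg Complex.im (h ⟨x, y⟩ hz)
  rw [Complex.add_im, Complex.add_im, Complex.ofReal_im, Complex.ofReal_im, zero_add, zero_add] at h1
  have h2 : ∀ ρ : Measure ℝ, Integrable (fun t : ℝ => (1 + t ^ 2)⁻¹) ρ →
      (∫ t, herglotzKernel ⟨x, y⟩ t ∂ρ).im = ∫ t, poisson x y t ∂ρ := fun ρ hρ => by
    rw [← RCLike.im_eq_complex_im, ← integral_im (integrable_herglotzKernel hρ hz)]
    exact integral_congr_ae (Eventually.of_forall fun t => herglotzKernel_im x y t)
  rwa [h2 μ hμ, h2 ν hν] at h1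

/-! ### Sesquilinear forms of matrices -/

section MatrixForm

variable {n : Type*} [Fintype n]

/-- The sesquilinear form `(u, D v)`. -/
def mform (D : Matrix n n ℂ) (u v : n → ℂ) : ℂ := star u ⬝ᵥ D.mulVec v

theorem mform_add_left (D : Matrix n n ℂ) (u u' v : n → ℂ) :
    mform D (u + u') v = mform D u v + mform D u' v := by
  simp [mform, add_dotProduct]

theorem mform_add_right (D : Matrix n n ℂ) (u v v' : n → ℂ) :
    mform D u (v + v') = mform D u v + mform D u v' := by
  simp [mform, Matrix.mulVec_add, dotProduct_add]

theorem mform_smul_left (D : Matrix n n ℂ) (c : ℂ) (u v : n → ℂ) :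
    mform D (c • u) v = star c * mform D u v := by
  simp [mform, smul_dotProduct]

theorem mform_smul_right (D : Matrix n n ℂ) (c : ℂ) (u v : n → ℂ) :
    mform D u (c • v) = c * mform D u v := by
  simp [mform, Matrix.mulVec_smul, dotProduct_smul]

theorem mform_eq_sum (D : Matrix n n ℂ) (u v : n → ℂ) :
    mform D u v = ∑ a, ∑ b, star (u a) * v b * D a b := by
  simp only [mform, dotProduct, Matrix.mulVec, Finset.mul_sum, Pi.star_apply]
  exact Finset.sum_congr rfl fun a _ => Finset.sum_congr rfl fun b _ => by ring

theorem mform_polarization (D : Matrix n n ℂ) (u v : n → ℂ) :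
    mform D u v = (1 / 4) * ∑ k ∈ Finset.range 4,
      Complex.I ^ k * mform D (v + Complex.I ^ k • u) (v + Complex.I ^ k • u) := by
  simp only [Finset.sum_range_succ, Finset.sum_range_zero, mform_add_left, mform_add_right,
    mform_smul_left, mform_smul_right, Complex.star_def, map_pow, Complex.conj_I]
  have h3 : Complex.I ^ 3 = -Complex.I := Complex.I_pow_three
  have h3' : (-Complex.I) ^ 3 = Complex.I := by rw [neg_pow, h3]; ring
  have h2' : (-Complex.I) ^ 2 = -1 := by rw [neg_pow, Complex.I_sq]; ring
  simp only [h3, h3', h2', Complex.I_sq, pow_zero, pow_one]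
  linear_combination (-(1 / 2) * mform D v u + (1 / 2) * mform D u v) * Complex.I_sq

theorem mform_single [DecidableEq n] (D : Matrix n n ℂ) (a b : n) :
    mform D (Pi.single a 1) (Pi.single b 1) = D a b := by
  have : star (Pi.single a 1 : n → ℂ) = Pi.single a 1 := by
    ext c; by_cases h : c = a
    · subst h; simp
    · simp [h]
  simp [mform, this]

theorem matrix_ext_of_mform {D D' : Matrix n n ℂ} (h : ∀ u, mform D u u = mform D' u u) :
    D = D' := by
  classical
  ext a b
  rw [← mform_single D, ← mform_single D', mform_polarization, mform_polarization D']
  simp only [h]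

theorem mform_add_matrix (D D' : Matrix n n ℂ) (u v : n → ℂ) :
    mform (D + D') u v = mform D u v + mform D' u v := by
  simp [mform, Matrix.add_mulVec, dotProduct_add]

theorem mform_conjTranspose (D : Matrix n n ℂ) (u v : n → ℂ) :
    mform D.conjTranspose u v = star (mform D v u) := by
  simp only [mform_eq_sum, star_sum, star_mul', star_star, Matrix.conjTranspose_apply]
  rw [Finset.sum_comm]
  exact Finset.sum_congr rfl fun a _ => Finset.sum_congr rfl fun b _ => by ring

/-- Diagonal entries are at most the trace. In the polarization formula the parallelogram inequality
bounds each of the four terms by `4`; the crude constant suffices, since only boundedness of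
densities is used. -/
theorem norm_entry_le_of_posSemidef {D : Matrix n n ℂ} (hD : D.PosSemidef) (htr : D.trace = 1)
    (a b : n) : ‖D a b‖ ≤ 4 := by
  classical
  have hpos : ∀ u, 0 ≤ mform D u u := fun u => hD.dotProduct_mulVec_nonneg u
  have hre : ∀ u, 0 ≤ (mform D u u).re := fun u => (Complex.nonneg_iff.1 (hpos u)).1
  have hn : ∀ u, ‖mform D u u‖ = (mform D u u).re := fun u => by
    rw [← Complex.re_eq_norm.2 (hpos u)]
  have hdiag : ∀ c, (mform D (Pi.single c 1) (Pi.single c 1)).re ≤ 1 := fun c => by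
    have h1 : ∑ c, (D c c).re = 1 := by
      have := congrArg Complex.re htr
      simpa [Matrix.trace] using this
    rw [mform_single, ← h1]
    refine Finset.single_le_sum (f := fun c => (D c c).re) (fun c _ => ?_) (Finset.mem_univ c)
    have := hre (Pi.single c 1)
    rwa [mform_single] at this
  have hpar : ∀ u v, (mform D (u + v) (u + v)).re ≤
      2 * ((mform D u u).re + (mform D v v).re) := fun u v => by
    have h1 := hre (u + (-1 : ℂ) • v)
    have h2 : mform D (u + v) (u + v) + mform D (u + (-1 : ℂ) • v) (u + (-1 : ℂ) • v) =
        2 * (mform D u u + mform D v v) := by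
      simp only [mform_add_left, mform_add_right, mform_smul_left, mform_smul_right, star_neg,
        star_one]
      ring
    have h3 := congrArg Complex.re h2
    simp only [Complex.add_re, Complex.mul_re, Complex.re_ofNat, Complex.im_ofNat, zero_mul,
      sub_zero] at h3
    linarith
  have hun : ∀ (k : ℕ) u, mform D (Complex.I ^ k • u) (Complex.I ^ k • u) = mform D u u := by
    intro k u
    rw [mform_smul_left, mform_smul_right, ← mul_assoc, Complex.star_def, ← Complex.normSq_eq_conj_mul_self]
    simp
  rw [← mform_single D a b, mform_polarization, norm_mul]
  have h4 : ‖(1 / 4 : ℂ)‖ = 1 / 4 := by norm_num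
  have h5 := norm_sum_le_of_le (Finset.range 4) (f := fun k => Complex.I ^ k *
    mform D (Pi.single b 1 + Complex.I ^ k • Pi.single a 1)
      (Pi.single b 1 + Complex.I ^ k • Pi.single a 1)) (n := fun _ => (4 : ℝ)) (fun k _ => by
      rw [norm_mul, norm_pow, Complex.norm_I, one_pow, one_mul, hn]
      refine (hpar _ _).trans ?_
      rw [hun]
      linarith [hdiag a, hdiag b])
  rw [h4]
  simp only [Finset.sum_const, Finset.card_range, nsmul_eq_mul] at h5
  push_cast at h5
  linarith

end MatrixForm

/-! ### Matrix measures generated by a resolution of the identity -/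

section Represents

variable {n : Type*} [Fintype n] {H : Type*} [NormedAddCommGroup H] [InnerProductSpace ℂ H]
  [CompleteSpace H]

theorem measurable_mform {D : ℝ → Matrix n n ℂ} (hD : ∀ a b, Measurable fun t => D t a b)
    {u v : ℝ → n → ℂ} (hu : ∀ a, Measurable fun t => u t a) (hv : ∀ a, Measurable fun t => v t a) :
    Measurable fun t => mform (D t) (u t) (v t) := by
  simp only [mform_eq_sum]
  exact Finset.measurable_sum _ fun a _ => Finset.measurable_sum _ fun b _ =>
    ((Complex.continuous_conj.measurable.comp (hu a)).mul (hv b)).mul (hD a b)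

/-- `(C, dΩ C) = (1 + λ²) d(ψ C, E ψ C)` for all vectors `C`. -/
def Represents (Ω : MatrixMeasure n) (E : ProjMeasure H) (ψ : (n → ℂ) →ₗ[ℂ] H) : Prop :=
  ∀ C : n → ℂ, Ω.base.withDensity (fun t => ENNReal.ofReal (mform (Ω.density t) C C).re) =
    (E.diag (ψ C)).withDensity fun t => ENNReal.ofReal (1 + t ^ 2)

theorem measurable_one_add_sq : Measurable fun t : ℝ => ENNReal.ofReal (1 + t ^ 2) := by
  fun_prop

theorem integrable_inv_withDensity {μ : Measure ℝ} [IsFiniteMeasure μ] :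
    Integrable (fun t : ℝ => (1 + t ^ 2)⁻¹) (μ.withDensity fun t => ENNReal.ofReal (1 + t ^ 2)) := by
  rw [integrable_withDensity_iff_integrable_smul' measurable_one_add_sq (by simp)]
  refine (integrable_const (1 : ℝ)).congr (Eventually.of_forall fun t => ?_)
  have : (0 : ℝ) < 1 + t ^ 2 := by positivity
  simp only
  rw [ENNReal.toReal_ofReal this.le, smul_eq_mul, mul_inv_cancel₀ this.ne']

instance locallyFinite_withDensity_one_add_sq {μ : Measure ℝ} [IsFiniteMeasure μ] :
    IsLocallyFiniteMeasure (μ.withDensity fun t : ℝ => ENNReal.ofReal (1 + t ^ 2)) :=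
  IsLocallyFiniteMeasure.withDensity_ofReal (by fun_prop)

theorem measurable_quad (Ω : MatrixMeasure n) (C : n → ℂ) :
    Measurable fun t => mform (Ω.density t) C C :=
  measurable_mform (u := fun _ => C) (v := fun _ => C) Ω.measurable (fun _ => measurable_const) fun _ => measurable_const

/-! ### Existence of a matrix measure with prescribed quadratic forms. -/

section Construction

variable [DecidableEq n] (E : ProjMeasure H) (ψ : (n → ℂ) →ₗ[ℂ] H)

/-- The sum of the measures `(ψ e_a, E ψ e_a)` over the standard basis. -/
def specBase : Measure ℝ := ∑ a, E.diag (ψ (Pi.single a 1))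

instance : IsFiniteMeasure (specBase E ψ) := by unfold specBase; infer_instance

/-- The density of `(ψ C, E ψ C)` with respect to `specBase`. -/
def specRatio (C : n → ℂ) (t : ℝ) : ℝ := ((E.diag (ψ C)).rnDeriv (specBase E ψ) t).toReal

/-- The matrix density of `(ψ e_a, E ψ e_b)` with respect to `specBase`. -/
def specDensity (t : ℝ) : Matrix n n ℂ := Matrix.of fun a b =>
  (1 / 4) * ∑ k ∈ Finset.range 4,
    Complex.I ^ k * (specRatio E ψ (Pi.single b 1 + Complex.I ^ k • Pi.single a 1) t : ℂ)

omit [CompleteSpace H] in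
theorem map_eq_sum_single (C : n → ℂ) : ψ C = ∑ a, C a • ψ (Pi.single a 1) := by
  conv_lhs => rw [pi_eq_sum_univ' C, map_sum]
  refine Finset.sum_congr rfl fun a _ => ?_
  rw [map_smul]

/-- A null set of the base annihilates every `ψ(e_a)`, hence by linearity every `ψ(C)`. -/
theorem diag_absolutelyContinuous_specBase (C : n → ℂ) : E.diag (ψ C) ≪ specBase E ψ := by
  refine Measure.AbsolutelyContinuous.mk fun S hS h0 => ?_
  have h1 : ∀ a, E S (ψ (Pi.single a 1)) = 0 := fun a => by
    have h2 : E.diag (ψ (Pi.single a 1)) S ≤ specBase E ψ S :=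
      Measure.le_iff'.1 (Finset.single_le_sum (f := fun a => E.diag (ψ (Pi.single a 1)))
        (fun _ _ => Measure.zero_le _) (Finset.mem_univ a)) S
    rw [h0, nonpos_iff_eq_zero, E.diag_apply hS, ENNReal.ofReal_eq_zero] at h2
    have h3 : ‖E S (ψ (Pi.single a 1))‖ ^ 2 = 0 := le_antisymm h2 (by positivity)
    simpa using h3
  rw [E.diag_apply hS, map_eq_sum_single ψ C, map_sum]
  simp [h1]

theorem measurable_specRatio (C : n → ℂ) : Measurable (specRatio E ψ C) :=
  (Measure.measurable_rnDeriv _ _).ennreal_toReal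

theorem integrable_specRatio (C : n → ℂ) :
    Integrable (fun t => (specRatio E ψ C t : ℂ)) (specBase E ψ) :=
  Integrable.ofReal (𝕜 := ℂ) Measure.integrable_toReal_rnDeriv

theorem inner_apply_self {S : Set ℝ} (hS : MeasurableSet S) (x : H) :
    inner ℂ x (E S x) = ((E.diag x).real S : ℂ) := by
  rw [← E.form_indicator hS, E.form_self, integral_indicator hS]
  simp

theorem setIntegral_specRatio (C : n → ℂ) (S : Set ℝ) :
    ∫ t in S, (specRatio E ψ C t : ℂ) ∂(specBase E ψ) = ((E.diag (ψ C)).real S : ℂ) := by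
  rw [integral_complex_ofReal]
  congr 1
  exact Measure.setIntegral_toReal_rnDeriv (diag_absolutelyContinuous_specBase E ψ C) S

theorem measurable_specDensity (a b : n) : Measurable fun t => specDensity E ψ t a b :=
  (Finset.measurable_sum _ fun _ _ =>
    (Complex.measurable_ofReal.comp (measurable_specRatio E ψ _)).const_mul _).const_mul _

theorem integrable_specDensity (a b : n) :
    Integrable (fun t => specDensity E ψ t a b) (specBase E ψ) :=
  (integrable_finsetSum _ fun _ _ => (integrable_specRatio E ψ _).const_mul _).const_mul _

theorem setIntegral_specDensity (a b : n) {S : Set ℝ} (hS : MeasurableSet S) :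
    ∫ t in S, specDensity E ψ t a b ∂(specBase E ψ) =
      inner ℂ (ψ (Pi.single a 1)) (E S (ψ (Pi.single b 1))) := by
  have e1 : inner ℂ (ψ (Pi.single a 1)) (E S (ψ (Pi.single b 1))) =
      inner ℂ (E S (ψ (Pi.single a 1))) (E S (ψ (Pi.single b 1))) := by
    rw [E.inner_apply_left hS, E.apply_apply hS hS, inter_self]
  simp only [specDensity, Matrix.of_apply]
  rw [integral_const_mul, integral_finsetSum (Finset.range 4) fun k _ =>
    ((integrable_specRatio E ψ _).const_mul _).integrableOn, e1,
    ProjMeasure.inner_eq_sum_norm_sq]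
  congr 1
  refine Finset.sum_congr rfl fun k _ => ?_
  rw [integral_const_mul, setIntegral_specRatio E ψ _ S, E.diag_real hS, map_add, map_smul,
    map_add, map_smul]

/-- The two densities have the same integral over every Borel set. The exceptional null set depends
on `C`. -/
theorem quad_specDensity (C : n → ℂ) : ∀ᵐ t ∂(specBase E ψ),
    mform (specDensity E ψ t) C C = (specRatio E ψ C t : ℂ) := by
  have hDi := integrable_specDensity E ψ
  have hint : Integrable (fun t => mform (specDensity E ψ t) C C) (specBase E ψ) := by
    simp only [mform_eq_sum]
    exact integrable_finsetSum _ fun a _ => integrable_finsetSum _ fun b _ =>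
      (hDi a b).const_mul _
  refine Integrable.ae_eq_of_forall_setIntegral_eq _ _ hint (integrable_specRatio E ψ C)
    fun S hS _ => ?_
  rw [setIntegral_specRatio E ψ C S, ← inner_apply_self E hS]
  simp only [mform_eq_sum]
  rw [integral_finsetSum _ fun a _ => (integrable_finsetSum _ fun b _ =>
    (hDi a b).const_mul _).integrableOn]
  have : inner ℂ (ψ C) (E S (ψ C)) = ∑ a, ∑ b, star (C a) * C b *
      inner ℂ (ψ (Pi.single a 1)) (E S (ψ (Pi.single b 1))) := by
    conv_lhs => rw [map_eq_sum_single ψ C]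
    rw [sum_inner]
    refine Finset.sum_congr rfl fun a _ => ?_
    rw [map_sum, inner_sum]
    refine Finset.sum_congr rfl fun b _ => ?_
    rw [map_smul, inner_smul_left, inner_smul_right, Complex.star_def]
    ring
  rw [this]
  refine Finset.sum_congr rfl fun a _ => ?_
  rw [integral_finsetSum _ fun b _ => ((hDi a b).const_mul _).integrableOn]
  refine Finset.sum_congr rfl fun b _ => ?_
  rw [integral_const_mul, setIntegral_specDensity E ψ a b hS]

theorem isHermitian_specDensity : ∀ᵐ t ∂(specBase E ψ), (specDensity E ψ t).IsHermitian := by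
  have h1 : ∀ a b, ∀ᵐ t ∂(specBase E ψ),
      star (specDensity E ψ t b a) = specDensity E ψ t a b := by
    intro a b
    have hstar : Integrable (fun t => star (specDensity E ψ t b a)) (specBase E ψ) :=
      Complex.conjCLE.toContinuousLinearMap.integrable_comp (integrable_specDensity E ψ b a)
    refine Integrable.ae_eq_of_forall_setIntegral_eq _ _ hstar (integrable_specDensity E ψ a b)
      fun S hS _ => ?_
    rw [setIntegral_specDensity E ψ a b hS]
    refine (integral_conj (f := fun t => specDensity E ψ t b a)).trans ?_
    rw [setIntegral_specDensity E ψ b a hS, ← E.inner_apply_left hS]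
    exact inner_conj_symm _ _
  have h2 := ae_all_iff.2 fun a => ae_all_iff.2 fun b => h1 a b
  filter_upwards [h2] with t ht
  ext a b
  exact ht a b

/-- Nonnegativity holds off one null set for a countable dense family of vectors and extends to all
vectors by continuity of the quadratic form. -/
theorem posSemidef_specDensity : ∀ᵐ t ∂(specBase E ψ), (specDensity E ψ t).PosSemidef := by
  have h1 : ∀ᵐ t ∂(specBase E ψ), ∀ k : ℕ,
      mform (specDensity E ψ t) (TopologicalSpace.denseSeq (n → ℂ) k)
        (TopologicalSpace.denseSeq (n → ℂ) k) =
        (specRatio E ψ (TopologicalSpace.denseSeq (n → ℂ) k) t : ℂ) :=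
    ae_all_iff.2 fun k => quad_specDensity E ψ _
  filter_upwards [h1, isHermitian_specDensity E ψ] with t ht hth
  refine Matrix.PosSemidef.of_dotProduct_mulVec_nonneg hth fun C => ?_
  have hc : IsClosed {C : n → ℂ | 0 ≤ mform (specDensity E ψ t) C C} := by
    refine isClosed_le continuous_const ?_
    simp only [mform_eq_sum]
    fun_prop
  have hsub : range (TopologicalSpace.denseSeq (n → ℂ)) ⊆
      {C : n → ℂ | 0 ≤ mform (specDensity E ψ t) C C} := by
    rintro _ ⟨k, rfl⟩
    change 0 ≤ mform (specDensity E ψ t) _ _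
    rw [ht k]
    exact Complex.zero_le_real.2 ENNReal.toReal_nonneg
  exact hc.closure_subset_iff.2 hsub ((TopologicalSpace.denseRange_denseSeq (n → ℂ)) C)

/-- The base measure is by definition the sum of the diagonal measures. -/
theorem trace_specDensity : ∀ᵐ t ∂(specBase E ψ), (specDensity E ψ t).trace = 1 := by
  have hint : Integrable (fun t => (specDensity E ψ t).trace) (specBase E ψ) :=
    integrable_finsetSum _ fun a _ => integrable_specDensity E ψ a a
  refine Integrable.ae_eq_of_forall_setIntegral_eq _ _ hint (integrable_const 1)
    fun S hS _ => ?_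
  simp only [Matrix.trace, Matrix.diag]
  rw [integral_finsetSum _ fun a _ => (integrable_specDensity E ψ a a).integrableOn]
  have h1 : (specBase E ψ).real S = ∑ a, (E.diag (ψ (Pi.single a 1))).real S := by
    simp only [specBase, Measure.real, Measure.coe_finsetSum, Finset.sum_apply]
    exact ENNReal.toReal_sum fun a _ => measure_ne_top _ _
  rw [setIntegral_const, h1]
  simp only [Complex.real_smul, mul_one, Complex.ofReal_sum]
  refine Finset.sum_congr rfl fun a _ => ?_
  rw [setIntegral_specDensity E ψ a a hS, inner_apply_self E hS]

/-- The matrix measure with `(C, dΩ C) = (1 + λ²) d(ψ C, E ψ C)`. -/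
def specMeasure : MatrixMeasure n where
  base := (specBase E ψ).withDensity fun t => ENNReal.ofReal (1 + t ^ 2)
  locallyFinite := locallyFinite_withDensity_one_add_sq
  density := specDensity E ψ
  measurable := measurable_specDensity E ψ
  posSemidef := (withDensity_absolutelyContinuous _ _).ae_le (posSemidef_specDensity E ψ)
  trace_eq_one := (withDensity_absolutelyContinuous _ _).ae_le (trace_specDensity E ψ)

theorem integrable_inv_specMeasure :
    Integrable (fun t : ℝ => (1 + t ^ 2)⁻¹) (specMeasure E ψ).base :=
  integrable_inv_withDensity

theorem represents_specMeasure : Represents (specMeasure E ψ) E ψ := by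
  intro C
  have hqm : Measurable fun t => ENNReal.ofReal (mform (specDensity E ψ t) C C).re :=
    (Complex.measurable_re.comp (measurable_quad (specMeasure E ψ) C)).ennreal_ofReal
  change ((specBase E ψ).withDensity fun t => ENNReal.ofReal (1 + t ^ 2)).withDensity
    (fun t => ENNReal.ofReal (mform (specDensity E ψ t) C C).re) = _
  rw [← withDensity_mul _ measurable_one_add_sq hqm]
  conv_rhs => rw [← Measure.withDensity_rnDeriv_eq _ _ (diag_absolutelyContinuous_specBase E ψ C)]
  rw [← withDensity_mul _ (Measure.measurable_rnDeriv _ _) measurable_one_add_sq]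
  refine withDensity_congr_ae ?_
  filter_upwards [quad_specDensity E ψ C,
    Measure.rnDeriv_lt_top (E.diag (ψ C)) (specBase E ψ)] with t h1 h2
  simp only [Pi.mul_apply, h1, Complex.ofReal_re, specRatio]
  rw [ENNReal.ofReal_toReal h2.ne, mul_comm]

end Construction

/-! ### Matrix measures and the Nevanlinna–Herglotz representation. -/

variable {Ω : MatrixMeasure n}

theorem quad_eq_ofReal (Ω : MatrixMeasure n) : ∀ᵐ t ∂Ω.base, ∀ C : n → ℂ,
    0 ≤ (mform (Ω.density t) C C).re ∧
    mform (Ω.density t) C C = ((mform (Ω.density t) C C).re : ℂ) := by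
  filter_upwards [Ω.posSemidef] with t ht C
  have h0 : 0 ≤ mform (Ω.density t) C C := ht.dotProduct_mulVec_nonneg C
  have h := Complex.nonneg_iff.1 h0
  exact ⟨h.1, Complex.ext (by simp) (by simpa using h.2.symm)⟩

/-- Integration of a scalar function against `(C, dΩ C)`. -/
theorem integral_mul_quad (Ω : MatrixMeasure n) (C : n → ℂ) (G : ℝ → ℂ) :
    ∫ t, G t * mform (Ω.density t) C C ∂Ω.base =
      ∫ t, G t ∂(Ω.base.withDensity fun t => ENNReal.ofReal (mform (Ω.density t) C C).re) := by
  have hm : Measurable fun t => ENNReal.ofReal (mform (Ω.density t) C C).re :=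
    (Complex.measurable_re.comp (measurable_quad Ω C)).ennreal_ofReal
  rw [integral_withDensity_eq_integral_toReal_smul hm (by simp)]
  refine integral_congr_ae ?_
  filter_upwards [quad_eq_ofReal Ω] with t ht
  rw [ENNReal.toReal_ofReal (ht C).1, Complex.real_smul, mul_comm, ← (ht C).2]

theorem Represents.integral_mul_quad {E : ProjMeasure H} {ψ : (n → ℂ) →ₗ[ℂ] H}
    (h : Represents Ω E ψ) (C : n → ℂ) (G : ℝ → ℂ) :
    ∫ t, G t * mform (Ω.density t) C C ∂Ω.base =
      ∫ t, ((1 + t ^ 2 : ℝ) : ℂ) * G t ∂(E.diag (ψ C)) := by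
  rw [SusySchrodinger.integral_mul_quad, h C,
    integral_withDensity_eq_integral_toReal_smul measurable_one_add_sq (by simp)]
  refine integral_congr_ae (Eventually.of_forall fun t => ?_)
  have : (0 : ℝ) < 1 + t ^ 2 := by positivity
  simp only
  rw [ENNReal.toReal_ofReal this.le, Complex.real_smul]

theorem integrable_herglotzKernel_mul_density
    (hΩ : Integrable (fun t : ℝ => (1 + t ^ 2)⁻¹) Ω.base) {z : ℂ} (hz : z.im ≠ 0) (a b : n) :
    Integrable (fun t => herglotzKernel z t * Ω.density t a b) Ω.base := by
  refine Integrable.mul_bdd (c := 4) (integrable_herglotzKernel hΩ hz)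
    (Ω.measurable a b).aestronglyMeasurable ?_
  filter_upwards [Ω.posSemidef, Ω.trace_eq_one] with t h1 h2
  exact norm_entry_le_of_posSemidef h1 h2 a b

theorem integral_herglotzKernel_mul_quad
    (hΩ : Integrable (fun t : ℝ => (1 + t ^ 2)⁻¹) Ω.base) {z : ℂ} (hz : z.im ≠ 0) (C : n → ℂ) :
    ∫ t, herglotzKernel z t * mform (Ω.density t) C C ∂Ω.base =
      mform (Matrix.of fun a b => ∫ t, herglotzKernel z t * Ω.density t a b ∂Ω.base) C C := by
  have hi := integrable_herglotzKernel_mul_density hΩ hz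
  have e : ∀ t, herglotzKernel z t * mform (Ω.density t) C C =
      ∑ a, ∑ b, star (C a) * C b * (herglotzKernel z t * Ω.density t a b) := fun t => by
    simp only [mform_eq_sum, Finset.mul_sum]
    exact Finset.sum_congr rfl fun a _ => Finset.sum_congr rfl fun b _ => by ring
  simp only [e]
  rw [integral_finsetSum _ fun a _ => integrable_finsetSum _ fun b _ => (hi a b).const_mul _,
    mform_eq_sum]
  refine Finset.sum_congr rfl fun a _ => ?_
  rw [integral_finsetSum _ fun b _ => (hi a b).const_mul _]
  exact Finset.sum_congr rfl fun b _ => integral_const_mul _ _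

variable {M : ℂ → Matrix n n ℂ} {E : ProjMeasure H} {ψ : (n → ℂ) →ₗ[ℂ] H}

/-- `M` has the Nevanlinna–Herglotz representation with `(C, dΩ C) = (1 + λ²) d(ψ C, E ψ C)`. -/
def HasHerglotzForm (M : ℂ → Matrix n n ℂ) (E : ProjMeasure H) (ψ : (n → ℂ) →ₗ[ℂ] H) : Prop :=
  ∀ (C : n → ℂ) (z : ℂ), z.im ≠ 0 → mform (M z) C C = ((mform (M Complex.I) C C).re : ℂ) +
    ∫ t, ((1 + t ^ 2 : ℝ) : ℂ) * herglotzKernel z t ∂(E.diag (ψ C))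

/-- The constant matrix is the Hermitian part of `M(i)`; matrices are recovered from their quadratic
forms by polarization. -/
theorem HasHerglotzForm.isHerglotzMeasure (h : HasHerglotzForm M E ψ) (hΩ : Represents Ω E ψ)
    (hi : Integrable (fun t : ℝ => (1 + t ^ 2)⁻¹) Ω.base) : Ω.IsHerglotzMeasure M := by
  refine ⟨hi, (1 / 2 : ℂ) • (M Complex.I + (M Complex.I).conjTranspose), ?_, fun z hz => ?_⟩
  · rw [Matrix.IsHermitian, Matrix.conjTranspose_smul, Matrix.conjTranspose_add,
      Matrix.conjTranspose_conjTranspose, add_comm]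
    simp
  · have e : M z = (1 / 2 : ℂ) • (M Complex.I + (M Complex.I).conjTranspose) +
        Matrix.of fun a b => ∫ t, herglotzKernel z t * Ω.density t a b ∂Ω.base := by
      refine matrix_ext_of_mform fun C => ?_
      rw [mform_add_matrix, ← integral_herglotzKernel_mul_quad hi hz, hΩ.integral_mul_quad,
        h C z hz]
      congr 1
      have h2 : mform ((1 / 2 : ℂ) • (M Complex.I + (M Complex.I).conjTranspose)) C C =
          (1 / 2 : ℂ) * (mform (M Complex.I) C C + star (mform (M Complex.I) C C)) := by
        rw [← mform_conjTranspose, ← mform_add_matrix]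
        simp only [mform, Matrix.smul_mulVec, dotProduct_smul, smul_eq_mul]
      rw [h2, Complex.star_def, Complex.add_conj]
      push_cast
      ring
    intro a b
    conv_lhs => rw [e]
    rfl

/-- For each vector `C` the matrix representation reduces to a scalar one for `(C, dΩ C)`, and
scalar uniqueness applies. Bounded densities make the scalar measure locally finite. -/
theorem HasHerglotzForm.represents (h : HasHerglotzForm M E ψ) (hΩ : Ω.IsHerglotzMeasure M) :
    Represents Ω E ψ := by
  obtain ⟨hi, C0, hC0, hM⟩ := hΩ
  have := Ω.locallyFinite
  intro C
  have hqm : Measurable fun t => ENNReal.ofReal (mform (Ω.density t) C C).re :=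
    (Complex.measurable_re.comp (measurable_quad Ω C)).ennreal_ofReal
  have hqb : ∃ K : ℝ, ∀ᵐ t ∂Ω.base, ‖mform (Ω.density t) C C‖ ≤ K := by
    refine ⟨∑ a, ∑ b, ‖star (C a) * C b‖ * 4, ?_⟩
    filter_upwards [Ω.posSemidef, Ω.trace_eq_one] with t h1 h2
    rw [mform_eq_sum]
    refine norm_sum_le_of_le _ fun a _ => norm_sum_le_of_le _ fun b _ => ?_
    rw [norm_mul]
    exact mul_le_mul_of_nonneg_left (norm_entry_le_of_posSemidef h1 h2 a b) (norm_nonneg _)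
  obtain ⟨K, hK⟩ := hqb
  have hle : Ω.base.withDensity (fun t => ENNReal.ofReal (mform (Ω.density t) C C).re) ≤
      ENNReal.ofReal K • Ω.base := by
    rw [← withDensity_const]
    refine withDensity_mono ?_
    filter_upwards [hK] with t ht
    exact ENNReal.ofReal_le_ofReal ((Complex.re_le_norm _).trans ht)
  have hlf : IsLocallyFiniteMeasure
      (Ω.base.withDensity fun t => ENNReal.ofReal (mform (Ω.density t) C C).re) := by
    refine ⟨fun x => ?_⟩
    obtain ⟨s, hs, hs'⟩ := Ω.base.finiteAt_nhds x
    refine ⟨s, hs, (hle s).trans_lt ?_⟩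
    rw [Measure.smul_apply, smul_eq_mul]
    exact ENNReal.mul_lt_top ENNReal.ofReal_lt_top hs'
  have hint : Integrable (fun t : ℝ => (1 + t ^ 2)⁻¹)
      (Ω.base.withDensity fun t => ENNReal.ofReal (mform (Ω.density t) C C).re) :=
    (hi.smul_measure ENNReal.ofReal_ne_top).mono_measure hle
  refine measure_eq_of_herglotz hint integrable_inv_withDensity (mform C0 C C).re
    (mform (M Complex.I) C C).re fun z hz => ?_
  have h1 : M z = C0 + Matrix.of fun a b => ∫ t, herglotzKernel z t * Ω.density t a b ∂Ω.base := by
    ext a b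
    exact hM z hz a b
  have h2 := congrArg (fun D => mform D C C) h1
  simp only [mform_add_matrix] at h2
  rw [← integral_herglotzKernel_mul_quad hi hz, SusySchrodinger.integral_mul_quad, h C z hz] at h2
  have h3 : mform C0 C C = ((mform C0 C C).re : ℂ) := by
    have h4 := mform_conjTranspose C0 C C
    rw [hC0.eq] at h4
    exact (Complex.conj_eq_iff_re.1 h4.symm).symm
  rw [← h3, ← h2]
  congr 1
  rw [integral_withDensity_eq_integral_toReal_smul measurable_one_add_sq (by simp)]
  refine integral_congr_ae (Eventually.of_forall fun t => ?_)
  have : (0 : ℝ) < 1 + t ^ 2 := by positivity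
  simp only
  rw [ENNReal.toReal_ofReal this.le, Complex.real_smul]

end Represents

/-! ### First-order systems `u' + Φ u = f` -/

section FirstOrder

variable {m : ℕ}

/-- A matrix as a bounded operator on `ℂ^m`. -/
def matCLM : Mat m →ₗ[ℂ] (Vec m →L[ℂ] Vec m) :=
  (LinearMap.toContinuousLinearMap : (Vec m →ₗ[ℂ] Vec m) ≃ₗ[ℂ] (Vec m →L[ℂ] Vec m)).toLinearMap ∘ₗ
    (Matrix.toEuclideanLin (𝕜 := ℂ) (m := Fin m) (n := Fin m)).toLinearMap

theorem matCLM_apply (M : Mat m) (v : Vec m) : matCLM M v = act M v := rfl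

theorem locallyIntegrable_linear_comp {E : Type*} [NormedAddCommGroup E] [NormedSpace ℂ E]
    (L : Mat m →ₗ[ℂ] E) {φ : ℝ → Mat m}
    (h : ∀ i k, LocallyIntegrable (fun x => φ x i k) (volume : Measure ℝ)) :
    LocallyIntegrable (fun x => L (φ x)) volume := by
  have e : (fun x => L (φ x)) = fun x => ∑ i, ∑ k, φ x i k • L (Matrix.single i k (1 : ℂ)) := by
    ext1 x
    conv_lhs => rw [Matrix.matrix_eq_sum_single (φ x)]
    simp only [map_sum]
    refine Finset.sum_congr rfl fun i _ => Finset.sum_congr rfl fun k _ => ?_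
    rw [← map_smul, Matrix.smul_single, smul_eq_mul, mul_one]
  rw [e]
  refine locallyIntegrable_iff.2 fun K hK => ?_
  exact integrable_finsetSum _ fun i _ => integrable_finsetSum _ fun k _ =>
    Integrable.smul_const ((h i k).integrableOn_isCompact hK) _

theorem inner_act_left (M : Mat m) (u v : Vec m) :
    inner ℂ (act M u) v = inner ℂ u (act M.conjTranspose v) := by
  unfold act
  rw [Matrix.toEuclideanLin_conjTranspose_eq_adjoint]
  exact (LinearMap.adjoint_inner_right _ _ _).symm

/-- Locally integrable, pointwise self-adjoint potentials. -/
structure IsPotential (Φ : ℝ → Vec m →L[ℂ] Vec m) : Prop where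
  locInt : LocallyIntegrable Φ volume
  symm : ∀ᵐ x, ∀ u v, inner ℂ (Φ x u) v = inner ℂ u (Φ x v)

theorem isPotential_matCLM {φ : ℝ → Mat m}
    (h : ∀ i k, LocallyIntegrable (fun x => φ x i k) (volume : Measure ℝ))
    (hs : ∀ᵐ x : ℝ, (φ x).IsHermitian) : IsPotential fun x => matCLM (φ x) := by
  refine ⟨locallyIntegrable_linear_comp matCLM h, ?_⟩
  filter_upwards [hs] with x hx u v
  rw [matCLM_apply, matCLM_apply, inner_act_left, hx.eq]

variable {Φ : ℝ → Vec m →L[ℂ] Vec m}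

theorem IsPotential.neg (h : IsPotential Φ) : IsPotential (-Φ) := by
  refine ⟨h.locInt.neg, ?_⟩
  filter_upwards [h.symm] with x hx u v
  simp [hx u v]

/-- `u` is locally absolutely continuous and `u' + Φ u = f`. -/
structure IsD (Φ : ℝ → Vec m →L[ℂ] Vec m) (u f : ℝ → Vec m) : Prop where
  ac : LocAC univ u
  locInt : LocallyIntegrable f volume
  deriv : ∀ᵐ x, HasDerivAt u (f x - Φ x (u x)) x

namespace IsD

variable {u v f g : ℝ → Vec m}

theorem continuous (h : IsD Φ u f) : Continuous u := h.ac.continuous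

theorem congr (h : IsD Φ u f) (hfg : f =ᵐ[volume] g) : IsD Φ u g := by
  refine ⟨h.ac, fun x => ?_, ?_⟩
  · obtain ⟨s, hs, hs'⟩ := h.locInt x
    exact ⟨s, hs, hs'.congr (ae_restrict_of_ae hfg)⟩
  · filter_upwards [h.deriv, hfg] with x hx hx'
    rwa [← hx']

theorem add (h : IsD Φ u f) (h' : IsD Φ v g) : IsD Φ (u + v) (f + g) := by
  refine ⟨fun a ha b hb => (h.ac a ha b hb).add (h'.ac a ha b hb), h.locInt.add h'.locInt, ?_⟩
  filter_upwards [h.deriv, h'.deriv] with x h1 h2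
  have e : (f + g) x - Φ x ((u + v) x) = f x - Φ x (u x) + (g x - Φ x (v x)) := by
    simp only [Pi.add_apply, map_add]
    abel
  rw [e]
  exact h1.add h2

theorem const_smul (h : IsD Φ u f) (c : ℂ) : IsD Φ (c • u) (c • f) := by
  refine ⟨fun a ha b hb => (h.ac a ha b hb).const_smul c, h.locInt.smul c, ?_⟩
  filter_upwards [h.deriv] with x h1
  have e : (c • f) x - Φ x ((c • u) x) = c • (f x - Φ x (u x)) := by
    simp only [Pi.smul_apply, map_smul, smul_sub]
  rw [e]
  exact h1.const_smul c

theorem neg (h : IsD Φ u f) : IsD Φ (-u) (-f) := by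
  simpa using h.const_smul (-1)

end IsD

theorem LocAC.of_integral {k u : ℝ → Vec m} (hk : LocallyIntegrable k volume) {x₀ : ℝ}
    {y₀ : Vec m} (h : ∀ x, u x = y₀ + ∫ t in x₀..x, k t) :
    LocAC univ u ∧ ∀ᵐ x, HasDerivAt u (k x) x := by
  have e : u = fun x => y₀ + ∫ t in x₀..x, k t := funext h
  have hki := locallyIntegrable_intervalIntegrable hk
  constructor
  · intro a _ b _
    rw [e]
    have hac := ac_intervalIntegral (hki a b) (left_mem_uIcc (a := a) (b := b))
    refine ac_of_dist_le (C := 1) hac hac fun x _ y _ => ?_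
    rw [dist_add_left, ← intervalIntegral.integral_add_adjacent_intervals (hki x₀ a) (hki a x),
      ← intervalIntegral.integral_add_adjacent_intervals (hki x₀ a) (hki a y), dist_add_left,
      one_mul]
    exact le_add_of_nonneg_right dist_nonneg
  · filter_upwards [_root_.LocallyIntegrable.ae_hasDerivAt_integral hk] with x hx
    rw [e]
    exact (hx x₀).const_add _

/-! ### Green's identity for first-order systems. -/

section Green

variable {u w f g : ℝ → Vec m}

theorem intervalIntegrable_inner_left (hf : LocallyIntegrable f volume) (hw : Continuous w)
    (a b : ℝ) : IntervalIntegrable (fun x => inner ℂ (f x) (w x)) volume a b := by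
  have h1 := locallyIntegrable_intervalIntegrable hf a b
  rw [intervalIntegrable_iff] at h1 ⊢
  obtain ⟨D, hD⟩ := isCompact_uIcc.exists_bound_of_continuousOn (s := uIcc a b) hw.continuousOn
  refine Integrable.mono' (h1.norm.mul_const D)
    (h1.aestronglyMeasurable.inner hw.aestronglyMeasurable) ?_
  refine (ae_restrict_iff' measurableSet_uIoc).2 (Eventually.of_forall fun x hx => ?_)
  exact (norm_inner_le_norm _ _).trans (mul_le_mul_of_nonneg_left (hD x (uIoc_subset_uIcc hx))
    (norm_nonneg _))

theorem intervalIntegrable_inner_right (hf : LocallyIntegrable f volume) (hw : Continuous w)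
    (a b : ℝ) : IntervalIntegrable (fun x => inner ℂ (w x) (f x)) volume a b := by
  have h := intervalIntegrable_inner_left hf hw a b
  rw [intervalIntegrable_iff] at h ⊢
  refine (Complex.conjCLE.toContinuousLinearMap.integrable_comp h).congr
    (Eventually.of_forall fun x => ?_)
  exact inner_conj_symm _ _

/-- Green's identity. -/
theorem green (hΦ : IsPotential Φ) (hu : IsD Φ u f) (hw : IsD (-Φ) w g) (a b : ℝ) :
    ∫ x in a..b, (inner ℂ (f x) (w x) + inner ℂ (u x) (g x)) =
      inner ℂ (u b) (w b) - inner ℂ (u a) (w a) := by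
  refine ac_integral_eq_sub (f := fun x => inner ℂ (u x) (w x)) ?_ ?_ ?_
  · have := ac_bilinear (isBoundedBilinearMap_inner (𝕜 := ℂ) (E := Vec m)).toContinuousLinearMap
      (hu.ac a trivial b trivial) (hw.ac a trivial b trivial)
    exact this
  · exact (intervalIntegrable_inner_left hu.locInt hw.continuous a b).add
      (intervalIntegrable_inner_right hw.locInt hu.continuous a b)
  · filter_upwards [hu.deriv, hw.deriv, hΦ.symm] with x h1 h2 h3 _
    -- In the derivative of `(u, w)` the two potential terms cancel because `Φ` is symmetric.
    have e : inner ℂ (f x) (w x) + inner ℂ (u x) (g x) =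
        inner ℂ (u x) (g x - (-Φ) x (w x)) + inner ℂ (f x - Φ x (u x)) (w x) := by
      simp only [Pi.neg_apply, _root_.neg_apply, inner_sub_left, inner_sub_right, inner_neg_right,
        h3]
      ring
    rw [e]
    exact h1.inner ℂ h2

theorem integrable_inner_of_memLp {μ : Measure ℝ} (hu : MemLp u 2 μ) (hw : MemLp w 2 μ) :
    Integrable (fun x => inner ℂ (u x) (w x)) μ := by
  refine (L2.integrable_inner (𝕜 := ℂ) (hu.toLp u) (hw.toLp w)).congr ?_
  filter_upwards [hu.coeFn_toLp, hw.coeFn_toLp] with x h1 h2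
  rw [h1, h2]

/-- By Green on `[x₀, b]` the function `(u, w)` has a limit at infinity; being integrable, it can
only have limit `0`. -/
theorem green_Ioi (hΦ : IsPotential Φ) (hu : IsD Φ u f) (hw : IsD (-Φ) w g) (x₀ : ℝ)
    (hu2 : MemLp u 2 (volume.restrict (Ioi x₀))) (hf2 : MemLp f 2 (volume.restrict (Ioi x₀)))
    (hw2 : MemLp w 2 (volume.restrict (Ioi x₀))) (hg2 : MemLp g 2 (volume.restrict (Ioi x₀))) :
    ∫ x in Ioi x₀, (inner ℂ (f x) (w x) + inner ℂ (u x) (g x)) = -inner ℂ (u x₀) (w x₀) := by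
  have hi : IntegrableOn (fun x => inner ℂ (f x) (w x) + inner ℂ (u x) (g x)) (Ioi x₀) :=
    (integrable_inner_of_memLp hf2 hw2).add (integrable_inner_of_memLp hu2 hg2)
  have h1 := intervalIntegral_tendsto_integral_Ioi x₀ hi tendsto_id
  simp only [green hΦ hu hw, id_eq] at h1
  have h2 := h1.add_const (inner ℂ (u x₀) (w x₀))
  simp only [sub_add_cancel] at h2
  have h3 := IntegrableAtFilter.eq_zero_of_tendsto (l := atTop) (μ := volume)
    ⟨Ioi x₀, Ioi_mem_atTop x₀, integrable_inner_of_memLp hu2 hw2⟩ (fun s hs => by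
      obtain ⟨b, hb⟩ := mem_atTop_sets.1 hs
      refine top_unique ?_
      rw [← Real.volume_Ici (a := b)]
      exact measure_mono fun x hx => hb x hx) h2
  exact eq_neg_of_add_eq_zero_left h3

theorem green_Iic (hΦ : IsPotential Φ) (hu : IsD Φ u f) (hw : IsD (-Φ) w g) (x₀ : ℝ)
    (hu2 : MemLp u 2 (volume.restrict (Iic x₀))) (hf2 : MemLp f 2 (volume.restrict (Iic x₀)))
    (hw2 : MemLp w 2 (volume.restrict (Iic x₀))) (hg2 : MemLp g 2 (volume.restrict (Iic x₀))) :
    ∫ x in Iic x₀, (inner ℂ (f x) (w x) + inner ℂ (u x) (g x)) = inner ℂ (u x₀) (w x₀) := by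
  have hi : IntegrableOn (fun x => inner ℂ (f x) (w x) + inner ℂ (u x) (g x)) (Iic x₀) :=
    (integrable_inner_of_memLp hf2 hw2).add (integrable_inner_of_memLp hu2 hg2)
  have h1 := intervalIntegral_tendsto_integral_Iic x₀ hi tendsto_id
  simp only [green hΦ hu hw, id_eq] at h1
  have h2 := h1.const_sub (inner ℂ (u x₀) (w x₀))
  simp only [sub_sub_cancel] at h2
  have h3 := IntegrableAtFilter.eq_zero_of_tendsto (l := atBot) (μ := volume)
    ⟨Iic x₀, Iic_mem_atBot x₀, integrable_inner_of_memLp hu2 hw2⟩ (fun s hs => by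
      obtain ⟨b, hb⟩ := mem_atBot_sets.1 hs
      refine top_unique ?_
      rw [← Real.volume_Iic (a := b)]
      exact measure_mono fun x hx => hb x hx) h2
  exact (sub_eq_zero.1 h3).symm

theorem green_univ (hΦ : IsPotential Φ) (hu : IsD Φ u f) (hw : IsD (-Φ) w g)
    (hu2 : MemLp u 2 volume) (hf2 : MemLp f 2 volume) (hw2 : MemLp w 2 volume)
    (hg2 : MemLp g 2 volume) :
    ∫ x, (inner ℂ (f x) (w x) + inner ℂ (u x) (g x)) = 0 := by
  have hi : Integrable (fun x => inner ℂ (f x) (w x) + inner ℂ (u x) (g x)) :=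
    (integrable_inner_of_memLp hf2 hw2).add (integrable_inner_of_memLp hu2 hg2)
  rw [← intervalIntegral.integral_Iic_add_Ioi (b := 0) hi.integrableOn hi.integrableOn,
    green_Iic hΦ hu hw 0 (hu2.restrict _) (hf2.restrict _) (hw2.restrict _) (hg2.restrict _),
    green_Ioi hΦ hu hw 0 (hu2.restrict _) (hf2.restrict _) (hw2.restrict _) (hg2.restrict _), add_neg_cancel]

end Green

end FirstOrder

/-! ### The second-order equation `τ u = z u + h` as a first-order system -/

section Tau

variable {m : ℕ} {Φ : ℝ → Vec m →L[ℂ] Vec m}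

theorem locallyIntegrable_of_intervalIntegrable {E : Type*} [NormedAddCommGroup E] {f : ℝ → E}
    (h : ∀ a b, IntervalIntegrable f volume a b) : LocallyIntegrable f volume := fun x =>
  ⟨Ioc (x - 1) (x + 1), mem_of_superset (Ioo_mem_nhds (by linarith) (by linarith))
    Ioo_subset_Ioc_self, by
      have := h (x - 1) (x + 1)
      rwa [intervalIntegrable_iff_integrableOn_Ioc_of_le (by linarith)] at this⟩

/-- The coefficient `(u, w) ↦ (w - Φ u, Φ w - z u)`. -/
def sysCLM (z : ℂ) (P : Vec m →L[ℂ] Vec m) : Vec m × Vec m →L[ℂ] Vec m × Vec m :=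
  (ContinuousLinearMap.snd ℂ (Vec m) (Vec m) - P ∘L ContinuousLinearMap.fst ℂ (Vec m) (Vec m)).prod
    (P ∘L ContinuousLinearMap.snd ℂ (Vec m) (Vec m) - z • ContinuousLinearMap.fst ℂ (Vec m) (Vec m))

theorem sysCLM_apply (z : ℂ) (P : Vec m →L[ℂ] Vec m) (y : Vec m × Vec m) :
    sysCLM z P y = (y.2 - P y.1, P y.2 - z • y.1) := rfl

theorem norm_sysCLM_le (z : ℂ) (P : Vec m →L[ℂ] Vec m) : ‖sysCLM z P‖ ≤ 1 + ‖z‖ + ‖P‖ := by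
  refine ContinuousLinearMap.opNorm_le_bound _ (by positivity) fun y => ?_
  have h1 := norm_fst_le y
  have h2 := norm_snd_le y
  have h3 := P.le_opNorm y.1
  have h4 := P.le_opNorm y.2
  have h5 := mul_le_mul_of_nonneg_left h1 (norm_nonneg P)
  have h6 := mul_le_mul_of_nonneg_left h2 (norm_nonneg P)
  have h7 := mul_le_mul_of_nonneg_left h1 (norm_nonneg z)
  have h8 : 0 ≤ ‖z‖ * ‖y‖ := by positivity
  rw [sysCLM_apply, norm_prod_le_iff]
  constructor
  · refine (norm_sub_le _ _).trans ?_
    linarith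
  · refine (norm_sub_le _ _).trans ?_
    rw [norm_smul]
    linarith [norm_nonneg y]

theorem continuous_sysCLM (z : ℂ) : Continuous (sysCLM (m := m) z) := by
  have h1 : Continuous fun P : Vec m →L[ℂ] Vec m =>
      ContinuousLinearMap.snd ℂ (Vec m) (Vec m) - P ∘L ContinuousLinearMap.fst ℂ (Vec m) (Vec m) :=
    continuous_const.sub (continuous_id.clm_comp continuous_const)
  have h2 : Continuous fun P : Vec m →L[ℂ] Vec m => P ∘L ContinuousLinearMap.snd ℂ (Vec m) (Vec m) -
      z • ContinuousLinearMap.fst ℂ (Vec m) (Vec m) :=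
    (continuous_id.clm_comp continuous_const).sub continuous_const
  exact (ContinuousLinearMap.prodₗᵢ ℂ).continuous.comp (h1.prodMk h2)

theorem locallyIntegrable_sysCLM (hΦ : IsPotential Φ) (z : ℂ) :
    LocallyIntegrable (fun t => (sysCLM z (Φ t)).restrictScalars ℝ) volume := by
  have h1 : LocallyIntegrable (fun t => 1 + ‖z‖ + ‖Φ t‖) volume :=
    (locallyIntegrable_const _).add (locallyIntegrable_norm hΦ.locInt)
  refine h1.mono ?_ (Eventually.of_forall fun t => ?_)
  · exact (ContinuousLinearMap.restrictScalarsL ℂ (Vec m × Vec m) (Vec m × Vec m) ℝ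
      ℝ).continuous.comp_aestronglyMeasurable
        ((continuous_sysCLM z).comp_aestronglyMeasurable hΦ.locInt.aestronglyMeasurable)
  · rw [ContinuousLinearMap.norm_restrictScalars, Real.norm_of_nonneg (by positivity)]
    exact norm_sysCLM_le z (Φ t)

/-- `τ u = z u + h`, where `w` is the quasi-derivative `u' + Φ u`. -/
structure IsTau (Φ : ℝ → Vec m →L[ℂ] Vec m) (z : ℂ) (h u w : ℝ → Vec m) : Prop where
  fst : IsD Φ u w
  snd : IsD (-Φ) w (-(z • u + h))

theorem exists_isTau (hΦ : IsPotential Φ) (z : ℂ) {h : ℝ → Vec m}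
    (hh : LocallyIntegrable h volume) (x₀ : ℝ) (C : Vec m × Vec m) :
    ∃ y : ℝ → Vec m × Vec m, IsTau Φ z h (fun x => (y x).1) (fun x => (y x).2) ∧ y x₀ = C := by
  have hb : LocallyIntegrable (fun t => ((0, -h t) : Vec m × Vec m)) volume := by
    refine (locallyIntegrable_norm hh).mono ?_ (Eventually.of_forall fun t => ?_)
    · exact aestronglyMeasurable_const.prodMk hh.aestronglyMeasurable.neg
    · simp
  have hA := locallyIntegrable_sysCLM hΦ z
  obtain ⟨y, hy, hyi⟩ := exists_linear_ode hA hb x₀ C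
  have hk : ∀ a b, IntervalIntegrable (fun t => ((sysCLM z (Φ t)).restrictScalars ℝ) (y t) +
      ((0, -h t) : Vec m × Vec m)) volume a b := fun a b =>
    (intervalIntegrable_clm_apply hA hy.continuousOn).add
      (locallyIntegrable_intervalIntegrable hb a b)
  have e1 : (fun t => (y t).2 - Φ t (y t).1) = fun t => ContinuousLinearMap.fst ℝ (Vec m) (Vec m)
      (((sysCLM z (Φ t)).restrictScalars ℝ) (y t) + ((0, -h t) : Vec m × Vec m)) := by
    ext1 t; simp [sysCLM_apply]
  have e2 : (fun t => Φ t (y t).2 - z • (y t).1 - h t) =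
      fun t => ContinuousLinearMap.snd ℝ (Vec m) (Vec m)
      (((sysCLM z (Φ t)).restrictScalars ℝ) (y t) + ((0, -h t) : Vec m × Vec m)) := by
    ext1 t; simp [sysCLM_apply, sub_eq_add_neg]
  have hk1 : ∀ a b, IntervalIntegrable (fun t => (y t).2 - Φ t (y t).1) volume a b := fun a b => by
    rw [e1]
    exact ⟨ContinuousLinearMap.integrable_comp _ (hk a b).1,
      ContinuousLinearMap.integrable_comp _ (hk a b).2⟩
  have hk2 : ∀ a b, IntervalIntegrable (fun t => Φ t (y t).2 - z • (y t).1 - h t) volume a b :=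
    fun a b => by
    rw [e2]
    exact ⟨ContinuousLinearMap.integrable_comp _ (hk a b).1,
      ContinuousLinearMap.integrable_comp _ (hk a b).2⟩
  obtain ⟨a1, d1⟩ := LocAC.of_integral (locallyIntegrable_of_intervalIntegrable hk1)
    (x₀ := x₀) (y₀ := C.1) (u := fun x => (y x).1) (fun x => by
      have := congrArg Prod.fst (hyi x)
      rw [Prod.fst_add] at this
      rw [this, e1]
      congr 1
      exact ((ContinuousLinearMap.fst ℝ (Vec m) (Vec m)).intervalIntegral_comp_comm (hk x₀ x)).symm)
  obtain ⟨a2, d2⟩ := LocAC.of_integral (locallyIntegrable_of_intervalIntegrable hk2)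
    (x₀ := x₀) (y₀ := C.2) (u := fun x => (y x).2) (fun x => by
      have := congrArg Prod.snd (hyi x)
      rw [Prod.snd_add] at this
      rw [this, e2]
      congr 1
      exact ((ContinuousLinearMap.snd ℝ (Vec m) (Vec m)).intervalIntegral_comp_comm (hk x₀ x)).symm)
  have hy1 : Continuous fun x => (y x).1 := continuous_fst.comp hy
  have hy2 : Continuous fun x => (y x).2 := continuous_snd.comp hy
  refine ⟨y, ⟨⟨a1, hy2.locallyIntegrable, d1⟩, ⟨a2, ?_, ?_⟩⟩, by simpa using hyi x₀⟩
  · exact ((hy1.const_smul z).locallyIntegrable.add hh).neg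
  · filter_upwards [d2] with x hx
    have e : (-(z • (fun x => (y x).1) + h)) x - (-Φ) x ((fun x => (y x).2) x) =
        Φ x (y x).2 - z • (y x).1 - h x := by
      simp only [Pi.neg_apply, Pi.add_apply, Pi.smul_apply, _root_.neg_apply]
      abel
    rw [e]
    exact hx

/-- The a priori bound for solutions on a compact interval. -/
theorem tau_bound (hΦ : IsPotential Φ) {z : ℂ} {h u w : ℝ → Vec m} {x₀ x₁ : ℝ}
    (hu : AbsolutelyContinuousOnInterval u x₀ x₁) (hw : AbsolutelyContinuousOnInterval w x₀ x₁)
    (hh : IntervalIntegrable h volume x₀ x₁)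
    (hd : ∀ᵐ x, x ∈ uIcc x₀ x₁ → HasDerivAt u (w x - Φ x (u x)) x ∧
      HasDerivAt w (Φ x (w x) - z • u x - h x) x) :
    ‖(u x₁, w x₁)‖ ≤ 2 * (‖(u x₀, w x₀)‖ + |∫ t in x₀..x₁, ‖h t‖|) *
      Real.exp (2 * |∫ t in x₀..x₁, (1 + ‖z‖ + ‖Φ t‖)|) := by
  have hA := locallyIntegrable_sysCLM hΦ z
  have hac : AbsolutelyContinuousOnInterval (fun x => (u x, w x)) x₀ x₁ :=
    ac_of_dist_le (C := 1) hu hw fun x _ y _ => by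
      rw [Prod.dist_eq, one_mul]
      exact max_le (le_add_of_nonneg_right dist_nonneg) (le_add_of_nonneg_left dist_nonneg)
  have hb : IntervalIntegrable (fun t => ((0, -h t) : Vec m × Vec m)) volume x₀ x₁ := by
    rw [intervalIntegrable_iff] at hh ⊢
    refine hh.norm.mono' (aestronglyMeasurable_const.prodMk hh.aestronglyMeasurable.neg)
      (Eventually.of_forall fun t => ?_)
    simp
  have hkey : ∀ x ∈ uIcc x₀ x₁, (fun x => (u x, w x)) x = (fun x => (u x, w x)) x₀ +
      ∫ t in x₀..x, ((sysCLM z (Φ t)).restrictScalars ℝ ((fun x => (u x, w x)) t) +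
        ((0, -h t) : Vec m × Vec m)) := by
    intro x hx
    have hsub : uIcc x₀ x ⊆ uIcc x₀ x₁ := uIcc_subset_uIcc left_mem_uIcc hx
    rw [ac_integral_eq_sub (f := fun x => (u x, w x)) (hac.mono hsub)
      ((intervalIntegrable_clm_apply hA (hac.continuousOn.mono hsub)).add
      (hb.mono_set hsub))]
    · simp
    · filter_upwards [hd] with t ht htx
      have := (ht (hsub htx)).1.prodMk (ht (hsub htx)).2
      have e : ((sysCLM z (Φ t)).restrictScalars ℝ) (u t, w t) + ((0, -h t) : Vec m × Vec m) =
          (w t - Φ t (u t), Φ t (w t) - z • u t - h t) := by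
        simp [sysCLM_apply, sub_eq_add_neg]
      rw [e]
      exact this
  refine (linear_ode_bound hA (y := fun x => (u x, w x)) hac.continuousOn hb hkey).trans ?_
  have e : ∀ t, ‖((0, -h t) : Vec m × Vec m)‖ = ‖h t‖ := fun t => by simp
  simp only [e]
  refine mul_le_mul_of_nonneg_left (Real.exp_le_exp.2 ?_) (by positivity)
  refine mul_le_mul_of_nonneg_left ?_ (by norm_num)
  rw [intervalIntegral.abs_intervalIntegral_eq, intervalIntegral.abs_intervalIntegral_eq,
    abs_of_nonneg (integral_nonneg fun t => norm_nonneg _),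
    abs_of_nonneg (integral_nonneg fun t => by positivity)]
  have h1 : LocallyIntegrable (fun t => 1 + ‖z‖ + ‖Φ t‖) volume :=
    (locallyIntegrable_const _).add (locallyIntegrable_norm hΦ.locInt)
  refine integral_mono
    (intervalIntegrable_iff.1 (locallyIntegrable_intervalIntegrable hA x₀ x₁)).norm
    (intervalIntegrable_iff.1 (locallyIntegrable_intervalIntegrable h1 x₀ x₁)) fun t => ?_
  rw [ContinuousLinearMap.norm_restrictScalars]
  exact norm_sysCLM_le z (Φ t)

namespace IsTau

variable {z : ℂ} {h k u w u' w' : ℝ → Vec m}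

theorem deriv_snd (H : IsTau Φ z h u w) :
    ∀ᵐ x, HasDerivAt w (Φ x (w x) - z • u x - h x) x := by
  filter_upwards [H.snd.deriv] with x hx
  have e : (-(z • u + h)) x - (-Φ) x (w x) = Φ x (w x) - z • u x - h x := by
    simp only [Pi.neg_apply, Pi.add_apply, Pi.smul_apply, _root_.neg_apply]
    abel
  rwa [e] at hx

theorem locInt (H : IsTau Φ z h u w) : LocallyIntegrable h volume := by
  have := H.snd.locInt.neg.sub (H.fst.continuous.const_smul z).locallyIntegrable
  refine this.congr ?_
  refine Eventually.of_forall fun x => ?_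
  simp

theorem bound (hΦ : IsPotential Φ) (H : IsTau Φ z h u w) (x₀ x₁ : ℝ) :
    ‖(u x₁, w x₁)‖ ≤ 2 * (‖(u x₀, w x₀)‖ + |∫ t in x₀..x₁, ‖h t‖|) *
      Real.exp (2 * |∫ t in x₀..x₁, (1 + ‖z‖ + ‖Φ t‖)|) :=
  tau_bound hΦ (H.fst.ac x₀ trivial x₁ trivial) (H.snd.ac x₀ trivial x₁ trivial)
    (locallyIntegrable_intervalIntegrable H.locInt _ _) (by
      filter_upwards [H.fst.deriv, H.deriv_snd] with x h1 h2 _ using ⟨h1, h2⟩)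

theorem add (H : IsTau Φ z h u w) (H' : IsTau Φ z k u' w') :
    IsTau Φ z (h + k) (u + u') (w + w') := by
  refine ⟨H.fst.add H'.fst, ?_⟩
  convert H.snd.add H'.snd using 1
  rw [smul_add]; abel

theorem const_smul (H : IsTau Φ z h u w) (c : ℂ) : IsTau Φ z (c • h) (c • u) (c • w) := by
  refine ⟨H.fst.const_smul c, ?_⟩
  convert H.snd.const_smul c using 1
  rw [smul_neg, smul_add, smul_comm]

theorem sub (H : IsTau Φ z h u w) (H' : IsTau Φ z k u' w') :
    IsTau Φ z (h - k) (u - u') (w - w') := by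
  have := H.add (H'.const_smul (-1))
  simpa [sub_eq_add_neg] using this

/-- Uniqueness. -/
theorem eq_of_eq (hΦ : IsPotential Φ) (H : IsTau Φ z h u w) (H' : IsTau Φ z h u' w') {x₀ : ℝ}
    (h1 : u x₀ = u' x₀) (h2 : w x₀ = w' x₀) : u = u' ∧ w = w' := by
  have hs := H.sub H'
  have h0 : ∀ x, ((u - u') x, (w - w') x) = 0 := fun x => by
    have := hs.bound hΦ x₀ x
    simpa [h1, h2] using this
  constructor
  · ext1 x
    exact sub_eq_zero.1 (congrArg Prod.fst (h0 x))
  · ext1 x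
    exact sub_eq_zero.1 (congrArg Prod.snd (h0 x))

end IsTau

/-- The solution of `τ u = z u` with `(u, u^{[1]})(x₀) = C`. -/
def tauSol (Φ : ℝ → Vec m →L[ℂ] Vec m) (z : ℂ) (x₀ : ℝ) (C : Vec m × Vec m) :
    ℝ → Vec m × Vec m :=
  Classical.epsilon fun y => IsTau Φ z 0 (fun x => (y x).1) (fun x => (y x).2) ∧ y x₀ = C

/-! ### Linear dependence of solutions on their initial data. -/

section Flow

variable (hΦ : IsPotential Φ) (z : ℂ) (x₀ : ℝ)
include hΦ

theorem tauSol_spec (C : Vec m × Vec m) :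
    IsTau Φ z 0 (fun x => (tauSol Φ z x₀ C x).1) (fun x => (tauSol Φ z x₀ C x).2) ∧
      tauSol Φ z x₀ C x₀ = C :=
  Classical.epsilon_spec (exists_isTau hΦ z (by
    exact (continuous_zero : Continuous (0 : ℝ → Vec m)).locallyIntegrable) x₀ C)

theorem isTau_tauSol (C : Vec m × Vec m) :
    IsTau Φ z 0 (fun x => (tauSol Φ z x₀ C x).1) (fun x => (tauSol Φ z x₀ C x).2) :=
  (tauSol_spec hΦ z x₀ C).1

theorem tauSol_self (C : Vec m × Vec m) : tauSol Φ z x₀ C x₀ = C := (tauSol_spec hΦ z x₀ C).2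

theorem eq_tauSol {u w : ℝ → Vec m} (H : IsTau Φ z 0 u w) (x : ℝ) :
    (u x, w x) = tauSol Φ z x₀ (u x₀, w x₀) x := by
  have hs := tauSol_self hΦ z x₀ (u x₀, w x₀)
  obtain ⟨h1, h2⟩ := H.eq_of_eq hΦ (isTau_tauSol hΦ z x₀ (u x₀, w x₀)) (x₀ := x₀)
    (by rw [hs]) (by rw [hs])
  exact Prod.ext (congrFun h1 x) (congrFun h2 x)

theorem tauSol_add (C C' : Vec m × Vec m) (x : ℝ) :
    tauSol Φ z x₀ (C + C') x = tauSol Φ z x₀ C x + tauSol Φ z x₀ C' x := by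
  have h := (isTau_tauSol hΦ z x₀ C).add (isTau_tauSol hΦ z x₀ C')
  rw [add_zero] at h
  have h2 := eq_tauSol hΦ z x₀ h x
  simp only [Pi.add_apply, tauSol_self hΦ] at h2
  exact h2.symm

theorem tauSol_smul (c : ℂ) (C : Vec m × Vec m) (x : ℝ) :
    tauSol Φ z x₀ (c • C) x = c • tauSol Φ z x₀ C x := by
  have h := (isTau_tauSol hΦ z x₀ C).const_smul c
  rw [smul_zero] at h
  have h2 := eq_tauSol hΦ z x₀ h x
  simp only [Pi.smul_apply, tauSol_self hΦ] at h2
  exact h2.symm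

end Flow

end Tau

/-! ### The adjoint of the maximal first-order operator -/

section Adjoint

variable {m : ℕ} {Φ : ℝ → Vec m →L[ℂ] Vec m}

theorem inner_toLp {u w : ℝ → Vec m} (hu : MemLp u 2 volume) (hw : MemLp w 2 volume) :
    inner ℂ (hu.toLp u) (hw.toLp w) = ∫ x, inner ℂ (u x) (w x) := by
  rw [L2.inner_def]
  refine integral_congr_ae ?_
  filter_upwards [hu.coeFn_toLp, hw.coeFn_toLp] with x h1 h2
  rw [h1, h2]

/-- A linear map into square integrable functions, as a linear map into `L²`. -/
def toLpLin {W : Type*} [AddCommGroup W] [Module ℂ W] (E : W →ₗ[ℂ] (ℝ → Vec m))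
    (h : ∀ c, MemLp (E c) 2 (volume : Measure ℝ)) : W →ₗ[ℂ] L2 m where
  toFun c := (h c).toLp (E c)
  map_add' c c' := by
    rw [← MemLp.toLp_add (h c) (h c')]
    exact MemLp.toLp_congr _ _ (by rw [map_add])
  map_smul' a c := by
    rw [RingHom.id_apply, ← MemLp.toLp_const_smul a (h c)]
    exact MemLp.toLp_congr _ _ (by rw [map_smul])

theorem memLp_indicator_of_continuous {u : ℝ → Vec m} (hu : Continuous u) (a b : ℝ) :
    MemLp ((Ioc a b).indicator u) 2 volume := by
  rw [memLp_indicator_iff_restrict measurableSet_Ioc]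
  obtain ⟨C, hC⟩ := isCompact_Icc.exists_bound_of_continuousOn (s := Icc a b) hu.continuousOn
  refine MemLp.of_bound hu.aestronglyMeasurable C ?_
  exact (ae_restrict_iff' measurableSet_Ioc).2
    (Eventually.of_forall fun x hx => hC x (Ioc_subset_Icc_self hx))

theorem memLp_of_continuous_of_zero {u : ℝ → Vec m} (hu : Continuous u) {a b : ℝ}
    (h1 : ∀ x ≤ a, u x = 0) (h2 : ∀ x, b ≤ x → u x = 0) : MemLp u 2 volume :=
  hu.memLp_of_hasCompactSupport (HasCompactSupport.intro (isCompact_Icc (a := a) (b := b))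
    fun x hx => by
      by_cases h : x ≤ a
      · exact h1 x h
      · refine h2 x ?_
        by_contra hb
        exact hx ⟨(not_le.1 h).le, (not_le.1 hb).le⟩)

/-- At `z = 0` the equation for the quasi-derivative decouples, so the second component of the
second-order system solves the first-order one. -/
theorem exists_isD_neg (hΦ : IsPotential Φ) {f : ℝ → Vec m} (hf : LocallyIntegrable f volume)
    (x₀ : ℝ) (c : Vec m) : ∃ u, IsD (-Φ) u f ∧ u x₀ = c := by
  obtain ⟨y, hy, hyx⟩ := exists_isTau hΦ 0 hf.neg x₀ (0, c)
  refine ⟨fun x => (y x).2, ?_, congrArg Prod.snd hyx⟩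
  have := hy.snd
  simpa using this

theorem exists_isD (hΦ : IsPotential Φ) {f : ℝ → Vec m} (hf : LocallyIntegrable f volume)
    (x₀ : ℝ) (c : Vec m) : ∃ u, IsD Φ u f ∧ u x₀ = c := by
  have := exists_isD_neg hΦ.neg hf x₀ c
  rwa [neg_neg] at this

/-- The solutions of `w' = Φ w`, parametrized by their value at `x₀`. -/
def adjointFlow (hΦ : IsPotential Φ) (x₀ : ℝ) : Vec m →ₗ[ℂ] (ℝ → Vec m) where
  toFun c x := (tauSol Φ 0 x₀ (0, c) x).2
  map_add' c c' := by
    ext1 x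
    have e : ((0, c + c') : Vec m × Vec m) = (0, c) + (0, c') := by simp
    rw [e, tauSol_add hΦ]
    rfl
  map_smul' a c := by
    ext1 x
    have e : ((0, a • c) : Vec m × Vec m) = a • (0, c) := by simp
    rw [e, tauSol_smul hΦ]
    rfl

theorem isD_adjointFlow (hΦ : IsPotential Φ) (x₀ : ℝ) (c : Vec m) :
    IsD (-Φ) (adjointFlow hΦ x₀ c) 0 := by
  have := (isTau_tauSol hΦ 0 x₀ (0, c)).snd
  rw [zero_smul, add_zero, neg_zero] at this
  exact this

theorem adjointFlow_self (hΦ : IsPotential Φ) (x₀ : ℝ) (c : Vec m) :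
    adjointFlow hΦ x₀ c x₀ = c := by
  change (tauSol Φ 0 x₀ (0, c) x₀).2 = c
  rw [tauSol_self hΦ]

/-- Apply Green to `v` and the adjoint solution whose value at `x` is `v x`: what remains is `‖v x‖²
= 0`. -/
theorem IsD.eq_zero (hΦ : IsPotential Φ) {v f : ℝ → Vec m} (hv : IsD Φ v f) {x₀ x : ℝ}
    (h0 : v x₀ = 0) (hf : ∀ c, ∫ t in x₀..x, inner ℂ (f t) (adjointFlow hΦ x c t) = 0) :
    v x = 0 := by
  have h := green hΦ hv (isD_adjointFlow hΦ x (v x)) x₀ x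
  simp only [Pi.zero_apply, inner_zero_right, add_zero, hf, h0, inner_zero_left, sub_zero,
    adjointFlow_self] at h
  exact inner_self_eq_zero.1 h.symm

/-- On a bounded interval take a particular solution `B` and remove from `b - B` its projection onto
the adjoint homogeneous solutions. The remainder `f` is orthogonal to those, so the solution of `v'
+ Φ v = f` starting from `0` also ends at `0`; it is compactly supported and may be tested. The
orthogonality relation and Green then give `(f, b - B) = 0`, hence `f = 0`, and `b` is `B` plus a
homogeneous solution. -/
theorem exists_isD_of_orthogonal_Ioc (hΦ : IsPotential Φ) {a b : ℝ → Vec m}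
    (ha : MemLp a 2 volume) (hb : MemLp b 2 volume)
    (hyp : ∀ v f, IsD Φ v f → MemLp v 2 volume → MemLp f 2 volume →
      ∫ x, (inner ℂ (v x) (a x) + inner ℂ (f x) (b x)) = 0) {R : ℝ} (hR : 0 < R) :
    ∃ B, IsD (-Φ) B a ∧ ∀ᵐ x, x ∈ Ioc (-R) R → b x = B x := by
  have hRR : -R ≤ R := by linarith
  obtain ⟨B, hB, -⟩ := exists_isD_neg hΦ (ha.locallyIntegrable (by norm_num)) R 0
  set S := Ioc (-R) R with hS
  let F : Vec m →ₗ[ℂ] (ℝ → Vec m) :=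
    { toFun := fun c => S.indicator (adjointFlow hΦ R c)
      map_add' := fun c c' => by rw [map_add]; exact indicator_add _ _ _
      map_smul' := fun a c => by rw [map_smul]; exact indicator_const_smul S a _ }
  have hF : ∀ c, MemLp (F c) 2 volume := fun c =>
    memLp_indicator_of_continuous (isD_adjointFlow hΦ R c).continuous _ _
  let L : Vec m →ₗ[ℂ] L2 m := toLpLin F hF
  have hx : MemLp (S.indicator (b - B)) 2 volume := by
    have e : S.indicator (b - B) = S.indicator b - S.indicator B := indicator_sub _ _ _
    rw [e]
    exact (hb.indicator measurableSet_Ioc).sub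
      (memLp_indicator_of_continuous hB.continuous _ _)
  let x : L2 m := hx.toLp _
  obtain ⟨c, hc⟩ : (LinearMap.range L).starProjection x ∈ LinearMap.range L :=
    Submodule.starProjection_apply_mem _ x
  have hperp : ∀ c', inner ℂ (x - L c) (L c') = 0 := fun c' => by
    rw [hc]
    exact Submodule.starProjection_inner_eq_zero x _ ⟨c', rfl⟩
  -- the difference is represented by `f`, which drives a compactly supported solution
  let f : ℝ → Vec m := S.indicator (b - B - adjointFlow hΦ R c)
  have hfe : f = S.indicator (b - B) - F c := indicator_sub _ _ _
  have hf2 : MemLp f 2 volume := by rw [hfe]; exact hx.sub (hF c)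
  have hfx : hf2.toLp f = x - L c := by
    change _ = hx.toLp _ - (hF c).toLp _
    rw [← MemLp.toLp_sub]
    exact MemLp.toLp_congr _ _ (by rw [hfe])
  have hf0 : ∀ t, t ∉ S → f t = 0 := fun t ht => indicator_of_notMem ht _
  have hloc : ∀ G : ℝ → ℂ, (∀ t, t ∉ S → G t = 0) → ∫ t in (-R)..R, G t = ∫ t, G t := fun G hG => by
    rw [intervalIntegral.integral_of_le hRR]
    exact setIntegral_eq_integral_of_forall_compl_eq_zero hG
  have hfe0 : ∀ c', ∫ t in (-R)..R, inner ℂ (f t) (adjointFlow hΦ R c' t) = 0 := fun c' => by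
    rw [hloc _ fun t ht => by rw [hf0 t ht, inner_zero_left], ← hperp c', ← hfx]
    refine Eq.trans ?_ (inner_toLp hf2 (hF c')).symm
    refine integral_congr_ae (Eventually.of_forall fun t => ?_)
    by_cases ht : t ∈ S
    · change _ = inner ℂ (f t) (S.indicator (adjointFlow hΦ R c') t)
      rw [indicator_of_mem ht]
    · simp only [hf0 t ht, inner_zero_left]
  obtain ⟨v, hv, hvR⟩ := exists_isD hΦ (hf2.locallyIntegrable (by norm_num)) (-R) 0
  have hvR' : v R = 0 := hv.eq_zero hΦ hvR hfe0
  have hv1 : ∀ t ≤ -R, v t = 0 := fun t ht => hv.eq_zero hΦ hvR fun c' => by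
    rw [intervalIntegral.integral_symm, neg_eq_zero, intervalIntegral.integral_of_le ht]
    refine setIntegral_eq_zero_of_forall_eq_zero fun s hs => ?_
    rw [hf0 s fun h => (not_lt.2 hs.2) h.1, inner_zero_left]
  have hv2 : ∀ t, R ≤ t → v t = 0 := fun t ht => hv.eq_zero hΦ hvR' fun c' => by
    rw [intervalIntegral.integral_of_le ht]
    refine setIntegral_eq_zero_of_forall_eq_zero fun s hs => ?_
    rw [hf0 s fun h => (not_lt.2 h.2) hs.1, inner_zero_left]
  have hv0 : ∀ t, t ∉ S → v t = 0 := fun t ht => by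
    by_cases h : t ≤ -R
    · exact hv1 t h
    · refine hv2 t ?_
      by_contra hb
      exact ht ⟨not_le.1 h, (not_le.1 hb).le⟩
  have hvm : MemLp v 2 volume := memLp_of_continuous_of_zero hv.continuous hv1 hv2
  have h1 := hyp v f hv hvm hf2
  have h2 := green hΦ hv hB (-R) R
  rw [hvR, hvR', inner_zero_left, inner_zero_left, sub_zero,
    hloc _ fun t ht => by rw [hf0 t ht, hv0 t ht, inner_zero_left, inner_zero_left, add_zero]] at h2
  have i1 : Integrable (fun t => inner ℂ (v t) (a t) + inner ℂ (f t) (b t)) :=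
    (integrable_inner_of_memLp hvm ha).add (integrable_inner_of_memLp hf2 hb)
  have efB : ∀ t, inner ℂ (f t) (B t) = inner ℂ (f t) (S.indicator B t) := fun t => by
    by_cases ht : t ∈ S
    · rw [indicator_of_mem ht]
    · rw [hf0 t ht, inner_zero_left, inner_zero_left]
  have i2 : Integrable (fun t => inner ℂ (f t) (B t) + inner ℂ (v t) (a t)) := by
    simp only [efB]
    exact (integrable_inner_of_memLp hf2 (memLp_indicator_of_continuous hB.continuous _ _)).add
      (integrable_inner_of_memLp hvm ha)
  have h3 : inner ℂ (hf2.toLp f) x = 0 := by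
    refine (inner_toLp hf2 hx).trans ?_
    have h4 := integral_sub i1 i2
    rw [h1, h2, sub_zero] at h4
    rw [← h4]
    refine integral_congr_ae (Eventually.of_forall fun t => ?_)
    by_cases ht : t ∈ S
    · simp only [indicator_of_mem ht, Pi.sub_apply, inner_sub_right]
      ring
    · simp only [hf0 t ht, hv0 t ht, inner_zero_left]
      ring
  have h5 : x - L c = 0 := by
    have h6 : inner ℂ (x - L c) (x - L c) = 0 := by
      rw [inner_sub_right, hperp c, sub_zero, ← hfx, h3]
    exact inner_self_eq_zero.1 h6
  have h7 : f =ᵐ[volume] 0 := by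
    rw [h5] at hfx
    have := hf2.coeFn_toLp
    rw [hfx] at this
    exact this.symm.trans (Lp.coeFn_zero _ _ _)
  refine ⟨B + adjointFlow hΦ R c, ?_, ?_⟩
  · have := hB.add (isD_adjointFlow hΦ R c)
    rwa [add_zero] at this
  · filter_upwards [h7] with t ht hts
    have h8 : f t = b t - B t - adjointFlow hΦ R c t := indicator_of_mem hts _
    rw [h8, Pi.zero_apply, sub_sub, sub_eq_zero] at ht
    exact ht

/-- The adjoint of the maximal operator `d/dx + Φ` is the maximal operator `-d/dx + Φ`. -/
theorem exists_isD_of_orthogonal (hΦ : IsPotential Φ) {a b : ℝ → Vec m}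
    (ha : MemLp a 2 volume) (hb : MemLp b 2 volume)
    (hyp : ∀ v f, IsD Φ v f → MemLp v 2 volume → MemLp f 2 volume →
      ∫ x, (inner ℂ (v x) (a x) + inner ℂ (f x) (b x)) = 0) :
    ∃ B, IsD (-Φ) B a ∧ b =ᵐ[volume] B := by
  choose Bn hBn hbn using fun n : ℕ => exists_isD_of_orthogonal_Ioc hΦ ha hb hyp
    (R := (n : ℝ) + 1) (by positivity)
  -- The local representatives agree a.e. with `b`, hence with each other by continuity, and can be
  -- patched.
  have hcomp : ∀ n k : ℕ, n ≤ k → EqOn (Bn n) (Bn k) (Ioo (-((n : ℝ) + 1)) (n + 1)) := by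
    intro n k hnk
    refine Measure.eqOn_open_of_ae_eq (μ := volume) ?_ isOpen_Ioo (hBn n).continuous.continuousOn
      (hBn k).continuous.continuousOn
    refine (ae_restrict_iff' measurableSet_Ioo).2 ?_
    filter_upwards [hbn n, hbn k] with x h1 h2 hx
    have hnk' : (n : ℝ) ≤ k := by exact_mod_cast hnk
    rw [← h1 ⟨hx.1, hx.2.le⟩, ← h2 ⟨by linarith [hx.1], by linarith [hx.2]⟩]
  let B : ℝ → Vec m := fun x => Bn ⌈|x|⌉₊ x
  have hB : ∀ n : ℕ, EqOn B (Bn n) (Ioo (-((n : ℝ) + 1)) (n + 1)) := by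
    intro n x hx
    have h1 : x ∈ Ioo (-((⌈|x|⌉₊ : ℝ) + 1)) (⌈|x|⌉₊ + 1) := by
      have := Nat.le_ceil |x|
      constructor
      · linarith [neg_abs_le x]
      · linarith [le_abs_self x]
    rcases le_total n ⌈|x|⌉₊ with h | h
    · exact (hcomp n _ h hx).symm
    · exact hcomp _ n h h1
  refine ⟨B, ⟨fun x _ y _ => ?_, ha.locallyIntegrable (by norm_num), ?_⟩, ?_⟩
  · obtain ⟨n, hn⟩ := exists_nat_gt (max |x| |y|)
    refine ac_congr ((hBn n).ac x trivial y trivial) fun t ht => (hB n ?_).symm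
    have h1 : |x| < n := (le_max_left _ _).trans_lt hn
    have h2 : |y| < n := (le_max_right _ _).trans_lt hn
    rw [abs_lt] at h1 h2
    refine ⟨lt_of_lt_of_le ?_ ht.1, lt_of_le_of_lt ht.2 ?_⟩
    · exact lt_min (by linarith) (by linarith)
    · exact max_lt (by linarith) (by linarith)
  · filter_upwards [ae_all_iff.2 fun n => (hBn n).deriv] with x hx
    obtain ⟨n, hn⟩ := exists_nat_gt |x|
    rw [abs_lt] at hn
    have hmem : x ∈ Ioo (-((n : ℝ) + 1)) (n + 1) := ⟨by linarith, by linarith⟩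
    rw [hB n hmem]
    exact (hx n).congr_of_eventuallyEq ((hB n).eventuallyEq_of_mem (Ioo_mem_nhds hmem.1 hmem.2))
  · filter_upwards [ae_all_iff.2 hbn] with x hx
    obtain ⟨n, hn⟩ := exists_nat_gt |x|
    rw [abs_lt] at hn
    rw [hx n ⟨by linarith, by linarith⟩, hB n ⟨by linarith, by linarith⟩]

end Adjoint

/-! ### Self-adjointness of `A⁺ A` and its spectral measure -/

section SelfAdjoint

variable {m : ℕ} {Φ : ℝ → Vec m →L[ℂ] Vec m}

/-- `(f, g)` belongs to the graph of the maximal operator `d/dx + Φ`. -/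
def InGraph (Φ : ℝ → Vec m →L[ℂ] Vec m) (f g : L2 m) : Prop :=
  ∃ u, IsD Φ u g ∧ f =ᵐ[volume] u

/-- `(f, g)` belongs to the graph of `(-d/dx + Φ)(d/dx + Φ)`. -/
def InGraphH (Φ : ℝ → Vec m →L[ℂ] Vec m) (f g : L2 m) : Prop :=
  ∃ y, InGraph Φ f y ∧ InGraph (-Φ) y (-g)

theorem locallyIntegrable_coe (g : L2 m) : LocallyIntegrable g volume :=
  (Lp.memLp g).locallyIntegrable (by norm_num)

namespace InGraph

variable {f g f' g' : L2 m}

theorem neg (h : InGraph Φ f g) : InGraph Φ (-f) (-g) := by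
  obtain ⟨u, hu, hfu⟩ := h
  exact ⟨-u, hu.neg.congr (Lp.coeFn_neg g).symm, (Lp.coeFn_neg f).trans hfu.neg⟩

theorem neg_iff : InGraph Φ (-f) (-g) ↔ InGraph Φ f g :=
  ⟨fun h => by simpa using h.neg, neg⟩

theorem inner_add_inner (hΦ : IsPotential Φ) (h : InGraph Φ f g) (h' : InGraph (-Φ) f' g') :
    inner ℂ g f' + inner ℂ f g' = 0 := by
  obtain ⟨u, hu, hfu⟩ := h
  obtain ⟨w, hw, hfw⟩ := h'
  have e := green_univ hΦ hu hw ((memLp_congr_ae hfu).1 (Lp.memLp f)) (Lp.memLp g)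
    ((memLp_congr_ae hfw).1 (Lp.memLp f')) (Lp.memLp g')
  rw [L2.inner_def, L2.inner_def, ← integral_add (L2.integrable_inner g f')
    (L2.integrable_inner f g'), ← e]
  refine integral_congr_ae ?_
  filter_upwards [hfu, hfw] with x h1 h2
  rw [h1, h2]

theorem of_orthogonal (hΦ : IsPotential Φ) {a b : L2 m}
    (h : ∀ f g, InGraph Φ f g → inner ℂ f a + inner ℂ g b = 0) : InGraph (-Φ) b a := by
  obtain ⟨B, hB, hbB⟩ := exists_isD_of_orthogonal hΦ (Lp.memLp a) (Lp.memLp b)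
    fun v f hv hv2 hf2 => by
      have h1 := h (hv2.toLp v) (hf2.toLp f)
        ⟨v, hv.congr hf2.coeFn_toLp.symm, hv2.coeFn_toLp⟩
      rw [L2.inner_def, L2.inner_def, ← integral_add (L2.integrable_inner _ _)
        (L2.integrable_inner _ _)] at h1
      rw [← h1]
      refine integral_congr_ae ?_
      filter_upwards [hv2.coeFn_toLp, hf2.coeFn_toLp] with x h2 h3
      rw [h2, h3]
  exact ⟨B, hB, hbB⟩

end InGraph

/-- The graph of `d/dx + Φ` as a subspace of the Hilbert space `L² ⊕ L²`. -/
def graphSubmodule (Φ : ℝ → Vec m →L[ℂ] Vec m) : Submodule ℂ (WithLp 2 (L2 m × L2 m)) where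
  carrier := {p | InGraph Φ p.fst p.snd}
  zero_mem' := ⟨0, ⟨fun a _ b _ => by
      simpa [AbsolutelyContinuousOnInterval] using tendsto_const_nhds, locallyIntegrable_coe _, by
      filter_upwards [Lp.coeFn_zero (Vec m) 2 (volume : Measure ℝ)] with x hx
      change HasDerivAt (fun _ => (0 : Vec m)) ((0 : L2 m) x - Φ x 0) x
      rw [hx, map_zero, Pi.zero_apply, sub_zero]
      exact hasDerivAt_const x 0⟩, Lp.coeFn_zero _ _ _⟩
  add_mem' := by
    rintro p q ⟨u, hu, hpu⟩ ⟨v, hv, hqv⟩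
    exact ⟨u + v, (hu.add hv).congr (Lp.coeFn_add _ _).symm,
      (Lp.coeFn_add _ _).trans (hpu.add hqv)⟩
  smul_mem' := by
    rintro c p ⟨u, hu, hpu⟩
    exact ⟨c • u, (hu.const_smul c).congr (Lp.coeFn_smul _ _).symm,
      (Lp.coeFn_smul _ _).trans (hpu.const_smul c)⟩

theorem mem_graphSubmodule {p : WithLp 2 (L2 m × L2 m)} :
    p ∈ graphSubmodule Φ ↔ InGraph Φ p.fst p.snd := Iff.rfl

/-- This is the description of the adjoint: the orthogonal complement of the graph is the flipped
graph for `-Φ`, the sign being absorbed in `-(-d/dx + Φ)`. -/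
theorem mem_orthogonal_graphSubmodule (hΦ : IsPotential Φ) {p : WithLp 2 (L2 m × L2 m)} :
    p ∈ (graphSubmodule Φ)ᗮ ↔ InGraph (-Φ) p.snd p.fst := by
  constructor
  · intro h
    refine InGraph.of_orthogonal hΦ fun f g hfg => ?_
    have := h (WithLp.toLp 2 (f, g)) hfg
    rwa [WithLp.prod_inner_apply] at this
  · intro h q hq
    rw [WithLp.prod_inner_apply, add_comm]
    exact InGraph.inner_add_inner hΦ (mem_graphSubmodule.1 hq) h

/-- Applying the adjoint description twice exhibits the graph as its own double orthogonal
complement. -/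
theorem isClosed_graphSubmodule (hΦ : IsPotential Φ) :
    IsClosed (graphSubmodule Φ : Set (WithLp 2 (L2 m × L2 m))) := by
  have e : graphSubmodule Φ = (graphSubmodule Φ)ᗮᗮ := by
    refine le_antisymm (Submodule.le_orthogonal_orthogonal _) fun p hp => ?_
    rw [mem_graphSubmodule, ← neg_neg Φ]
    refine InGraph.of_orthogonal hΦ.neg fun f g hfg => ?_
    have := hp (WithLp.toLp 2 (g, f)) ((mem_orthogonal_graphSubmodule hΦ).2 hfg)
    rw [WithLp.prod_inner_apply] at this
    rw [add_comm]
    exact this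
  rw [e]
  exact Submodule.isClosed_orthogonal _

/-- Von Neumann's argument: project `(k, 0)` orthogonally onto the closed graph of `d/dx + Φ` and
keep the first component. This bounded self-adjoint operator is `(1 + T)⁻¹`. -/
theorem exists_isSpectralMeasure_of_graph (hΦ : IsPotential Φ) {T : L2 m →ₗ.[ℂ] L2 m}
    (hT : ∀ f g, (f, g) ∈ T.graph ↔ InGraphH Φ f g) : ∃ E, IsSpectralMeasure T E := by
  have := (isClosed_graphSubmodule hΦ).completeSpace_coe
  let P := (graphSubmodule Φ).starProjection
  let ι : L2 m →L[ℂ] WithLp 2 (L2 m × L2 m) :=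
    (WithLp.prodContinuousLinearEquiv 2 ℂ (L2 m) (L2 m)).symm.toContinuousLinearMap ∘L
      ContinuousLinearMap.inl ℂ (L2 m) (L2 m)
  let π : WithLp 2 (L2 m × L2 m) →L[ℂ] L2 m :=
    ContinuousLinearMap.fst ℂ (L2 m) (L2 m) ∘L
      (WithLp.prodContinuousLinearEquiv 2 ℂ (L2 m) (L2 m)).toContinuousLinearMap
  have hι : ∀ k, ι k = WithLp.toLp 2 (k, 0) := fun k => rfl
  have hπ : ∀ p, π p = p.fst := fun p => rfl
  have hιπ : ∀ k p, inner ℂ (ι k) p = inner ℂ k (π p) := fun k p => by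
    rw [hι, hπ, WithLp.prod_inner_apply]
    simp
  have hιπ' : ∀ k p, inner ℂ p (ι k) = inner ℂ (π p) k := fun k p => by
    rw [← inner_conj_symm, hιπ, inner_conj_symm]
  let R : L2 m →L[ℂ] L2 m := π ∘L P ∘L ι
  have hR : ∀ k, R k = (P (ι k)).fst := fun k => rfl
  -- The point `(v, y)` of the graph is the projection of `(v + r, 0)` exactly when the residual
  -- `(r, -y)` is orthogonal to the graph, that is, when the adjoint operator sends `y` to `r`.
  have hgraph : ∀ v r, (v, r) ∈ T.graph ↔ v = R (v + r) := by
    intro v r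
    rw [hT]
    constructor
    · rintro ⟨y, h1, h2⟩
      have h3 : P (ι (v + r)) = WithLp.toLp 2 (v, y) := by
        refine Submodule.eq_starProjection_of_mem_of_inner_eq_zero h1 fun q hq => ?_
        have h4 : ι (v + r) - WithLp.toLp 2 (v, y) ∈ (graphSubmodule Φ)ᗮ := by
          rw [mem_orthogonal_graphSubmodule hΦ, hι, ← InGraph.neg_iff]
          simpa using h2
        rw [← inner_conj_symm, h4 q hq, map_zero]
      exact (congrArg (fun p => p.fst) h3).symm
    · intro h
      have h1 : InGraph Φ (P (ι (v + r))).fst (P (ι (v + r))).snd :=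
        mem_graphSubmodule.1 (Submodule.starProjection_apply_mem (graphSubmodule Φ) (ι (v + r)))
      have h2 := (mem_orthogonal_graphSubmodule hΦ).1
        (Submodule.sub_starProjection_mem_orthogonal (K := graphSubmodule Φ) (ι (v + r)))
      rw [← hR, ← h] at h1
      refine ⟨_, h1, ?_⟩
      rw [← InGraph.neg_iff]
      have e1 : (ι (v + r) - P (ι (v + r))).fst = r := by
        rw [WithLp.sub_fst, ← hR, ← h, hι]
        simp
      have e2 : (ι (v + r) - P (ι (v + r))).snd = -(P (ι (v + r))).snd := by
        rw [WithLp.sub_snd, hι]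
        simp
      rw [e1, e2] at h2
      rwa [neg_neg]
  refine exists_isSpectralMeasure (R := R) ?_ (fun k hk => ?_) hgraph
  · rw [ContinuousLinearMap.isSelfAdjoint_iff_isSymmetric]
    intro x y
    change inner ℂ (π (P (ι x))) y = inner ℂ x (π (P (ι y)))
    rw [← hιπ, ← hιπ']
    exact Submodule.inner_starProjection_left_eq_right _ _ _
  · have h0 := (hgraph 0 k).2 (by rw [zero_add, hk])
    exact T.graph_fst_eq_zero_snd h0 rfl

/-! ### Identification of the operators -/

theorem mem_firstOrderGraph_one {φ : ℝ → Mat m} {f g : L2 m} :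
    (f, g) ∈ firstOrderGraph φ 1 ↔ InGraph (fun x => matCLM (φ x)) f g := by
  constructor
  · rintro ⟨u, hu, hfu, hd⟩
    refine ⟨u, ⟨hu, locallyIntegrable_coe g, ?_⟩, hfu⟩
    filter_upwards [hd] with x ⟨u', h1, h2⟩
    rw [matCLM_apply, h2, one_smul, add_sub_cancel_right]
    exact h1
  · rintro ⟨u, hu, hfu⟩
    refine ⟨u, hu.ac, hfu, ?_⟩
    filter_upwards [hu.deriv] with x hx
    exact ⟨_, hx, by rw [one_smul, matCLM_apply, sub_add_cancel]⟩

theorem mem_firstOrderGraph_neg_one {φ : ℝ → Mat m} {f g : L2 m} :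
    (f, g) ∈ firstOrderGraph φ (-1) ↔ InGraph (-fun x => matCLM (φ x)) f (-g) := by
  constructor
  · rintro ⟨u, hu, hfu, hd⟩
    refine ⟨u, ⟨hu, locallyIntegrable_coe _, ?_⟩, hfu⟩
    filter_upwards [hd, Lp.coeFn_neg g] with x ⟨u', h1, h2⟩ h3
    have e : (-g : L2 m) x - (-fun x => matCLM (φ x)) x (u x) = u' := by
      rw [h3, Pi.neg_apply, h2, Pi.neg_apply, _root_.neg_apply, matCLM_apply, neg_one_smul]
      abel
    rw [e]
    exact h1
  · rintro ⟨u, hu, hfu⟩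
    refine ⟨u, hu.ac, hfu, ?_⟩
    filter_upwards [hu.deriv, Lp.coeFn_neg g] with x hx h3
    refine ⟨_, hx, ?_⟩
    rw [h3, Pi.neg_apply, Pi.neg_apply, _root_.neg_apply, matCLM_apply, neg_one_smul]
    change g x = _
    abel

theorem graph_opA (φ : ℝ → Mat m) : (opA φ).graph = firstOrderGraph φ 1 :=
  Submodule.toLinearPMap_graph_eq _ (firstOrderGraph_single φ 1)

theorem graph_opAPlus (φ : ℝ → Mat m) : (opAPlus φ).graph = firstOrderGraph φ (-1) :=
  Submodule.toLinearPMap_graph_eq _ (firstOrderGraph_single φ (-1))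

theorem graph_opProd (T S : L2 m →ₗ.[ℂ] L2 m) : (opProd T S).graph = prodGraph T S :=
  Submodule.toLinearPMap_graph_eq _ (prodGraph_single T S)

/-- The potential `(-1)^{j+1} φ`. -/
def pot (φ : ℝ → Mat m) (j : ℕ) : ℝ → Vec m →L[ℂ] Vec m :=
  fun x => matCLM ((-1 : ℂ) ^ (j + 1) • φ x)

theorem pot_one (φ : ℝ → Mat m) : pot φ 1 = fun x => matCLM (φ x) := by
  ext1 x; simp [pot]

theorem pot_two (φ : ℝ → Mat m) : pot φ 2 = -fun x => matCLM (φ x) := by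
  ext1 x
  have : (-1 : ℂ) ^ (2 + 1) = -1 := by norm_num
  simp only [pot, this, neg_smul, one_smul, map_neg, Pi.neg_apply]

theorem isPotential_pot {φ : ℝ → Mat m}
    (h : ∀ i k, LocallyIntegrable (fun x => φ x i k) (volume : Measure ℝ))
    (hs : ∀ᵐ x : ℝ, (φ x).IsHermitian) {j : ℕ} (hj : j = 1 ∨ j = 2) : IsPotential (pot φ j) := by
  rcases hj with rfl | rfl
  · rw [pot_one]; exact isPotential_matCLM h hs
  · rw [pot_two]; exact (isPotential_matCLM h hs).neg

/-- Replacing `φ` by `-φ` exchanges `A` and `-A⁺`; for `j = 2` the intermediate vector therefore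
changes sign, and the two signs cancel in the product. -/
theorem mem_graph_opH (φ : ℝ → Mat m) {j : ℕ} (hj : j = 1 ∨ j = 2) (f g : L2 m) :
    (f, g) ∈ (opH φ j).graph ↔ InGraphH (pot φ j) f g := by
  rcases hj with rfl | rfl
  · rw [pot_one, opH, if_pos rfl, graph_opProd]
    change (∃ y, (f, y) ∈ (opA φ).graph ∧ (y, g) ∈ (opAPlus φ).graph) ↔ _
    simp only [graph_opA, graph_opAPlus, mem_firstOrderGraph_one, mem_firstOrderGraph_neg_one]
    rfl
  · rw [pot_two, opH, if_neg (by norm_num), graph_opProd]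
    change (∃ y, (f, y) ∈ (opAPlus φ).graph ∧ (y, g) ∈ (opA φ).graph) ↔ _
    simp only [graph_opA, graph_opAPlus, mem_firstOrderGraph_one, mem_firstOrderGraph_neg_one,
      InGraphH, neg_neg]
    constructor
    · rintro ⟨y, h1, h2⟩
      exact ⟨-y, h1, h2.neg⟩
    · rintro ⟨y, h1, h2⟩
      refine ⟨-y, by rwa [neg_neg], ?_⟩
      rw [← InGraph.neg_iff, neg_neg]
      exact h2

theorem isSpectralMeasure_opH {φ : ℝ → Mat m}
    (h : ∀ i k, LocallyIntegrable (fun x => φ x i k) (volume : Measure ℝ))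
    (hs : ∀ᵐ x : ℝ, (φ x).IsHermitian) {j : ℕ} (hj : j = 1 ∨ j = 2) :
    IsSpectralMeasure (opH φ j) (spectralMeasure (opH φ j)) :=
  Classical.epsilon_spec
    (exists_isSpectralMeasure_of_graph (isPotential_pot h hs hj) (mem_graph_opH φ hj))

end SelfAdjoint

/-! ### Green's identity for the second-order equation -/

section Weyl

variable {m : ℕ} {Φ : ℝ → Vec m →L[ℂ] Vec m}

/-- The boundary form `(p^{[1]}, q) - (p, q^{[1]})`. -/
def bdry (p q : Vec m × Vec m) : ℂ := inner ℂ p.2 q.1 - inner ℂ p.1 q.2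

section SecondGreen

variable {p p1 P q q1 Q : ℝ → Vec m}

/-- The second-order identity is the difference of one first-order identity and the conjugate of the
other; the common term `∫ (p1, q1)` drops out. -/
theorem integral_green_pair {μ : Measure ℝ} {b1 b2 : ℂ}
    (i1 : Integrable (fun x => inner ℂ (p1 x) (q1 x)) μ)
    (i2 : Integrable (fun x => inner ℂ (p x) (Q x)) μ)
    (i3 : Integrable (fun x => inner ℂ (P x) (q x)) μ)
    (h1 : ∫ x, (inner ℂ (p1 x) (q1 x) + inner ℂ (p x) ((-Q) x)) ∂μ = b1)
    (h2 : ∫ x, (inner ℂ (q1 x) (p1 x) + inner ℂ (q x) ((-P) x)) ∂μ = b2) :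
    ∫ x, (inner ℂ (p x) (Q x) - inner ℂ (P x) (q x)) ∂μ = star b2 - b1 := by
  have h3 : ∫ x, (inner ℂ (p1 x) (q1 x) - inner ℂ (P x) (q x)) ∂μ = star b2 := by
    rw [← h2, Complex.star_def, ← integral_conj]
    refine integral_congr_ae (Eventually.of_forall fun x => ?_)
    simp only [map_add, inner_conj_symm, Pi.neg_apply, inner_neg_right, map_neg, sub_eq_add_neg]
  have h4 : ∫ x, (inner ℂ (p1 x) (q1 x) - inner ℂ (p x) (Q x)) ∂μ = b1 := by
    rw [← h1]
    refine integral_congr_ae (Eventually.of_forall fun x => ?_)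
    simp only [Pi.neg_apply, inner_neg_right, sub_eq_add_neg]
  rw [integral_sub i2 i3]
  rw [integral_sub i1 i3] at h3
  rw [integral_sub i1 i2] at h4
  rw [← h3, ← h4]
  ring

variable (hΦ : IsPotential Φ) (hp : IsD Φ p p1) (hp1 : IsD (-Φ) p1 (-P)) (hq : IsD Φ q q1)
  (hq1 : IsD (-Φ) q1 (-Q))

include hΦ hp hp1 hq hq1

theorem green_second {a b : ℝ} (hab : a ≤ b) :
    ∫ x in a..b, (inner ℂ (p x) (Q x) - inner ℂ (P x) (q x)) =
      bdry (p b, p1 b) (q b, q1 b) - bdry (p a, p1 a) (q a, q1 a) := by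
  have h1 := green hΦ hp hq1 a b
  have h2 := green hΦ hq hp1 a b
  have hQ := hq1.locInt.neg
  have hP := hp1.locInt.neg
  rw [neg_neg] at hQ hP
  have i1 := intervalIntegrable_inner_left hq.locInt hp1.continuous a b
  have i1' := (intervalIntegrable_inner_left hp.locInt hq1.continuous a b)
  have i2 := intervalIntegrable_inner_right hQ hp.continuous a b
  have i3 := intervalIntegrable_inner_left hP hq.continuous a b
  rw [intervalIntegrable_iff_integrableOn_Ioc_of_le hab] at i1' i2 i3
  rw [intervalIntegral.integral_of_le hab] at h1 h2 ⊢
  rw [integral_green_pair i1' i2 i3 h1 h2]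
  simp only [bdry, star_sub, Complex.star_def, inner_conj_symm]
  ring

theorem green_second_Ioi (x₀ : ℝ) (h1 : MemLp p 2 (volume.restrict (Ioi x₀)))
    (h2 : MemLp p1 2 (volume.restrict (Ioi x₀))) (h3 : MemLp P 2 (volume.restrict (Ioi x₀)))
    (h4 : MemLp q 2 (volume.restrict (Ioi x₀))) (h5 : MemLp q1 2 (volume.restrict (Ioi x₀)))
    (h6 : MemLp Q 2 (volume.restrict (Ioi x₀))) :
    ∫ x in Ioi x₀, (inner ℂ (p x) (Q x) - inner ℂ (P x) (q x)) =
      -bdry (p x₀, p1 x₀) (q x₀, q1 x₀) := by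
  rw [integral_green_pair (integrable_inner_of_memLp h2 h5) (integrable_inner_of_memLp h1 h6)
    (integrable_inner_of_memLp h3 h4) (green_Ioi hΦ hp hq1 x₀ h1 h2 h5 h6.neg)
    (green_Ioi hΦ hq hp1 x₀ h4 h5 h2 h3.neg)]
  simp only [bdry, star_neg, Complex.star_def, inner_conj_symm]
  ring

theorem green_second_Iic (x₀ : ℝ) (h1 : MemLp p 2 (volume.restrict (Iic x₀)))
    (h2 : MemLp p1 2 (volume.restrict (Iic x₀))) (h3 : MemLp P 2 (volume.restrict (Iic x₀)))
    (h4 : MemLp q 2 (volume.restrict (Iic x₀))) (h5 : MemLp q1 2 (volume.restrict (Iic x₀)))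
    (h6 : MemLp Q 2 (volume.restrict (Iic x₀))) :
    ∫ x in Iic x₀, (inner ℂ (p x) (Q x) - inner ℂ (P x) (q x)) =
      bdry (p x₀, p1 x₀) (q x₀, q1 x₀) := by
  rw [integral_green_pair (integrable_inner_of_memLp h2 h5) (integrable_inner_of_memLp h1 h6)
    (integrable_inner_of_memLp h3 h4) (green_Iic hΦ hp hq1 x₀ h1 h2 h5 h6.neg)
    (green_Iic hΦ hq hp1 x₀ h4 h5 h2 h3.neg)]
  simp only [bdry, Complex.star_def, inner_conj_symm]

end SecondGreen

/-! ### Square integrable solutions -/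

theorem isTau_zero (Φ : ℝ → Vec m →L[ℂ] Vec m) (z : ℂ) : IsTau Φ z 0 0 0 := by
  have h : ∀ Ψ : ℝ → Vec m →L[ℂ] Vec m, IsD Ψ 0 0 := fun Ψ => by
    refine ⟨fun a _ b _ => by
      simpa [AbsolutelyContinuousOnInterval] using tendsto_const_nhds,
      (continuous_zero : Continuous (0 : ℝ → Vec m)).locallyIntegrable,
      Eventually.of_forall fun x => ?_⟩
    simp
  refine ⟨h _, ?_⟩
  rw [smul_zero, add_zero, neg_zero]
  exact h _

theorem IsTau.eq_zero {z : ℂ} {u w : ℝ → Vec m} (hΦ : IsPotential Φ) (H : IsTau Φ z 0 u w) {x : ℝ}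
    (h1 : u x = 0) (h2 : w x = 0) : u = 0 ∧ w = 0 :=
  H.eq_of_eq hΦ (isTau_zero Φ z) (x₀ := x) h1 h2

theorem ae_eq_zero_of_integral_inner {μ : Measure ℝ} {u : ℝ → Vec m} (hu : MemLp u 2 μ)
    (h : ∫ x, inner ℂ (u x) (u x) ∂μ = 0) : u =ᵐ[μ] 0 := by
  have e : ∀ x, inner ℂ (u x) (u x) = ((‖u x‖ ^ 2 : ℝ) : ℂ) := fun x => by
    rw [inner_self_eq_norm_sq_to_K]; norm_cast
  have hi := integrable_inner_of_memLp hu hu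
  simp only [e] at h hi
  rw [integral_complex_ofReal, Complex.ofReal_eq_zero] at h
  have hi' : Integrable (fun x => ‖u x‖ ^ 2) μ := by
    have := Complex.reCLM.integrable_comp hi
    exact this.congr (Eventually.of_forall fun x => Complex.ofReal_re _)
  have := (integral_eq_zero_iff_of_nonneg (fun x => by positivity) hi').1 h
  filter_upwards [this] with x hx
  simpa using hx

/-- For non-real `z` the energy identity forces a solution to vanish. -/
theorem IsTau.eq_zero_of_energy {z : ℂ} (hz : z.im ≠ 0) {u w : ℝ → Vec m} (hΦ : IsPotential Φ)
    (H : IsTau Φ z 0 u w) {I : Set ℝ} (hI : volume I ≠ 0)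
    (hu : MemLp u 2 (volume.restrict I)) (hw : MemLp w 2 (volume.restrict I))
    (h : ∫ x in I, (inner ℂ (w x) (w x) + inner ℂ (u x) ((-(z • u + 0)) x)) = 0) :
    u = 0 ∧ w = 0 := by
  have e : ∀ v : Vec m, inner ℂ v v = ((‖v‖ ^ 2 : ℝ) : ℂ) := fun v => by
    rw [inner_self_eq_norm_sq_to_K]; norm_cast
  have h1 : ∫ x in I, inner ℂ (w x) (w x) = z * ∫ x in I, inner ℂ (u x) (u x) := by
    rw [← integral_const_mul, ← sub_eq_zero, ← integral_sub (integrable_inner_of_memLp hw hw)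
      ((integrable_inner_of_memLp hu hu).const_mul z), ← h]
    refine integral_congr_ae (Eventually.of_forall fun x => ?_)
    simp only [Pi.neg_apply, Pi.smul_apply, add_zero, inner_neg_right,
      inner_smul_right, sub_eq_add_neg]
  have h2 : ∫ x in I, inner ℂ (u x) (u x) = 0 := by
    have h3 := congrArg Complex.im h1
    simp only [e, integral_complex_ofReal] at h3 ⊢
    rw [Complex.ofReal_im, Complex.im_mul_ofReal] at h3
    rw [Complex.ofReal_eq_zero]
    exact (mul_eq_zero.1 h3.symm).resolve_left hz
  rw [h2, mul_zero] at h1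
  have : NeZero (volume.restrict I) := ⟨by rwa [Ne, Measure.restrict_eq_zero]⟩
  obtain ⟨x, hx1, hx2⟩ := ((ae_eq_zero_of_integral_inner hu h2).and
    (ae_eq_zero_of_integral_inner hw h1)).exists
  exact H.eq_zero hΦ hx1 hx2

/-- The initial data at `x₀` of the solutions of `τ u = z u` which are square integrable, together
with their quasi-derivatives, over `I`. -/
def weylSpace (hΦ : IsPotential Φ) (z : ℂ) (x₀ : ℝ) (I : Set ℝ) : Submodule ℂ (Vec m × Vec m) where
  carrier := {C | MemLp (fun x => (tauSol Φ z x₀ C x).1) 2 (volume.restrict I) ∧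
    MemLp (fun x => (tauSol Φ z x₀ C x).2) 2 (volume.restrict I)}
  zero_mem' := by
    have h0 : ∀ x, tauSol Φ z x₀ 0 x = 0 := fun x => by
      have := tauSol_smul hΦ z x₀ 0 0 x
      simpa using this
    rw [mem_ofPred_eq]
    simp only [h0, Prod.fst_zero, Prod.snd_zero]
    exact ⟨MemLp.zero', MemLp.zero'⟩
  add_mem' := by
    rintro C C' ⟨h1, h2⟩ ⟨h3, h4⟩
    rw [mem_ofPred_eq]
    simp only [tauSol_add hΦ, Prod.fst_add, Prod.snd_add]
    exact ⟨h1.add h3, h2.add h4⟩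
  smul_mem' := by
    rintro c C ⟨h1, h2⟩
    rw [mem_ofPred_eq]
    simp only [tauSol_smul hΦ, Prod.smul_fst, Prod.smul_snd]
    exact ⟨h1.const_smul c, h2.const_smul c⟩

theorem mem_weylSpace {hΦ : IsPotential Φ} {z : ℂ} {x₀ : ℝ} {I : Set ℝ} {C : Vec m × Vec m} :
    C ∈ weylSpace hΦ z x₀ I ↔ MemLp (fun x => (tauSol Φ z x₀ C x).1) 2 (volume.restrict I) ∧
      MemLp (fun x => (tauSol Φ z x₀ C x).2) 2 (volume.restrict I) := Iff.rfl

theorem mem_weylSpace_of_eqOn {hΦ : IsPotential Φ} {z : ℂ} {x₀ : ℝ} {I : Set ℝ}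
    (hI : MeasurableSet I) {C : Vec m × Vec m} {u w : ℝ → Vec m}
    (h : ∀ x ∈ I, (u x, w x) = tauSol Φ z x₀ C x) (hu : MemLp u 2 (volume.restrict I))
    (hw : MemLp w 2 (volume.restrict I)) : C ∈ weylSpace hΦ z x₀ I := by
  refine mem_weylSpace.2 ⟨(memLp_congr_ae ?_).1 hu, (memLp_congr_ae ?_).1 hw⟩
  · refine (ae_restrict_iff' hI).2 (Eventually.of_forall fun x hx => congrArg Prod.fst (h x hx))
  · refine (ae_restrict_iff' hI).2 (Eventually.of_forall fun x hx => congrArg Prod.snd (h x hx))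

theorem restrict_Ici_eq (x₀ : ℝ) :
    (volume : Measure ℝ).restrict (Ici x₀) = volume.restrict (Ioi x₀) :=
  (Measure.restrict_congr_set Ioi_ae_eq_Ici).symm

theorem memLp_of_Iic_Ioi {u : ℝ → Vec m} {x₀ : ℝ} (h1 : MemLp u 2 (volume.restrict (Iic x₀)))
    (h2 : MemLp u 2 (volume.restrict (Ioi x₀))) : MemLp u 2 volume := by
  rw [← memLp_indicator_iff_restrict measurableSet_Iic] at h1
  rw [← memLp_indicator_iff_restrict measurableSet_Ioi] at h2
  have := h1.add h2
  rwa [← compl_Iic, indicator_self_add_compl] at this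

/-! ### Half-line solutions at a non-real spectral parameter. -/

section NonReal

variable (hΦ : IsPotential Φ) {z : ℂ} (hz : z.im ≠ 0) (x₀ : ℝ)

include hz

/-- With vanishing boundary term the energy identity reads `‖w‖² = z ‖u‖²`, impossible for non-real
`z` unless both vanish. In particular the first component determines the data. -/
theorem eq_zero_of_mem_weylSpace_Ici {C : Vec m × Vec m} (hC : C ∈ weylSpace hΦ z x₀ (Ici x₀))
    (h : inner ℂ C.1 C.2 = 0) : C = 0 := by
  rw [mem_weylSpace, restrict_Ici_eq] at hC
  have H := isTau_tauSol hΦ z x₀ C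
  have hs := tauSol_self hΦ z x₀ C
  have hg := green_Ioi hΦ H.fst H.snd x₀ hC.1 hC.2 hC.2 (by
    rw [add_zero]; exact (hC.1.const_smul z).neg)
  rw [hs, h, neg_zero] at hg
  obtain ⟨h1, h2⟩ := H.eq_zero_of_energy hz hΦ (by simp) hC.1 hC.2 hg
  rw [← hs]
  exact Prod.ext (congrFun h1 x₀) (congrFun h2 x₀)

theorem eq_zero_of_mem_weylSpace_Iic {C : Vec m × Vec m} (hC : C ∈ weylSpace hΦ z x₀ (Iic x₀))
    (h : inner ℂ C.1 C.2 = 0) : C = 0 := by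
  rw [mem_weylSpace] at hC
  have H := isTau_tauSol hΦ z x₀ C
  have hs := tauSol_self hΦ z x₀ C
  have hg := green_Iic hΦ H.fst H.snd x₀ hC.1 hC.2 hC.2 (by
    rw [add_zero]; exact (hC.1.const_smul z).neg)
  rw [hs, h] at hg
  obtain ⟨h1, h2⟩ := H.eq_zero_of_energy hz hΦ (by simp) hC.1 hC.2 hg
  rw [← hs]
  exact Prod.ext (congrFun h1 x₀) (congrFun h2 x₀)

/-- A solution in both spaces is square integrable on the line, where the energy identity has no
boundary term. -/
theorem disjoint_weylSpace : Disjoint (weylSpace hΦ z x₀ (Ici x₀)) (weylSpace hΦ z x₀ (Iic x₀)) := by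
  refine Submodule.disjoint_def.2 fun C h1 h2 => ?_
  rw [mem_weylSpace, restrict_Ici_eq] at h1
  rw [mem_weylSpace] at h2
  have H := isTau_tauSol hΦ z x₀ C
  have hs := tauSol_self hΦ z x₀ C
  have hu := memLp_of_Iic_Ioi h2.1 h1.1
  have hw := memLp_of_Iic_Ioi h2.2 h1.2
  have hg := green_univ hΦ H.fst H.snd hu hw hw (by
    rw [add_zero]; exact (hu.const_smul z).neg)
  rw [← setIntegral_univ] at hg
  obtain ⟨e1, e2⟩ := H.eq_zero_of_energy hz hΦ (by simp) (hu.restrict _) (hw.restrict _) hg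
  rw [← hs]
  exact Prod.ext (congrFun e1 x₀) (congrFun e2 x₀)

end NonReal

/-! ### Dimension count and existence of half-line Weyl matrices. -/

theorem InGraphH.exists_isTau {f g : L2 m} (h : InGraphH Φ f g) (z : ℂ) {k : ℝ → Vec m}
    (hk : (g - z • f : L2 m) =ᵐ[volume] k) :
    ∃ u w, f =ᵐ[volume] u ∧ MemLp u 2 volume ∧ MemLp w 2 volume ∧ IsTau Φ z k u w := by
  obtain ⟨y, ⟨u, hu, hfu⟩, ⟨w, hw, hyw⟩⟩ := h
  refine ⟨u, w, hfu, (memLp_congr_ae hfu).1 (Lp.memLp f), (memLp_congr_ae hyw).1 (Lp.memLp y),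
    hu.congr hyw, hw.congr ?_⟩
  filter_upwards [Lp.coeFn_neg g, hk, Lp.coeFn_sub g (z • f), Lp.coeFn_smul z f, hfu] with x h1 h2
    h3 h4 h5
  rw [h1, Pi.neg_apply, Pi.neg_apply, Pi.add_apply, ← h2, h3, Pi.sub_apply, h4, Pi.smul_apply,
    Pi.smul_apply, h5]
  abel

theorem IsTau.eqOn_of_forcing_zero {z : ℂ} {h u w u' w' : ℝ → Vec m} (hΦ : IsPotential Φ)
    (H : IsTau Φ z h u w) (H' : IsTau Φ z 0 u' w') {x₀ x : ℝ} (h1 : u x₀ = u' x₀)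
    (h2 : w x₀ = w' x₀) (h0 : ∀ t ∈ uIoc x₀ x, h t = 0) : (u x, w x) = (u' x, w' x) := by
  have hs := (H.sub H').bound hΦ x₀ x
  have e : ∫ t in x₀..x, ‖(h - 0) t‖ = 0 := by
    refine intervalIntegral.integral_zero_ae (Eventually.of_forall fun t ht => ?_)
    simp [h0 t ht]
  rw [e] at hs
  simp only [Pi.sub_apply, h1, h2, sub_self] at hs
  have h3 : (u x - u' x, w x - w' x) = (0 : Vec m × Vec m) := by simpa using hs
  exact Prod.ext (sub_eq_zero.1 (congrArg Prod.fst h3)) (sub_eq_zero.1 (congrArg Prod.snd h3))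

theorem exists_inner_eq (f : (Vec m × Vec m) →ₗ[ℂ] ℂ) :
    ∃ d1 d2 : Vec m, ∀ C, f C = inner ℂ d1 C.1 + inner ℂ d2 C.2 := by
  let f1 : Vec m →L[ℂ] ℂ := LinearMap.toContinuousLinearMap (f ∘ₗ LinearMap.inl ℂ (Vec m) (Vec m))
  let f2 : Vec m →L[ℂ] ℂ := LinearMap.toContinuousLinearMap (f ∘ₗ LinearMap.inr ℂ (Vec m) (Vec m))
  refine ⟨(InnerProductSpace.toDual ℂ _).symm f1, (InnerProductSpace.toDual ℂ _).symm f2,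
    fun C => ?_⟩
  rw [InnerProductSpace.toDual_symm_apply, InnerProductSpace.toDual_symm_apply]
  change f C = f (C.1, 0) + f (0, C.2)
  rw [← map_add]
  simp

/-- Solvability of `(H - z) v = h` splits data: for `h` supported in `(x₀, x₀ + 1]`, let `q` solve
the same equation and vanish to the right. Then `v` lies in the left Weyl space at `x₀` and `v - q`
in the right one, so the data of `q` belong to the sum. A functional vanishing on the sum is
realized as the boundary form with a solution `χ` at `z̄`, and the choice `h = χ` makes Green's
identity say `∫ |χ|² = 0`. -/
theorem weylSpace_sup_eq_top (hΦ : IsPotential Φ) (z : ℂ)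
    (hsurj : ∀ k : L2 m, ∃ f g, InGraphH Φ f g ∧ g - z • f = k) (x₀ : ℝ) :
    weylSpace hΦ z x₀ (Ici x₀) ⊔ weylSpace hΦ z x₀ (Iic x₀) = ⊤ := by
  by_contra hne
  obtain ⟨f, hf0, hf⟩ := Submodule.exists_le_ker_of_lt_top _ (lt_top_iff_ne_top.2 hne)
  obtain ⟨d1, d2, hd⟩ := exists_inner_eq f
  -- These initial data are chosen so that the boundary form of `χ` with `C` at `x₀` is the
  -- functional evaluated at `C`.
  have Hχ := isTau_tauSol hΦ (starRingEnd ℂ z) x₀ (-d2, d1)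
  have hχ0 := tauSol_self hΦ (starRingEnd ℂ z) x₀ (-d2, d1)
  set χ := fun x => (tauSol Φ (starRingEnd ℂ z) x₀ (-d2, d1) x).1 with hχ
  set χ1 := fun x => (tauSol Φ (starRingEnd ℂ z) x₀ (-d2, d1) x).2 with hχ1
  let h : ℝ → Vec m := (Ioc x₀ (x₀ + 1)).indicator χ
  have hh : MemLp h 2 volume := memLp_indicator_of_continuous Hχ.fst.continuous _ _
  have hxx : x₀ ≤ x₀ + 1 := by linarith
  -- the `L²` solution and the solution vanishing to the right
  obtain ⟨a, b, hab, hk⟩ := hsurj (hh.toLp h)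
  obtain ⟨v, v1, -, hv, hv1, Hv⟩ := hab.exists_isTau z (k := h) (by rw [hk]; exact hh.coeFn_toLp)
  obtain ⟨y, Hy, hyx⟩ := exists_isTau hΦ z (hh.locallyIntegrable (by norm_num)) (x₀ + 1) 0
  set q := fun x => (y x).1 with hq
  set q1 := fun x => (y x).2 with hq1
  have hq0 : ∀ x, x₀ + 1 ≤ x → q x = 0 ∧ q1 x = 0 := fun x hx => by
    have := Hy.eqOn_of_forcing_zero hΦ (isTau_zero Φ z) (x₀ := x₀ + 1) (x := x)
      (congrArg Prod.fst hyx) (congrArg Prod.snd hyx) fun t ht => by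
        rw [uIoc_of_le hx] at ht
        exact indicator_of_notMem (fun h' => (not_lt.2 h'.2) ht.1) _
    exact ⟨congrArg Prod.fst this, congrArg Prod.snd this⟩
  have hm : (v x₀, v1 x₀) ∈ weylSpace hΦ z x₀ (Iic x₀) := by
    refine mem_weylSpace_of_eqOn measurableSet_Iic (fun x hx => ?_) (hv.restrict _) (hv1.restrict _)
    have hs := tauSol_self hΦ z x₀ (v x₀, v1 x₀)
    refine Hv.eqOn_of_forcing_zero hΦ (isTau_tauSol hΦ z x₀ (v x₀, v1 x₀)) (x₀ := x₀)
      (congrArg Prod.fst hs).symm (congrArg Prod.snd hs).symm fun t ht => ?_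
    rw [uIoc_of_ge hx] at ht
    exact indicator_of_notMem (fun h' => (not_lt.2 ht.2) h'.1) _
  have hmem : ∀ r : ℝ → Vec m, Continuous r → (∀ x, x₀ + 1 ≤ x → r x = 0) →
      MemLp r 2 (volume.restrict (Ici x₀)) := fun r hr hr0 => by
    rw [restrict_Ici_eq, ← memLp_indicator_iff_restrict measurableSet_Ioi]
    have e : (Ioi x₀).indicator r = (Ioc x₀ (x₀ + 1)).indicator r := by
      ext1 x
      by_cases h1 : x ∈ Ioi x₀
      · by_cases h2 : x ≤ x₀ + 1
        · rw [indicator_of_mem h1, indicator_of_mem (s := Ioc x₀ (x₀ + 1)) ⟨h1, h2⟩]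
        · rw [indicator_of_mem h1, indicator_of_notMem fun h' => h2 h'.2,
            hr0 x (not_le.1 h2).le]
      · rw [indicator_of_notMem h1, indicator_of_notMem fun h' => h1 h'.1]
    rw [e]
    exact memLp_indicator_of_continuous hr _ _
  have hp : (v x₀ - q x₀, v1 x₀ - q1 x₀) ∈ weylSpace hΦ z x₀ (Ici x₀) := by
    have Hd := Hv.sub Hy
    rw [sub_self] at Hd
    refine mem_weylSpace_of_eqOn measurableSet_Ici (fun x _ => eq_tauSol hΦ z x₀ Hd x)
      ((hv.restrict _).sub (hmem q Hy.fst.continuous fun x hx => (hq0 x hx).1))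
      ((hv1.restrict _).sub (hmem q1 Hy.snd.continuous fun x hx => (hq0 x hx).2))
  have hfq : f (q x₀, q1 x₀) = 0 := by
    have e : (q x₀, q1 x₀) = (v x₀, v1 x₀) - (v x₀ - q x₀, v1 x₀ - q1 x₀) := by simp
    rw [e]
    exact hf (Submodule.sub_mem _ (Submodule.mem_sup_right hm) (Submodule.mem_sup_left hp))
  have hg := green_second hΦ Hχ.fst Hχ.snd Hy.fst Hy.snd hxx
  have hb1 : bdry (χ (x₀ + 1), χ1 (x₀ + 1)) (q (x₀ + 1), q1 (x₀ + 1)) = 0 := by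
    rw [(hq0 _ le_rfl).1, (hq0 _ le_rfl).2]
    simp [bdry]
  have hb0 : bdry (χ x₀, χ1 x₀) (q x₀, q1 x₀) = 0 := by
    have e1 : χ x₀ = -d2 := congrArg Prod.fst hχ0
    have e2 : χ1 x₀ = d1 := congrArg Prod.snd hχ0
    rw [← hfq, hd, bdry, e1, e2, inner_neg_left, sub_neg_eq_add]
  rw [hb1, hb0, sub_zero, intervalIntegral.integral_of_le hxx] at hg
  have hint : ∫ x in Ioc x₀ (x₀ + 1), inner ℂ (χ x) (χ x) = 0 := by
    rw [← hg]
    refine setIntegral_congr_fun measurableSet_Ioc fun x hx => ?_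
    have ex : h x = χ x := indicator_of_mem hx _
    simp only [Pi.add_apply, Pi.smul_apply, Pi.zero_apply, add_zero, ex, inner_add_right,
      inner_smul_left, inner_smul_right, Complex.conj_conj]
    ring
  have hχL : MemLp χ 2 (volume.restrict (Ioc x₀ (x₀ + 1))) :=
    (memLp_indicator_iff_restrict measurableSet_Ioc).1 hh
  have hz1 : EqOn χ 0 (Ioo x₀ (x₀ + 1)) :=
    Measure.eqOn_open_of_ae_eq (μ := volume) (ae_restrict_of_ae_restrict_of_subset Ioo_subset_Ioc_self
      (ae_eq_zero_of_integral_inner hχL hint)) isOpen_Ioo Hχ.fst.continuous.continuousOn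
      continuousOn_const
  -- On an open interval `χ = 0` forces its derivative, hence also its quasi-derivative, to vanish
  -- at some point; uniqueness then kills `χ` everywhere.
  have hz2 : ∃ x, χ x = 0 ∧ χ1 x = 0 := by
    have hne : NeZero (volume.restrict (Ioo x₀ (x₀ + 1))) :=
      ⟨by rw [Ne, Measure.restrict_eq_zero]; simp⟩
    have h3 : ∀ᵐ x ∂volume.restrict (Ioo x₀ (x₀ + 1)), χ x = 0 ∧ χ1 x = 0 := by
      refine (ae_restrict_iff' measurableSet_Ioo).2 ?_
      filter_upwards [Hχ.fst.deriv] with x hx hxm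
      have h4 : HasDerivAt χ 0 x := (hasDerivAt_const x (0 : Vec m)).congr_of_eventuallyEq
        (hz1.eventuallyEq_of_mem (Ioo_mem_nhds hxm.1 hxm.2))
      have h5 := hx.unique h4
      have h6 : χ x = 0 := hz1 hxm
      refine ⟨h6, ?_⟩
      change χ1 x - Φ x (χ x) = 0 at h5
      rwa [h6, map_zero, sub_zero] at h5
    exact h3.exists
  obtain ⟨x, hx1, hx2⟩ := hz2
  obtain ⟨e1, e2⟩ := Hχ.eq_zero hΦ hx1 hx2
  have e3 : -d2 = 0 := (congrArg Prod.fst hχ0).symm.trans (congrFun e1 x₀)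
  have e4 : d1 = 0 := (congrArg Prod.snd hχ0).symm.trans (congrFun e2 x₀)
  refine hf0 (LinearMap.ext fun C => ?_)
  rw [hd, e4, neg_eq_zero.1 e3]
  simp

/-- Each Weyl space injects into its first components, so has dimension at most `m`; as the two span
a space of dimension `2m`, both have dimension `m` and are graphs. -/
theorem exists_weylMatrix (hΦ : IsPotential Φ) {z : ℂ} (hz : z.im ≠ 0)
    (hsurj : ∀ k : L2 m, ∃ f g, InGraphH Φ f g ∧ g - z • f = k) (x₀ : ℝ) {I : Set ℝ}
    (hI : I = Ici x₀ ∨ I = Iic x₀) :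
    ∃ M : Mat m, ∀ C, C ∈ weylSpace hΦ z x₀ I ↔ C.2 = act M C.1 := by
  have hinj : ∀ J, J = Ici x₀ ∨ J = Iic x₀ → Function.Injective
      ((LinearMap.fst ℂ (Vec m) (Vec m)).comp (weylSpace hΦ z x₀ J).subtype) := by
    intro J hJ
    rw [injective_iff_map_eq_zero]
    rintro ⟨C, hC⟩ h0
    have h0' : C.1 = 0 := h0
    have h1 : inner ℂ C.1 C.2 = 0 := by rw [h0', inner_zero_left]
    rcases hJ with rfl | rfl
    · exact Subtype.ext (eq_zero_of_mem_weylSpace_Ici hΦ hz x₀ hC h1)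
    · exact Subtype.ext (eq_zero_of_mem_weylSpace_Iic hΦ hz x₀ hC h1)
  have hle : ∀ J, J = Ici x₀ ∨ J = Iic x₀ →
      Module.finrank ℂ (weylSpace hΦ z x₀ J) ≤ Module.finrank ℂ (Vec m) := fun J hJ =>
    LinearMap.finrank_le_finrank_of_injective (hinj J hJ)
  have hsum := Submodule.finrank_sup_add_finrank_inf_eq (weylSpace hΦ z x₀ (Ici x₀))
    (weylSpace hΦ z x₀ (Iic x₀))
  rw [weylSpace_sup_eq_top hΦ z hsurj x₀, (disjoint_weylSpace hΦ hz x₀).eq_bot, finrank_top,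
    finrank_bot, Module.finrank_prod] at hsum
  have h1 := hle _ (Or.inl rfl)
  have h2 := hle _ (Or.inr rfl)
  have heq : Module.finrank ℂ (weylSpace hΦ z x₀ I) = Module.finrank ℂ (Vec m) := by
    rcases hI with rfl | rfl <;> omega
  let e : weylSpace hΦ z x₀ I ≃ₗ[ℂ] Vec m :=
    LinearEquiv.ofBijective _ ⟨hinj I hI,
      (LinearMap.injective_iff_surjective_of_finrank_eq_finrank heq).1 (hinj I hI)⟩
  have he : ∀ C : weylSpace hΦ z x₀ I, e C = C.1.1 := fun C => rfl
  let T : Vec m →ₗ[ℂ] Vec m := (LinearMap.snd ℂ (Vec m) (Vec m)).comp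
    ((weylSpace hΦ z x₀ I).subtype.comp e.symm.toLinearMap)
  have hT : ∀ c, act (Matrix.toEuclideanLin.symm T) c = (e.symm c).1.2 := fun c => by
    unfold act
    rw [LinearEquiv.apply_symm_apply]
    rfl
  refine ⟨Matrix.toEuclideanLin.symm T, fun C => ⟨fun hC => ?_, fun hC => ?_⟩⟩
  · rw [hT]
    have : e.symm C.1 = ⟨C, hC⟩ := by rw [LinearEquiv.symm_apply_eq]; rfl
    rw [this]
  · rw [hT] at hC
    have h3 : (e.symm C.1).1 = C := by
      refine Prod.ext ?_ hC.symm
      rw [← he, LinearEquiv.apply_symm_apply]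
    rw [← h3]
    exact (e.symm C.1).2

end Weyl

/-! ### The resolvent through the functional calculus -/

section Resolvent

variable {m : ℕ} {Φ : ℝ → Vec m →L[ℂ] Vec m} {E : ProjMeasure (L2 m)}

theorem bddMeas_inv_sub {z : ℂ} (hz : z.im ≠ 0) : BddMeas fun t : ℝ => ((t : ℂ) - z)⁻¹ :=
  ⟨measurable_inv_sub z, _, norm_inv_sub_le hz⟩

theorem bddMeas_sub_mul_inv_sub {z : ℂ} (hz : z.im ≠ 0) (w : ℂ) :
    BddMeas fun t : ℝ => ((t : ℂ) - w) * ((t : ℂ) - z)⁻¹ := by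
  have e : (fun t : ℝ => ((t : ℂ) - w) * ((t : ℂ) - z)⁻¹) =
      (fun _ => 1) + (z - w) • fun t : ℝ => ((t : ℂ) - z)⁻¹ := by
    ext t
    have := ofReal_sub_ne_zero hz t
    simp only [Pi.add_apply, Pi.smul_apply, smul_eq_mul]
    field_simp
    ring
  rw [e]
  exact (BddMeas.const 1).add ((bddMeas_inv_sub hz).smul _)

/-- `E` is the spectral measure of `(-d/dx + Φ)(d/dx + Φ)`. -/
def IsSpectralFor (Φ : ℝ → Vec m →L[ℂ] Vec m) (E : ProjMeasure (L2 m)) : Prop :=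
  ∀ f g, InGraphH Φ f g ↔ E.IsIntegral (fun t => (t : ℂ)) f g

theorem IsSpectralFor.inGraphH_fcalc (hE : IsSpectralFor Φ E) {G : ℝ → ℂ} (hG : BddMeas G)
    (hG' : BddMeas ((fun t : ℝ => (t : ℂ)) * G)) (k : L2 m) :
    InGraphH Φ (E.fcalc G k) (E.fcalc ((fun t : ℝ => (t : ℂ)) * G) k) :=
  (hE _ _).2 (E.isIntegral_fcalc Complex.measurable_ofReal hG hG' k)

theorem fcalc_sub_smul {G : ℝ → ℂ} (hG : BddMeas G) (hG' : BddMeas ((fun t : ℝ => (t : ℂ)) * G))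
    (w : ℂ) (k : L2 m) : E.fcalc ((fun t : ℝ => (t : ℂ)) * G) k - w • E.fcalc G k =
      E.fcalc (fun t : ℝ => ((t : ℂ) - w) * G t) k := by
  have e : (fun t : ℝ => ((t : ℂ) - w) * G t) = (fun t : ℝ => (t : ℂ)) * G - w • G := by
    ext t
    simp [sub_mul]
  rw [e, E.fcalc_sub hG' (hG.smul w), E.fcalc_smul w hG]
  rfl

/-- The solution is `∫ (λ - z)⁻¹ dE k`; the symbol and its product with `λ` are bounded. -/
theorem IsSpectralFor.exists_resolvent (hE : IsSpectralFor Φ E) {z : ℂ} (hz : z.im ≠ 0)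
    (k : L2 m) : ∃ f g, InGraphH Φ f g ∧ g - z • f = k := by
  have h1 := bddMeas_inv_sub hz
  have h2 : BddMeas ((fun t : ℝ => (t : ℂ)) * fun t : ℝ => ((t : ℂ) - z)⁻¹) := by
    simpa [Pi.mul_def] using bddMeas_sub_mul_inv_sub hz 0
  refine ⟨_, _, hE.inGraphH_fcalc h1 h2 k, ?_⟩
  rw [fcalc_sub_smul h1 h2]
  have e : (fun t : ℝ => ((t : ℂ) - z) * ((t : ℂ) - z)⁻¹) = 1 := by
    ext t
    exact mul_inv_cancel₀ (ofReal_sub_ne_zero hz t)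
  rw [e, E.fcalc_one]
  rfl

theorem isSpectralFor_opH {φ : ℝ → Mat m}
    (h : ∀ i k, LocallyIntegrable (fun x => φ x i k) (volume : Measure ℝ))
    (hs : ∀ᵐ x : ℝ, (φ x).IsHermitian) {j : ℕ} (hj : j = 1 ∨ j = 2) :
    IsSpectralFor (pot φ j) (spectralMeasure (opH φ j)) := fun f g => by
  rw [← mem_graph_opH φ hj]
  exact isSpectralMeasure_opH h hs hj f g

end Resolvent

/-! ### Weyl–Titchmarsh matrices of the Dirac system -/

section Dirac

variable {m : ℕ} {φ : ℝ → Mat m}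

theorem pot_one_apply (φ : ℝ → Mat m) (x : ℝ) (v : Vec m) : pot φ 1 x v = act (φ x) v := by
  rw [pot_one]; rfl

theorem pot_two_apply (φ : ℝ → Mat m) (x : ℝ) (v : Vec m) : pot φ 2 x v = -act (φ x) v := by
  rw [pot_two]; rfl

theorem LocAC.const_smul {I : Set ℝ} {u : ℝ → Vec m} (h : LocAC I u) (c : ℂ) :
    LocAC I (c • u) := fun a ha b hb => (h a ha b hb).const_smul c

/-- Eliminating `v`: the quasi-derivative of `u` is `ζ v`, so the Dirac system at `ζ` is the `j = 1`
equation at `ζ²`. -/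
theorem IsDiracSolution.isTau_one {ζ : ℂ} {u v : ℝ → Vec m}
    (h : IsDiracSolution φ ζ univ u v) : IsTau (pot φ 1) (ζ ^ 2) 0 u (ζ • v) := by
  obtain ⟨hu, hv, hd⟩ := h
  rw [Measure.restrict_univ] at hd
  have hvc : Continuous (ζ • v) := (hv.const_smul ζ).continuous
  refine ⟨⟨hu, hvc.locallyIntegrable, ?_⟩, ⟨hv.const_smul ζ, ?_, ?_⟩⟩
  · filter_upwards [hd] with x ⟨u', v', h1, h2, h3, h4⟩
    have e : (ζ • v) x - pot φ 1 x (u x) = u' := by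
      rw [pot_one_apply, Pi.smul_apply, ← h4, add_sub_cancel_right]
    rw [e]; exact h1
  · rw [add_zero]
    exact (hu.continuous.const_smul (ζ ^ 2)).neg.locallyIntegrable
  · filter_upwards [hd] with x ⟨u', v', h1, h2, h3, h4⟩
    have e : (-(ζ ^ 2 • u + 0)) x - (-pot φ 1) x ((ζ • v) x) = ζ • v' := by
      have h5 : v' = act (φ x) (v x) - ζ • u x := by rw [← h3]; abel
      rw [Pi.neg_apply, Pi.neg_apply, _root_.neg_apply, pot_one_apply, h5, add_zero]
      simp only [Pi.smul_apply, act, map_smul, smul_sub, smul_smul, pow_two]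
      abel
    rw [e]; exact h2.const_smul ζ

/-- Eliminating `u` instead: the quasi-derivative of `v` for `j = 2` is `-ζ u`. -/
theorem IsDiracSolution.isTau_two {ζ : ℂ} {u v : ℝ → Vec m}
    (h : IsDiracSolution φ ζ univ u v) : IsTau (pot φ 2) (ζ ^ 2) 0 v ((-ζ) • u) := by
  obtain ⟨hu, hv, hd⟩ := h
  rw [Measure.restrict_univ] at hd
  have huc : Continuous ((-ζ) • u) := (hu.const_smul (-ζ)).continuous
  refine ⟨⟨hv, huc.locallyIntegrable, ?_⟩, ⟨hu.const_smul (-ζ), ?_, ?_⟩⟩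
  · filter_upwards [hd] with x ⟨u', v', h1, h2, h3, h4⟩
    have e : ((-ζ) • u) x - pot φ 2 x (v x) = v' := by
      rw [pot_two_apply, Pi.smul_apply, neg_smul, ← h3]
      abel
    rw [e]; exact h2
  · rw [add_zero]
    exact (hv.continuous.const_smul (ζ ^ 2)).neg.locallyIntegrable
  · filter_upwards [hd] with x ⟨u', v', h1, h2, h3, h4⟩
    have e : (-(ζ ^ 2 • v + 0)) x - (-pot φ 2) x (((-ζ) • u) x) = (-ζ) • u' := by
      have h5 : u' = ζ • v x - act (φ x) (u x) := by rw [← h4]; abel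
      rw [Pi.neg_apply, Pi.neg_apply, _root_.neg_apply, pot_two_apply, h5, add_zero]
      simp only [Pi.smul_apply, act, map_smul, smul_sub, smul_smul, pow_two, neg_mul]
      simp only [neg_smul]
      abel
    rw [e]; exact h1.const_smul (-ζ)

theorem IsTau.isDiracSolution {ζ : ℂ} (hζ : ζ ≠ 0) {u w : ℝ → Vec m}
    (h : IsTau (pot φ 1) (ζ ^ 2) 0 u w) : IsDiracSolution φ ζ univ u (ζ⁻¹ • w) := by
  refine ⟨h.fst.ac, h.snd.ac.const_smul ζ⁻¹, ?_⟩
  rw [Measure.restrict_univ]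
  filter_upwards [h.fst.deriv, h.deriv_snd] with x h1 h2
  refine ⟨_, _, h1, h2.const_smul ζ⁻¹, ?_, ?_⟩
  · rw [pot_one_apply, Pi.smul_apply, Pi.zero_apply, sub_zero]
    simp only [act, map_smul, smul_sub, smul_smul]
    rw [pow_two, inv_mul_cancel_left₀ hζ]
    abel
  · rw [pot_one_apply, sub_add_cancel, Pi.smul_apply, smul_smul, mul_inv_cancel₀ hζ, one_smul]

/-- A Dirac solution known only on an interval is identified there with a global flow, through the a
priori bound for the difference. -/
theorem IsDiracSolution.eq_tauSol (hΦ : IsPotential (pot φ 1)) {ζ : ℂ} {I : Set ℝ}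
    (hI : I.OrdConnected) {u v : ℝ → Vec m} (h : IsDiracSolution φ ζ I u v) {x₀ x : ℝ}
    (hx₀ : x₀ ∈ I) (hx : x ∈ I) :
    (u x, ζ • v x) = tauSol (pot φ 1) (ζ ^ 2) x₀ (u x₀, ζ • v x₀) x := by
  obtain ⟨hu, hv, hd⟩ := h
  rw [ae_restrict_iff' hI.measurableSet] at hd
  have H := isTau_tauSol hΦ (ζ ^ 2) x₀ (u x₀, ζ • v x₀)
  have hs := tauSol_self hΦ (ζ ^ 2) x₀ (u x₀, ζ • v x₀)
  have hb := tau_bound hΦ (z := ζ ^ 2) (h := 0) (x₀ := x₀) (x₁ := x)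
    ((hu x₀ hx₀ x hx).sub (H.fst.ac x₀ trivial x trivial))
    (((hv.const_smul ζ) x₀ hx₀ x hx).sub (H.snd.ac x₀ trivial x trivial))
    (IntervalIntegrable.zero) (by
      filter_upwards [hd, H.fst.deriv, H.deriv_snd] with t h1 h2 h3 ht
      obtain ⟨u', v', g1, g2, g3, g4⟩ := h1 (hI.uIcc_subset hx₀ hx ht)
      have e5 : u' = ζ • v t - act (φ t) (u t) := by rw [← g4]; abel
      have e6 : v' = act (φ t) (v t) - ζ • u t := by rw [← g3]; abel
      refine ⟨?_, ?_⟩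
      · refine (g1.sub h2).congr_deriv ?_
        simp only [Pi.sub_apply, Pi.smul_apply, map_sub, pot_one_apply, e5]
        abel
      · refine ((g2.const_smul ζ).sub h3).congr_deriv ?_
        simp only [Pi.sub_apply, Pi.smul_apply, map_sub, map_smul, pot_one_apply, e6, smul_sub,
          smul_smul, pow_two, Pi.zero_apply, sub_zero]
        abel)
  simp only [Pi.sub_apply, Pi.smul_apply, hs, sub_self, Pi.zero_apply, norm_zero,
    intervalIntegral.integral_zero, abs_zero, add_zero, Prod.mk_zero_zero, mul_zero, zero_mul,
    norm_le_zero_iff] at hb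
  exact Prod.ext (sub_eq_zero.1 (congrArg Prod.fst hb)) (sub_eq_zero.1 (congrArg Prod.snd hb))

/-- Derivatives are two-sided, so functions that agree only on `I` share them at interior points;
the end point is a null set. -/
theorem IsDiracSolution.congr_on {ζ : ℂ} {I : Set ℝ} (hI : I.OrdConnected)
    (hI' : ∀ᵐ x, x ∈ I → I ∈ 𝓝 x) {u v p q : ℝ → Vec m} (h : IsDiracSolution φ ζ univ u v)
    (hp : EqOn p u I) (hq : EqOn q v I) : IsDiracSolution φ ζ I p q := by
  obtain ⟨hu, hv, hd⟩ := h
  rw [Measure.restrict_univ] at hd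
  refine ⟨fun a ha b hb => ac_congr (hu a trivial b trivial) fun x hx =>
    (hp (hI.uIcc_subset ha hb hx)).symm, fun a ha b hb => ac_congr (hv a trivial b trivial)
    fun x hx => (hq (hI.uIcc_subset ha hb hx)).symm, ?_⟩
  rw [ae_restrict_iff' hI.measurableSet]
  filter_upwards [hd, hI'] with x ⟨u', v', h1, h2, h3, h4⟩ hx hxI
  refine ⟨u', v', h1.congr_of_eventuallyEq (hp.eventuallyEq_of_mem (hx hxI)),
    h2.congr_of_eventuallyEq (hq.eventuallyEq_of_mem (hx hxI)), ?_, ?_⟩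
  · rw [hp hxI, hq hxI, h3]
  · rw [hp hxI, hq hxI, h4]

/-- The matrix of a linear map `ℂ^m → ℂ^m`. -/
theorem act_symm (T : Vec m →ₗ[ℂ] Vec m) (c : Vec m) :
    act (Matrix.toEuclideanLin.symm T) c = T c := by
  unfold act
  rw [LinearEquiv.apply_symm_apply]

theorem mat_ext {M N : Mat m} (h : ∀ c, act M c = act N c) : M = N :=
  Matrix.toEuclideanLin.injective (LinearMap.ext h)

theorem act_one (c : Vec m) : act (1 : Mat m) c = c := by
  simp [act]

theorem act_mul (M N : Mat m) (c : Vec m) : act (M * N) c = act M (act N c) := by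
  simp [act, Matrix.toLpLin_apply, Matrix.mulVec_mulVec]

theorem act_smul (a : ℂ) (M : Mat m) (c : Vec m) : act (a • M) c = a • act M c := by
  simp [act]

/-- The columns of the matrix solution with data `(A, B)` at `x₀`. -/
def tauLin (hΦ : IsPotential (pot φ 1)) (z : ℂ) (x₀ : ℝ) (M : Mat m) (x : ℝ) :
    Vec m →ₗ[ℂ] Vec m × Vec m where
  toFun c := tauSol (pot φ 1) z x₀ (c, act M c) x
  map_add' c c' := by
    rw [← tauSol_add hΦ]
    simp [act]
  map_smul' a c := by
    rw [RingHom.id_apply, ← tauSol_smul hΦ]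
    simp [act]

/-- The factor `ζ⁻¹` converts quasi-derivatives into second Dirac components; membership in the
deficiency space becomes membership of the data in the Weyl space. -/
theorem isDiracWeylMatrix_of_weylSpace (hΦ : IsPotential (pot φ 1)) {ζ : ℂ} (hζ : ζ ≠ 0)
    {x₀ : ℝ} {I : Set ℝ} (hI : I.OrdConnected) (hI' : ∀ᵐ x, x ∈ I → I ∈ 𝓝 x) (hx₀ : x₀ ∈ I)
    {M : Mat m} (hM : ∀ C, C ∈ weylSpace hΦ (ζ ^ 2) x₀ I ↔ C.2 = act M C.1) :
    IsDiracWeylMatrix φ ζ x₀ I (ζ⁻¹ • M) := by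
  let u : ℝ → Mat m := fun x => Matrix.toEuclideanLin.symm
    ((LinearMap.fst ℂ (Vec m) (Vec m)).comp (tauLin hΦ (ζ ^ 2) x₀ M x))
  let v : ℝ → Mat m := fun x => Matrix.toEuclideanLin.symm
    (ζ⁻¹ • (LinearMap.snd ℂ (Vec m) (Vec m)).comp (tauLin hΦ (ζ ^ 2) x₀ M x))
  have hu : ∀ x c, act (u x) c = (tauSol (pot φ 1) (ζ ^ 2) x₀ (c, act M c) x).1 := fun x c =>
    act_symm _ c
  have hv : ∀ x c, act (v x) c = ζ⁻¹ • (tauSol (pot φ 1) (ζ ^ 2) x₀ (c, act M c) x).2 :=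
    fun x c => act_symm _ c
  have hsol : ∀ c, IsDiracSolution φ ζ univ (fun x => act (u x) c) (fun x => act (v x) c) := by
    intro c
    simp only [hu, hv]
    exact (isTau_tauSol hΦ (ζ ^ 2) x₀ (c, act M c)).isDiracSolution hζ
  refine ⟨u, v, mat_ext fun c => ?_, mat_ext fun c => ?_, hsol, fun p q => ⟨fun h => ?_, ?_⟩⟩
  · rw [hu, tauSol_self hΦ, act_one]
  · rw [hv, tauSol_self hΦ, act_smul]
  · obtain ⟨h1, h2, h3⟩ := h
    have hmem : (p x₀, ζ • q x₀) ∈ weylSpace hΦ (ζ ^ 2) x₀ I :=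
      mem_weylSpace_of_eqOn hI.measurableSet (u := p) (w := ζ • q)
        (fun x hx => h1.eq_tauSol hΦ hI hx₀ hx) h2 (h3.const_smul ζ)
    have hMp : ζ • q x₀ = act M (p x₀) := (hM _).1 hmem
    refine ⟨p x₀, fun x hx => ?_⟩
    have h4 := h1.eq_tauSol hΦ hI hx₀ hx
    rw [hMp] at h4
    rw [hu, hv, ← h4]
    exact ⟨rfl, by rw [smul_smul, inv_mul_cancel₀ hζ, one_smul]⟩
  · rintro ⟨c, hc⟩
    have hmem : ((c, act M c) : Vec m × Vec m) ∈ weylSpace hΦ (ζ ^ 2) x₀ I := (hM _).2 rfl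
    rw [mem_weylSpace] at hmem
    refine ⟨(hsol c).congr_on hI hI' (fun x hx => (hc x hx).1) fun x hx => (hc x hx).2,
      (memLp_congr_ae ?_).2 hmem.1, (memLp_congr_ae ?_).2 (hmem.2.const_smul ζ⁻¹)⟩
    · refine (ae_restrict_iff' hI.measurableSet).2 (Eventually.of_forall fun x hx => ?_)
      rw [(hc x hx).1, hu]
    · refine (ae_restrict_iff' hI.measurableSet).2 (Eventually.of_forall fun x hx => ?_)
      rw [(hc x hx).2, hv]
      rfl

theorem IsDiracWeylMatrix.exists_solution {ζ : ℂ} {x₀ : ℝ} {I : Set ℝ} {M : Mat m}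
    (h : IsDiracWeylMatrix φ ζ x₀ I M) (c : Vec m) : ∃ u v : ℝ → Vec m, u x₀ = c ∧
      v x₀ = act M c ∧ IsDiracSolution φ ζ univ u v ∧ MemLp u 2 (volume.restrict I) ∧
      MemLp v 2 (volume.restrict I) := by
  obtain ⟨u, v, hu, hv, hsol, hdef⟩ := h
  have h1 := (hdef (fun x => act (u x) c) (fun x => act (v x) c)).2 ⟨c, fun x _ => ⟨rfl, rfl⟩⟩
  refine ⟨fun x => act (u x) c, fun x => act (v x) c, ?_, ?_, hsol c, h1.2.1, h1.2.2⟩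
  · simp only [hu, act_one]
  · simp only [hv]

/-- `M̂_{±,0,j}` parametrizes the square integrable solutions of `τ_j u = z u`. -/
theorem IsDiracWeylMatrix.mem_weylSpace {ζ : ℂ} {x₀ : ℝ} {I : Set ℝ} {M : Mat m}
    (hImeas : MeasurableSet I) (h : IsDiracWeylMatrix φ ζ x₀ I M) {j : ℕ} (hj : j = 1 ∨ j = 2)
    (hΦ : IsPotential (pot φ j)) (hζ : ζ ≠ 0)
    (hinj : ∀ C ∈ weylSpace hΦ (ζ ^ 2) x₀ I, C.1 = 0 → C = 0) (c : Vec m) :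
    (c, act (hatOf j ζ M) c) ∈ weylSpace hΦ (ζ ^ 2) x₀ I := by
  rcases hj with rfl | rfl
  · obtain ⟨u, v, hu, hv, hsol, hu2, hv2⟩ := h.exists_solution c
    have e : (c, act (hatOf 1 ζ M) c) = (u x₀, (ζ • v) x₀) := by
      rw [hu, Pi.smul_apply, hv, hatOf, if_pos rfl, act_smul]
    rw [e]
    exact mem_weylSpace_of_eqOn hImeas (fun x _ => SusySchrodinger.eq_tauSol hΦ _ x₀ hsol.isTau_one x) hu2
      (hv2.const_smul ζ)
  · have hmem : ∀ c, (act M c, (-ζ) • c) ∈ weylSpace hΦ (ζ ^ 2) x₀ I := fun c => by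
      obtain ⟨u, v, hu, hv, hsol, hu2, hv2⟩ := h.exists_solution c
      have e : (act M c, (-ζ) • c) = (v x₀, ((-ζ) • u) x₀) := by
        rw [hv, Pi.smul_apply, hu]
      rw [e]
      exact mem_weylSpace_of_eqOn hImeas (fun x _ => SusySchrodinger.eq_tauSol hΦ _ x₀ hsol.isTau_two x) hv2
        (hu2.const_smul (-ζ))
    -- For `j = 2` the data are `(M c, -ζ c)`. If `M c = 0`, the first component vanishes, hence so
    -- does `c`; this makes `M` invertible and allows the reparametrization by `M⁻¹`.
    have hMinj : Function.Injective (Matrix.toEuclideanLin M) := by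
      rw [injective_iff_map_eq_zero]
      intro c hc
      have h1 := hinj _ (hmem c) hc
      have h2 : (-ζ) • c = 0 := congrArg Prod.snd h1
      exact (smul_eq_zero.1 h2).resolve_left (neg_ne_zero.2 hζ)
    have hunit : IsUnit M.det := by
      rw [← Matrix.isUnit_iff_isUnit_det, ← Matrix.mulVec_injective_iff_isUnit]
      intro a b hab
      have := hMinj (a₁ := WithLp.toLp 2 a) (a₂ := WithLp.toLp 2 b) (by
        simp [hab])
      exact congrArg WithLp.ofLp this
    have h3 := hmem (act M⁻¹ c)
    rw [← act_mul, Matrix.mul_nonsing_inv _ hunit, act_one] at h3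
    have e : act (hatOf 2 ζ M) c = (-ζ) • act M⁻¹ c := by
      rw [hatOf, if_neg (by norm_num), ← neg_smul, act_smul]
    rwa [e]

theorem zetaOf_sq (z : ℂ) : zetaOf z ^ 2 = z := by
  have := Complex.cpow_nat_inv_pow z (two_ne_zero)
  rw [zetaOf]
  rw [Nat.cast_ofNat, ← one_div] at this
  exact this

theorem zetaOf_ne_zero {z : ℂ} (hz : z.im ≠ 0) : zetaOf z ≠ 0 := by
  intro h
  have := zetaOf_sq z
  rw [h, zero_pow two_ne_zero] at this
  rw [← this] at hz
  exact hz rfl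

theorem ae_Ici_mem_nhds (x₀ : ℝ) : ∀ᵐ x, x ∈ Ici x₀ → Ici x₀ ∈ 𝓝 x := by
  filter_upwards [Measure.ae_ne volume x₀] with x hx h
  exact Ici_mem_nhds (lt_of_le_of_ne h (Ne.symm hx))

theorem ae_Iic_mem_nhds (x₀ : ℝ) : ∀ᵐ x, x ∈ Iic x₀ → Iic x₀ ∈ 𝓝 x := by
  filter_upwards [Measure.ae_ne volume x₀] with x hx h
  exact Iic_mem_nhds (lt_of_le_of_ne h hx)

/-! ### The chosen half-line Weyl matrices at non-real `z`. -/

section Main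

variable (h : ∀ i k, LocallyIntegrable (fun x => φ x i k) (volume : Measure ℝ))
  (hs : ∀ᵐ x : ℝ, (φ x).IsHermitian) {j : ℕ} (hj : j = 1 ∨ j = 2) {z : ℂ} (hz : z.im ≠ 0) (x₀ : ℝ)

include hz

include h hs in
-- The case `j = 1` suffices, since the Dirac matrix serves both values of `j`.
theorem exists_isDiracWeylMatrix {I : Set ℝ} (hI : I = Ici x₀ ∨ I = Iic x₀) :
    ∃ M, IsDiracWeylMatrix φ (zetaOf z) x₀ I M := by
  have hΦ := isPotential_pot h hs (Or.inl rfl : (1 = 1 ∨ 1 = 2))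
  have hsurj := fun k => (isSpectralFor_opH h hs (Or.inl rfl : (1 = 1 ∨ 1 = 2))).exists_resolvent
    hz k
  obtain ⟨M, hM⟩ := exists_weylMatrix hΦ hz hsurj x₀ hI
  rw [← zetaOf_sq z] at hM
  rcases hI with rfl | rfl
  · exact ⟨_, isDiracWeylMatrix_of_weylSpace hΦ (zetaOf_ne_zero hz) ordConnected_Ici
      (ae_Ici_mem_nhds x₀) self_mem_Ici hM⟩
  · exact ⟨_, isDiracWeylMatrix_of_weylSpace hΦ (zetaOf_ne_zero hz) ordConnected_Iic
      (ae_Iic_mem_nhds x₀) self_mem_Iic hM⟩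

theorem mem_weylSpace_Mhatplus (c : Vec m) : (c, act (Mhatplus φ j z x₀) c) ∈
    weylSpace (isPotential_pot h hs hj) z x₀ (Ici x₀) := by
  have h1 : IsDiracWeylMatrix φ (zetaOf z) x₀ (Ici x₀) (MDplus φ (zetaOf z) x₀) :=
    Classical.epsilon_spec (exists_isDiracWeylMatrix h hs hz x₀ (Or.inl rfl))
  have hz' : (zetaOf z ^ 2).im ≠ 0 := by rwa [zetaOf_sq]
  have h2 := h1.mem_weylSpace measurableSet_Ici hj (isPotential_pot h hs hj) (zetaOf_ne_zero hz)
    (fun C hC h0 => eq_zero_of_mem_weylSpace_Ici _ hz' x₀ hC (by rw [h0, inner_zero_left])) c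
  rw [zetaOf_sq] at h2
  exact h2

theorem mem_weylSpace_Mhatminus (c : Vec m) : (c, act (Mhatminus φ j z x₀) c) ∈
    weylSpace (isPotential_pot h hs hj) z x₀ (Iic x₀) := by
  have h1 : IsDiracWeylMatrix φ (zetaOf z) x₀ (Iic x₀) (MDminus φ (zetaOf z) x₀) :=
    Classical.epsilon_spec (exists_isDiracWeylMatrix h hs hz x₀ (Or.inr rfl))
  have hz' : (zetaOf z ^ 2).im ≠ 0 := by rwa [zetaOf_sq]
  have h2 := h1.mem_weylSpace measurableSet_Iic hj (isPotential_pot h hs hj) (zetaOf_ne_zero hz)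
    (fun C hC h0 => eq_zero_of_mem_weylSpace_Iic _ hz' x₀ hC (by rw [h0, inner_zero_left])) c
  rw [zetaOf_sq] at h2
  exact h2

end Main

end Dirac

/-! ### Functions glued at `x₀` -/

section Glue

variable {m : ℕ} {Φ : ℝ → Vec m →L[ℂ] Vec m}

/-- `f` to the left and `g` to the right of `x₀`. -/
def glue (x₀ : ℝ) (f g : ℝ → Vec m) : ℝ → Vec m := fun x => if x ≤ x₀ then f x else g x

theorem glue_of_le {x₀ x : ℝ} (h : x ≤ x₀) (f g : ℝ → Vec m) : glue x₀ f g x = f x := if_pos h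

theorem glue_of_lt {x₀ x : ℝ} (h : x₀ < x) (f g : ℝ → Vec m) : glue x₀ f g x = g x :=
  if_neg (not_le.2 h)

theorem glue_self (x₀ : ℝ) (f : ℝ → Vec m) : glue x₀ f f = f := by
  ext1 x; exact ite_self _

theorem glue_smul (x₀ : ℝ) (c : ℂ) (f g : ℝ → Vec m) :
    glue x₀ (c • f) (c • g) = c • glue x₀ f g := by
  ext1 x
  simp only [glue, Pi.smul_apply]
  split_ifs <;> rfl

theorem memLp_glue {x₀ : ℝ} {f g : ℝ → Vec m} (hf : MemLp f 2 (volume.restrict (Iic x₀)))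
    (hg : MemLp g 2 (volume.restrict (Ioi x₀))) : MemLp (glue x₀ f g) 2 volume := by
  refine memLp_of_Iic_Ioi (x₀ := x₀) ((memLp_congr_ae ?_).2 hf) ((memLp_congr_ae ?_).2 hg)
  · exact (ae_restrict_iff' measurableSet_Iic).2 (Eventually.of_forall fun x hx => glue_of_le hx f g)
  · exact (ae_restrict_iff' measurableSet_Ioi).2 (Eventually.of_forall fun x hx => glue_of_lt hx f g)

/-- `τ p = P` with quasi-derivative `p1`, everything square integrable over `I`. -/
structure IsPiece (Φ : ℝ → Vec m →L[ℂ] Vec m) (I : Set ℝ) (p p1 P : ℝ → Vec m) : Prop where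
  fst : IsD Φ p p1
  snd : IsD (-Φ) p1 (-P)
  memLp : MemLp p 2 (volume.restrict I)
  memLp_quasi : MemLp p1 2 (volume.restrict I)
  memLp_image : MemLp P 2 (volume.restrict I)

theorem IsTau.isPiece {z : ℂ} {h u w : ℝ → Vec m} {I : Set ℝ} (H : IsTau Φ z h u w)
    (hu : MemLp u 2 (volume.restrict I)) (hw : MemLp w 2 (volume.restrict I))
    (hh : MemLp h 2 (volume.restrict I)) : IsPiece Φ I u w (z • u + h) :=
  ⟨H.fst, H.snd, hu, hw, (hu.const_smul z).add hh⟩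

theorem IsPiece.mono {I J : Set ℝ} (hJ : J ⊆ I) {p p1 P : ℝ → Vec m} (h : IsPiece Φ I p p1 P) :
    IsPiece Φ J p p1 P :=
  ⟨h.fst, h.snd, h.memLp.mono_measure (Measure.restrict_mono hJ le_rfl),
    h.memLp_quasi.mono_measure (Measure.restrict_mono hJ le_rfl),
    h.memLp_image.mono_measure (Measure.restrict_mono hJ le_rfl)⟩

/-- The two half-line identities are added; the contributions at infinity vanish and the boundary
forms from the two sides of `x₀` survive. -/
theorem green_glue (hΦ : IsPotential Φ) {x₀ : ℝ} {p p1 P p' p1' P' q q1 Q q' q1' Q' : ℝ → Vec m}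
    (hp : IsPiece Φ (Iic x₀) p p1 P) (hp' : IsPiece Φ (Ioi x₀) p' p1' P')
    (hq : IsPiece Φ (Iic x₀) q q1 Q) (hq' : IsPiece Φ (Ioi x₀) q' q1' Q') :
    ∫ x, (inner ℂ (glue x₀ p p' x) (glue x₀ Q Q' x) -
        inner ℂ (glue x₀ P P' x) (glue x₀ q q' x)) =
      bdry (p x₀, p1 x₀) (q x₀, q1 x₀) - bdry (p' x₀, p1' x₀) (q' x₀, q1' x₀) := by
  have hi : Integrable (fun x => inner ℂ (glue x₀ p p' x) (glue x₀ Q Q' x) -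
      inner ℂ (glue x₀ P P' x) (glue x₀ q q' x)) :=
    (integrable_inner_of_memLp (memLp_glue hp.memLp hp'.memLp)
      (memLp_glue hq.memLp_image hq'.memLp_image)).sub
      (integrable_inner_of_memLp (memLp_glue hp.memLp_image hp'.memLp_image)
        (memLp_glue hq.memLp hq'.memLp))
  rw [← intervalIntegral.integral_Iic_add_Ioi (b := x₀) hi.integrableOn hi.integrableOn]
  have e1 := green_second_Iic hΦ hp.fst hp.snd hq.fst hq.snd x₀ hp.memLp hp.memLp_quasi
    hp.memLp_image hq.memLp hq.memLp_quasi hq.memLp_image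
  have e2 := green_second_Ioi hΦ hp'.fst hp'.snd hq'.fst hq'.snd x₀ hp'.memLp hp'.memLp_quasi
    hp'.memLp_image hq'.memLp hq'.memLp_quasi hq'.memLp_image
  rw [sub_eq_add_neg, ← e1, ← e2]
  congr 1
  · refine setIntegral_congr_fun measurableSet_Iic fun x hx => ?_
    simp only [glue_of_le (mem_Iic.1 hx)]
  · refine setIntegral_congr_fun measurableSet_Ioi fun x hx => ?_
    simp only [glue_of_lt (mem_Ioi.1 hx)]

end Glue

/-! ### Weyl solutions and the Weyl–Titchmarsh matrix of the full line -/

section WeylPair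

variable {m : ℕ} {Φ : ℝ → Vec m →L[ℂ] Vec m}

/-- The upper half of a vector in `ℂ^{2m}`. -/
def upper : ((Fin m ⊕ Fin m) → ℂ) →ₗ[ℂ] Vec m where
  toFun C := WithLp.toLp 2 fun i => C (Sum.inl i)
  map_add' _ _ := rfl
  map_smul' _ _ := rfl

/-- The lower half of a vector in `ℂ^{2m}`. -/
def lower : ((Fin m ⊕ Fin m) → ℂ) →ₗ[ℂ] Vec m where
  toFun C := WithLp.toLp 2 fun i => C (Sum.inr i)
  map_add' _ _ := rfl
  map_smul' _ _ := rfl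

theorem star_dotProduct_eq (C D : Fin m ⊕ Fin m → ℂ) :
    star C ⬝ᵥ D = inner ℂ (upper C) (upper D) + inner ℂ (lower C) (lower D) := by
  simp only [dotProduct, Fintype.sum_sum_type, upper, lower,
    PiLp.inner_apply, RCLike.inner_apply, Pi.star_apply, Complex.star_def]
  congr 1 <;> exact Finset.sum_congr rfl fun i _ => mul_comm _ _

/-- The `2m × 2m` Weyl–Titchmarsh matrix assembled from its half-line matrices. -/
def fullWeyl (Mp Mm : Mat m) : Matrix (Fin m ⊕ Fin m) (Fin m ⊕ Fin m) ℂ :=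
  Matrix.fromBlocks (Mm - Mp)⁻¹ ((1 / 2 : ℂ) • ((Mm - Mp)⁻¹ * (Mm + Mp)))
    ((1 / 2 : ℂ) • ((Mm + Mp) * (Mm - Mp)⁻¹)) (Mp * (Mm - Mp)⁻¹ * Mm)

/-- Substituting `Mm = W + Mp` makes both products equal to `Mp + Mp W⁻¹ Mp`. -/
theorem mul_inv_sub_mul {Mp Mm : Mat m} (hW : IsUnit (Mm - Mp).det) :
    Mm * (Mm - Mp)⁻¹ * Mp = Mp * (Mm - Mp)⁻¹ * Mm := by
  set W := Mm - Mp with hWd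
  have e : Mm = W + Mp := by rw [hWd, sub_add_cancel]
  rw [e, add_mul, Matrix.mul_nonsing_inv _ hW, mul_add, mul_assoc Mp W⁻¹ W,
    Matrix.nonsing_inv_mul _ hW, add_mul, one_mul, mul_one]

/-- The solutions with data `(c, M₊ c)`, `(c, M₋ c)` at `x₀` are square integrable near `∞`,
`-∞`. -/
structure WeylPair (hΦ : IsPotential Φ) (z : ℂ) (x₀ : ℝ) (Mp Mm : Mat m) : Prop where
  plus : ∀ c, (c, act Mp c) ∈ weylSpace hΦ z x₀ (Ici x₀)
  minus : ∀ c, (c, act Mm c) ∈ weylSpace hΦ z x₀ (Iic x₀)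
  isUnit : IsUnit (Mm - Mp).det

theorem act_sub (M N : Mat m) (c : Vec m) : act (M - N) c = act M c - act N c := by
  simp [act]

theorem act_add (M N : Mat m) (c : Vec m) : act (M + N) c = act M c + act N c := by
  simp [act]

/-- A kernel vector of `M₋ - M₊` gives one set of data lying in both Weyl spaces. -/
theorem weylPair_of_mem {hΦ : IsPotential Φ} {z : ℂ} (hz : z.im ≠ 0) {x₀ : ℝ} {Mp Mm : Mat m}
    (hp : ∀ c, (c, act Mp c) ∈ weylSpace hΦ z x₀ (Ici x₀))
    (hm : ∀ c, (c, act Mm c) ∈ weylSpace hΦ z x₀ (Iic x₀)) : WeylPair hΦ z x₀ Mp Mm := by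
  refine ⟨hp, hm, ?_⟩
  rw [← Matrix.isUnit_iff_isUnit_det, ← Matrix.mulVec_injective_iff_isUnit]
  intro a b hab
  have h0 : act (Mm - Mp) (WithLp.toLp 2 a - WithLp.toLp 2 b) = 0 := by
    have : act (Mm - Mp) (WithLp.toLp 2 a) = act (Mm - Mp) (WithLp.toLp 2 b) := by
      exact congrArg (WithLp.toLp 2) hab
    unfold act at this ⊢
    rw [map_sub, this, sub_self]
  rw [act_sub, sub_eq_zero] at h0
  have h1 := hp (WithLp.toLp 2 a - WithLp.toLp 2 b)
  rw [← h0] at h1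
  have h2 := Submodule.disjoint_def.1 (disjoint_weylSpace hΦ hz x₀) _ h1 (hm _)
  have h3 : (WithLp.toLp 2 a - WithLp.toLp 2 b : Vec m) = 0 := congrArg Prod.fst h2
  exact congrArg WithLp.ofLp (sub_eq_zero.1 h3)

/-- The data `(α, M₊ α)`, `α = W⁻¹ (a + M₋ b)`. -/
def dataPlus (Mp Mm : Mat m) (C : Fin m ⊕ Fin m → ℂ) : Vec m × Vec m :=
  (act (Mm - Mp)⁻¹ (upper C + act Mm (lower C)),
    act Mp (act (Mm - Mp)⁻¹ (upper C + act Mm (lower C))))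

/-- The data `(β, M₋ β)`, `β = W⁻¹ (a + M₊ b)`. -/
def dataMinus (Mp Mm : Mat m) (C : Fin m ⊕ Fin m → ℂ) : Vec m × Vec m :=
  (act (Mm - Mp)⁻¹ (upper C + act Mp (lower C)),
    act Mm (act (Mm - Mp)⁻¹ (upper C + act Mp (lower C))))

/-- The jump depends on `C` alone and not on `z`; this allows the Weyl functions at different
parameters to be compared. -/
theorem dataPlus_sub_dataMinus {Mp Mm : Mat m} (hW : IsUnit (Mm - Mp).det)
    (C : Fin m ⊕ Fin m → ℂ) : dataPlus Mp Mm C - dataMinus Mp Mm C = (lower C, -upper C) := by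
  have e := mul_inv_sub_mul hW
  have h1 : ∀ c, act (Mm - Mp)⁻¹ (act Mm c) - act (Mm - Mp)⁻¹ (act Mp c) = c := fun c => by
    rw [← act_mul, ← act_mul, ← act_sub, ← mul_sub, Matrix.nonsing_inv_mul _ hW, act_one]
  have h2 : ∀ c, act Mp (act (Mm - Mp)⁻¹ c) - act Mm (act (Mm - Mp)⁻¹ c) = -c := fun c => by
    rw [← act_mul, ← act_mul, ← act_sub, ← sub_mul, ← neg_sub, neg_mul,
      Matrix.mul_nonsing_inv _ hW]
    simp [act]
  have h3 : ∀ c, act Mp (act (Mm - Mp)⁻¹ (act Mm c)) = act Mm (act (Mm - Mp)⁻¹ (act Mp c)) :=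
    fun c => by simp only [← act_mul, ← mul_assoc, e]
  have ha : ∀ (M : Mat m) (c c' : Vec m), act M (c + c') = act M c + act M c' := fun M c c' =>
    map_add _ c c'
  refine Prod.ext ?_ ?_
  · simp only [dataPlus, dataMinus, Prod.fst_sub, ha]
    rw [add_sub_add_left_eq_sub, h1]
  · simp only [dataPlus, dataMinus, Prod.snd_sub, ha]
    rw [h3, add_sub_add_right_eq_sub, h2]

/-- The mean of the one-sided data at `x₀` is the full Weyl matrix applied to `C`; the symmetric
off-diagonal blocks come from this averaging. -/
theorem data_add {Mp Mm : Mat m} (hW : IsUnit (Mm - Mp).det) (C : Fin m ⊕ Fin m → ℂ) :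
    dataPlus Mp Mm C + dataMinus Mp Mm C =
      (2 : ℂ) • (upper ((fullWeyl Mp Mm).mulVec C), lower ((fullWeyl Mp Mm).mulVec C)) := by
  have e := mul_inv_sub_mul hW
  have hu : upper ((fullWeyl Mp Mm).mulVec C) = act (Mm - Mp)⁻¹ (upper C) +
      act ((1 / 2 : ℂ) • ((Mm - Mp)⁻¹ * (Mm + Mp))) (lower C) := by
    rw [fullWeyl, Matrix.fromBlocks_mulVec]
    rfl
  have hl : lower ((fullWeyl Mp Mm).mulVec C) =
      act ((1 / 2 : ℂ) • ((Mm + Mp) * (Mm - Mp)⁻¹)) (upper C) +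
      act (Mp * (Mm - Mp)⁻¹ * Mm) (lower C) := by
    rw [fullWeyl, Matrix.fromBlocks_mulVec]
    rfl
  have ha : ∀ (M : Mat m) (c c' : Vec m), act M (c + c') = act M c + act M c' := fun M c c' =>
    map_add _ c c'
  have h3 : ∀ c, act Mp (act (Mm - Mp)⁻¹ (act Mm c)) = act Mm (act (Mm - Mp)⁻¹ (act Mp c)) :=
    fun c => by simp only [← act_mul, ← mul_assoc, e]
  refine Prod.ext ?_ ?_
  · simp only [dataPlus, dataMinus, Prod.fst_add, Prod.smul_fst, hu, ha, act_smul, act_mul,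
      act_add, smul_add, smul_smul]
    norm_num
    rw [two_smul]
    abel
  · simp only [dataPlus, dataMinus, Prod.snd_add, Prod.smul_snd, hl, ha, act_smul, act_mul,
      act_add, smul_add, smul_smul, h3]
    norm_num
    rw [two_smul]
    abel

/-- Write one-sided data as mean plus or minus half the jump. The quadratic terms cancel and only
pairings of the common jump with the means are left. -/
theorem bdry_identity (u v C J : Vec m × Vec m) (p p' q q' : Vec m × Vec m)
    (h1 : p' - p = J) (h2 : q' - q = J) (h3 : p' + p = (2 : ℂ) • u) (h4 : q' + q = (2 : ℂ) • v)
    (hJ : J = (C.2, -C.1)) :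
    bdry p q - bdry p' q' = (inner ℂ C.1 v.1 + inner ℂ C.2 v.2) -
      star (inner ℂ C.1 u.1 + inner ℂ C.2 u.2) := by
  have e1 : p' = u + (1 / 2 : ℂ) • J := by
    have : (2 : ℂ) • p' = (2 : ℂ) • u + J := by rw [← h3, ← h1, two_smul]; abel
    rw [← one_smul ℂ p', show (1 : ℂ) = (1 / 2) * 2 by norm_num, mul_smul, this, smul_add,
      smul_smul]
    norm_num
  have e2 : p = u - (1 / 2 : ℂ) • J := by
    rw [← sub_sub_cancel p' p, h1, e1]
    nth_rewrite 2 [← one_smul ℂ J]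
    rw [add_sub_assoc, ← sub_smul, show (1 / 2 - 1 : ℂ) = -(1 / 2) by norm_num, neg_smul,
      ← sub_eq_add_neg]
  have e3 : q' = v + (1 / 2 : ℂ) • J := by
    have : (2 : ℂ) • q' = (2 : ℂ) • v + J := by rw [← h4, ← h2, two_smul]; abel
    rw [← one_smul ℂ q', show (1 : ℂ) = (1 / 2) * 2 by norm_num, mul_smul, this, smul_add,
      smul_smul]
    norm_num
  have e4 : q = v - (1 / 2 : ℂ) • J := by
    rw [← sub_sub_cancel q' q, h2, e3]
    nth_rewrite 2 [← one_smul ℂ J]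
    rw [add_sub_assoc, ← sub_smul, show (1 / 2 - 1 : ℂ) = -(1 / 2) by norm_num, neg_smul,
      ← sub_eq_add_neg]
  rw [e1, e2, e3, e4, hJ]
  simp only [bdry, Prod.fst_add, Prod.snd_add, Prod.fst_sub, Prod.snd_sub, Prod.smul_fst,
    Prod.smul_snd, inner_add_left, inner_add_right, inner_sub_left, inner_sub_right,
    inner_smul_left, inner_smul_right, inner_neg_left, inner_neg_right, smul_neg, star_add,
    Complex.star_def, inner_conj_symm, map_div₀, map_one, map_ofNat]
  ring

/-! ### Weyl functions as vectors in `L²`. -/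

section Psi

variable {hΦ : IsPotential Φ} {z : ℂ} {x₀ : ℝ} {Mp Mm : Mat m}

/-- The function which solves `τ ψ = z ψ` off `x₀` with the jump `(b, -a)` at `x₀`. -/
def psiFun (hΦ : IsPotential Φ) (z : ℂ) (x₀ : ℝ) (Mp Mm : Mat m) :
    (Fin m ⊕ Fin m → ℂ) →ₗ[ℂ] (ℝ → Vec m) where
  toFun C := glue x₀ (fun x => (tauSol Φ z x₀ (dataMinus Mp Mm C) x).1)
    (fun x => (tauSol Φ z x₀ (dataPlus Mp Mm C) x).1)
  map_add' C D := by
    have e1 : dataMinus Mp Mm (C + D) = dataMinus Mp Mm C + dataMinus Mp Mm D := by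
      simp only [dataMinus, act, map_add, Prod.mk_add_mk]
      refine Prod.ext ?_ ?_ <;> simp only <;> abel
    have e2 : dataPlus Mp Mm (C + D) = dataPlus Mp Mm C + dataPlus Mp Mm D := by
      simp only [dataPlus, act, map_add, Prod.mk_add_mk]
      refine Prod.ext ?_ ?_ <;> simp only <;> abel
    ext1 x
    simp only [glue, e1, e2, tauSol_add hΦ, Pi.add_apply, Prod.fst_add]
    split_ifs <;> rfl
  map_smul' c C := by
    have e1 : dataMinus Mp Mm (c • C) = c • dataMinus Mp Mm C := by
      simp only [dataMinus, act, map_add, map_smul, ← smul_add, Prod.smul_mk]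
    have e2 : dataPlus Mp Mm (c • C) = c • dataPlus Mp Mm C := by
      simp only [dataPlus, act, map_add, map_smul, ← smul_add, Prod.smul_mk]
    ext1 x
    simp only [glue, e1, e2, tauSol_smul hΦ, Pi.smul_apply, Prod.smul_fst, RingHom.id_apply]
    split_ifs <;> rfl

theorem WeylPair.isPiece_minus (h : WeylPair hΦ z x₀ Mp Mm) (C : Fin m ⊕ Fin m → ℂ) :
    IsPiece Φ (Iic x₀) (fun x => (tauSol Φ z x₀ (dataMinus Mp Mm C) x).1)
      (fun x => (tauSol Φ z x₀ (dataMinus Mp Mm C) x).2)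
      (z • fun x => (tauSol Φ z x₀ (dataMinus Mp Mm C) x).1) := by
  have h1 := mem_weylSpace.1 (h.minus (dataMinus Mp Mm C).1)
  have := (isTau_tauSol hΦ z x₀ (dataMinus Mp Mm C)).isPiece h1.1 h1.2 (MemLp.zero' (p := 2))
  rwa [add_zero] at this

theorem WeylPair.isPiece_plus (h : WeylPair hΦ z x₀ Mp Mm) (C : Fin m ⊕ Fin m → ℂ) :
    IsPiece Φ (Ioi x₀) (fun x => (tauSol Φ z x₀ (dataPlus Mp Mm C) x).1)
      (fun x => (tauSol Φ z x₀ (dataPlus Mp Mm C) x).2)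
      (z • fun x => (tauSol Φ z x₀ (dataPlus Mp Mm C) x).1) := by
  have h1 := mem_weylSpace.1 (h.plus (dataPlus Mp Mm C).1)
  rw [restrict_Ici_eq] at h1
  have := (isTau_tauSol hΦ z x₀ (dataPlus Mp Mm C)).isPiece h1.1 h1.2 (MemLp.zero' (p := 2))
  rwa [add_zero] at this

theorem WeylPair.memLp_psiFun (h : WeylPair hΦ z x₀ Mp Mm) (C : Fin m ⊕ Fin m → ℂ) :
    MemLp (psiFun hΦ z x₀ Mp Mm C) 2 volume :=
  memLp_glue (h.isPiece_minus C).memLp (h.isPiece_plus C).memLp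

/-- The class of `psiFun` in `L²`. -/
def WeylPair.psi (h : WeylPair hΦ z x₀ Mp Mm) : (Fin m ⊕ Fin m → ℂ) →ₗ[ℂ] L2 m :=
  toLpLin (psiFun hΦ z x₀ Mp Mm) h.memLp_psiFun

/-- The pairing of `ψ_z(C)` with `(H - z̄) v` is the pairing of `C` with the data of `v` at `x₀`. -/
theorem WeylPair.inner_psi (h : WeylPair hΦ z x₀ Mp Mm) (C : Fin m ⊕ Fin m → ℂ)
    {u w r : ℝ → Vec m} (hu : IsPiece Φ univ u w r) {f g : L2 m} (hf : f =ᵐ[volume] u)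
    (hg : g =ᵐ[volume] r) :
    inner ℂ (h.psi C) (g - starRingEnd ℂ z • f) =
      inner ℂ (upper C) (u x₀) + inner ℂ (lower C) (w x₀) := by
  have hg1 := green_glue hΦ (h.isPiece_minus C) (h.isPiece_plus C) (hu.mono (subset_univ _))
    (hu.mono (subset_univ _))
  rw [glue_self, glue_self, glue_smul] at hg1
  simp only [tauSol_self hΦ] at hg1
  have hj := dataPlus_sub_dataMinus h.isUnit C
  have hb : bdry ((dataMinus Mp Mm C).1, (dataMinus Mp Mm C).2) (u x₀, w x₀) -
      bdry ((dataPlus Mp Mm C).1, (dataPlus Mp Mm C).2) (u x₀, w x₀) =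
      inner ℂ (upper C) (u x₀) + inner ℂ (lower C) (w x₀) := by
    have e1 : (dataPlus Mp Mm C).1 = (dataMinus Mp Mm C).1 + lower C := by
      have := congrArg Prod.fst hj
      simp only [Prod.fst_sub] at this
      rw [← this]; abel
    have e2 : (dataPlus Mp Mm C).2 = (dataMinus Mp Mm C).2 - upper C := by
      have := congrArg Prod.snd hj
      simp only [Prod.snd_sub] at this
      rw [sub_eq_add_neg, ← this]; abel
    rw [e1, e2]
    simp only [bdry, inner_add_left, inner_sub_left]
    ring
  rw [hb] at hg1
  rw [← hg1, L2.inner_def]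
  refine integral_congr_ae ?_
  filter_upwards [(h.memLp_psiFun C).coeFn_toLp, Lp.coeFn_sub g (starRingEnd ℂ z • f),
    Lp.coeFn_smul (starRingEnd ℂ z) f, hf, hg] with x h1 h2 h3 h4 h5
  have h1' : (h.psi C) x = psiFun hΦ z x₀ Mp Mm C x := h1
  rw [h1', h2, Pi.sub_apply, h3, Pi.smul_apply, h4, h5, inner_sub_right, inner_smul_right,
    Pi.smul_apply, inner_smul_left]
  rfl

/-- Green's identity for two glued Weyl functions; equal jumps reduce the boundary term to quadratic
forms of the two Weyl matrices. -/
theorem WeylPair.inner_psi_psi (h : WeylPair hΦ z x₀ Mp Mm) {w : ℂ} {Np Nm : Mat m}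
    (h' : WeylPair hΦ w x₀ Np Nm) (C : Fin m ⊕ Fin m → ℂ) :
    (z - starRingEnd ℂ w) * inner ℂ (h'.psi C) (h.psi C) =
      mform (fullWeyl Mp Mm) C C - star (mform (fullWeyl Np Nm) C C) := by
  have hg := green_glue hΦ (h'.isPiece_minus C) (h'.isPiece_plus C) (h.isPiece_minus C)
    (h.isPiece_plus C)
  rw [glue_smul, glue_smul] at hg
  simp only [tauSol_self hΦ] at hg
  rw [bdry_identity _ _ (upper C, lower C) _ _ _ _ _ (dataPlus_sub_dataMinus h'.isUnit C)
    (dataPlus_sub_dataMinus h.isUnit C) (data_add h'.isUnit C) (data_add h.isUnit C) rfl] at hg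
  rw [mform, mform, star_dotProduct_eq, star_dotProduct_eq]
  refine Eq.trans ?_ hg
  rw [WeylPair.psi, WeylPair.psi]
  have e : inner ℂ (toLpLin (psiFun hΦ w x₀ Np Nm) h'.memLp_psiFun C)
      (toLpLin (psiFun hΦ z x₀ Mp Mm) h.memLp_psiFun C) =
      ∫ x, inner ℂ (psiFun hΦ w x₀ Np Nm C x) (psiFun hΦ z x₀ Mp Mm C x) :=
    inner_toLp (h'.memLp_psiFun C) (h.memLp_psiFun C)
  rw [e, ← integral_const_mul]
  refine integral_congr_ae (Eventually.of_forall fun x => ?_)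
  simp only [Pi.smul_apply, inner_smul_left, inner_smul_right]
  change (z - _) * inner ℂ (glue x₀ _ _ x) (glue x₀ _ _ x) = _
  ring

theorem InGraphH.exists_isPiece {f g : L2 m} (h : InGraphH Φ f g) :
    ∃ u w, f =ᵐ[volume] u ∧ IsPiece Φ univ u w g := by
  obtain ⟨u, w, h1, h2, h3, H⟩ := h.exists_isTau 0 (k := g) (by rw [zero_smul, sub_zero])
  refine ⟨u, w, h1, ?_⟩
  have := H.isPiece (h2.restrict univ) (h3.restrict univ) ((Lp.memLp g).restrict univ)
  rwa [zero_smul, zero_add] at this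

/-- Test both Weyl functions against the same `v = (H - z̄)⁻¹ k`. Both give the pairing of `C` with
the data of `v`, so the function at `z` paired with `k` equals the one at `w` paired with `(H -
w̄)(H - z̄)⁻¹ k`. -/
theorem WeylPair.psi_eq_fcalc {E : ProjMeasure (L2 m)} (hE : IsSpectralFor Φ E) (hz : z.im ≠ 0)
    (h : WeylPair hΦ z x₀ Mp Mm) {w : ℂ} {Np Nm : Mat m} (h' : WeylPair hΦ w x₀ Np Nm)
    (C : Fin m ⊕ Fin m → ℂ) :
    h.psi C = E.fcalc (fun t : ℝ => ((t : ℂ) - w) * ((t : ℂ) - z)⁻¹) (h'.psi C) := by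
  refine ext_inner_right ℂ fun k => ?_
  have hz' : (starRingEnd ℂ z).im ≠ 0 := by simpa using hz
  have h1 := bddMeas_inv_sub hz'
  have h2 : BddMeas ((fun t : ℝ => (t : ℂ)) * fun t : ℝ => ((t : ℂ) - starRingEnd ℂ z)⁻¹) := by
    simpa [Pi.mul_def] using bddMeas_sub_mul_inv_sub hz' 0
  have hgr := hE.inGraphH_fcalc h1 h2 k
  obtain ⟨u, v, hfu, hp⟩ := hgr.exists_isPiece
  have e1 := h.inner_psi C hp hfu (EventuallyEq.refl _ _)
  have e2 := h'.inner_psi C hp hfu (EventuallyEq.refl _ _)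
  rw [← e2, fcalc_sub_smul h1 h2, fcalc_sub_smul h1 h2] at e1
  have e3 : (fun t : ℝ => ((t : ℂ) - starRingEnd ℂ z) * ((t : ℂ) - starRingEnd ℂ z)⁻¹) = 1 := by
    ext t
    exact mul_inv_cancel₀ (ofReal_sub_ne_zero hz' t)
  rw [e3, E.fcalc_one] at e1
  rw [E.inner_fcalc_left (bddMeas_sub_mul_inv_sub hz w)]
  refine e1.trans ?_
  congr 3
  ext t
  simp

/-- The Nevanlinna–Herglotz representation of the Weyl–Titchmarsh matrix. -/
theorem hasHerglotzForm_of_weylPair {E : ProjMeasure (L2 m)} (hE : IsSpectralFor Φ E)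
    {Mp Mm : ℂ → Mat m} (h : ∀ z : ℂ, z.im ≠ 0 → WeylPair hΦ z x₀ (Mp z) (Mm z)) :
    HasHerglotzForm (fun z => fullWeyl (Mp z) (Mm z)) E (h Complex.I (by simp)).psi := by
  intro C z hz
  have hI : Complex.I.im ≠ 0 := by simp
  set ψ := (h Complex.I hI).psi C with hψ
  -- Compare parameter `w` with `i`; the factor `w + i` is `w` minus the conjugate of `i`.
  have h1 : ∀ w : ℂ, w.im ≠ 0 → mform (fullWeyl (Mp w) (Mm w)) C C =
      star (mform (fullWeyl (Mp Complex.I) (Mm Complex.I)) C C) + (w + Complex.I) *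
        ∫ t, ((t : ℂ) - Complex.I) * ((t : ℂ) - w)⁻¹ ∂(E.diag ψ) := fun w hw => by
    have e := (h w hw).inner_psi_psi (h Complex.I hI) C
    rw [(h w hw).psi_eq_fcalc hE hw (h Complex.I hI) C,
      E.inner_fcalc (bddMeas_sub_mul_inv_sub hw _), E.form_self, Complex.conj_I,
      sub_neg_eq_add] at e
    rw [e]
    ring
  have h2 := h1 Complex.I hI
  have e1 : ∀ t : ℝ, ((t : ℂ) - Complex.I) * ((t : ℂ) - Complex.I)⁻¹ = 1 := fun t =>
    mul_inv_cancel₀ (ofReal_sub_ne_zero hI t)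
  simp only [e1, integral_const, Complex.real_smul, mul_one] at h2
  set X := mform (fullWeyl (Mp Complex.I) (Mm Complex.I)) C C with hX
  -- Taking `w = i` above shows that the imaginary part of the form at `i` is the total mass of the
  -- measure.
  have h3 : star X = (X.re : ℂ) - Complex.I * ((E.diag ψ).real univ : ℂ) := by
    have h4 : (X.re : ℂ) = (X + star X) / 2 := by
      rw [Complex.star_def, Complex.add_conj]; push_cast; ring
    rw [h4]
    linear_combination (-(1 / 2 : ℂ)) * h2
  rw [h1 z hz, h3, sub_add_eq_add_sub, add_sub_assoc]
  congr 1
  have h5 : Complex.I * ((E.diag ψ).real univ : ℂ) = ∫ _, Complex.I ∂(E.diag ψ) := by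
    rw [integral_const, Complex.real_smul, mul_comm]
  rw [h5, ← integral_const_mul, ← integral_sub
    (((bddMeas_sub_mul_inv_sub hz Complex.I).integrable _).const_mul _) (integrable_const _)]
  refine integral_congr_ae (Eventually.of_forall fun t => ?_)
  have g1 := ofReal_sub_ne_zero hz t
  have g2 := one_add_sq_ne_zero t
  simp only [herglotzKernel]
  push_cast
  field_simp
  linear_combination (-1 : ℂ) * Complex.I_sq

end Psi

end WeylPair

/-! ### Expansions with respect to a matrix of spectral measures -/

section Expansion

variable {H : Type*} [NormedAddCommGroup H] [InnerProductSpace ℂ H] [CompleteSpace H]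

/-- The components of `x` in disjoint spectral intervals are orthogonal, so `N` pieces of norm
`O(1/N)` add up to squared norm `O(1/N)`. -/
theorem ProjMeasure.apply_Ioc_eq_zero (E : ProjMeasure H) {a b K : ℝ} (hab : a ≤ b) {x : H}
    (h : ∀ s t, a ≤ s → s ≤ t → t ≤ b → ‖E (Ioc s t) x‖ ≤ K * (t - s)) : E (Ioc a b) x = 0 := by
  have key : ∀ N : ℕ, ‖E (Ioc a b) x‖ ^ 2 ≤ (K * (b - a)) ^ 2 / ((N + 1 : ℕ) : ℝ) := fun N => by
    set M : ℝ := ((N + 1 : ℕ) : ℝ) with hM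
    have hM0 : 0 < M := by positivity
    set δ := (b - a) / M with hδ
    have hδ0 : 0 ≤ δ := div_nonneg (sub_nonneg.2 hab) hM0.le
    have hMδ : M * δ = b - a := mul_div_cancel₀ _ hM0.ne'
    have ind : ∀ k : ℕ, k ≤ N + 1 → (E.diag x).real (Ioc a (a + k * δ)) ≤ k * (K * δ) ^ 2 := by
      intro k
      induction k with
      | zero => simp
      | succ k ih =>
        intro hk
        have h1 : a ≤ a + k * δ := by have := mul_nonneg (Nat.cast_nonneg k : (0 : ℝ) ≤ k) hδ0; linarith
        have h2 : a + k * δ ≤ a + ((k + 1 : ℕ) : ℝ) * δ := by push_cast; linarith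
        have h3 : a + ((k + 1 : ℕ) : ℝ) * δ ≤ b := by
          have : ((k + 1 : ℕ) : ℝ) * δ ≤ M * δ :=
            mul_le_mul_of_nonneg_right (Nat.cast_le.2 hk) hδ0
          linarith
        rw [← Ioc_union_Ioc_eq_Ioc h1 h2, measureReal_union (Ioc_disjoint_Ioc_of_le le_rfl)
          measurableSet_Ioc]
        have h4 := h _ _ h1 h2 h3
        have h5 : a + ((k + 1 : ℕ) : ℝ) * δ - (a + k * δ) = δ := by push_cast; ring
        rw [h5] at h4
        have h6 := E.diag_real (S := Ioc (a + k * δ) (a + ((k + 1 : ℕ) : ℝ) * δ)) measurableSet_Ioc x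
        rw [h6]
        have h7 : ‖E (Ioc (a + k * δ) (a + ((k + 1 : ℕ) : ℝ) * δ)) x‖ ^ 2 ≤ (K * δ) ^ 2 := by
          gcongr
        have := ih (by omega)
        push_cast at *
        linarith
    have h1 := ind (N + 1) le_rfl
    rw [← hM, hMδ, add_sub_cancel, E.diag_real measurableSet_Ioc] at h1
    refine h1.trans (le_of_eq ?_)
    rw [hδ]
    field_simp
  have h0 : Tendsto (fun N : ℕ => (K * (b - a)) ^ 2 / ((N + 1 : ℕ) : ℝ)) atTop (𝓝 0) :=
    (tendsto_const_div_atTop_nhds_zero_nat _).comp (tendsto_add_atTop_nat 1)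
  have h1 : ‖E (Ioc a b) x‖ ^ 2 ≤ 0 := ge_of_tendsto' h0 key
  exact norm_eq_zero.1 (pow_eq_zero_iff two_ne_zero |>.1 (le_antisymm h1 (by positivity)))

theorem indicator_one_mul_mul {S T : Set ℝ} (h : S ⊆ T) (F : ℝ → ℂ) :
    S.indicator 1 * (F * T.indicator 1) = F * S.indicator 1 := by
  ext t
  by_cases hS : t ∈ S
  · simp [hS, h hS]
  · simp [hS]

theorem norm_mul_indicator_le {F : ℝ → ℂ} {S : Set ℝ} {C : ℝ} (hC : 0 ≤ C)
    (h : ∀ t ∈ S, ‖F t‖ ≤ C) (t : ℝ) : ‖(F * S.indicator 1 : ℝ → ℂ) t‖ ≤ C := by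
  by_cases hS : t ∈ S
  · simpa [hS] using h t hS
  · simpa [hS] using hC

variable {n : Type*} [Fintype n]

/-- The factor `λ - i`. -/
def subI (t : ℝ) : ℂ := (t : ℂ) - Complex.I

theorem continuous_subI : Continuous subI := by unfold subI; fun_prop

theorem norm_subI_le (t : ℝ) : ‖subI t‖ ≤ |t| + 1 := by
  refine (norm_sub_le _ _).trans ?_
  simp

variable [DecidableEq n]

/-- `E(B) x = ∑_a ∫_B (λ - i) η_a(λ) dE(λ) ψ(e_a)` for all bounded intervals `B`. -/
structure Expands (E : ProjMeasure H) (ψ : (n → ℂ) →ₗ[ℂ] H) (x : H) (η : ℝ → n → ℂ) : Prop where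
  continuous : Continuous η
  apply_Ioc : ∀ a b, a ≤ b → E (Ioc a b) x =
    ∑ i, E.fcalc ((fun r => subI r * η r i) * (Ioc a b).indicator 1) (ψ (Pi.single i 1))

/-! ### A local criterion for the expansion. -/

section Criterion

variable {E : ProjMeasure H} {ψ : (n → ℂ) →ₗ[ℂ] H} {x : H} {η : ℝ → n → ℂ}

/-- On a short interval ending at `t` the hypothesis gives the expansion with `η` frozen at `t`, up
to a term of norm `O(t - s)`; unfreezing costs the same by the Lipschitz bound. A defect that is
locally linear in the length of the interval vanishes. -/
theorem apply_Ioc_eq_sum_fcalc (hη : Continuous η) {a b K : ℝ} (hab : a ≤ b)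
    (hL : ∀ s ∈ Icc a b, ∀ t ∈ Icc a b, ∀ i, ‖η s i - η t i‖ ≤ K * |s - t|)
    (hq : ∀ t ∈ Icc a b, ∃ q, ‖q‖ ≤ K ∧ ∀ s, a ≤ s → s ≤ t →
      E (Ioc s t) x = E.fcalc (subI * (Ioc s t).indicator 1) (ψ (η t)) +
        E.fcalc ((fun r : ℝ => (r : ℂ) - t) * (Ioc s t).indicator 1) q) :
    E (Ioc a b) x =
      ∑ i, E.fcalc ((fun r => subI r * η r i) * (Ioc a b).indicator 1) (ψ (Pi.single i 1)) := by
  have hηi : ∀ i, Continuous fun r => η r i := fun i => (continuous_apply i).comp hη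
  have hF : ∀ i, Continuous fun r => subI r * η r i := fun i => continuous_subI.mul (hηi i)
  have hK : 0 ≤ K := by
    obtain ⟨q, h1, -⟩ := hq a ⟨le_rfl, hab⟩
    exact (norm_nonneg q).trans h1
  set M : ℝ := |a| + |b| + 1 with hM
  have hM0 : 0 ≤ M := by positivity
  have hMb : ∀ r ∈ Icc a b, ‖subI r‖ ≤ M := fun r hr => by
    refine (norm_subI_le r).trans ?_
    have := abs_le_max_abs_abs hr.1 hr.2
    have h1 : max |a| |b| ≤ |a| + |b| := max_le_add_of_nonneg (abs_nonneg _) (abs_nonneg _)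
    linarith
  have hB : MeasurableSet (Ioc a b) := measurableSet_Ioc
  set D := E (Ioc a b) x - ∑ i, E.fcalc ((fun r => subI r * η r i) * (Ioc a b).indicator 1)
    (ψ (Pi.single i 1)) with hD
  -- The defect localizes: applying `E((s, t])` produces the analogous defect for the subinterval.
  have hED : ∀ s t, a ≤ s → s ≤ t → t ≤ b → E (Ioc s t) D = E (Ioc s t) x -
      ∑ i, E.fcalc ((fun r => subI r * η r i) * (Ioc s t).indicator 1) (ψ (Pi.single i 1)) := by
    intro s t h1 h2 h3
    have hsub : Ioc s t ⊆ Ioc a b := Ioc_subset_Ioc h1 h3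
    rw [hD, map_sub, E.apply_apply measurableSet_Ioc hB, inter_eq_left.2 hsub, map_sum]
    congr 1
    refine Finset.sum_congr rfl fun i _ => ?_
    rw [← E.fcalc_indicator measurableSet_Ioc, E.fcalc_fcalc (BddMeas.indicator_one measurableSet_Ioc)
      (BddMeas.of_continuousOn_indicator (hF i) hB Ioc_subset_Icc_self), indicator_one_mul_mul hsub]
  have hsmall : E (Ioc a b) D = 0 := by
    refine E.apply_Ioc_eq_zero (K := K + ∑ i, M * K * ‖ψ (Pi.single i 1)‖) hab
      fun s t h1 h2 h3 => ?_
    have hts : 0 ≤ t - s := sub_nonneg.2 h2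
    have hS : MeasurableSet (Ioc s t) := measurableSet_Ioc
    obtain ⟨q, hq1, hq2⟩ := hq t ⟨h1.trans h2, h3⟩
    have hIcc : ∀ r ∈ Ioc s t, r ∈ Icc a b := fun r hr => ⟨h1.trans hr.1.le, hr.2.trans h3⟩
    have hdiff : ∀ i, E.fcalc (subI * (Ioc s t).indicator 1) (η t i • ψ (Pi.single i 1)) -
        E.fcalc ((fun r => subI r * η r i) * (Ioc s t).indicator 1) (ψ (Pi.single i 1)) =
        E.fcalc ((fun r => subI r * (η t i - η r i)) * (Ioc s t).indicator 1)
          (ψ (Pi.single i 1)) := fun i => by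
      have b1 := BddMeas.of_continuousOn_indicator continuous_subI hS
        (Ioc_subset_Icc_self (a := s) (b := t))
      have b2 := BddMeas.of_continuousOn_indicator (hF i) hS
        (Ioc_subset_Icc_self (a := s) (b := t))
      have e : (fun r => subI r * (η t i - η r i)) * (Ioc s t).indicator 1 =
          η t i • (subI * (Ioc s t).indicator 1) -
            (fun r => subI r * η r i) * (Ioc s t).indicator 1 := by
        ext r
        simp only [Pi.mul_apply, Pi.sub_apply, Pi.smul_apply, smul_eq_mul]
        ring
      rw [e, E.fcalc_sub (b1.smul _) b2, E.fcalc_smul _ b1, map_smul]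
      rfl
    rw [hED s t h1 h2 h3, hq2 s h1 h2, map_eq_sum_single ψ, map_sum, add_sub_right_comm,
      ← Finset.sum_sub_distrib, Finset.sum_congr rfl fun i _ => hdiff i, add_comm]
    refine (norm_add_le _ _).trans ?_
    rw [add_mul]
    refine add_le_add ?_ ?_
    · refine (E.norm_fcalc_le (BddMeas.of_continuousOn_indicator (by fun_prop) hS
        (Ioc_subset_Icc_self (a := s) (b := t))) (norm_mul_indicator_le hts fun r hr => ?_) q).trans ?_
      · rw [← Complex.ofReal_sub, Complex.norm_real, Real.norm_eq_abs, abs_sub_comm,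
          abs_of_nonneg (sub_nonneg.2 hr.2)]
        linarith [hr.1]
      · rw [mul_comm]
        exact mul_le_mul_of_nonneg_right hq1 hts
    · rw [Finset.sum_mul]
      refine (norm_sum_le _ _).trans (Finset.sum_le_sum fun i _ => ?_)
      refine (E.norm_fcalc_le (C := M * (K * (t - s))) (BddMeas.of_continuousOn_indicator
        (continuous_subI.mul (continuous_const.sub (hηi i))) hS
        (Ioc_subset_Icc_self (a := s) (b := t)))
        (norm_mul_indicator_le (by positivity) fun r hr => ?_) _).trans (le_of_eq (by ring))
      rw [Pi.mul_apply, norm_mul]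
      refine mul_le_mul (hMb r (hIcc r hr)) ((hL t ⟨h1.trans h2, h3⟩ r (hIcc r hr) i).trans ?_)
        (norm_nonneg _) hM0
      refine mul_le_mul_of_nonneg_left ?_ hK
      rw [abs_of_nonneg (sub_nonneg.2 hr.2)]
      linarith [hr.1]
  have hEq := hED a b le_rfl hab le_rfl
  rw [hsmall] at hEq
  exact sub_eq_zero.1 hEq.symm

end Criterion

/-! ### From expansions to integrals against the matrix measure. -/

section Consequences

variable {Ω : MatrixMeasure n} {E : ProjMeasure H} {ψ : (n → ℂ) →ₗ[ℂ] H}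

omit [DecidableEq n] in
theorem integrable_mul_density {G : ℝ → ℂ} (hG : Integrable G Ω.base) (a b : n) :
    Integrable (fun t => G t * Ω.density t a b) Ω.base := by
  refine Integrable.mul_bdd (c := 4) hG (Ω.measurable a b).aestronglyMeasurable ?_
  filter_upwards [Ω.posSemidef, Ω.trace_eq_one] with t h1 h2
  exact norm_entry_le_of_posSemidef h1 h2 a b

/-- Polarization transfers the relation between quadratic forms and measures to the matrix entries.
-/
theorem Represents.form_single (h : Represents Ω E ψ) {G : ℝ → ℂ} (hG : Integrable G Ω.base)
    (a b : n) :
    E.form (fun t => ((1 + t ^ 2 : ℝ) : ℂ) * G t) (ψ (Pi.single a 1)) (ψ (Pi.single b 1)) =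
      ∫ t, G t * Ω.density t a b ∂Ω.base := by
  have hi : ∀ C : n → ℂ, Integrable (fun t => G t * mform (Ω.density t) C C) Ω.base := fun C => by
    simp only [mform_eq_sum, Finset.mul_sum]
    refine integrable_finsetSum _ fun a _ => integrable_finsetSum _ fun b _ => ?_
    refine ((integrable_mul_density hG a b).const_mul (star (C a) * C b)).congr
      (Eventually.of_forall fun t => ?_)
    simp only
    ring
  have e : ∀ t, G t * Ω.density t a b = (1 / 4) * ∑ k ∈ Finset.range 4, Complex.I ^ k *
      (G t * mform (Ω.density t) (Pi.single b 1 + Complex.I ^ k • Pi.single a 1)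
        (Pi.single b 1 + Complex.I ^ k • Pi.single a 1)) := fun t => by
    rw [← mform_single (Ω.density t) a b, mform_polarization, ← mul_assoc, mul_comm (G t), mul_assoc,
      Finset.mul_sum]
    congr 1
    exact Finset.sum_congr rfl fun k _ => by ring
  simp only [e]
  rw [integral_const_mul, integral_finsetSum _ fun k _ => (hi _).const_mul _, ProjMeasure.form]
  congr 1
  refine Finset.sum_congr rfl fun k _ => ?_
  rw [integral_const_mul, h.integral_mul_quad, map_add, map_smul]

variable {x y : H} {η θ : ℝ → n → ℂ}

omit [DecidableEq n] in
theorem integrable_mul_indicator {F : ℝ → ℂ} (hF : Continuous F) (a b : ℝ) :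
    Integrable (F * (Ioc a b).indicator 1) Ω.base := by
  have := Ω.locallyFinite
  have h := (hF.integrableOn_Ioc (μ := Ω.base) (a := a) (b := b)).integrable_indicator
    measurableSet_Ioc
  refine h.congr (Eventually.of_forall fun t => ?_)
  by_cases ht : t ∈ Ioc a b
  · simp [ht]
  · simp [ht]

/-- Insert both expansions. The functional calculus collects `|λ - i|² F` times the coefficients,
and `|λ - i|² = 1 + λ²` is the weight relating `Ω` to the measures of `E`. -/
theorem Expands.inner_fcalc (hΩ : Represents Ω E ψ) (hx : Expands E ψ x η) (hy : Expands E ψ y θ)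
    {F : ℝ → ℂ} (hF : Continuous F) {a b : ℝ} (hab : a ≤ b) :
    Integrable (fun t => mform (Ω.density t) (η t) ((F * (Ioc a b).indicator 1 : ℝ → ℂ) t • θ t)) Ω.base ∧
    inner ℂ x (E.fcalc (F * (Ioc a b).indicator 1) y) =
      ∫ t, mform (Ω.density t) (η t) ((F * (Ioc a b).indicator 1 : ℝ → ℂ) t • θ t) ∂Ω.base := by
  have hη : ∀ i, Continuous fun r => η r i := fun i => (continuous_apply i).comp hx.continuous
  have hθ : ∀ i, Continuous fun r => θ r i := fun i => (continuous_apply i).comp hy.continuous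
  set G : n → n → ℝ → ℂ := fun i k t => F t * (star (η t i) * θ t k) with hG
  have hGc : ∀ i k, Continuous (G i k) := fun i k =>
    hF.mul ((continuous_star.comp (hη i)).mul (hθ k))
  have hGi : ∀ i k, Integrable (G i k * (Ioc a b).indicator 1) Ω.base := fun i k =>
    integrable_mul_indicator (hGc i k) a b
  have em : ∀ t, mform (Ω.density t) (η t) ((F * (Ioc a b).indicator 1 : ℝ → ℂ) t • θ t) =
      ∑ i, ∑ k, (G i k * (Ioc a b).indicator 1 : ℝ → ℂ) t * Ω.density t i k := fun t => by
    rw [mform_eq_sum]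
    refine Finset.sum_congr rfl fun i _ => Finset.sum_congr rfl fun k _ => ?_
    simp only [hG, Pi.smul_apply, Pi.mul_apply, smul_eq_mul]
    ring
  simp only [em]
  refine ⟨integrable_finsetSum _ fun i _ => integrable_finsetSum _ fun k _ =>
    integrable_mul_density (hGi i k) i k, ?_⟩
  rw [integral_finsetSum _ fun i _ => integrable_finsetSum _ fun k _ =>
    integrable_mul_density (hGi i k) i k]
  have hB : MeasurableSet (Ioc a b) := measurableSet_Ioc
  have bF := BddMeas.of_continuousOn_indicator hF hB Ioc_subset_Icc_self
  have bη : ∀ i, BddMeas ((fun r => subI r * η r i) * (Ioc a b).indicator 1) := fun i =>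
    BddMeas.of_continuousOn_indicator (continuous_subI.mul (hη i)) hB Ioc_subset_Icc_self
  have bθ : ∀ i, BddMeas ((fun r => subI r * θ r i) * (Ioc a b).indicator 1) := fun i =>
    BddMeas.of_continuousOn_indicator (continuous_subI.mul (hθ i)) hB Ioc_subset_Icc_self
  have b1 := BddMeas.indicator_one hB
  -- The projection is inserted on both sides of the operator, so that only `E(B) x` and `E(B) y`,
  -- for which expansions exist, enter.
  have e1 : E.fcalc (F * (Ioc a b).indicator 1) y =
      E (Ioc a b) (E.fcalc (F * (Ioc a b).indicator 1) (E (Ioc a b) y)) := by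
    rw [← E.fcalc_indicator hB, E.fcalc_fcalc bF b1, E.fcalc_fcalc b1 (bF.mul b1)]
    congr 2
    ext t
    by_cases ht : t ∈ Ioc a b <;> simp [ht]
  rw [e1, ← E.inner_apply_left hB, hx.apply_Ioc a b hab, hy.apply_Ioc a b hab, map_sum, sum_inner]
  refine Finset.sum_congr rfl fun i _ => ?_
  rw [inner_sum, integral_finsetSum _ fun k _ => integrable_mul_density (hGi i k) i k]
  refine Finset.sum_congr rfl fun k _ => ?_
  rw [E.inner_fcalc_left (bη i), E.fcalc_fcalc bF (bθ k), E.fcalc_fcalc (bη i).star (bF.mul (bθ k)),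
    E.inner_fcalc ((bη i).star.mul (bF.mul (bθ k))), ← hΩ.form_single (hGi i k)]
  congr 1
  ext t
  by_cases ht : t ∈ Ioc a b
  · have : star (subI t) * subI t = ((1 + t ^ 2 : ℝ) : ℂ) := by
      simp only [subI, star_sub, Complex.star_def, Complex.conj_ofReal, Complex.conj_I]
      push_cast
      linear_combination (-1 : ℂ) * Complex.I_sq
    rw [← this]
    simp [ht, hG]
    ring
  · simp [ht]

/-- A Bessel bound: over `(-k, k]` the integral equals `‖E((-k, k]) x‖² ≤ ‖x‖²`, and the intervals
exhaust the line. -/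
theorem Expands.memL2 (hΩ : Represents Ω E ψ) (hx : Expands E ψ x η) : Ω.MemL2 η := by
  refine ⟨hx.continuous.aestronglyMeasurable, ?_⟩
  have hi := fun k : ℕ => hx.inner_fcalc hΩ hx (F := fun _ => 1) continuous_const
    (a := -(k : ℝ)) (b := k) (by linarith [(Nat.cast_nonneg k : (0 : ℝ) ≤ k)])
  have e : ∀ (k : ℕ) (t : ℝ), mform (Ω.density t) (η t)
      (((fun _ => 1) * (Ioc (-(k : ℝ)) k).indicator 1 : ℝ → ℂ) t • η t) =
      (Ioc (-(k : ℝ)) k).indicator (fun t => mform (Ω.density t) (η t) (η t)) t := fun k t => by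
    by_cases ht : t ∈ Ioc (-(k : ℝ)) k
    · simp [ht]
    · simp [ht, mform]
  simp only [e] at hi
  have hcov : AECover Ω.base atTop fun k : ℕ => Ioc (-(k : ℝ)) k :=
    aecover_Ioc (tendsto_neg_atTop_atBot.comp tendsto_natCast_atTop_atTop)
      tendsto_natCast_atTop_atTop
  refine hcov.integrable_of_integral_norm_bounded (‖x‖ ^ 2)
    (fun k => (integrable_indicator_iff measurableSet_Ioc).1 (hi k).1)
    (Eventually.of_forall fun k => ?_)
  have h2 := (hi k).2
  have e1 : ((fun _ => 1) * (Ioc (-(k : ℝ)) k).indicator 1 : ℝ → ℂ) =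
      (Ioc (-(k : ℝ)) k).indicator 1 := by ext t; simp
  rw [e1, E.fcalc_indicator measurableSet_Ioc, inner_apply_self E measurableSet_Ioc,
    integral_indicator measurableSet_Ioc] at h2
  have e2 : ∫ t in Ioc (-(k : ℝ)) k, ‖star (η t) ⬝ᵥ (Ω.density t).mulVec (η t)‖ ∂Ω.base =
      (E.diag x).real (Ioc (-(k : ℝ)) k) := by
    apply Complex.ofReal_injective
    rw [h2, ← integral_complex_ofReal]
    refine setIntegral_congr_ae measurableSet_Ioc ?_
    filter_upwards [quad_eq_ofReal Ω] with t ht _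
    obtain ⟨h3, h4⟩ := ht (η t)
    rw [← mform, h4, Complex.norm_real, Real.norm_of_nonneg h3]
  rw [e2, E.diag_real measurableSet_Ioc]
  have h5 : ‖E (Ioc (-(k : ℝ)) k) x‖ ≤ 1 * ‖x‖ := by
    rw [← E.fcalc_indicator measurableSet_Ioc]
    exact E.norm_fcalc_le (BddMeas.indicator_one measurableSet_Ioc)
      (fun t => (norm_indicator_le_norm_self _ _).trans (by simp)) x
  rw [one_mul] at h5
  gcongr

/-- The integrability statement of `Expands.inner_fcalc`, used with the continuous function `|F|²`.
-/
theorem Expands.memL2_mulBy (hΩ : Represents Ω E ψ) (hx : Expands E ψ x η) {F : ℝ → ℂ}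
    (hF : Continuous F) {a b : ℝ} (hab : a ≤ b) :
    Ω.MemL2 (mulBy (F * (Ioc a b).indicator 1) η) := by
  refine ⟨?_, ?_⟩
  · exact ((hF.measurable.mul (measurable_one.indicator measurableSet_Ioc)).smul
      hx.continuous.measurable).aestronglyMeasurable
  · have h := (hx.inner_fcalc hΩ hx ((continuous_star.comp hF).mul hF) hab).1
    refine h.congr (Eventually.of_forall fun t => ?_)
    change _ = mform (Ω.density t) _ _
    simp only [mulBy]
    rw [mform_smul_left, mform_smul_right, mform_smul_right, ← mul_assoc]
    congr 1
    by_cases ht : t ∈ Ioc a b <;> simp [ht]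

end Consequences

end Expansion

/-! ### Inhomogeneous equations with compactly supported right-hand side -/

section Source

variable {m : ℕ} {Φ : ℝ → Vec m →L[ℂ] Vec m}

/-- The factor `b - a + 1` replaces the square root of the length, which it dominates. -/
theorem norm_toLp_le_of_bound {u : ℝ → Vec m} (hu : MemLp u 2 volume) {a b D : ℝ} (hab : a ≤ b)
    (hD : 0 ≤ D) (hb : ∀ x ∈ Icc a b, ‖u x‖ ≤ D) (h0 : ∀ x ∉ Icc a b, u x = 0) :
    ‖hu.toLp u‖ ≤ D * (b - a + 1) := by
  have h1 : ((‖hu.toLp u‖ ^ 2 : ℝ) : ℂ) = ∫ x, inner ℂ (u x) (u x) := by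
    rw [← inner_toLp hu hu, inner_self_eq_norm_sq_to_K]
    norm_cast
  have h2 : ∫ x, inner ℂ (u x) (u x) = ∫ x in Icc a b, inner ℂ (u x) (u x) := by
    rw [setIntegral_eq_integral_of_forall_compl_eq_zero]
    intro x hx
    rw [h0 x hx, inner_zero_left]
  have h3 : ‖∫ x in Icc a b, inner ℂ (u x) (u x)‖ ≤ D ^ 2 * volume.real (Icc a b) := by
    refine norm_setIntegral_le_of_norm_le_const (by simp) fun x hx => ?_
    refine (norm_inner_le_norm _ _).trans ?_
    rw [sq]
    exact mul_le_mul (hb x hx) (hb x hx) (norm_nonneg _) hD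
  rw [← h2, ← h1, Complex.norm_real, Real.norm_of_nonneg (by positivity), Real.volume_real_Icc_of_le hab] at h3
  have hl : 0 ≤ b - a := sub_nonneg.2 hab
  refine le_of_sq_le_sq ?_ (by positivity)
  rw [mul_pow]
  refine h3.trans (mul_le_mul_of_nonneg_left ?_ (by positivity))
  nlinarith

theorem memLp_Iic_of_zero {u : ℝ → Vec m} (hu : Continuous u) {a : ℝ} (h : ∀ x ≤ a, u x = 0)
    (x₀ : ℝ) : MemLp u 2 (volume.restrict (Iic x₀)) := by
  rw [← memLp_indicator_iff_restrict measurableSet_Iic]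
  have e : (Iic x₀).indicator u = (Ioc a x₀).indicator u := by
    ext1 x
    by_cases h1 : x ∈ Iic x₀
    · by_cases h2 : x ≤ a
      · simp [indicator, h x h2]
      · rw [indicator_of_mem (s := Iic x₀) h1,
          indicator_of_mem (s := Ioc a x₀) ⟨not_le.1 h2, h1⟩]
    · rw [indicator_of_notMem (s := Iic x₀) h1,
        indicator_of_notMem (s := Ioc a x₀) fun h2 => h1 h2.2]
  rw [e]
  exact memLp_indicator_of_continuous hu a x₀

theorem memLp_Ioi_of_zero {u : ℝ → Vec m} (hu : Continuous u) {b : ℝ} (h : ∀ x, b ≤ x → u x = 0)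
    (x₀ : ℝ) : MemLp u 2 (volume.restrict (Ioi x₀)) := by
  rw [← memLp_indicator_iff_restrict measurableSet_Ioi]
  have e : (Ioi x₀).indicator u = (Ioc x₀ b).indicator u := by
    ext1 x
    by_cases h1 : x ∈ Ioi x₀
    · by_cases h2 : b ≤ x
      · simp [indicator, h x h2]
      · rw [indicator_of_mem (s := Ioi x₀) h1,
          indicator_of_mem (s := Ioc x₀ b) ⟨h1, (not_le.1 h2).le⟩]
    · rw [indicator_of_notMem (s := Ioi x₀) h1,
        indicator_of_notMem (s := Ioc x₀ b) fun h2 => h1 h2.1]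
  rw [e]
  exact memLp_indicator_of_continuous hu x₀ b

/-- Solutions with vanishing data are bounded by their forcing term, locally uniformly in `z`. -/
theorem exists_isTau_bound (hΦ : IsPotential Φ) {a b : ℝ} (hab : a ≤ b) (L : ℝ) :
    ∃ K, 0 ≤ K ∧ ∀ (z : ℂ) (h u w : ℝ → Vec m), ‖z‖ ≤ L → IsTau Φ z h u w →
      ∀ x₁ ∈ Icc a b, u x₁ = 0 → w x₁ = 0 → ∀ D, (∀ t ∈ Icc a b, ‖h t‖ ≤ D) →
      ∀ x ∈ Icc a b, ‖(u x, w x)‖ ≤ K * D := by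
  have hi : ∀ c : ℝ, IntervalIntegrable (fun t => 1 + c + ‖Φ t‖) volume a b := fun c =>
    locallyIntegrable_intervalIntegrable
      ((locallyIntegrable_const _).add (locallyIntegrable_norm hΦ.locInt)) a b
  refine ⟨2 * (b - a) * Real.exp (2 * ∫ t in a..b, (1 + L + ‖Φ t‖)),
    mul_nonneg (mul_nonneg zero_le_two (sub_nonneg.2 hab)) (Real.exp_nonneg _),
    fun z h u w hz H x₁ hx₁ hu hw D hD x hx => ?_⟩
  have hsub : uIoc x₁ x ⊆ uIoc a b := by
    rw [uIoc_of_le hab, uIoc]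
    exact Ioc_subset_Ioc (le_min hx₁.1 hx.1) (max_le hx₁.2 hx.2)
  have hsub' : uIoc x₁ x ⊆ Icc a b := by
    rw [uIoc_of_le hab] at hsub
    exact hsub.trans Ioc_subset_Icc_self
  have hD0 : 0 ≤ D := (norm_nonneg _).trans (hD a ⟨le_rfl, hab⟩)
  have h1 : |∫ t in x₁..x, ‖h t‖| ≤ D * (b - a) := by
    have := intervalIntegral.norm_integral_le_of_norm_le_const (f := fun t => ‖h t‖) (C := D)
      (a := x₁) (b := x) fun t ht => by rw [norm_norm]; exact hD t (hsub' ht)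
    refine this.trans (mul_le_mul_of_nonneg_left ?_ hD0)
    rw [abs_le]
    constructor <;> linarith [hx.1, hx.2, hx₁.1, hx₁.2]
  have h2 : |∫ t in x₁..x, (1 + ‖z‖ + ‖Φ t‖)| ≤ ∫ t in a..b, (1 + L + ‖Φ t‖) := by
    have e1 := intervalIntegral.abs_integral_mono_interval hsub
      (Eventually.of_forall fun t => by positivity) (hi ‖z‖)
    refine e1.trans ?_
    rw [abs_of_nonneg (intervalIntegral.integral_nonneg hab fun t _ => by positivity)]
    exact intervalIntegral.integral_mono_on hab (hi _) (hi _) fun t _ => by linarith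
  have h3 := H.bound hΦ x₁ x
  rw [hu, hw] at h3
  simp only [Prod.mk_zero_zero, norm_zero, zero_add] at h3
  refine h3.trans ?_
  calc _ ≤ 2 * (D * (b - a)) * Real.exp (2 * ∫ t in a..b, (1 + L + ‖Φ t‖)) := by gcongr
    _ = _ := by ring

/-- The solution of `τ u = z u + h` with vanishing data at `x₁`. -/
def srcSol (Φ : ℝ → Vec m →L[ℂ] Vec m) (z : ℂ) (h : ℝ → Vec m) (x₁ : ℝ) : ℝ → Vec m × Vec m :=
  Classical.epsilon fun y => IsTau Φ z h (fun x => (y x).1) (fun x => (y x).2) ∧ y x₁ = 0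

section

variable (hΦ : IsPotential Φ) (z : ℂ) {h : ℝ → Vec m} (hh : LocallyIntegrable h volume) (x₁ : ℝ)

include hΦ hh

theorem srcSol_spec : IsTau Φ z h (fun x => (srcSol Φ z h x₁ x).1)
    (fun x => (srcSol Φ z h x₁ x).2) ∧ srcSol Φ z h x₁ x₁ = 0 :=
  Classical.epsilon_spec (exists_isTau hΦ z hh x₁ 0)

theorem srcSol_eq_zero {x : ℝ} (h0 : ∀ t ∈ uIoc x₁ x, h t = 0) : srcSol Φ z h x₁ x = 0 := by
  obtain ⟨H, h1⟩ := srcSol_spec hΦ z hh x₁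
  exact H.eqOn_of_forcing_zero hΦ (isTau_zero Φ z) (congrArg Prod.fst h1) (congrArg Prod.snd h1) h0

end

/-- A change of the spectral parameter is moved into the forcing term; this gives Lipschitz
dependence on the parameter. -/
theorem IsTau.change_parameter {z : ℂ} {h u w : ℝ → Vec m} (H : IsTau Φ z h u w) (z' : ℂ) :
    IsTau Φ z' (h + (z - z') • u) u w := by
  refine ⟨H.fst, ?_⟩
  have e : z' • u + (h + (z - z') • u) = z • u + h := by
    rw [sub_smul]; abel
  rw [e]
  exact H.snd

/-- The jump data at `x₀` of the function which solves `τ q = z q + h` off `x₀` and vanishes to the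
left of `a` and to the right of `b`. -/
def jump (Φ : ℝ → Vec m →L[ℂ] Vec m) (h : ℝ → Vec m) (a b x₀ : ℝ) (z : ℂ) : Fin m ⊕ Fin m → ℂ :=
  Sum.elim (fun i => ((srcSol Φ z h b x₀).2 - (srcSol Φ z h a x₀).2) i)
    (fun i => ((srcSol Φ z h a x₀).1 - (srcSol Φ z h b x₀).1) i)

theorem upper_jump (Φ : ℝ → Vec m →L[ℂ] Vec m) (h : ℝ → Vec m) (a b x₀ : ℝ) (z : ℂ) :
    upper (jump Φ h a b x₀ z) = (srcSol Φ z h b x₀).2 - (srcSol Φ z h a x₀).2 := rfl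

theorem lower_jump (Φ : ℝ → Vec m →L[ℂ] Vec m) (h : ℝ → Vec m) (a b x₀ : ℝ) (z : ℂ) :
    lower (jump Φ h a b x₀ z) = (srcSol Φ z h a x₀).1 - (srcSol Φ z h b x₀).1 := rfl

/-- The function which solves `τ q = z q + h` off `x₀` and vanishes near `±∞`. -/
def srcGlue (Φ : ℝ → Vec m →L[ℂ] Vec m) (h : ℝ → Vec m) (a b x₀ : ℝ) (z : ℂ) : ℝ → Vec m :=
  glue x₀ (fun x => (srcSol Φ z h a x).1) (fun x => (srcSol Φ z h b x).1)

/-! ### The glued solution with compactly supported source and its jump. -/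

section Compact

variable (hΦ : IsPotential Φ) {h : ℝ → Vec m} (hc : Continuous h) {a b x₀ : ℝ} (ha : a ≤ x₀)
  (hb : x₀ ≤ b) (h1 : ∀ x ≤ a, h x = 0) (h2 : ∀ x, b ≤ x → h x = 0)

include hΦ hc h1 in
theorem srcSol_left (z : ℂ) {x : ℝ} (hx : x ≤ a) : srcSol Φ z h a x = 0 :=
  srcSol_eq_zero hΦ z hc.locallyIntegrable a fun t ht => by
    rw [uIoc_of_ge hx] at ht
    exact h1 t ht.2

include hΦ hc h2 in
theorem srcSol_right (z : ℂ) {x : ℝ} (hx : b ≤ x) : srcSol Φ z h b x = 0 :=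
  srcSol_eq_zero hΦ z hc.locallyIntegrable b fun t ht => by
    rw [uIoc_of_le hx] at ht
    exact h2 t ht.1.le

include hΦ hc h1 h2

theorem isPiece_srcSol_left (z : ℂ) (x₀ : ℝ) : IsPiece Φ (Iic x₀) (fun x => (srcSol Φ z h a x).1)
    (fun x => (srcSol Φ z h a x).2) ((z • fun x => (srcSol Φ z h a x).1) + h) := by
  have H := (srcSol_spec hΦ z hc.locallyIntegrable a).1
  refine H.isPiece (memLp_Iic_of_zero H.fst.continuous (a := a) (fun x hx => ?_) x₀)
    (memLp_Iic_of_zero H.snd.continuous (a := a) (fun x hx => ?_) x₀)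
    ((memLp_of_continuous_of_zero hc h1 h2).restrict _)
  · rw [srcSol_left hΦ hc h1 z hx]; rfl
  · rw [srcSol_left hΦ hc h1 z hx]; rfl

theorem isPiece_srcSol_right (z : ℂ) (x₀ : ℝ) : IsPiece Φ (Ioi x₀) (fun x => (srcSol Φ z h b x).1)
    (fun x => (srcSol Φ z h b x).2) ((z • fun x => (srcSol Φ z h b x).1) + h) := by
  have H := (srcSol_spec hΦ z hc.locallyIntegrable b).1
  refine H.isPiece (memLp_Ioi_of_zero H.fst.continuous (b := b) (fun x hx => ?_) x₀)
    (memLp_Ioi_of_zero H.snd.continuous (b := b) (fun x hx => ?_) x₀)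
    ((memLp_of_continuous_of_zero hc h1 h2).restrict _)
  · rw [srcSol_right hΦ hc h2 z hx]; rfl
  · rw [srcSol_right hΦ hc h2 z hx]; rfl

theorem memLp_srcGlue (z : ℂ) (x₀ : ℝ) : MemLp (srcGlue Φ h a b x₀ z) 2 volume :=
  memLp_glue (isPiece_srcSol_left hΦ hc h1 h2 z x₀).memLp
    (isPiece_srcSol_right hΦ hc h1 h2 z x₀).memLp

/-- Green's identity for the glued solution: the source contributes the pairing with `h`, and the
jump contributes the pairing with the data of `u` at `x₀`. The spectral parameter is real, so it
needs no conjugation. -/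
theorem inner_srcGlue (t : ℝ) {u w r : ℝ → Vec m} (hu : IsPiece Φ univ u w r) {f g : L2 m}
    (hf : f =ᵐ[volume] u) (hg : g =ᵐ[volume] r) :
    inner ℂ ((memLp_srcGlue hΦ hc h1 h2 t x₀).toLp _) (g - (t : ℂ) • f) =
      inner ℂ ((memLp_of_continuous_of_zero hc h1 h2).toLp h) f -
        (inner ℂ (upper (jump Φ h a b x₀ t)) (u x₀) +
          inner ℂ (lower (jump Φ h a b x₀ t)) (w x₀)) := by
  have hm := memLp_srcGlue hΦ hc h1 h2 (t : ℂ) x₀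
  have hhm := memLp_of_continuous_of_zero hc h1 h2
  have hg1 := green_glue hΦ (isPiece_srcSol_left hΦ hc h1 h2 (t : ℂ) x₀)
    (isPiece_srcSol_right hΦ hc h1 h2 (t : ℂ) x₀) (hu.mono (subset_univ _))
    (hu.mono (subset_univ _))
  rw [glue_self, glue_self] at hg1
  have e0 : bdry ((srcSol Φ t h a x₀).1, (srcSol Φ t h a x₀).2) (u x₀, w x₀) -
      bdry ((srcSol Φ t h b x₀).1, (srcSol Φ t h b x₀).2) (u x₀, w x₀) =
      -(inner ℂ (upper (jump Φ h a b x₀ t)) (u x₀) +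
          inner ℂ (lower (jump Φ h a b x₀ t)) (w x₀)) := by
    rw [upper_jump, lower_jump]
    simp only [bdry, inner_sub_left]
    ring
  rw [e0] at hg1
  rw [sub_eq_add_neg (inner ℂ (hhm.toLp h) f), ← hg1, L2.inner_def, L2.inner_def,
    ← integral_add (L2.integrable_inner (hhm.toLp h) f)]
  · refine integral_congr_ae ?_
    filter_upwards [hm.coeFn_toLp, hhm.coeFn_toLp, Lp.coeFn_sub g ((t : ℂ) • f),
      Lp.coeFn_smul (t : ℂ) f, hf, hg] with x h3 h4 h5 h6 h7 h8
    rw [h3, h4, h5, Pi.sub_apply, h6, Pi.smul_apply, h7, h8, inner_sub_right, inner_smul_right]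
    simp only [srcGlue, glue]
    split_ifs <;>
    · simp only [Pi.add_apply, Pi.smul_apply, inner_add_left, inner_smul_left, Complex.conj_ofReal]
      ring
  · have hpl := isPiece_srcSol_left hΦ hc h1 h2 (t : ℂ) x₀
    have hpr := isPiece_srcSol_right hΦ hc h1 h2 (t : ℂ) x₀
    have hum := hu.memLp
    have hrm := hu.memLp_image
    rw [Measure.restrict_univ] at hum hrm
    exact (integrable_inner_of_memLp (memLp_glue hpl.memLp hpr.memLp) hrm).sub
      (integrable_inner_of_memLp (memLp_glue hpl.memLp_image hpr.memLp_image) hum)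

include ha hb

/-- Green on `[a, x₀]` and `[x₀, b]` against the homogeneous solution with data `C`: the data of the
sources vanish at `a` and `b`, and the boundary terms at `x₀` assemble the jump. Hence the jump does
not depend on the choice of `a` and `b`. -/
theorem star_jump_dotProduct (t : ℝ) (C : Fin m ⊕ Fin m → ℂ) :
    star (jump Φ h a b x₀ t) ⬝ᵥ C =
      ∫ x, inner ℂ (h x) (tauSol Φ t x₀ (upper C, lower C) x).1 := by
  have Hs := isTau_tauSol hΦ t x₀ (upper C, lower C)
  have Ha := srcSol_spec hΦ (t : ℂ) hc.locallyIntegrable a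
  have Hb := srcSol_spec hΦ (t : ℂ) hc.locallyIntegrable b
  have g1 := green_second hΦ Ha.1.fst Ha.1.snd Hs.fst Hs.snd ha
  have g2 := green_second hΦ Hb.1.fst Hb.1.snd Hs.fst Hs.snd hb
  have hsc : Continuous fun x => (tauSol Φ t x₀ (upper C, lower C) x).1 := Hs.fst.continuous
  have e : ∀ p s k : Vec m, inner ℂ p ((t : ℂ) • s + 0) - inner ℂ ((t : ℂ) • p + k) s =
      -inner ℂ k s := fun p s k => by
    rw [add_zero, inner_smul_right, inner_add_left, inner_smul_left, Complex.conj_ofReal]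
    ring
  simp only [Pi.add_apply, Pi.smul_apply, Pi.zero_apply, e, intervalIntegral.integral_neg, Ha.2,
    Hb.2, tauSol_self hΦ] at g1 g2
  have hsum := intervalIntegral.integral_add_adjacent_intervals
    (intervalIntegrable_inner_left hc.locallyIntegrable hsc a x₀)
    (intervalIntegrable_inner_left hc.locallyIntegrable hsc x₀ b)
  have hall : ∫ x in a..b, inner ℂ (h x) (tauSol Φ t x₀ (upper C, lower C) x).1 =
      ∫ x, inner ℂ (h x) (tauSol Φ t x₀ (upper C, lower C) x).1 := by
    rw [intervalIntegral.integral_of_le (ha.trans hb),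
      setIntegral_eq_integral_of_forall_compl_eq_zero]
    intro x hx
    by_cases hxa : x ≤ a
    · rw [h1 x hxa, inner_zero_left]
    · rw [h2 x (by
        by_contra hxb
        exact hx ⟨not_le.1 hxa, (not_le.1 hxb).le⟩), inner_zero_left]
  rw [← hall, ← hsum, star_dotProduct_eq, upper_jump, lower_jump]
  simp only [bdry, Prod.fst_zero, Prod.snd_zero, inner_zero_left, sub_zero, zero_sub] at g1 g2
  simp only [inner_sub_left]
  linear_combination g1 + g2

/-- Bounds which are uniform for `t` in a compact interval. -/
theorem exists_srcGlue_bound (l₁ l₂ : ℝ) : ∃ K, 0 ≤ K ∧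
    (∀ t ∈ Icc l₁ l₂, ‖(memLp_srcGlue hΦ hc h1 h2 (t : ℂ) x₀).toLp _‖ ≤ K) ∧
    ∀ s ∈ Icc l₁ l₂, ∀ t ∈ Icc l₁ l₂, ∀ i,
      ‖jump Φ h a b x₀ s i - jump Φ h a b x₀ t i‖ ≤ K * |s - t| := by
  have hab := ha.trans hb
  obtain ⟨K, hK, hKb⟩ := exists_isTau_bound hΦ hab (|l₁| + |l₂|)
  obtain ⟨D, hD⟩ := isCompact_Icc.exists_bound_of_continuousOn (s := Icc a b) hc.continuousOn
  have hD0 : 0 ≤ D := (norm_nonneg _).trans (hD a ⟨le_rfl, hab⟩)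
  have hL : ∀ t ∈ Icc l₁ l₂, ‖(t : ℂ)‖ ≤ |l₁| + |l₂| := fun t ht => by
    rw [Complex.norm_real, Real.norm_eq_abs]
    exact (abs_le_max_abs_abs ht.1 ht.2).trans
      (max_le_add_of_nonneg (abs_nonneg _) (abs_nonneg _))
  have hspec := fun (t x₁ : ℝ) => srcSol_spec hΦ (t : ℂ) hc.locallyIntegrable x₁
  have hB : ∀ t ∈ Icc l₁ l₂, ∀ x₁ ∈ Icc a b, ∀ x ∈ Icc a b, ‖srcSol Φ t h x₁ x‖ ≤ K * D :=
    fun t ht x₁ hx₁ x hx => hKb _ _ _ _ (hL t ht) (hspec t x₁).1 x₁ hx₁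
      (congrArg Prod.fst (hspec t x₁).2) (congrArg Prod.snd (hspec t x₁).2) D hD x hx
  -- The difference of two solutions solves the equation at `s` with forcing `(s - t)` times the
  -- solution at `t`, so the a priori bound applies a second time.
  have hdiff : ∀ s ∈ Icc l₁ l₂, ∀ t ∈ Icc l₁ l₂, ∀ x₁ ∈ Icc a b, ∀ x ∈ Icc a b,
      ‖srcSol Φ s h x₁ x - srcSol Φ t h x₁ x‖ ≤ K * (|s - t| * (K * D)) := by
    intro s hs t ht x₁ hx₁ x hx
    have H := (hspec s x₁).1.sub ((hspec t x₁).1.change_parameter (s : ℂ))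
    have e : h - (h + ((t : ℂ) - s) • fun x => (srcSol Φ t h x₁ x).1) =
        ((s : ℂ) - t) • fun x => (srcSol Φ t h x₁ x).1 := by
      rw [sub_add_cancel_left, ← neg_smul, neg_sub]
    rw [e] at H
    refine hKb _ _ _ _ (hL s hs) H x₁ hx₁ ?_ ?_ _ (fun y hy => ?_) x hx
    · simp [(hspec s x₁).2, (hspec t x₁).2]
    · simp [(hspec s x₁).2, (hspec t x₁).2]
    · rw [Pi.smul_apply, norm_smul, ← Complex.ofReal_sub, Complex.norm_real, Real.norm_eq_abs]
      exact mul_le_mul_of_nonneg_left ((norm_fst_le _).trans (hB t ht x₁ hx₁ y hy)) (abs_nonneg _)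
  have haI : a ∈ Icc a b := ⟨le_rfl, hab⟩
  have hbI : b ∈ Icc a b := ⟨hab, le_rfl⟩
  have hxI : x₀ ∈ Icc a b := ⟨ha, hb⟩
  have hl : 0 ≤ b - a := sub_nonneg.2 hab
  refine ⟨K * D * (b - a + 1) + 2 * (K * (K * D)), by positivity, fun t ht => ?_,
    fun s hs t ht i => ?_⟩
  · refine (norm_toLp_le_of_bound (memLp_srcGlue hΦ hc h1 h2 (t : ℂ) x₀) hab (mul_nonneg hK hD0)
      (fun x hx => ?_) fun x hx => ?_).trans (le_add_of_nonneg_right (by positivity))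
    · simp only [srcGlue, glue]
      split_ifs
      · exact (norm_fst_le _).trans (hB t ht a haI x hx)
      · exact (norm_fst_le _).trans (hB t ht b hbI x hx)
    · by_cases hxx : x ≤ x₀
      · rw [srcGlue, glue_of_le hxx, srcSol_left hΦ hc h1 _ (le_of_not_ge fun hax =>
          hx ⟨hax, hxx.trans hb⟩), Prod.fst_zero]
      · rw [srcGlue, glue_of_lt (not_le.1 hxx), srcSol_right hΦ hc h2 _ (le_of_not_ge fun hxb =>
          hx ⟨ha.trans (not_le.1 hxx).le, hxb⟩), Prod.fst_zero]
  · have hda := hdiff s hs t ht a haI x₀ hxI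
    have hdb := hdiff s hs t ht b hbI x₀ hxI
    have key : ‖jump Φ h a b x₀ s i - jump Φ h a b x₀ t i‖ ≤
        ‖srcSol Φ s h a x₀ - srcSol Φ t h a x₀‖ + ‖srcSol Φ s h b x₀ - srcSol Φ t h b x₀‖ := by
      rcases i with i | i
      · have e : jump Φ h a b x₀ s (Sum.inl i) - jump Φ h a b x₀ t (Sum.inl i) =
            ((srcSol Φ s h b x₀ - srcSol Φ t h b x₀).2 -
              (srcSol Φ s h a x₀ - srcSol Φ t h a x₀).2) i := by
          simp only [jump, Sum.elim_inl, Prod.snd_sub, PiLp.sub_apply]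
          ring
        rw [e, add_comm]
        exact (PiLp.norm_apply_le _ i).trans ((norm_sub_le _ _).trans
          (add_le_add (norm_snd_le _) (norm_snd_le _)))
      · have e : jump Φ h a b x₀ s (Sum.inr i) - jump Φ h a b x₀ t (Sum.inr i) =
            ((srcSol Φ s h a x₀ - srcSol Φ t h a x₀).1 -
              (srcSol Φ s h b x₀ - srcSol Φ t h b x₀).1) i := by
          simp only [jump, Sum.elim_inr, Prod.fst_sub, PiLp.sub_apply]
          ring
        rw [e]
        exact (PiLp.norm_apply_le _ i).trans ((norm_sub_le _ _).trans
          (add_le_add (norm_fst_le _) (norm_fst_le _)))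
    have h3 : 0 ≤ K * D * (b - a + 1) * |s - t| := by positivity
    linarith

theorem continuous_jump : Continuous fun t : ℝ => jump Φ h a b x₀ t := by
  refine continuous_pi fun i => continuous_iff_continuousAt.2 fun t => ?_
  obtain ⟨K, hK, -, hKL⟩ := exists_srcGlue_bound (x₀ := x₀) hΦ hc ha hb h1 h2 (t - 1) (t + 1)
  have hL : LipschitzOnWith (Real.toNNReal K) (fun t : ℝ => jump Φ h a b x₀ t i)
      (Icc (t - 1) (t + 1)) := LipschitzOnWith.of_dist_le_mul fun s hs r hr => by
    rw [dist_eq_norm, Real.dist_eq, Real.coe_toNNReal K hK]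
    exact hKL s hs r hr i
  exact hL.continuousOn.continuousAt (Icc_mem_nhds (by linarith) (by linarith))

/-- For `v = E((s, t]) k` the jump pairing from `inner_srcGlue` is also the pairing of `ψ_i` with
`(H + i) v`. Moving the bounded functions of `H` to the left gives the two-term formula required by
the criterion, with the glued solution at `t` as the controlled vector. -/
theorem expands_jump {E : ProjMeasure (L2 m)} (hE : IsSpectralFor Φ E) {Mp Mm : Mat m}
    (hW : WeylPair hΦ Complex.I x₀ Mp Mm) :
    Expands E hW.psi ((memLp_of_continuous_of_zero hc h1 h2).toLp h)
      (fun t : ℝ => jump Φ h a b x₀ t) := by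
  refine ⟨continuous_jump hΦ hc ha hb h1 h2, fun l₁ l₂ hl => ?_⟩
  obtain ⟨K, hK, hq, hL⟩ := exists_srcGlue_bound (x₀ := x₀) hΦ hc ha hb h1 h2 l₁ l₂
  refine apply_Ioc_eq_sum_fcalc (K := K) (continuous_jump hΦ hc ha hb h1 h2) hl hL fun t ht =>
    ⟨_, hq t ht, fun s _ _ => ?_⟩
  refine ext_inner_right ℂ fun k => ?_
  have hS : MeasurableSet (Ioc s t) := measurableSet_Ioc
  have b1 := BddMeas.indicator_one hS
  have b2 : BddMeas ((fun r : ℝ => (r : ℂ)) * (Ioc s t).indicator 1) :=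
    BddMeas.of_continuousOn_indicator Complex.continuous_ofReal hS Ioc_subset_Icc_self
  have b3 : BddMeas (subI * (Ioc s t).indicator 1) :=
    BddMeas.of_continuousOn_indicator continuous_subI hS Ioc_subset_Icc_self
  have b4 : BddMeas ((fun r : ℝ => (r : ℂ) - t) * (Ioc s t).indicator 1) :=
    BddMeas.of_continuousOn_indicator (by fun_prop) hS Ioc_subset_Icc_self
  obtain ⟨u, v, hfu, hp⟩ := (hE.inGraphH_fcalc b1 b2 k).exists_isPiece
  have e1 := hW.inner_psi (jump Φ h a b x₀ t) hp hfu (EventuallyEq.refl _ _)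
  have e2 := inner_srcGlue (x₀ := x₀) hΦ hc h1 h2 t hp hfu (EventuallyEq.refl _ _)
  rw [← e1, fcalc_sub_smul b1 b2, fcalc_sub_smul b1 b2] at e2
  rw [E.inner_apply_left hS, ← E.fcalc_indicator hS, inner_add_left, E.inner_fcalc_left b3,
    E.inner_fcalc_left b4]
  have e3 : star (subI * (Ioc s t).indicator 1) =
      fun r : ℝ => ((r : ℂ) - starRingEnd ℂ Complex.I) * (Ioc s t).indicator 1 r := by
    ext r
    by_cases hr : r ∈ Ioc s t <;> simp [hr, subI]
  have e4 : star ((fun r : ℝ => (r : ℂ) - t) * (Ioc s t).indicator 1) =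
      fun r : ℝ => ((r : ℂ) - t) * (Ioc s t).indicator 1 r := by
    ext r
    by_cases hr : r ∈ Ioc s t <;> simp [hr]
  rw [e3, e4, e2]
  ring

end Compact

end Source

/-! ### The fundamental system and the generalized Fourier transform -/

section Transform

variable {m : ℕ} {φ : ℝ → Mat m} {j : ℕ}

theorem pot_apply (φ : ℝ → Mat m) (j : ℕ) (x : ℝ) (v : Vec m) :
    pot φ j x v = (-1 : ℂ) ^ (j + 1) • act (φ x) v := by
  rw [pot, matCLM_apply, act_smul]

theorem IsTauSolution.isTau {z : ℂ} {u w : ℝ → Vec m} (H : IsTauSolution φ j z u w) :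
    IsTau (pot φ j) z 0 u w := by
  obtain ⟨hu, hw, hd⟩ := H
  refine ⟨⟨hu, hw.continuous.locallyIntegrable, ?_⟩, ⟨hw, ?_, ?_⟩⟩
  · filter_upwards [hd] with x ⟨u', w', h1, _, h3, _⟩
    rw [pot_apply, h3, add_sub_cancel_right]
    exact h1
  · rw [add_zero]
    exact (hu.continuous.const_smul z).neg.locallyIntegrable
  · filter_upwards [hd] with x ⟨u', w', _, h2, _, h4⟩
    have e : (-(z • u + 0)) x - (-pot φ j) x (w x) = w' := by
      simp only [add_zero, Pi.neg_apply, Pi.smul_apply, _root_.neg_apply, pot_apply, ← h4]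
      abel
    rw [e]
    exact h2

theorem IsTau.isTauSolution {z : ℂ} {u w : ℝ → Vec m} (H : IsTau (pot φ j) z 0 u w) :
    IsTauSolution φ j z u w := by
  refine ⟨H.fst.ac, H.snd.ac, ?_⟩
  filter_upwards [H.fst.deriv, H.deriv_snd] with x h1 h2
  refine ⟨_, _, h1, h2, ?_, ?_⟩
  · rw [pot_apply, sub_add_cancel]
  · rw [pot_apply, Pi.zero_apply]
    abel

/-- The flow of the homogeneous equation on initial data depending linearly on a vector. -/
def flowLin {Φ : ℝ → Vec m →L[ℂ] Vec m} (hΦ : IsPotential Φ) (z : ℂ) (x₀ : ℝ)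
    (L : Vec m →ₗ[ℂ] Vec m × Vec m) (x : ℝ) : Vec m →ₗ[ℂ] Vec m × Vec m where
  toFun c := tauSol Φ z x₀ (L c) x
  map_add' c c' := by rw [map_add, tauSol_add hΦ]
  map_smul' a c := by rw [map_smul, tauSol_smul hΦ]; rfl

theorem exists_isTauMatrixSolution (hΦ : IsPotential (pot φ j)) (z : ℂ) (x₀ : ℝ) (A B : Mat m) :
    ∃ U, IsTauMatrixSolution φ j z x₀ A B U := by
  let L : Vec m →ₗ[ℂ] Vec m × Vec m := (Matrix.toEuclideanLin A).prod (Matrix.toEuclideanLin B)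
  let U : ℝ → Mat m := fun x => Matrix.toEuclideanLin.symm
    ((LinearMap.fst ℂ (Vec m) (Vec m)).comp (flowLin hΦ z x₀ L x))
  let W : ℝ → Mat m := fun x => Matrix.toEuclideanLin.symm
    ((LinearMap.snd ℂ (Vec m) (Vec m)).comp (flowLin hΦ z x₀ L x))
  have hU : ∀ x c, act (U x) c = (tauSol (pot φ j) z x₀ (L c) x).1 := fun x c => act_symm _ c
  have hW : ∀ x c, act (W x) c = (tauSol (pot φ j) z x₀ (L c) x).2 := fun x c => act_symm _ c
  refine ⟨U, W, mat_ext fun c => ?_, mat_ext fun c => ?_, fun c => ?_⟩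
  · rw [hU, tauSol_self hΦ]; rfl
  · rw [hW, tauSol_self hΦ]; rfl
  · simp only [hU, hW]
    exact (isTau_tauSol hΦ z x₀ (L c)).isTauSolution

theorem IsTauMatrixSolution.act_eq (hΦ : IsPotential (pot φ j)) {z : ℂ} {x₀ : ℝ} {A B : Mat m}
    {U : ℝ → Mat m} (H : IsTauMatrixSolution φ j z x₀ A B U) (x : ℝ) (c : Vec m) :
    act (U x) c = (tauSol (pot φ j) z x₀ (act A c, act B c) x).1 := by
  obtain ⟨W, hU, hW, hs⟩ := H
  have h := eq_tauSol hΦ z x₀ (hs c).isTau x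
  rw [hU, hW] at h
  exact congrArg Prod.fst h

theorem act_cSol (hΦ : IsPotential (pot φ j)) (z : ℂ) (x x₀ : ℝ) (c : Vec m) :
    act (cSol φ j z x x₀) c = (tauSol (pot φ j) z x₀ (c, 0) x).1 := by
  have h : IsTauMatrixSolution φ j z x₀ 1 0 fun x => cSol φ j z x x₀ :=
    Classical.epsilon_spec (exists_isTauMatrixSolution hΦ z x₀ 1 0)
  rw [h.act_eq hΦ x c, act_one]
  simp [act]

theorem act_sSol (hΦ : IsPotential (pot φ j)) (z : ℂ) (x x₀ : ℝ) (c : Vec m) :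
    act (sSol φ j z x x₀) c = (tauSol (pot φ j) z x₀ (0, c) x).1 := by
  have h : IsTauMatrixSolution φ j z x₀ 0 1 fun x => sSol φ j z x x₀ :=
    Classical.epsilon_spec (exists_isTauMatrixSolution hΦ z x₀ 0 1)
  rw [h.act_eq hΦ x c, act_one]
  simp [act]

theorem act_conjTranspose_eq_sum (M : Mat m) (v : Vec m) :
    act M.conjTranspose v = ∑ i, inner ℂ (act M (EuclideanSpace.single i 1)) v •
      (EuclideanSpace.single i 1 : Vec m) := by
  have h := (EuclideanSpace.basisFun (Fin m) ℂ).sum_repr' (act M.conjTranspose v)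
  simp only [EuclideanSpace.basisFun_apply] at h
  rw [← h]
  simp only [inner_act_left]

/-- Continuity of the columns of `M` is what is known, so the adjoint is expanded in the standard
basis before integrability is checked. -/
theorem inner_integral_act {M : ℝ → Mat m} (hM : ∀ c, Continuous fun x => act (M x) c)
    {h : ℝ → Vec m} (hc : Continuous h) (hs : HasCompactSupport h) (c : Vec m) :
    inner ℂ (∫ x, act (M x).conjTranspose (h x)) c = ∫ x, inner ℂ (h x) (act (M x) c) := by
  have hi : Integrable fun x => act (M x).conjTranspose (h x) := by
    refine Continuous.integrable_of_hasCompactSupport ?_ ?_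
    · simp only [act_conjTranspose_eq_sum]
      refine continuous_finsetSum _ fun i _ => ?_
      have hi : Continuous fun x => inner ℂ (act (M x) (EuclideanSpace.single i 1)) (h x) :=
        (hM _).inner hc
      exact hi.smul continuous_const
    · refine hs.mono fun x hx => ?_
      rw [Function.mem_support] at hx ⊢
      intro h0
      exact hx (by rw [h0]; exact map_zero _)
  rw [← inner_conj_symm, ← integral_inner hi, ← integral_conj]
  refine integral_congr_ae (Eventually.of_forall fun x => ?_)
  simp only
  rw [inner_conj_symm, ← inner_conj_symm, ← inner_act_left, inner_conj_symm]

/-- Paired with `C`, both sides integrate `h` against the homogeneous solution with data `C`, which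
is `c_j` and `s_j` applied to the two halves of `C`. -/
theorem hatTransform_eq_jump (hΦ : IsPotential (pot φ j)) {h : ℝ → Vec m} (hc : Continuous h)
    (hs : HasCompactSupport h) {a b x₀ : ℝ} (ha : a ≤ x₀) (hb : x₀ ≤ b) (h1 : ∀ x ≤ a, h x = 0)
    (h2 : ∀ x, b ≤ x → h x = 0) (t : ℝ) :
    hatTransform φ j x₀ h t = jump (pot φ j) h a b x₀ t := by
  have key : ∀ C, star (hatTransform φ j x₀ h t) ⬝ᵥ C = star (jump (pot φ j) h a b x₀ t) ⬝ᵥ C := by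
    intro C
    rw [star_jump_dotProduct hΦ hc ha hb h1 h2, star_dotProduct_eq]
    have eu : upper (hatTransform φ j x₀ h t) =
        ∫ x : ℝ, act (cSol φ j (t : ℂ) x x₀).conjTranspose (h x) := rfl
    have el : lower (hatTransform φ j x₀ h t) =
        ∫ x : ℝ, act (sSol φ j (t : ℂ) x x₀).conjTranspose (h x) := rfl
    have hcc : ∀ c, Continuous fun x => act (cSol φ j (t : ℂ) x x₀) c := fun c => by
      simp only [act_cSol hΦ]
      exact (isTau_tauSol hΦ t x₀ (c, 0)).fst.continuous
    have hsc : ∀ c, Continuous fun x => act (sSol φ j (t : ℂ) x x₀) c := fun c => by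
      simp only [act_sSol hΦ]
      exact (isTau_tauSol hΦ t x₀ (0, c)).fst.continuous
    have hi : ∀ {u : ℝ → Vec m}, Continuous u → Integrable fun x => inner ℂ (h x) (u x) :=
      fun hu => (hc.inner hu).integrable_of_hasCompactSupport (hs.mono fun x hx => by
        rw [Function.mem_support] at hx ⊢
        intro h0
        exact hx (by rw [h0, inner_zero_left]))
    rw [eu, el, inner_integral_act hcc hc hs, inner_integral_act hsc hc hs,
      ← integral_add (hi (hcc _)) (hi (hsc _))]
    refine integral_congr_ae (Eventually.of_forall fun x => ?_)
    simp only
    rw [← inner_add_right, act_cSol hΦ, act_sSol hΦ, ← Prod.fst_add, ← tauSol_add hΦ,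
      Prod.mk_add_mk, add_zero, zero_add]
  have h3 : star (hatTransform φ j x₀ h t) = star (jump (pot φ j) h a b x₀ t) := by
    funext i
    have := key (Pi.single i 1)
    rwa [dotProduct_single_one, dotProduct_single_one] at this
  exact star_injective h3

end Transform

/-! ### The spectral measure of `H_j` -/

section Main

variable {m : ℕ} {φ : ℝ → Mat m}
  (h : ∀ i k, LocallyIntegrable (fun x => φ x i k) (volume : Measure ℝ))
  (hs : ∀ᵐ x : ℝ, (φ x).IsHermitian) {j : ℕ} (hj : j = 1 ∨ j = 2)

theorem weylPair_Mhat {z : ℂ} (hz : z.im ≠ 0) (x₀ : ℝ) :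
    WeylPair (isPotential_pot h hs hj) z x₀ (Mhatplus φ j z x₀) (Mhatminus φ j z x₀) :=
  weylPair_of_mem hz (mem_weylSpace_Mhatplus h hs hj hz x₀) (mem_weylSpace_Mhatminus h hs hj hz x₀)

/-- Existence of a Herglotz measure validates the choice made in `OmegaHat`; uniqueness then gives
the relation to `E` whichever measure was chosen. -/
theorem represents_OmegaHat (x₀ : ℝ) :
    Represents (OmegaHat φ j x₀) (spectralMeasure (opH φ j))
      (weylPair_Mhat h hs hj (z := Complex.I) (by simp) x₀).psi := by
  have hM : HasHerglotzForm (fun z => Mbold φ j z x₀) (spectralMeasure (opH φ j))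
      (weylPair_Mhat h hs hj (z := Complex.I) (by simp) x₀).psi :=
    hasHerglotzForm_of_weylPair (isSpectralFor_opH h hs hj) fun z hz => weylPair_Mhat h hs hj hz x₀
  exact hM.represents (Classical.epsilon_spec
    (p := fun Ω : MatrixMeasure (Fin m ⊕ Fin m) => Ω.IsHerglotzMeasure fun z => Mbold φ j z x₀)
    ⟨_, hM.isHerglotzMeasure (represents_specMeasure _ _) (integrable_inv_specMeasure _ _)⟩)

theorem expands_hatTransform (x₀ : ℝ) {f : ℝ → Vec m} (hf : ContDiff ℝ ∞ f)
    (hfc : HasCompactSupport f) :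
    Expands (spectralMeasure (opH φ j)) (weylPair_Mhat h hs hj (z := Complex.I) (by simp) x₀).psi
      (testToL2 f hf hfc) (hatTransform φ j x₀ f) := by
  have hΦ := isPotential_pot h hs hj
  obtain ⟨R, hR, hsub⟩ := hfc.isCompact.isBounded.subset_closedBall_lt 0 x₀
  have h0 : ∀ x, R < |x - x₀| → f x = 0 := fun x hx => by
    by_contra h1
    have h2 := hsub (subset_tsupport f (Function.mem_support.2 h1))
    rw [Metric.mem_closedBall, Real.dist_eq] at h2
    linarith
  -- The margin `1` turns the closed support ball into vanishing up to and including the end points.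
  have h1 : ∀ x ≤ x₀ - (R + 1), f x = 0 := fun x hx => h0 x (by
    rw [abs_sub_comm]; exact lt_of_lt_of_le (by linarith) (le_abs_self _))
  have h2 : ∀ x, x₀ + (R + 1) ≤ x → f x = 0 := fun x hx => h0 x
    (lt_of_lt_of_le (by linarith) (le_abs_self _))
  have ha : x₀ - (R + 1) ≤ x₀ := by linarith
  have hb : x₀ ≤ x₀ + (R + 1) := by linarith
  have e : hatTransform φ j x₀ f =
      fun t : ℝ => jump (pot φ j) f (x₀ - (R + 1)) (x₀ + (R + 1)) x₀ t :=
    funext fun t => hatTransform_eq_jump hΦ hf.continuous hfc ha hb h1 h2 t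
  rw [e]
  exact expands_jump hΦ hf.continuous ha hb h1 h2 (isSpectralFor_opH h hs hj) _

end Main

end SusySchrodinger

end

/-! ### The expansion theorem. -/

open SusySchrodinger MeasureTheory
open scoped ContDiff

theorem theorem4p5 {m : ℕ} (φ : ℝ → Matrix (Fin m) (Fin m) ℂ)
    (hφ_loc : ∀ i k, LocallyIntegrable (fun x => φ x i k) (volume : Measure ℝ))
    (hφ_adj : ∀ᵐ x : ℝ, (φ x).IsHermitian)
    (j : ℕ) (hj : j = 1 ∨ j = 2)
    (f g : ℝ → EuclideanSpace ℂ (Fin m))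
    (hf : ContDiff ℝ ∞ f) (hfc : HasCompactSupport f)
    (hg : ContDiff ℝ ∞ g) (hgc : HasCompactSupport g)
    (F : ℝ → ℂ) (hF : Continuous F) (x₀ l₁ l₂ : ℝ) (hl : l₁ < l₂) :
    (OmegaHat φ j x₀).MemL2 (hatTransform φ j x₀ f) ∧
    (OmegaHat φ j x₀).InMulDomain (chi l₁ l₂) (hatTransform φ j x₀ g) ∧
    (OmegaHat φ j x₀).InMulDomain F (mulBy (chi l₁ l₂) (hatTransform φ j x₀ g)) ∧
    ∃ y : L2 m,
      IsFunctionOf (opH φ j) F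
        (spectralMeasure (opH φ j) (Set.Ioc l₁ l₂) (testToL2 g hg hgc)) y ∧
      inner ℂ (testToL2 f hf hfc) y =
        (OmegaHat φ j x₀).innerL2 (hatTransform φ j x₀ f)
          (mulBy F (mulBy (chi l₁ l₂) (hatTransform φ j x₀ g))) := by
  have hΩ := represents_OmegaHat hφ_loc hφ_adj hj x₀
  have hfx := expands_hatTransform hφ_loc hφ_adj hj x₀ hf hfc
  have hgx := expands_hatTransform hφ_loc hφ_adj hj x₀ hg hgc
  have hB : MeasurableSet (Set.Ioc l₁ l₂) := measurableSet_Ioc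
  -- The cut-off is written with a constant factor `1` so that the statement for `F χ` also covers
  -- `χ` alone.
  have e1 : mulBy (chi l₁ l₂) (hatTransform φ j x₀ g) =
      mulBy ((fun _ => 1) * (Set.Ioc l₁ l₂).indicator 1) (hatTransform φ j x₀ g) := by
    funext t
    simp only [mulBy, chi, Pi.mul_apply, one_mul]
  have e2 : mulBy F (mulBy (chi l₁ l₂) (hatTransform φ j x₀ g)) =
      mulBy (F * (Set.Ioc l₁ l₂).indicator 1) (hatTransform φ j x₀ g) := by
    funext t
    simp only [mulBy, chi, Pi.mul_apply, mul_smul]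
  have m1 : (OmegaHat φ j x₀).MemL2 (mulBy (chi l₁ l₂) (hatTransform φ j x₀ g)) := by
    rw [e1]
    exact hgx.memL2_mulBy hΩ continuous_const hl.le
  have m2 : (OmegaHat φ j x₀).MemL2 (mulBy F (mulBy (chi l₁ l₂) (hatTransform φ j x₀ g))) := by
    rw [e2]
    exact hgx.memL2_mulBy hΩ hF hl.le
  -- Although `F` may be unbounded, `F` times the indicator of the interval is bounded, so the
  -- required vector comes from the bounded calculus applied to `g`.
  refine ⟨hfx.memL2 hΩ, ⟨hgx.memL2 hΩ, m1⟩, ⟨m1, m2⟩,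
    (spectralMeasure (opH φ j)).fcalc (F * (Set.Ioc l₁ l₂).indicator 1) (testToL2 g hg hgc), ?_, ?_⟩
  · rw [IsFunctionOf, ← (spectralMeasure (opH φ j)).fcalc_indicator hB]
    exact (spectralMeasure (opH φ j)).isIntegral_fcalc hF.measurable (BddMeas.indicator_one hB)
      (BddMeas.of_continuousOn_indicator hF hB Set.Ioc_subset_Icc_self) _
  · rw [(hfx.inner_fcalc hΩ hgx hF hl.le).2, e2]
    rfl
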